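/- Let $\xi_0,\xi_1,\ldots$ be i.i.d. real Gaussian random variables of mean zero and positive variance, let $f_n(z)=\sum_{k=0}^n \xi_k z^k$ and let $Z(f_n)=\{z\in\mathbb C: f_n(z)=0\}$. Let $\mathcal M$ be the space of locally finite Borel measures on $\mathbb R$ with the vague topology (the coarsest topology for which $\mu\mapsto\int g\,d\mu$ is continuous for every continuous compactly supported $g:\mathbb R\to\mathbb R$). Then, as $n\to\infty$, the random set $$\{\,n^2(1-|z|) : z\in Z(f_n)\,\},$$ identified with its counting measure (so that a pair of conjugate roots contributes one point), converges in distribution in $\mathcal M$ to a homogeneous Poisson point process on $\mathbb R$ of intensity $1/12$. The point process $S\mapsto\#\{z\in Z(f_n): n^2(1-|z|)\in S,\ \operatorname{Im} z\ge 0\}$, zeros being counted with multiplicity, converges in distribution in $\mathcal M$ to the same limit. (On the null event $f_n=0$ both point processes are taken to be the zero measure.) In particular, for every $x>0$, $$\lim_{n\to\infty}\mathbb P\bigl(n^2\operatorname{dist}(\mathbb S^1,Z(f_n))\ge x\bigr)=e^{-x/6},$$ where $\mathbb S^1=\{z\in\mathbb C:|z|=1\}$ and $\operatorname{dist}(A,B)=\inf\{|w-z|: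 w\in A,\ z\in B\}$. -/

import Mathlib

open MeasureTheory ProbabilityTheory Filter Topology
open scoped NNReal ENNReal Polynomial CompactlySupported

noncomputable section

/-- The space of locally finite Borel measures on `ℝ`. -/
def LocFinMeasure : Type := {μ : Measure ℝ // IsLocallyFiniteMeasure μ}

namespace LocFinMeasure

/-- The underlying measure. -/
def toMeasure (μ : LocFinMeasure) : Measure ℝ := Subtype.val μ

/-- The vague topology: the coarsest topology for which `μ ↦ ∫ g dμ` is continuous for every
continuous compactly supported `g : ℝ → ℝ`. -/
instance instTopologicalSpace : TopologicalSpace LocFinMeasure :=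
  ⨅ g : C_c(ℝ, ℝ), TopologicalSpace.induced (fun μ => ∫ x, g x ∂μ.toMeasure) inferInstance

/-- The Borel σ-algebra of the vague topology. -/
instance instMeasurableSpace : MeasurableSpace LocFinMeasure := borel LocFinMeasure

instance instBorelSpace : BorelSpace LocFinMeasure := ⟨rfl⟩

end LocFinMeasure

theorem isFiniteMeasure_sum_dirac (s : Multiset ℝ) :
    IsFiniteMeasure (s.map Measure.dirac).sum := by
  induction s using Multiset.induction_on with
  | empty => rw [Multiset.map_zero, Multiset.sum_zero]; infer_instance
  | cons a s ih => rw [Multiset.map_cons, Multiset.sum_cons]; infer_instance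

/-- The counting measure `∑_{y ∈ s} δ_y` of a finite multiset of reals. -/
def pointMeasure (s : Multiset ℝ) : LocFinMeasure :=
  ⟨(s.map Measure.dirac).sum, by
    have := isFiniteMeasure_sum_dirac s
    infer_instance⟩

/-- `Q` is the law of a homogeneous Poisson point process on `ℝ` of intensity `r`: the number of
points in a Borel set `B` of finite Lebesgue measure `|B|` is Poisson with parameter `r * |B|`,
and the numbers of points in disjoint Borel sets are independent. -/
structure IsPoissonProcessLaw (r : ℝ≥0) (Q : Measure LocFinMeasure) : Prop where
  hasLaw : ∀ B : Set ℝ, MeasurableSet B → volume B ≠ ∞ →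
    HasLaw (fun μ : LocFinMeasure => μ.toMeasure B)
      ((poissonMeasure (r * (volume B).toNNReal)).map (fun k : ℕ => (k : ℝ≥0∞))) Q
  indep : ∀ (k : ℕ) (B : Fin k → Set ℝ), (∀ i, MeasurableSet (B i)) →
    Pairwise (Function.onFun Disjoint B) →
    iIndepFun (fun (i : Fin k) (μ : LocFinMeasure) => μ.toMeasure (B i)) Q

/-- The Kac polynomial `∑_{k=0}^n a_k z^k`, as a polynomial over `ℂ`. -/
def kacPoly (n : ℕ) (a : ℕ → ℝ) : ℂ[X] :=
  ∑ k ∈ Finset.range (n + 1), Polynomial.C (a k : ℂ) * Polynomial.X ^ k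

/-- The zero set `Z(f)`. -/
def zeroSet (f : ℂ[X]) : Set ℂ := {z | f.eval z = 0}

/-- The rescaled signed distance `n² (1 - |z|)` to the unit circle. -/
def rescaledModulus (n : ℕ) (z : ℂ) : ℝ := (n : ℝ) ^ 2 * (1 - ‖z‖)

/-- The counting measure of the set `{n² (1 - |z|) : z ∈ Z(f)}`, each element of the set having
mass one. (It is the zero measure if `f = 0`.) -/
def modulusSetProcess (n : ℕ) (f : ℂ[X]) : LocFinMeasure :=
  pointMeasure (f.roots.toFinset.image (rescaledModulus n)).val

/-- The point process `S ↦ #{z ∈ Z(f) : n² (1 - |z|) ∈ S, Im z ≥ 0}`, zeros being counted with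
multiplicity. (It is the zero measure if `f = 0`.) -/
def upperRootProcess (n : ℕ) (f : ℂ[X]) : LocFinMeasure :=
  pointMeasure ((f.roots.filter (fun z => 0 ≤ z.im)).map (rescaledModulus n))

/-- The distance `inf {|w - z| : w ∈ A, z ∈ B}` between two nonempty sets. -/
def setDist (A B : Set ℂ) : ℝ := sInf (Set.image2 dist A B)

end

noncomputable section

open scoped Real
open ENNReal (ofReal ofReal_mul ofReal_le_ofReal ofReal_ne_top ofReal_pow ofReal_prod_of_nonneg
  ofReal_lt_top ofReal_one ofReal_add toReal_ofReal toReal_le_of_le_ofReal ofReal_toReal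
  ofReal_zero ofReal_sum_of_nonneg)
open Finset (range sum_congr univ mul_sum card_univ sum_le_sum prod_const mem_univ mem_range
  prod_congr sum_sub_distrib sum_div sum_nonneg sum_le_card_nsmul prod_nonneg measurable_fun_prod
  card_range prod_mul_distrib prod_le_prod sum_mul mem_filter sum_const sum_add_distrib sum_comm
  measurable_fun_sum prod_insert sum_insert prod_eq_zero sum_eq_single mem_image mul_prod_erase
  card_ne_zero single_le_sum)
open Complex (exp I arg norm_real normSq_eq_norm_sq norm_exp_ofReal_mul_I normSq_apply ofReal_sum
  re_sum exp_sum continuous_ofReal norm_natCast measurable_ofReal measurable_im measurable_exp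
  abs_re_le_norm)
open Set (indicator_of_notMem indicator_of_mem Ioo Icc Ico)
open Matrix (mulVec mulVec_mulVec dotProduct_mulVec mulVec_transpose)
open Real (pi_pos norm_of_nonneg cos sq_sqrt norm_eq_abs)
open Fintype (card)

/-! The argument combines the Kac–Rice method with truncated inclusion–exclusion over short arcs.

For a polynomial with simple roots, the measure with density `|f'|² 1_{|f| < ε} / (π ε²)` has total
mass at most the degree and tends to the counting measure of the roots, because `|f'|²` is the
Jacobian of `f` (`tendsto_integral_pi_rootMeasure`). Expected sums over tuples of roots are
therefore limits of Gaussian integrals in the values and derivatives of `f` at finitely many points.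

Put `z = (1 - x / n²) exp(iθ)`. If finitely many arguments stay away from each other and from `0`
and `π`, oscillating sums kill all correlations between different points, while at one point the
covariance of `f / √n` and `z f' / (n √n)` tends to one half of the moments `1, 1/2, 1/3` of the
uniform law on `[0, 1]` (`tendsto_gramRows`). Given that `f` vanishes, each coordinate of the
normalised derivative has variance `1/6 - 1/8 = 1/24`, which gives the intensity `1 / (12 π)` in the
coordinates `(x, θ)`. The points in the upper half plane have `θ` in `(0, π)`, hence the intensity
`1/12` in `x`. The product form of the limiting intensities is what makes the limit Poisson.

Two degenerate situations need bounds that are uniform in `n`: two roots close to each other, and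
roots close to the real axis. In both the values of `f` become nearly dependent, but the derivative
at a point where `f` is small becomes small too, and the gain outweighs the loss. Both rest on a
Gaussian estimate for products of squares on a small-ball event, proved by exponential tilting
(`lintegral_gaussVec_prod_le`), and on lower bounds for quadratic forms of powers
(`NearCircle.sum_sq_norm_ge`, `sum_sq_re_ge_of_clusters`).

The interval `(0, π)` is then cut into `M` blocks separated by small gaps. For `|1 + ψ| ≤ 1`, the
product of `1 + ψ` over the upper roots is compared with a Bonferroni expansion of order `K` in
which each block is replaced by its linear part (`norm_prod_roots_sub_le`). The gaps and the pairs
of roots in one block contribute `O(1 / M)`, and the truncation contributes a factorially small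
term. Letting first `n`, then `M`, then `K` tend to infinity yields `exp((1/12) ∫ ψ)`
(`tendsto_integral_rootProduct`), and `ψ = exp(i g) - 1` gives the characteristic functional. Real
roots are negligible by `tendsto_measure_real_root`.

The limit law is built explicitly from independent unit cells, and `tendsto_of_charFunctional`
converts characteristic functionals into weak convergence, without a separate tightness argument
since the limit is known. The set version follows because two different upper roots rarely have the
same modulus (`tendsto_measure_collision`). The statement on the distance is the void probability of
`(-x, x)`, namely `exp(-2x / 12)`. -/

/-! ### Mollified root counts of a fixed polynomial. -/

theorem abs_det_mulDeriv (c : ℂ) :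
    |((ContinuousLinearMap.toSpanSingleton ℂ c).restrictScalars ℝ : ℂ →L[ℝ] ℂ).det| = ‖c‖ ^ 2 := by
  have h : ((ContinuousLinearMap.toSpanSingleton ℂ c).restrictScalars ℝ : ℂ →L[ℝ] ℂ).det
      = Algebra.norm ℝ c := by
    rw [Algebra.norm_apply, ContinuousLinearMap.det]
    congr 1
    ext <;> simp [mul_comm]
  rw [h, Algebra.norm_complex_apply, normSq_eq_norm_sq]
  exact abs_of_nonneg (by positivity)

/-- The image under an injective polynomial map has area `∫ ‖f'‖²`. -/
theorem setLIntegral_sq_norm_derivative (f : ℂ[X]) {s : Set ℂ} (hs : MeasurableSet s)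
    (hinj : Set.InjOn (fun z => f.eval z) s) :
    ∫⁻ z in s, ofReal (‖f.derivative.eval z‖ ^ 2) = volume ((fun z => f.eval z) '' s) := by
  rw [← lintegral_abs_det_fderiv_eq_addHaar_image volume hs
    (f' := fun z => (ContinuousLinearMap.toSpanSingleton ℂ (f.derivative.eval z)).restrictScalars ℝ)
    (fun z _ => ((f.hasDerivAt z).hasFDerivAt.restrictScalars ℝ).hasFDerivWithinAt) hinj]
  simp_rw [abs_det_mulDeriv]

/-- The Kac–Rice mollifier `‖f'(z)‖² 1_{‖f(z)‖ < ε} / (π ε²)`. -/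
def rootKernel (f : ℂ[X]) (ε : ℝ) (z : ℂ) : ℝ :=
  if ‖f.eval z‖ < ε then ‖f.derivative.eval z‖ ^ 2 / (π * ε ^ 2) else 0

theorem rootKernel_nonneg (f : ℂ[X]) (ε : ℝ) (z : ℂ) : 0 ≤ rootKernel f ε z := by
  unfold rootKernel; split_ifs <;> positivity

theorem measurable_rootKernel (f : ℂ[X]) (ε : ℝ) : Measurable (rootKernel f ε) := by
  unfold rootKernel
  refine Measurable.ite ?_ ?_ measurable_const
  · exact measurableSet_lt (by fun_prop) measurable_const
  · fun_prop

/-- The measure with density `rootKernel`. -/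
def rootMeasure (f : ℂ[X]) (ε : ℝ) : Measure ℂ :=
  volume.withDensity (fun z => ofReal (rootKernel f ε z))

/-- The area formula: where `f` is injective, the density integrates to the fraction of the disc of
radius `ε` that the image covers. -/
theorem rootMeasure_apply_of_injOn (f : ℂ[X]) {ε : ℝ} (hε : 0 < ε) {s : Set ℂ}
    (hs : MeasurableSet s) (hinj : Set.InjOn (fun z => f.eval z) s) :
    rootMeasure f ε s = (ofReal (π * ε ^ 2))⁻¹ *
      volume ((fun z => f.eval z) '' (s ∩ {z | ‖f.eval z‖ < ε})) := by
  have hm : MeasurableSet {z : ℂ | ‖f.eval z‖ < ε} :=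
    measurableSet_lt (by fun_prop) measurable_const
  rw [rootMeasure, withDensity_apply _ hs,
    ← setLIntegral_sq_norm_derivative f (hs.inter hm) (hinj.mono Set.inter_subset_left),
    Set.inter_comm, ← Measure.restrict_restrict hm, ← lintegral_indicator hm,
    ← lintegral_const_mul _ (by
      refine Measurable.indicator ?_ hm
      fun_prop)]
  refine lintegral_congr fun z => ?_
  by_cases h : ‖f.eval z‖ < ε
  · rw [indicator_of_mem (by exact h), rootKernel, if_pos h, div_eq_inv_mul,
      ofReal_mul (by positivity), ENNReal.ofReal_inv_of_pos (by positivity)]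
  · rw [indicator_of_notMem (by exact h), rootKernel, if_neg h]; simp

theorem exists_ball_injOn_eval (f : ℂ[X]) {p : ℂ} (hp : f.derivative.eval p ≠ 0) :
    ∃ U ∈ 𝓝 p, Set.InjOn (fun z => f.eval z) U := by
  have hs : HasStrictDerivAt (fun z => f.eval z) (f.derivative.eval p) p := f.hasStrictDerivAt p
  have := hs.eventually_left_inverse hp
  refine ⟨_, this, fun x hx y hy hxy => ?_⟩
  have hx' : hs.localInverse _ _ _ hp (f.eval x) = x := hx
  have hy' : hs.localInverse _ _ _ hp (f.eval y) = y := hy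
  rw [← hx', ← hy']
  exact congrArg _ hxy

/-- The total mass of `rootMeasure` is at most the degree. -/
theorem rootMeasure_univ_le (f : ℂ[X]) (hf : 0 < f.natDegree) {ε : ℝ} (hε : 0 < ε) :
    rootMeasure f ε Set.univ ≤ f.natDegree := by
  classical
  have hU : ∀ p : ℂ, ∃ U ∈ 𝓝 p, f.derivative.eval p ≠ 0 → Set.InjOn (fun z => f.eval z) U := by
    intro p
    by_cases hp : f.derivative.eval p = 0
    · exact ⟨Set.univ, univ_mem, fun h => absurd hp h⟩
    · obtain ⟨U, hU, h⟩ := exists_ball_injOn_eval f hp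
      exact ⟨U, hU, fun _ => h⟩
  choose U hUn hUi using hU
  set s : Set ℂ := {z | f.derivative.eval z ≠ 0} with hs
  have hsm : MeasurableSet s :=
    (measurableSet_singleton (0 : ℂ)).compl.preimage (by fun_prop : Measurable fun z => f.derivative.eval z)
  -- The critical points carry no mass since the kernel vanishes there. The rest is covered by
  -- countably many sets of injectivity, made disjoint below.
  obtain ⟨t, hts, htc, htU⟩ := TopologicalSpace.countable_cover_nhdsWithin (s := s)
    (f := fun p => interior (U p))
    (fun x _ => mem_nhdsWithin_of_mem_nhds (interior_mem_nhds.2 (hUn x)))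
  have hzero : rootMeasure f ε sᶜ = 0 := by
    rw [rootMeasure, withDensity_apply _ hsm.compl]
    refine setLIntegral_eq_zero hsm.compl fun z hz => ?_
    have : f.derivative.eval z = 0 := by simpa [hs] using hz
    simp [rootKernel, this]
  rcases t.eq_empty_or_nonempty with rfl | htne
  · have : s = ∅ := by simpa using htU
    rw [this, Set.compl_empty] at hzero
    simp [hzero]
  obtain ⟨e, he⟩ := htc.exists_eq_range htne
  set V : ℕ → Set ℂ := disjointed (fun i => interior (U (e i)) ∩ s) with hV
  have hVm : ∀ i, MeasurableSet (V i) :=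
    MeasurableSet.disjointed fun i => isOpen_interior.measurableSet.inter hsm
  have hVd : Pairwise (Function.onFun Disjoint V) := disjoint_disjointed _
  have hVs : ∀ i, V i ⊆ interior (U (e i)) ∩ s := fun i => disjointed_subset _ i
  have hVu : (⋃ i, V i) = s := by
    rw [hV, iUnion_disjointed, ← Set.iUnion_inter]
    refine Set.inter_eq_right.2 ?_
    rw [he] at htU
    simpa using htU
  have hVinj : ∀ i, Set.InjOn (fun z => f.eval z) (V i) := fun i =>
    (hUi (e i) (hts (he ▸ Set.mem_range_self i))).mono (fun z hz => interior_subset (hVs i hz).1)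
  set B : Set ℂ := {z | ‖f.eval z‖ < ε} with hB
  have hBm : MeasurableSet B := measurableSet_lt (by fun_prop) measurable_const
  set W : ℕ → Set ℂ := fun i => (fun z => f.eval z) '' (V i ∩ B) with hW
  have hWm : ∀ i, MeasurableSet (W i) := fun i =>
    ((hVm i).inter hBm).image_of_continuousOn_injOn (by fun_prop)
      ((hVinj i).mono Set.inter_subset_left)
  -- A value is taken at most `natDegree` times, and the pieces `V i` are disjoint, so the images `W
  -- i` cover each point of the disc at most that often.
  have hsum : ∑' i, volume (W i) ≤ f.natDegree * volume (Metric.ball (0 : ℂ) ε) := by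
    have h1 : ∑' i, volume (W i) = ∫⁻ v, ∑' i, (W i).indicator 1 v := by
      rw [lintegral_tsum fun i => (measurable_one.indicator (hWm i)).aemeasurable]
      simp_rw [lintegral_indicator_one (hWm _)]
    rw [h1, ← setLIntegral_const, ← lintegral_indicator measurableSet_ball]
    refine lintegral_mono fun v => ?_
    rw [ENNReal.tsum_eq_iSup_sum]
    refine iSup_le fun F => ?_
    by_cases hv : v ∈ Metric.ball (0 : ℂ) ε
    · rw [indicator_of_mem hv]
      have : ∑ i ∈ F, (W i).indicator (1 : ℂ → ℝ≥0∞) v =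
          ((F.filter fun i => v ∈ W i).card : ℝ≥0∞) := by
        simp [Set.indicator_apply]
      rw [this]
      norm_cast
      have hch : ∀ i, v ∈ W i → ∃ z, z ∈ V i ∧ f.eval z = v := by
        rintro i ⟨z, hz, rfl⟩; exact ⟨z, hz.1, rfl⟩
      choose! g hg1 hg2 using hch
      have hne : f - Polynomial.C v ≠ 0 := by
        intro h0
        have : f.natDegree = 0 := by
          rw [sub_eq_zero.1 h0]; simp
        omega
      have hcard : (F.filter fun i => v ∈ W i).card ≤ (f - Polynomial.C v).roots.toFinset.card := by
        refine Finset.card_le_card_of_injOn g ?_ ?_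
        · intro i hi
          have hi' := (mem_filter.1 hi).2
          simp [hne, Polynomial.IsRoot, hg2 i hi']
        · intro i hi j hj hij
          have hi' := (mem_filter.1 hi).2
          have hj' := (mem_filter.1 hj).2
          by_contra hne'
          exact Set.disjoint_left.1 (hVd hne') (hg1 i hi') (hij ▸ hg1 j hj')
      refine hcard.trans ((Multiset.toFinset_card_le _).trans ((Polynomial.card_roots' _).trans ?_))
      simp
    · have : ∀ i, v ∉ W i := by
        rintro i ⟨z, hz, rfl⟩
        exact hv (by simpa [hB] using hz.2)
      simp [this]
  calc rootMeasure f ε Set.univ ≤ rootMeasure f ε s + rootMeasure f ε sᶜ := by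
        rw [← Set.union_compl_self s]; exact measure_union_le _ _
    _ = ∑' i, rootMeasure f ε (V i) := by
        rw [hzero, add_zero, ← hVu, measure_iUnion hVd hVm]
    _ = (ofReal (π * ε ^ 2))⁻¹ * ∑' i, volume (W i) := by
        rw [← ENNReal.tsum_mul_left]
        exact tsum_congr fun i => rootMeasure_apply_of_injOn f hε (hVm i) (hVinj i)
    _ ≤ (ofReal (π * ε ^ 2))⁻¹ * (f.natDegree * volume (Metric.ball (0 : ℂ) ε)) := by gcongr
    _ = f.natDegree := by
        have hvol : volume (Metric.ball (0 : ℂ) ε) = ofReal (π * ε ^ 2) := by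
          rw [Complex.volume_ball, mul_comm π, ofReal_mul (by positivity), ofReal_pow hε.le]
          congr 1
          rw [← NNReal.coe_real_pi, ENNReal.ofReal_coe_nnreal]
        rw [hvol, mul_left_comm, ENNReal.inv_mul_cancel (by simp; positivity) (by simp), mul_one]

theorem volume_ball_complex {ε : ℝ} (hε : 0 < ε) :
    volume (Metric.ball (0 : ℂ) ε) = ofReal (π * ε ^ 2) := by
  rw [Complex.volume_ball, mul_comm π, ofReal_mul (by positivity), ofReal_pow hε.le]
  congr 1
  rw [← NNReal.coe_real_pi, ENNReal.ofReal_coe_nnreal]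

/-- A small ball about a simple root has mass one, for small `ε`. -/
theorem exists_rootMeasure_ball_eq_one (f : ℂ[X]) {p : ℂ} (hp0 : f.eval p = 0)
    (hp : f.derivative.eval p ≠ 0) :
    ∃ r₀ > 0, ∀ r, 0 < r → r ≤ r₀ →
      ∀ᶠ ε in 𝓝[>] (0 : ℝ), rootMeasure f ε (Metric.ball p r) = 1 := by
  obtain ⟨U, hU, hinj⟩ := exists_ball_injOn_eval f hp
  obtain ⟨r₀, hr₀, hball⟩ := Metric.mem_nhds_iff.1 hU
  refine ⟨r₀, hr₀, fun r hr hrr => ?_⟩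
  have himg : (fun z => f.eval z) '' Metric.ball p r ∈ 𝓝 (0 : ℂ) := by
    have hs : HasStrictDerivAt (fun z => f.eval z) (f.derivative.eval p) p := f.hasStrictDerivAt p
    have := hs.map_nhds_eq hp
    rw [← hp0, ← this]
    exact image_mem_map (Metric.ball_mem_nhds p hr)
  obtain ⟨ε₀, hε₀, hsub⟩ := Metric.mem_nhds_iff.1 himg
  filter_upwards [Ioo_mem_nhdsGT hε₀] with ε hε
  have hi : Set.InjOn (fun z => f.eval z) (Metric.ball p r) :=
    hinj.mono ((Metric.ball_subset_ball hrr).trans hball)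
  rw [rootMeasure_apply_of_injOn f hε.1 measurableSet_ball hi]
  -- The image of the ball is a neighbourhood of `0`, so for small `ε` the whole disc of radius `ε`
  -- is attained.
  have : (fun z => f.eval z) '' (Metric.ball p r ∩ {z | ‖f.eval z‖ < ε}) = Metric.ball 0 ε := by
    ext v
    constructor
    · rintro ⟨z, hz, rfl⟩; simpa using hz.2
    · intro hv
      obtain ⟨z, hz, rfl⟩ := hsub (Metric.ball_subset_ball hε.2.le hv)
      exact ⟨z, ⟨hz, by simpa using hv⟩, rfl⟩
  have hpos := hε.1
  rw [this, volume_ball_complex hε.1, ENNReal.inv_mul_cancel (by simp; positivity) (by simp)]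

/-- Small values are only taken near the roots. -/
theorem eventually_norm_eval_lt_imp_near_root (f : ℂ[X]) (hf : f ≠ 0) {r : ℝ} (hr : 0 < r) :
    ∀ᶠ ε in 𝓝[>] (0 : ℝ), ∀ z, ‖f.eval z‖ < ε → ∃ p ∈ f.roots, dist z p < r := by
  have hlc : 0 < ‖f.leadingCoeff‖ := by simpa using hf
  have hc : 0 < ‖f.leadingCoeff‖ * r ^ (f.roots.card) := by positivity
  filter_upwards [Ioo_mem_nhdsGT hc] with ε hε z hz
  by_contra! hcon
  have h1 := (IsAlgClosed.splits f).eval_eq_prod_roots z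
  -- In the factorisation over the roots, a point at distance at least `r` from every root has `|f|`
  -- at least `|leading coefficient| r ^ degree`.
  have key : ∀ s : Multiset ℂ, (∀ p ∈ s, r ≤ dist z p) →
      r ^ s.card ≤ ‖(s.map (fun a => z - a)).prod‖ := by
    intro s
    induction s using Multiset.induction_on with
    | empty => simp
    | cons a s ih =>
      intro h
      rw [Multiset.card_cons, Multiset.map_cons, Multiset.prod_cons, norm_mul, pow_succ, mul_comm]
      refine mul_le_mul ?_ (ih fun p hp => h p (Multiset.mem_cons_of_mem hp)) (by positivity)
        (norm_nonneg _)
      rw [← dist_eq_norm]; exact h a (Multiset.mem_cons_self a s)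
  have h2 := key _ hcon
  rw [h1, norm_mul] at hz
  have := mul_le_mul_of_nonneg_left h2 hlc.le
  linarith [hε.2]

theorem isFiniteMeasure_rootMeasure (f : ℂ[X]) (hf : 0 < f.natDegree) {ε : ℝ} (hε : 0 < ε) :
    IsFiniteMeasure (rootMeasure f ε) :=
  ⟨(rootMeasure_univ_le f hf hε).trans_lt (by simp)⟩

instance sigmaFinite_rootMeasure (f : ℂ[X]) (ε : ℝ) : SigmaFinite (rootMeasure f ε) :=
  SigmaFinite.withDensity_ofReal _

/-- Product form of the Kac–Rice mollification: for a polynomial with simple roots, integrals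
against powers of `rootMeasure` converge to sums over tuples of roots. -/
theorem tendsto_integral_pi_rootMeasure {ι : Type*} [Fintype ι] [DecidableEq ι] (f : ℂ[X])
    (hf : 0 < f.natDegree)
    (hsep : ∀ p ∈ f.roots, f.derivative.eval p ≠ 0) {Φ : (ι → ℂ) → ℂ} (hΦ : Continuous Φ) :
    Tendsto (fun ε => ∫ z, Φ z ∂Measure.pi (fun _ : ι => rootMeasure f ε)) (𝓝[>] 0)
      (𝓝 (∑ p ∈ Fintype.piFinset (fun _ : ι => f.roots.toFinset), Φ p)) := by
  classical
  have hf0 : f ≠ 0 := by rintro rfl; simp at hf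
  set R := f.roots.toFinset with hR
  have hRroot : ∀ p ∈ R, f.eval p = 0 ∧ f.derivative.eval p ≠ 0 := by
    intro p hp
    have hp' : p ∈ f.roots := by simpa [hR] using hp
    exact ⟨(Polynomial.mem_roots hf0).1 hp', hsep p hp'⟩
  have hball : ∀ p : ℂ, ∃ r₀ > 0, p ∈ R → ∀ r, 0 < r → r ≤ r₀ →
      ∀ᶠ ε in 𝓝[>] (0 : ℝ), rootMeasure f ε (Metric.ball p r) = 1 := by
    intro p
    by_cases hp : p ∈ R
    · obtain ⟨r₀, h0, h⟩ := exists_rootMeasure_ball_eq_one f (hRroot p hp).1 (hRroot p hp).2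
      exact ⟨r₀, h0, fun _ => h⟩
    · exact ⟨1, one_pos, fun h => absurd h hp⟩
  choose ρ hρ0 hρ using hball
  rw [Metric.tendsto_nhds]
  intro η' hη'
  set Q := Fintype.piFinset (fun _ : ι => R) with hQ
  obtain ⟨η, hη, hηlt⟩ : ∃ η > 0, Q.card * η < η' := by
    refine ⟨η' / (Q.card + 1), by positivity, ?_⟩
    rw [← mul_div_assoc, div_lt_iff₀ (by positivity)]
    nlinarith
  have hcont : ∀ p : ι → ℂ, ∃ r > 0, ∀ z, dist z p < r → dist (Φ z) (Φ p) < η := fun p => by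
    obtain ⟨r, hr, h⟩ := Metric.continuous_iff.1 hΦ p η hη
    exact ⟨r, hr, h⟩
  choose σ hσ0 hσ using hcont
  -- a common radius
  obtain ⟨r, hr, hr1, hr2, hr3⟩ : ∃ r > 0, (∀ p ∈ R, r ≤ ρ p) ∧ (∀ p ∈ Q, r ≤ σ p) ∧
      (∀ p ∈ R, ∀ q ∈ R, p ≠ q → 2 * r ≤ dist p q) := by
    have e1 : ∀ᶠ r in 𝓝[>] (0 : ℝ), ∀ p ∈ R, r ≤ ρ p :=
      (Finset.eventually_all _).2 fun p _ => by
        filter_upwards [Ioo_mem_nhdsGT (hρ0 p)] with r h using h.2.le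
    have e2 : ∀ᶠ r in 𝓝[>] (0 : ℝ), ∀ p ∈ Q, r ≤ σ p :=
      (Finset.eventually_all _).2 fun p _ => by
        filter_upwards [Ioo_mem_nhdsGT (hσ0 p)] with r h using h.2.le
    have e3 : ∀ᶠ r in 𝓝[>] (0 : ℝ), ∀ p ∈ R, ∀ q ∈ R, p ≠ q → 2 * r ≤ dist p q :=
      (Finset.eventually_all _).2 fun p _ => (Finset.eventually_all _).2 fun q _ => by
        by_cases hpq : p = q
        · exact Eventually.of_forall fun r h => absurd hpq h
        · filter_upwards [Ioo_mem_nhdsGT (half_pos (dist_pos.2 hpq))] with r h _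
          linarith [h.2]
    obtain ⟨r, ⟨⟨h1, h2⟩, h3⟩, h4⟩ := (((e1.and e2).and e3).and self_mem_nhdsWithin).exists
    exact ⟨r, h4, h1, h2, h3⟩
  have hmass : ∀ᶠ ε in 𝓝[>] (0 : ℝ), ∀ p ∈ R, rootMeasure f ε (Metric.ball p r) = 1 :=
    (Finset.eventually_all _).2 fun p hp => hρ p hp r hr (hr1 p hp)
  filter_upwards [hmass, eventually_norm_eval_lt_imp_near_root f hf0 hr, self_mem_nhdsWithin]
    with ε hm hnear hε
  have : IsFiniteMeasure (rootMeasure f ε) := isFiniteMeasure_rootMeasure f hf hε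
  set ν := Measure.pi (fun _ : ι => rootMeasure f ε) with hν
  -- The product measure consists of disjoint boxes of mass one around the tuples of roots. On each
  -- of them `Φ` varies by at most `η`, so the total error is at most `Q.card * η`.
  have hbox : ∀ p ∈ Q, ν (Metric.ball p r) = 1 := by
    intro p hp
    rw [ball_pi p hr, hν, Measure.pi_pi]
    exact Finset.prod_eq_one fun i _ => hm _ (Fintype.mem_piFinset.1 hp i)
  have hdisj : ∀ p ∈ Q, ∀ q ∈ Q, p ≠ q → Disjoint (Metric.ball p r) (Metric.ball q r) := by
    intro p hp q hq hpq
    obtain ⟨i, hi⟩ := Function.ne_iff.1 hpq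
    refine Metric.ball_disjoint_ball ?_
    have := hr3 _ (Fintype.mem_piFinset.1 hp i) _ (Fintype.mem_piFinset.1 hq i) hi
    linarith [dist_le_pi_dist p q i]
  have hone : rootMeasure f ε {z | ∃ p ∈ R, dist z p < r}ᶜ = 0 := by
    have hopen : MeasurableSet {z : ℂ | ∃ p ∈ R, dist z p < r} := by
      have : {z : ℂ | ∃ p ∈ R, dist z p < r} = ⋃ p ∈ R, Metric.ball p r := by
        ext z; simp
      rw [this]
      exact R.measurableSet_biUnion fun p _ => measurableSet_ball
    rw [rootMeasure, withDensity_apply _ hopen.compl]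
    refine setLIntegral_eq_zero hopen.compl fun z hz => ?_
    have : ¬ ‖f.eval z‖ < ε := by
      intro hlt
      obtain ⟨p, hp, hd⟩ := hnear z hlt
      exact hz ⟨p, by simpa [hR, hf0] using hp, hd⟩
    simp [rootKernel, this]
  have hae : ∀ᵐ z ∂ν, z ∈ ⋃ p ∈ Q, Metric.ball p r := by
    have hi : ∀ i : ι, ∀ᵐ z ∂ν, ∃ p ∈ R, dist (z i) p < r := by
      intro i
      have : ∀ᵐ w ∂(rootMeasure f ε), ∃ p ∈ R, dist w p < r := by
        rw [ae_iff]; exact hone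
      exact (Measure.tendsto_eval_ae_ae (μ := fun _ : ι => rootMeasure f ε) (i := i)).eventually this
    filter_upwards [ae_all_iff.2 hi] with z hz
    choose p hp hd using hz
    simp only [Set.mem_iUnion]
    refine ⟨p, Fintype.mem_piFinset.2 hp, ?_⟩
    rw [ball_pi p hr]
    exact fun i _ => hd i
  have hbd : ∀ p ∈ Q, ∀ z ∈ Metric.ball p r, ‖Φ z - Φ p‖ ≤ η := fun p hp z hz => by
    rw [← dist_eq_norm]
    exact (hσ p z ((Metric.mem_ball.1 hz).trans_le (hr2 p hp))).le
  have hint : ∀ p ∈ Q, IntegrableOn Φ (Metric.ball p r) ν := by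
    intro p hp
    refine Measure.integrableOn_of_bounded (M := ‖Φ p‖ + η) (measure_ne_top _ _)
      hΦ.aestronglyMeasurable ?_
    refine (ae_restrict_iff' measurableSet_ball).2 (Eventually.of_forall fun z hz => ?_)
    have := hbd p hp z hz
    calc ‖Φ z‖ = ‖Φ p + (Φ z - Φ p)‖ := by ring_nf
      _ ≤ _ := (norm_add_le _ _).trans (by gcongr)
  have hsplit : ∫ z, Φ z ∂ν = ∑ p ∈ Q, ∫ z in Metric.ball p r, Φ z ∂ν := by
    rw [← integral_biUnion_finset Q (fun p _ => measurableSet_ball)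
      (fun p hp q hq hpq => hdisj p hp q hq hpq) hint]
    rw [Measure.restrict_eq_self_of_ae_mem hae]
  rw [hsplit, dist_eq_norm, ← sum_sub_distrib]
  refine lt_of_le_of_lt ?_ hηlt
  rw [← nsmul_eq_mul]
  refine (norm_sum_le_of_le (f := fun p => (∫ z in Metric.ball p r, Φ z ∂ν) - Φ p)
    (n := fun _ => η) Q fun p hp => ?_).trans_eq (by simp)
  have hc : ∫ z in Metric.ball p r, Φ p ∂ν = Φ p := by
    rw [setIntegral_const]; simp [Measure.real, hbox p hp]
  rw [← hc]
  rw [← integral_sub (hint p hp) (integrableOn_const (by simp [hbox p hp]))]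
  have := norm_setIntegral_le_of_norm_le_const (μ := ν) (s := Metric.ball p r) (C := η)
    (f := fun z => Φ z - Φ p) (by simp [hbox p hp]) (fun z hz => hbd p hp z hz)
  simpa [Measure.real, hbox p hp] using this

theorem pi_withDensity_ofReal {ι E : Type*} [Fintype ι] [MeasureSpace E]
    [SigmaFinite (volume : Measure E)] (f : ι → E → ℝ) (hf0 : ∀ i x, 0 ≤ f i x)
    (hfi : ∀ i, Integrable (f i)) :
    Measure.pi (fun i => (volume : Measure E).withDensity (fun x => ofReal (f i x))) =
      (volume : Measure (ι → E)).withDensity (fun x => ofReal (∏ i, f i (x i))) := by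
  have (i : ι) : SigmaFinite ((volume : Measure E).withDensity
      (fun x => ofReal (f i x))) := SigmaFinite.withDensity_ofReal _
  refine Measure.pi_eq fun s hs => ?_
  rw [withDensity_apply _ (MeasurableSet.univ_pi hs),
    ← lintegral_indicator (MeasurableSet.univ_pi hs)]
  have h1 : ∀ x : ι → E, (Set.univ.pi s).indicator (fun x => ofReal (∏ i, f i (x i))) x =
      ofReal (∏ i, (s i).indicator (f i) (x i)) := by
    intro x
    by_cases hx : x ∈ Set.univ.pi s
    · rw [indicator_of_mem hx]
      congr 1
      exact prod_congr rfl fun i _ => (indicator_of_mem (hx i trivial) _).symm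
    · rw [indicator_of_notMem hx]
      obtain ⟨i, hi⟩ : ∃ i, x i ∉ s i := by simpa [Set.mem_pi] using hx
      rw [prod_eq_zero (mem_univ i) (indicator_of_notMem hi _)]
      simp
  simp_rw [h1]
  have hint : Integrable (fun x : ι → E => ∏ i, (s i).indicator (f i) (x i)) :=
    Integrable.fintype_prod fun i => (hfi i).indicator (hs i)
  rw [← ofReal_integral_eq_lintegral_ofReal hint (Eventually.of_forall fun x =>
    prod_nonneg fun i _ => Set.indicator_nonneg (fun y _ => hf0 i y) _),
    integral_fintype_prod_volume_eq_prod, ofReal_prod_of_nonneg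
      (fun i _ => integral_nonneg fun y => Set.indicator_nonneg (fun y _ => hf0 i y) _)]
  refine prod_congr rfl fun i _ => ?_
  rw [withDensity_apply _ (hs i), integral_indicator (hs i),
    ofReal_integral_eq_lintegral_ofReal (hfi i).integrableOn (Eventually.of_forall (hf0 i))]

/-! ### Gaussian vectors: linear images, tilting and small-ball bounds. -/

/-- The standard Gaussian measure on `κ → ℝ`. -/
def gaussVec (κ : Type*) [Fintype κ] : Measure (κ → ℝ) := Measure.pi fun _ => gaussianReal 0 1

local notation "γ[" n "]" => gaussVec (Fin (n + 1))

instance (κ : Type*) [Fintype κ] : IsProbabilityMeasure (gaussVec κ) := by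
  unfold gaussVec; infer_instance

/-- The density of `gaussVec`. -/
def gaussDens {κ : Type*} [Fintype κ] (x : κ → ℝ) : ℝ :=
  (√(2 * π))⁻¹ ^ card κ * Real.exp (-(x ⬝ᵥ x) / 2)

theorem gaussDens_nonneg {κ : Type*} [Fintype κ] (x : κ → ℝ) : 0 ≤ gaussDens x := by
  unfold gaussDens; positivity

theorem continuous_gaussDens {κ : Type*} [Fintype κ] : Continuous (gaussDens : (κ → ℝ) → ℝ) := by
  unfold gaussDens dotProduct; fun_prop

theorem gaussVec_eq_withDensity (κ : Type*) [Fintype κ] :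
    gaussVec κ = volume.withDensity (fun x => ofReal (gaussDens x)) := by
  have h : gaussianReal 0 1 = (volume : Measure ℝ).withDensity
      (fun x => ofReal (gaussianPDFReal 0 1 x)) := by
    rw [gaussianReal_of_var_ne_zero _ one_ne_zero]; rfl
  unfold gaussVec
  simp_rw [h]
  rw [pi_withDensity_ofReal _ (fun _ x => gaussianPDFReal_nonneg 0 1 x)
    (fun _ => integrable_gaussianPDFReal 0 1)]
  congr 1
  ext x
  congr 1
  simp only [gaussianPDFReal_def, NNReal.coe_one, mul_one, sub_zero, prod_mul_distrib,
    prod_const, card_univ, ← Real.exp_sum, gaussDens, dotProduct]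
  congr 2
  rw [← Finset.sum_neg_distrib, sum_div]
  exact sum_congr rfl fun i _ => by ring

theorem lintegral_gaussVec {κ : Type*} [Fintype κ] {F : (κ → ℝ) → ℝ≥0∞} (hF : Measurable F) :
    ∫⁻ x, F x ∂gaussVec κ = ∫⁻ x, ofReal (gaussDens x) * F x := by
  rw [gaussVec_eq_withDensity, lintegral_withDensity_eq_lintegral_mul _
    (continuous_gaussDens.measurable.ennreal_ofReal) hF]
  rfl

open scoped MatrixOrder in
theorem exists_symm_sqrt_of_posDef {κ : Type*} [Fintype κ] [DecidableEq κ] {A : Matrix κ κ ℝ}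
    (hA : A.PosDef) :
    ∃ C : Matrix κ κ ℝ, C.transpose = C ∧ C * C = A ∧ C.det ≠ 0 ∧ |C.det| = √A.det := by
  have h0 : 0 ≤ A := hA.posSemidef.nonneg
  have hC : CFC.sqrt A * CFC.sqrt A = A := CFC.sqrt_mul_sqrt_self A h0
  have hdet : (CFC.sqrt A).det * (CFC.sqrt A).det = A.det := by rw [← Matrix.det_mul, hC]
  refine ⟨CFC.sqrt A, ?_, hC, ?_, ?_⟩
  · have := (CFC.sqrt_nonneg A).isSelfAdjoint
    have h2 : (CFC.sqrt A).conjTranspose = CFC.sqrt A := this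
    rwa [Matrix.conjTranspose_eq_transpose_of_trivial] at h2
  · intro h
    have := hA.det_pos
    rw [← hdet, h] at this
    simp at this
  · rw [← hdet, Real.sqrt_mul_self_eq_abs]

theorem lintegral_comp_mulVec {κ : Type*} [Fintype κ] [DecidableEq κ] (C : Matrix κ κ ℝ)
    (hC : C.det ≠ 0) {g : (κ → ℝ) → ℝ≥0∞} (hg : Measurable g) :
    ∫⁻ x, g (C.mulVec x) = ofReal |C.det|⁻¹ * ∫⁻ x, g x := by
  have h := Real.map_matrix_volume_pi_eq_smul_volume_pi hC
  have hm : Measurable (Matrix.toLin' C : (κ → ℝ) → (κ → ℝ)) :=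
    (LinearMap.continuous_of_finiteDimensional _).measurable
  have h2 : ∫⁻ x, g x ∂(Measure.map (Matrix.toLin' C) volume) = ∫⁻ x, g (C.mulVec x) := by
    rw [lintegral_map hg hm]; rfl
  rw [← h2, h, lintegral_smul_measure, abs_inv]; rfl

theorem measurable_mulVec {κ κ' : Type*} [Fintype κ] [Fintype κ'] (C : Matrix κ' κ ℝ) :
    Measurable (fun x : κ → ℝ => C.mulVec x) := by
  unfold mulVec dotProduct
  fun_prop

/-- Exponential quadratic tilting of a standard Gaussian vector. -/
theorem lintegral_gaussVec_tilt {κ : Type*} [Fintype κ] [DecidableEq κ] {C P : Matrix κ κ ℝ}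
    (hsymm : C.transpose = C) (hCP : C * C = P) (hdet : C.det ≠ 0)
    {F : (κ → ℝ) → ℝ≥0∞} (hF : Measurable F) :
    ∫⁻ x, ofReal (Real.exp (-(x ⬝ᵥ P.mulVec x - x ⬝ᵥ x) / 2)) * F x ∂gaussVec κ =
      ofReal |C.det|⁻¹ * ∫⁻ y, F (C⁻¹.mulVec y) ∂gaussVec κ := by
  -- The substitution `y = C x` turns the tilted density `exp(-x·Px / 2)` back into the standard
  -- one.
  have hq : ∀ x, C.mulVec x ⬝ᵥ C.mulVec x = x ⬝ᵥ P.mulVec x := by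
    intro x
    rw [← hCP, ← mulVec_mulVec, dotProduct_mulVec x, ← mulVec_transpose, hsymm]
  have hm2 : Measurable fun x : κ → ℝ =>
      ofReal (Real.exp (-(x ⬝ᵥ P.mulVec x - x ⬝ᵥ x) / 2)) := by
    unfold mulVec dotProduct; fun_prop
  rw [lintegral_gaussVec (F := fun x =>
      ofReal (Real.exp (-(x ⬝ᵥ P.mulVec x - x ⬝ᵥ x) / 2)) * F x) (hm2.mul hF),
    lintegral_gaussVec (F := fun y => F (C⁻¹.mulVec y)) (hF.comp (measurable_mulVec _)),
    ← lintegral_comp_mulVec C hdet (g := fun y => ofReal (gaussDens y) * F (C⁻¹.mulVec y))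
      ((continuous_gaussDens.measurable.ennreal_ofReal).mul (hF.comp (measurable_mulVec _)))]
  refine lintegral_congr fun x => ?_
  have : C⁻¹.mulVec (C.mulVec x) = x := by
    rw [mulVec_mulVec, Matrix.nonsing_inv_mul _ (isUnit_iff_ne_zero.2 hdet), Matrix.one_mulVec]
  simp only [this, ← mul_assoc]
  congr 1
  rw [← ofReal_mul (gaussDens_nonneg _)]
  congr 1
  simp only [gaussDens, hq, mul_assoc, ← Real.exp_add]
  congr 2
  ring

/-- Testing the quadratic form on unit eigenvectors bounds every eigenvalue from below by `lam`. -/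
theorem pow_card_le_det {d : Type*} [Fintype d] [DecidableEq d] {M : Matrix d d ℝ}
    (hM : M.IsHermitian) {lam : ℝ} (hlam : 0 ≤ lam)
    (h : ∀ c : d → ℝ, lam * (c ⬝ᵥ c) ≤ c ⬝ᵥ M.mulVec c) : lam ^ card d ≤ M.det := by
  rw [hM.det_eq_prod_eigenvalues, card, ← prod_const]
  simp only [RCLike.ofReal_real_eq_id, id]
  refine prod_le_prod (fun _ _ => hlam) fun i _ => ?_
  rw [hM.eigenvalues_eq i]
  have hv := h (hM.eigenvectorBasis i)
  have h1 : (hM.eigenvectorBasis i : d → ℝ) ⬝ᵥ (hM.eigenvectorBasis i : d → ℝ) = 1 := by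
    have := hM.eigenvectorBasis.orthonormal.1 i
    have h2 : ‖hM.eigenvectorBasis i‖ ^ 2 = 1 := by rw [this]; simp
    rw [EuclideanSpace.real_norm_sq_eq] at h2
    simpa [dotProduct, sq] using h2
  rw [h1, mul_one] at hv
  simpa using hv

/-- A linear form of a standard Gaussian vector is Gaussian. -/
theorem map_dotProduct_gaussVec {κ : Type*} [Fintype κ] (l : κ → ℝ) :
    (gaussVec κ).map (fun x => l ⬝ᵥ x) = gaussianReal 0 (l ⬝ᵥ l).toNNReal := by
  have hm : Measurable fun x : κ → ℝ => l ⬝ᵥ x := by unfold dotProduct; fun_prop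
  have : IsProbabilityMeasure ((gaussVec κ).map (fun x => l ⬝ᵥ x)) :=
    Measure.isProbabilityMeasure_map hm.aemeasurable
  refine Measure.ext_of_charFun ?_
  ext t
  rw [charFun_apply_real, integral_map hm.aemeasurable (by fun_prop), charFun_gaussianReal]
  have h1 : ∀ x : κ → ℝ, exp (t * ((l ⬝ᵥ x : ℝ) : ℂ) * I) =
      ∏ i, exp (((t * l i : ℝ) : ℂ) * (x i : ℂ) * I) := by
    intro x
    rw [← exp_sum]
    congr 1
    simp only [dotProduct, ofReal_sum, mul_sum, sum_mul]
    exact sum_congr rfl fun i _ => by push_cast; ring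
  simp_rw [h1]
  unfold gaussVec
  rw [integral_fintype_prod_eq_prod (f := fun (i : κ) (y : ℝ) =>
    exp (((t * l i : ℝ) : ℂ) * (y : ℂ) * I))]
  simp_rw [← charFun_apply_real, charFun_gaussianReal, ← exp_sum]
  congr 1
  have h0 : 0 ≤ l ⬝ᵥ l := by
    simp only [dotProduct]; exact sum_nonneg fun i _ => mul_self_nonneg _
  rw [Real.coe_toNNReal _ h0]
  simp only [Complex.ofReal_zero, mul_zero, zero_mul, zero_sub, NNReal.coe_one,
    Complex.ofReal_one, one_mul, dotProduct, ofReal_sum, Finset.sum_neg_distrib]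
  rw [sum_mul, sum_div]
  congr 1
  exact sum_congr rfl fun i _ => by push_cast; ring

/-- Even moments of the standard normal distribution. -/
def gaussMoment (m : ℕ) : ℝ≥0∞ := ∫⁻ g, ofReal (g ^ 2) ^ m ∂gaussianReal 0 1

theorem gaussMoment_ne_top (m : ℕ) : gaussMoment m ≠ ∞ := by
  have h : MemLp id (2 * m : ℕ) (gaussianReal 0 1) := by
    exact_mod_cast memLp_id_gaussianReal (2 * m : ℕ)
  rcases Nat.eq_zero_or_pos m with rfl | hm
  · simp [gaussMoment]
  have h2 := h.integrable_norm_pow (by omega)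
  have h3 := h2.lintegral_lt_top
  unfold gaussMoment
  refine (lt_of_eq_of_lt ?_ h3).ne
  refine lintegral_congr fun g => ?_
  rw [← ofReal_pow (by positivity)]
  simp [pow_mul]

/-- The form `l · y` is distributed as `√(l · l)` times a standard normal variable, so normalising
by an upper bound `t` of the variance makes the moments uniformly bounded. -/
theorem lintegral_sq_dotProduct_pow_le {κ : Type*} [Fintype κ] (l : κ → ℝ) {t : ℝ} (ht : 0 < t)
    (hl : l ⬝ᵥ l ≤ t) (m : ℕ) :
    ∫⁻ y, ofReal ((l ⬝ᵥ y) ^ 2 / t) ^ m ∂gaussVec κ ≤ gaussMoment m := by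
  have hm : Measurable fun x : κ → ℝ => l ⬝ᵥ x := by unfold dotProduct; fun_prop
  have h0 : 0 ≤ l ⬝ᵥ l := by
    simp only [dotProduct]; exact sum_nonneg fun i _ => mul_self_nonneg _
  have h1 : gaussianReal 0 (l ⬝ᵥ l).toNNReal = (gaussianReal 0 1).map (√(l ⬝ᵥ l) * ·) := by
    rw [gaussianReal_map_const_mul]
    congr 1
    · simp
    · ext; simp [sq_sqrt h0, h0]
  rw [← lintegral_map (f := fun g : ℝ => ofReal (g ^ 2 / t) ^ m) (by fun_prop) hm,
    map_dotProduct_gaussVec, h1, lintegral_map (by fun_prop) (by fun_prop)]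
  refine lintegral_mono fun g => ?_
  gcongr
  rw [div_le_iff₀ ht, mul_pow, sq_sqrt h0, mul_comm]
  gcongr

theorem add_pow_three_le (x y z : ℝ≥0∞) (m : ℕ) :
    (x + y + z) ^ m ≤ 3 ^ m * (x ^ m + y ^ m + z ^ m) := by
  have h : x + y + z ≤ 3 * max (max x y) z := by
    have h1 : x ≤ max (max x y) z := (le_max_left _ _).trans (le_max_left _ _)
    have h2 : y ≤ max (max x y) z := (le_max_right _ _).trans (le_max_left _ _)
    have h3 : z ≤ max (max x y) z := le_max_right _ _
    calc x + y + z ≤ max (max x y) z + max (max x y) z + max (max x y) z := by gcongr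
      _ = _ := by ring
  calc (x + y + z) ^ m ≤ (3 * max (max x y) z) ^ m := by gcongr
    _ = 3 ^ m * (max (max x y) z) ^ m := mul_pow _ _ _
    _ ≤ _ := by
      gcongr
      rcases max_choice (max x y) z with h | h <;> rw [h]
      · rcases max_choice x y with h | h <;> rw [h]
        · rw [add_assoc]; exact le_self_add
        · exact le_trans (le_add_left le_rfl) le_self_add
      · exact le_add_left le_rfl

theorem prod_le_one_add_sum_pow {J : Type*} [Fintype J] (u : J → ℝ≥0∞) :
    ∏ j, u j ≤ 1 + ∑ j, u j ^ card J := by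
  classical
  rcases isEmpty_or_nonempty J with h | h
  · simp
  obtain ⟨j₀, -, hj⟩ := Finset.exists_max_image univ u Finset.univ_nonempty
  calc ∏ j, u j ≤ u j₀ ^ card J := Finset.prod_le_pow_card _ _ _ (fun j hm => hj j hm)
    _ ≤ ∑ j, u j ^ card J :=
      single_le_sum (f := fun j => u j ^ card J) (fun _ _ => zero_le) (mem_univ j₀)
    _ ≤ _ := le_add_left le_rfl

/-- The constant of `lintegral_gaussVec_prod_le`. -/
def ubConst (d m : ℕ) : ℝ≥0∞ :=
  ofReal (Real.exp (d / 2)) * (1 + m * (3 ^ m * (1 + gaussMoment m + gaussMoment m)))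

theorem ubConst_ne_top (d m : ℕ) : ubConst d m ≠ ∞ := by
  have := gaussMoment_ne_top m
  unfold ubConst
  finiteness

theorem sq_norm_sum_ofReal_mul {κ : Type*} [Fintype κ] (x : κ → ℝ) (q : κ → ℂ) :
    ‖∑ i, (x i : ℂ) * q i‖ ^ 2 =
      ((fun i => (q i).re) ⬝ᵥ x) ^ 2 + ((fun i => (q i).im) ⬝ᵥ x) ^ 2 := by
  rw [← normSq_eq_norm_sq, normSq_apply, re_sum, Complex.im_sum]
  simp [dotProduct, mul_comm, sq]

/-- Dividing the factors by `t j` reduces the claim to bounded moments. The product is dominated by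
the sum of the powers of order `card J` of the factors, so no joint law of the forms is needed. -/
theorem lintegral_gaussVec_prod_sq_le {κ J : Type*} [Fintype κ] [Fintype J] (k t : J → ℝ)
    (lr li : J → κ → ℝ) (ht : ∀ j, 0 < t j) (hkt : ∀ j, k j ≤ t j)
    (hlr : ∀ j, lr j ⬝ᵥ lr j ≤ t j) (hli : ∀ j, li j ⬝ᵥ li j ≤ t j) :
    ∫⁻ y, ∏ j, ofReal (k j + (lr j ⬝ᵥ y) ^ 2 + (li j ⬝ᵥ y) ^ 2) ∂gaussVec κ ≤
      (1 + card J * (3 ^ card J * (1 + gaussMoment (card J) + gaussMoment (card J)))) *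
      ofReal (∏ j, t j) := by
  set m := card J
  have hmeas : ∀ l : κ → ℝ, Measurable fun x : κ → ℝ => l ⬝ᵥ x := fun l => by
    unfold dotProduct; fun_prop
  have hr := fun j => hmeas (lr j)
  have hi := fun j => hmeas (li j)
  have hpt : ∀ y : κ → ℝ, ∏ j, ofReal (k j + (lr j ⬝ᵥ y) ^ 2 + (li j ⬝ᵥ y) ^ 2) ≤
      ofReal (∏ j, t j) * (1 + ∑ j, 3 ^ m * (1 + ofReal ((lr j ⬝ᵥ y) ^ 2 / t j) ^ m
        + ofReal ((li j ⬝ᵥ y) ^ 2 / t j) ^ m)) := by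
    intro y
    have h1 : ∀ j, ofReal (k j + (lr j ⬝ᵥ y) ^ 2 + (li j ⬝ᵥ y) ^ 2) ≤
        ofReal (t j) * (1 + ofReal ((lr j ⬝ᵥ y) ^ 2 / t j) + ofReal ((li j ⬝ᵥ y) ^ 2 / t j)) := by
      intro j
      rw [← ofReal_one, ← ofReal_add (by norm_num)
        (div_nonneg (sq_nonneg _) (ht j).le), ← ofReal_add (by
          have := div_nonneg (sq_nonneg (lr j ⬝ᵥ y)) (ht j).le; linarith)
        (div_nonneg (sq_nonneg _) (ht j).le), ← ofReal_mul (ht j).le]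
      refine ofReal_le_ofReal ?_
      have := ht j
      have e : t j * (1 + (lr j ⬝ᵥ y) ^ 2 / t j + (li j ⬝ᵥ y) ^ 2 / t j) =
        t j + (lr j ⬝ᵥ y) ^ 2 + (li j ⬝ᵥ y) ^ 2 := by field_simp
      rw [e]
      linarith [hkt j]
    refine (Finset.prod_le_prod' fun j _ => h1 j).trans ?_
    rw [prod_mul_distrib, ofReal_prod_of_nonneg fun j _ => (ht j).le]
    gcongr
    refine (prod_le_one_add_sum_pow _).trans ?_
    gcongr with j
    refine (add_pow_three_le _ _ _ _).trans ?_
    rw [one_pow]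
  refine (lintegral_mono hpt).trans ?_
  rw [lintegral_const_mul _ (by fun_prop), mul_comm]
  gcongr
  rw [lintegral_add_left measurable_const, lintegral_finsetSum _ (by fun_prop)]
  simp only [lintegral_const, measure_univ, mul_one]
  gcongr
  rw [← nsmul_eq_mul, show m = univ.card (α := J) from rfl]
  refine sum_le_card_nsmul _ _ _ fun j _ => ?_
  rw [lintegral_const_mul _ (by fun_prop), lintegral_add_left (by fun_prop),
    lintegral_add_left (by fun_prop)]
  simp only [lintegral_const, measure_univ, mul_one]
  gcongr
  · exact lintegral_sq_dotProduct_pow_le _ (ht j) (hlr j) m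
  · exact lintegral_sq_dotProduct_pow_le _ (ht j) (hli j) m

/-- Upper bound for products of squares of linear forms of a Gaussian vector, on the event that
other, non-degenerate, linear forms are small. -/
theorem lintegral_gaussVec_prod_le {κ ι J : Type*} [Fintype κ] [Fintype ι] [Fintype J]
    [DecidableEq ι] [DecidableEq κ]
    (A : Matrix ι κ ℝ) {lam : ℝ} (hlam : 0 < lam)
    (hA : ∀ c : ι → ℝ, lam * (c ⬝ᵥ c) ≤ A.transpose.mulVec c ⬝ᵥ A.transpose.mulVec c)
    (e : ι → ℝ) (he : ∀ i, 0 < e i) (q : J → κ → ℂ) (k t : J → ℝ) (hk : ∀ j, 0 ≤ k j)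
    (ht : ∀ j, 0 < t j) (hkt : ∀ j, k j + ∑ i, ‖q j i‖ ^ 2 ≤ t j) :
    ∫⁻ x, (∏ j, ofReal (k j + ‖∑ i, (x i : ℂ) * q j i‖ ^ 2)) *
      {x | ∀ i, |A.mulVec x i| ≤ e i}.indicator 1 x ∂gaussVec κ ≤
    ubConst (card ι) (card J) * ofReal (∏ j, t j) * ofReal ((∏ i, e i) / √lam ^ card ι) := by
  classical
  set d := card ι
  set D : Matrix ι ι ℝ := Matrix.diagonal fun i => (e i)⁻¹ with hD
  -- On the event `|B x|² ≤ d`, so its indicator is at most `exp(d/2) exp(-|B x|² / 2)`. The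
  -- Gaussian tilted by this factor has precision `P = 1 + BᵀB`: normalisation produces `det P ^
  -- (-1/2)`, which is the small-ball factor, and the covariance only decreases, so the moments stay
  -- bounded.
  set B : Matrix ι κ ℝ := D * A with hB
  have hPq : ∀ x, x ⬝ᵥ (1 + B.transpose * B).mulVec x = x ⬝ᵥ x + B.mulVec x ⬝ᵥ B.mulVec x := by
    intro x
    rw [Matrix.add_mulVec, Matrix.one_mulVec, dotProduct_add, ← mulVec_mulVec,
      dotProduct_mulVec x, ← mulVec_transpose, Matrix.transpose_transpose]
  have hselfι : ∀ (x : ι → ℝ), 0 ≤ x ⬝ᵥ x := fun x => by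
    simp only [dotProduct]; exact sum_nonneg fun i _ => mul_self_nonneg _
  have hP : (1 + B.transpose * B).PosDef := by
    refine Matrix.PosDef.one.add_posSemidef ?_
    have := Matrix.posSemidef_conjTranspose_mul_self B
    rwa [Matrix.conjTranspose_eq_transpose_of_trivial] at this
  obtain ⟨C, hCs, hCP, hCd, hCa⟩ := exists_symm_sqrt_of_posDef hP
  have hCinv : C * C⁻¹ = 1 := Matrix.mul_nonsing_inv _ (isUnit_iff_ne_zero.2 hCd)
  have hCis : C⁻¹.transpose = C⁻¹ := by rw [Matrix.transpose_nonsing_inv, hCs]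
  -- Since `C² = P ≥ 1`, the inverse of `C` is a contraction: variances decrease under the tilt.
  have hshrink : ∀ l : κ → ℝ, C⁻¹.mulVec l ⬝ᵥ C⁻¹.mulVec l ≤ l ⬝ᵥ l := by
    intro l
    set y := C⁻¹.mulVec l with hy
    have hl : l = C.mulVec y := by rw [hy, mulVec_mulVec, hCinv, Matrix.one_mulVec]
    have : l ⬝ᵥ l = y ⬝ᵥ y + B.mulVec y ⬝ᵥ B.mulVec y := by
      rw [← hPq, ← hCP, ← mulVec_mulVec, dotProduct_mulVec y, ← mulVec_transpose, hCs, ← hl]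
    rw [this]
    linarith [hselfι (B.mulVec y)]
  have hdetP : (∏ i, (e i)⁻¹) ^ 2 * lam ^ d ≤ (1 + B.transpose * B).det := by
    -- Exchanging the factors gives a determinant indexed by `ι`, which splits into the powers of `1
    -- / e i` and a matrix that dominates `A Aᵀ`, where `hA` applies.
    rw [Matrix.det_one_add_mul_comm]
    have h1 : 1 + B * B.transpose =
        D * (Matrix.diagonal (fun i => e i ^ 2) + A * A.transpose) * D := by
      rw [hB, Matrix.transpose_mul, Matrix.mul_add, Matrix.add_mul, hD,
        Matrix.diagonal_transpose, Matrix.diagonal_mul_diagonal, Matrix.diagonal_mul_diagonal]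
      congr 1
      · rw [← Matrix.diagonal_one]
        congr 1
        ext i
        have := (he i).ne'
        field_simp
      · simp only [Matrix.mul_assoc]
    rw [h1, Matrix.det_mul, Matrix.det_mul, hD, Matrix.det_diagonal]
    have h2 : lam ^ d ≤ (Matrix.diagonal (fun i => e i ^ 2) + A * A.transpose).det := by
      refine pow_card_le_det ?_ hlam.le fun c => ?_
      · refine Matrix.IsHermitian.add ?_ ?_
        · rw [Matrix.isHermitian_diagonal_iff]; intro i; rfl
        · have := Matrix.isHermitian_mul_conjTranspose_self A
          rwa [Matrix.conjTranspose_eq_transpose_of_trivial] at this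
      · rw [Matrix.add_mulVec, dotProduct_add, ← mulVec_mulVec, dotProduct_mulVec c A,
          ← mulVec_transpose]
        refine (hA c).trans (le_add_of_nonneg_left ?_)
        simp only [dotProduct, Matrix.mulVec_diagonal]
        exact sum_nonneg fun i _ => by nlinarith [mul_nonneg (sq_nonneg (e i)) (sq_nonneg (c i))]
    have h3 : 0 ≤ (∏ i, (e i)⁻¹) ^ 2 := sq_nonneg _
    nlinarith [mul_le_mul_of_nonneg_left h2 h3]
  have hCdet : |C.det|⁻¹ ≤ (∏ i, e i) / √lam ^ d := by
    have hpe : 0 < ∏ i, e i := Finset.prod_pos fun i _ => he i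
    rw [hCa]
    have : √lam ^ d / ∏ i, e i ≤ √(1 + B.transpose * B).det := by
      refine Real.le_sqrt_of_sq_le ?_
      refine le_trans (le_of_eq ?_) hdetP
      rw [div_pow, ← pow_mul, mul_comm d 2, pow_mul, sq_sqrt hlam.le, Finset.prod_inv_distrib,
        inv_pow, div_eq_inv_mul]
    have h4 := inv_anti₀ (by positivity) this
    rwa [inv_div] at h4
  have hmeas : ∀ l : κ → ℝ, Measurable fun x : κ → ℝ => l ⬝ᵥ x := fun l => by
    unfold dotProduct; fun_prop
  set F : (κ → ℝ) → ℝ≥0∞ := fun x => ∏ j, ofReal (k j + ‖∑ i, (x i : ℂ) * q j i‖ ^ 2) with hF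
  have hFm : Measurable F := by rw [hF]; fun_prop
  have hpt : ∀ x, F x * {x | ∀ i, |A.mulVec x i| ≤ e i}.indicator 1 x ≤
      ofReal (Real.exp (d / 2)) * (ofReal (Real.exp
        (-(x ⬝ᵥ (1 + B.transpose * B).mulVec x - x ⬝ᵥ x) / 2)) * F x) := by
    intro x
    by_cases hx : ∀ i, |A.mulVec x i| ≤ e i
    · rw [indicator_of_mem (by exact hx), Pi.one_apply, mul_one, ← mul_assoc,
        ← ofReal_mul (by positivity), ← Real.exp_add]
      refine le_mul_of_one_le_left zero_le ?_
      rw [← ofReal_one]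
      refine ofReal_le_ofReal (Real.one_le_exp ?_)
      rw [hPq]
      have : B.mulVec x ⬝ᵥ B.mulVec x ≤ d := by
        have hle : ∀ i, B.mulVec x i * B.mulVec x i ≤ 1 := by
          intro i
          rw [hB, ← mulVec_mulVec, hD, Matrix.mulVec_diagonal]
          have h1 : |(e i)⁻¹ * A.mulVec x i| ≤ 1 := by
            rw [abs_mul, abs_of_pos (inv_pos.2 (he i)), inv_mul_le_iff₀ (he i), mul_one]
            exact hx i
          have := abs_mul_abs_self ((e i)⁻¹ * A.mulVec x i)
          nlinarith [abs_nonneg ((e i)⁻¹ * A.mulVec x i)]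
        simp only [dotProduct]
        refine (sum_le_card_nsmul _ _ 1 fun i _ => hle i).trans (by simp [d])
      linarith
    · rw [indicator_of_notMem (by exact hx), mul_zero]
      exact zero_le
  refine (lintegral_mono hpt).trans ?_
  rw [lintegral_const_mul _ (by
    refine Measurable.mul ?_ hFm
    unfold mulVec dotProduct; fun_prop), lintegral_gaussVec_tilt hCs hCP hCd hFm]
  have hrew : ∀ y : κ → ℝ, F (C⁻¹.mulVec y) = ∏ j, ofReal (k j +
      (C⁻¹.mulVec (fun i => (q j i).re) ⬝ᵥ y) ^ 2 + (C⁻¹.mulVec (fun i => (q j i).im) ⬝ᵥ y) ^ 2) := by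
    intro y
    have hadj : ∀ l : κ → ℝ, l ⬝ᵥ C⁻¹.mulVec y = C⁻¹.mulVec l ⬝ᵥ y := fun l => by
      rw [dotProduct_mulVec, ← mulVec_transpose, hCis]
    simp only [hF, sq_norm_sum_ofReal_mul, hadj, add_assoc]
  simp_rw [hrew]
  have hre : ∀ j, (fun i => (q j i).re) ⬝ᵥ (fun i => (q j i).re) ≤ t j := fun j => by
    refine le_trans (sum_le_sum fun i _ => ?_) ((le_add_of_nonneg_left (hk j)).trans (hkt j))
    rw [← normSq_eq_norm_sq, normSq_apply]
    nlinarith [mul_self_nonneg (q j i).im]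
  have him : ∀ j, (fun i => (q j i).im) ⬝ᵥ (fun i => (q j i).im) ≤ t j := fun j => by
    refine le_trans (sum_le_sum fun i _ => ?_) ((le_add_of_nonneg_left (hk j)).trans (hkt j))
    rw [← normSq_eq_norm_sq, normSq_apply]
    nlinarith [mul_self_nonneg (q j i).re]
  have hfin := lintegral_gaussVec_prod_sq_le k t (fun j => C⁻¹.mulVec (fun i => (q j i).re))
    (fun j => C⁻¹.mulVec (fun i => (q j i).im)) ht
    (fun j => (le_add_of_nonneg_right (sum_nonneg fun i _ => by positivity)).trans (hkt j))
    (fun j => (hshrink _).trans (hre j)) (fun j => (hshrink _).trans (him j))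
  refine (mul_le_mul' le_rfl (mul_le_mul' (ofReal_le_ofReal hCdet) hfin)).trans_eq ?_
  unfold ubConst
  ring

theorem lintegral_fintype_prod_ofReal {ι E : Type*} [Fintype ι] [MeasureSpace E]
    [SigmaFinite (volume : Measure E)] (f : ι → E → ℝ) (hf0 : ∀ i x, 0 ≤ f i x)
    (hfi : ∀ i, Integrable (f i)) :
    ∫⁻ x : ι → E, ofReal (∏ i, f i (x i)) = ∏ i, ∫⁻ x, ofReal (f i x) := by
  have (i : ι) : SigmaFinite ((volume : Measure E).withDensity
      (fun x => ofReal (f i x))) := SigmaFinite.withDensity_ofReal _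
  have h := congrArg (fun μ : Measure (ι → E) => μ Set.univ) (pi_withDensity_ofReal f hf0 hfi)
  simp only [Measure.pi_univ, withDensity_apply _ MeasurableSet.univ, Measure.restrict_univ] at h
  exact h.symm

/-- The law of a non-degenerate linear image of a standard Gaussian vector. -/
theorem lintegral_gaussVec_comp_mulVec {κ τ : Type*} [Fintype κ] [Fintype τ] [DecidableEq τ]
    (A : Matrix τ κ ℝ) (hG : (A * A.transpose).PosDef) {F : (τ → ℝ) → ℝ≥0∞} (hF : Measurable F) :
    ∫⁻ x, F (A.mulVec x) ∂gaussVec κ =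
      ∫⁻ v, ofReal ((√(2 * π))⁻¹ ^ card τ * (√(A * A.transpose).det)⁻¹ *
        Real.exp (-(v ⬝ᵥ (A * A.transpose)⁻¹.mulVec v) / 2)) * F v := by
  obtain ⟨C, hCs, hCG, hCd, hCa⟩ := exists_symm_sqrt_of_posDef hG
  -- `A x` and `C y` are centred with the same covariance `A Aᵀ = C Cᵀ`, so every linear functional
  -- has the same law under both. The invertible square matrix `C` then gives the density by
  -- substitution.
  have hlaw : (gaussVec κ).map (fun x => A.mulVec x) = (gaussVec τ).map (fun y => C.mulVec y) := by
    have hp1 : IsProbabilityMeasure ((gaussVec κ).map (fun x => A.mulVec x)) :=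
      Measure.isProbabilityMeasure_map (measurable_mulVec A).aemeasurable
    have hp2 : IsProbabilityMeasure ((gaussVec τ).map (fun y => C.mulVec y)) :=
      Measure.isProbabilityMeasure_map (measurable_mulVec C).aemeasurable
    refine Measure.ext_of_charFunDual ?_
    ext L
    rw [charFunDual_eq_charFun_map_one, charFunDual_eq_charFun_map_one]
    congr 1
    rw [Measure.map_map L.continuous.measurable (measurable_mulVec A),
      Measure.map_map L.continuous.measurable (measurable_mulVec C)]
    set w : τ → ℝ := fun i => L (Pi.single i 1) with hw
    have hL : ∀ v, L v = w ⬝ᵥ v := by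
      intro v
      conv_lhs => rw [← Finset.univ_sum_single v]
      rw [map_sum, dotProduct]
      refine sum_congr rfl fun i _ => ?_
      rw [hw, show (Pi.single i (v i) : τ → ℝ) = v i • Pi.single i (1 : ℝ) by
        rw [← Pi.single_smul]; simp, map_smul, smul_eq_mul, mul_comm]
    have e1 : (L ∘ fun x => A.mulVec x) = fun x => A.transpose.mulVec w ⬝ᵥ x := by
      ext x; simp only [Function.comp, hL]; rw [dotProduct_mulVec, ← mulVec_transpose]
    have e2 : (L ∘ fun y => C.mulVec y) = fun y => C.transpose.mulVec w ⬝ᵥ y := by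
      ext x; simp only [Function.comp, hL]; rw [dotProduct_mulVec, ← mulVec_transpose]
    have e3 : ∀ {κ' : Type _} [Fintype κ'] (D : Matrix τ κ' ℝ),
        D.transpose.mulVec w ⬝ᵥ D.transpose.mulVec w = w ⬝ᵥ (D * D.transpose).mulVec w := by
      intro κ' _ D
      rw [← mulVec_mulVec, dotProduct_mulVec w, ← mulVec_transpose]
    have e4 : C.transpose.mulVec w ⬝ᵥ C.transpose.mulVec w =
        A.transpose.mulVec w ⬝ᵥ A.transpose.mulVec w := by
      have e5 : A.transpose.mulVec w ⬝ᵥ A.transpose.mulVec w = w ⬝ᵥ (A * A.transpose).mulVec w := by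
        rw [← mulVec_mulVec, dotProduct_mulVec w, ← mulVec_transpose]
      rw [e3, e5, hCs, hCG]
    rw [e1, e2, map_dotProduct_gaussVec, map_dotProduct_gaussVec, e4]
  have hCinv : C⁻¹ * C = 1 := Matrix.nonsing_inv_mul _ (isUnit_iff_ne_zero.2 hCd)
  have hCis : C⁻¹.transpose = C⁻¹ := by rw [Matrix.transpose_nonsing_inv, hCs]
  have hq : ∀ v, C⁻¹.mulVec v ⬝ᵥ C⁻¹.mulVec v = v ⬝ᵥ (A * A.transpose)⁻¹.mulVec v := by
    intro v
    rw [← hCG, Matrix.mul_inv_rev, ← mulVec_mulVec, dotProduct_mulVec v, ← mulVec_transpose, hCis]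
  rw [← lintegral_map hF (measurable_mulVec A), hlaw, lintegral_map hF (measurable_mulVec C),
    lintegral_gaussVec (F := fun y => F (C.mulVec y)) (hF.comp (measurable_mulVec C))]
  have hg : Measurable fun v : τ → ℝ => ofReal (gaussDens (C⁻¹.mulVec v)) * F v :=
    ((continuous_gaussDens.measurable.comp (measurable_mulVec _)).ennreal_ofReal).mul hF
  have h := lintegral_comp_mulVec C hCd hg
  have hid : ∀ y, C⁻¹.mulVec (C.mulVec y) = y := fun y => by
    rw [mulVec_mulVec, hCinv, Matrix.one_mulVec]
  simp only [hid] at h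
  rw [h, ← lintegral_const_mul _ hg]
  refine lintegral_congr fun v => ?_
  rw [← mul_assoc, ← ofReal_mul (by positivity), gaussDens, hq, hCa]
  congr 2
  ring

/-! ### The limit of the Gaussian Kac–Rice integral. -/

/-- Coordinates `(Re u, Im u, Re w, Im w)` of a family of pairs of complex numbers. -/
def pairCoords {S : Type*} (y : S → ℂ × ℂ) : Fin 4 × S → ℝ :=
  fun i => ![(y i.2).1.re, (y i.2).1.im, (y i.2).2.re, (y i.2).2.im] i.1

theorem measurePreserving_pairCoords {S : Type*} [Fintype S] :
    MeasurePreserving (pairCoords : (S → ℂ × ℂ) → Fin 4 × S → ℝ) volume volume := by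
  have hm : Measurable (pairCoords : (S → ℂ × ℂ) → Fin 4 × S → ℝ) := by
    refine measurable_pi_iff.2 fun i => ?_
    obtain ⟨i, s⟩ := i
    fin_cases i <;> simp only [pairCoords] <;> simp <;> fun_prop
  refine ⟨hm, ?_⟩
  symm
  refine Measure.pi_eq fun s hs => ?_
  rw [Measure.map_apply hm (MeasurableSet.univ_pi hs)]
  have hc : ∀ a b : Set ℝ, MeasurableSet a → MeasurableSet b →
      volume {z : ℂ | z.re ∈ a ∧ z.im ∈ b} = volume a * volume b := by
    intro a b ha hb
    have := Complex.volume_preserving_equiv_real_prod.measure_preimage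
      (ha.prod hb).nullMeasurableSet
    rw [Measure.volume_eq_prod, Measure.prod_prod] at this
    rw [← this]
    rfl
  have hpre : pairCoords ⁻¹' (Set.univ.pi s) = Set.univ.pi (fun j : S =>
      {z : ℂ | z.re ∈ s (0, j) ∧ z.im ∈ s (1, j)} ×ˢ {z : ℂ | z.re ∈ s (2, j) ∧ z.im ∈ s (3, j)}) := by
    ext y
    simp only [Set.mem_preimage, Set.mem_pi, Set.mem_univ, true_implies, Prod.forall, Set.mem_prod,
      Set.mem_ofPred_eq, pairCoords]
    constructor
    · intro h j
      exact ⟨⟨h 0 j, h 1 j⟩, ⟨h 2 j, h 3 j⟩⟩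
    · intro h i j
      fin_cases i
      · exact (h j).1.1
      · exact (h j).1.2
      · exact (h j).2.1
      · exact (h j).2.2
  rw [hpre, volume_pi_pi, Fintype.prod_prod_type_right]
  refine prod_congr rfl fun j _ => ?_
  rw [Measure.volume_eq_prod, Measure.prod_prod, hc _ _ (hs _) (hs _), hc _ _ (hs _) (hs _)]
  simp only [Fin.prod_univ_four]
  ring

/-- The unit-scale Kac–Rice integrand `∏ |w|² 1_{|u| < 1} / π`. -/
def unitKernel {S : Type*} [Fintype S] (v : Fin 4 × S → ℝ) : ℝ :=
  ∏ s, ((v (2, s) ^ 2 + v (3, s) ^ 2) * if v (0, s) ^ 2 + v (1, s) ^ 2 < 1 then π⁻¹ else 0)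

theorem unitKernel_nonneg {S : Type*} [Fintype S] (v : Fin 4 × S → ℝ) : 0 ≤ unitKernel v :=
  prod_nonneg fun s _ => mul_nonneg (by positivity) (by split_ifs; exacts [by positivity, le_rfl])

theorem measurable_unitKernel {S : Type*} [Fintype S] :
    Measurable (unitKernel : (Fin 4 × S → ℝ) → ℝ) := by
  unfold unitKernel
  refine measurable_fun_prod _ fun s _ => Measurable.mul (by fun_prop) ?_
  exact Measurable.ite (measurableSet_lt (by fun_prop) measurable_const) measurable_const
    measurable_const

theorem integral_sq_norm_mul_exp {α : ℝ} (hα : 0 < α) :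
    ∫ w : ℂ, ‖w‖ ^ 2 * Real.exp (-α * ‖w‖ ^ 2) = π / α ^ 2 := by
  have h := Complex.integral_rpow_mul_exp_neg_mul_rpow (p := 2) (q := 2) (b := α) (by norm_num)
    (by norm_num) hα
  simp only [Real.rpow_two] at h
  rw [h]
  norm_num
  rfl

/-- The integrand factorises over `S`. For each index the value `u` integrates to one over the unit
disc, and the derivative `w` contributes the second moment `π / α²` of a Gaussian weight. -/
theorem lintegral_unitKernel_exp {S : Type*} [Fintype S] {α : ℝ} (hα : 0 < α) :
    ∫⁻ v : Fin 4 × S → ℝ, ofReal (unitKernel v *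
      Real.exp (-α * ∑ s, (v (2, s) ^ 2 + v (3, s) ^ 2))) =
      ofReal ((π / α ^ 2) ^ card S) := by
  set k₁ : ℂ → ℝ := (Metric.ball 0 1).indicator fun _ => π⁻¹ with hk₁
  set k₂ : ℂ → ℝ := fun w => ‖w‖ ^ 2 * Real.exp (-α * ‖w‖ ^ 2) with hk₂
  have hk₁i : Integrable k₁ := by
    rw [hk₁, integrable_indicator_iff measurableSet_ball]
    exact integrableOn_const (by rw [volume_ball_complex one_pos]; simp)
  have hk₂i : Integrable k₂ := by
    by_contra hcon
    have := integral_undef hcon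
    rw [hk₂, integral_sq_norm_mul_exp hα] at this
    have : 0 < π / α ^ 2 := by positivity
    linarith
  have hk₁int : ∫ u, k₁ u = 1 := by
    rw [hk₁, integral_indicator measurableSet_ball, setIntegral_const, Measure.real,
      volume_ball_complex one_pos, toReal_ofReal (by positivity)]
    simp [Real.pi_ne_zero]
  have hk0 : ∀ y : ℂ × ℂ, 0 ≤ k₁ y.1 * k₂ y.2 := fun y =>
    mul_nonneg (Set.indicator_nonneg (fun _ _ => by positivity) _) (by simp only [hk₂]; positivity)
  have hki : Integrable (fun y : ℂ × ℂ => k₁ y.1 * k₂ y.2) := hk₁i.mul_prod hk₂i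
  have hmeas : Measurable fun v : Fin 4 × S → ℝ => ofReal (unitKernel v *
      Real.exp (-α * ∑ s, (v (2, s) ^ 2 + v (3, s) ^ 2))) :=
    (measurable_unitKernel.mul (by fun_prop)).ennreal_ofReal
  rw [← measurePreserving_pairCoords.lintegral_comp hmeas]
  have hpt : ∀ y : S → ℂ × ℂ, unitKernel (pairCoords y) * Real.exp (-α * ∑ s,
      (pairCoords y (2, s) ^ 2 + pairCoords y (3, s) ^ 2)) = ∏ s, (k₁ (y s).1 * k₂ (y s).2) := by
    intro y
    rw [unitKernel, mul_sum, Real.exp_sum, ← prod_mul_distrib]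
    refine prod_congr rfl fun s _ => ?_
    have hn : ∀ z : ℂ, z.re ^ 2 + z.im ^ 2 = ‖z‖ ^ 2 := fun z => by
      rw [← normSq_eq_norm_sq, normSq_apply]; ring
    have e0 : pairCoords y (0, s) = (y s).1.re := rfl
    have e1 : pairCoords y (1, s) = (y s).1.im := rfl
    have e2 : pairCoords y (2, s) = (y s).2.re := rfl
    have e3 : pairCoords y (3, s) = (y s).2.im := rfl
    rw [e0, e1, e2, e3, hn, hn]
    have hk₁' : k₁ (y s).1 = if ‖(y s).1‖ < 1 then π⁻¹ else 0 := by
      rw [hk₁]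
      split_ifs with h
      · exact indicator_of_mem (by simpa using h) _
      · exact indicator_of_notMem (by simpa using h) _
    rw [hk₁']
    simp only [hk₂]
    have : ‖(y s).1‖ ^ 2 < 1 ↔ ‖(y s).1‖ < 1 := by
      rw [sq_lt_one_iff₀ (norm_nonneg _)]
    simp only [this]
    ring
  simp_rw [hpt]
  rw [lintegral_fintype_prod_ofReal (fun (_ : S) (y : ℂ × ℂ) => k₁ y.1 * k₂ y.2)
    (fun _ => hk0) (fun _ => hki), prod_const, card_univ,
    ← ofReal_integral_eq_lintegral_ofReal hki (Eventually.of_forall hk0),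
    ← ofReal_pow (integral_nonneg hk0)]
  congr 2
  rw [Measure.volume_eq_prod, integral_prod_mul, hk₁int, one_mul, integral_sq_norm_mul_exp hα]

/-- The limiting covariance block of `(f(z), z f'(z))`, suitably normalised. -/
def covBlock : Matrix (Fin 4) (Fin 4) ℝ :=
  !![1/2, 0, 1/4, 0; 0, 1/2, 0, 1/4; 1/4, 0, 1/6, 0; 0, 1/4, 0, 1/6]

/-- The entry `24` is the inverse of the conditional variance `1/6 - (1/4)² / (1/2)` of a coordinate
of `w` given `u = 0`. -/
def covBlockInv : Matrix (Fin 4) (Fin 4) ℝ :=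
  !![8, 0, -12, 0; 0, 8, 0, -12; -12, 0, 24, 0; 0, -12, 0, 24]

theorem covBlock_mul_inv : covBlock * covBlockInv = 1 := by
  ext i j
  fin_cases i <;> fin_cases j <;>
    simp [covBlock, covBlockInv, Matrix.mul_apply, Fin.sum_univ_four] <;> norm_num

theorem det_covBlock : covBlock.det = (1 / 48) ^ 2 := by
  rw [covBlock, Matrix.det_succ_row_zero]
  simp [Matrix.det_succ_row_zero, Fin.sum_univ_succ, Fin.succAbove]
  norm_num

/-- The limiting covariance matrix. -/
def covLimit (S : Type*) [DecidableEq S] : Matrix (Fin 4 × S) (Fin 4 × S) ℝ :=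
  Matrix.blockDiagonal fun _ => covBlock

theorem det_covLimit (S : Type*) [DecidableEq S] [Fintype S] :
    (covLimit S).det = ((1 / 48) ^ 2) ^ card S := by
  rw [covLimit, Matrix.det_blockDiagonal, det_covBlock, prod_const, card_univ]

theorem inv_covLimit (S : Type*) [DecidableEq S] [Fintype S] :
    (covLimit S)⁻¹ = Matrix.blockDiagonal fun _ => covBlockInv := by
  refine Matrix.inv_eq_right_inv ?_
  rw [covLimit, ← Matrix.blockDiagonal_mul]
  simp_rw [covBlock_mul_inv]
  exact Matrix.blockDiagonal_one

/-- The Kac–Rice integrand `∏ |w|² 1_{|u| < ε} / (π ε²)`. -/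
def scaledKernel {S : Type*} [Fintype S] (ε : ℝ) (v : Fin 4 × S → ℝ) : ℝ :=
  ∏ s, ((v (2, s) ^ 2 + v (3, s) ^ 2) *
    if v (0, s) ^ 2 + v (1, s) ^ 2 < ε ^ 2 then (π * ε ^ 2)⁻¹ else 0)

theorem measurable_scaledKernel {S : Type*} [Fintype S] (ε : ℝ) :
    Measurable (scaledKernel ε : (Fin 4 × S → ℝ) → ℝ) := by
  unfold scaledKernel
  refine measurable_fun_prod _ fun s _ => Measurable.mul (by fun_prop) ?_
  exact Measurable.ite (measurableSet_lt (by fun_prop) measurable_const) measurable_const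
    measurable_const

/-- For a symmetric square root `C` of `G` and `v = C y`, Cauchy–Schwarz bounds `|C y|²` by the
squared Hilbert–Schmidt norm of `C`, which is the trace of `G`, times `|y|²`. It supplies a Gaussian
dominating function that only depends on a bound for the trace. -/
theorem dotProduct_self_le_trace_mul {τ : Type*} [Fintype τ] [DecidableEq τ] {G : Matrix τ τ ℝ}
    (hG : G.PosDef) (v : τ → ℝ) : v ⬝ᵥ v ≤ G.trace * (v ⬝ᵥ G⁻¹.mulVec v) := by
  obtain ⟨C, hCs, hCG, hCd, hCa⟩ := exists_symm_sqrt_of_posDef hG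
  have hCinv : C * C⁻¹ = 1 := Matrix.mul_nonsing_inv _ (isUnit_iff_ne_zero.2 hCd)
  have hCis : C⁻¹.transpose = C⁻¹ := by rw [Matrix.transpose_nonsing_inv, hCs]
  set y := C⁻¹.mulVec v with hy
  have hv : v = C.mulVec y := by rw [hy, mulVec_mulVec, hCinv, Matrix.one_mulVec]
  have hq : v ⬝ᵥ G⁻¹.mulVec v = y ⬝ᵥ y := by
    rw [← hCG, Matrix.mul_inv_rev, ← mulVec_mulVec, dotProduct_mulVec v, ← mulVec_transpose, hCis]
  have htr : G.trace = ∑ i, ∑ j, C i j ^ 2 := by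
    rw [← hCG]
    simp only [Matrix.trace, Matrix.diag, Matrix.mul_apply]
    refine sum_congr rfl fun i _ => sum_congr rfl fun j _ => ?_
    rw [sq]
    congr 1
    exact congrFun (congrFun hCs i) j
  rw [hq, htr, sum_mul, hv]
  refine sum_le_sum fun i _ => ?_
  simp only [mulVec, dotProduct, ← sq]
  exact Finset.sum_mul_sq_le_sq_mul_sq _ _ _

theorem tendsto_matrix_inv {τ : Type*} [Fintype τ] [DecidableEq τ] {l : Filter ℕ}
    {G : ℕ → Matrix τ τ ℝ} {G₀ : Matrix τ τ ℝ} (hG : Tendsto G l (𝓝 G₀)) (h0 : G₀.det ≠ 0) :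
    Tendsto (fun n => (G n)⁻¹) l (𝓝 G₀⁻¹) := by
  simp only [Matrix.inv_def, Ring.inverse_eq_inv']
  have h1 : Tendsto (fun n => (G n).det) l (𝓝 G₀.det) :=
    ((continuous_id.matrix_det).tendsto G₀).comp hG
  have h2 : Tendsto (fun n => (G n).adjugate) l (𝓝 G₀.adjugate) :=
    ((continuous_id.matrix_adjugate).tendsto G₀).comp hG
  exact (h1.inv₀ h0).smul h2

/-- The limit of Kac–Rice expectations, for Gaussian vectors whose covariance matrices converge
to `covLimit`. -/
theorem tendsto_lintegral_scaledKernel {S : Type*} [Fintype S] [DecidableEq S] {κ : ℕ → Type*}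
    [∀ n, Fintype (κ n)] (A : ∀ n : ℕ, Matrix (Fin 4 × S) (κ n) ℝ)
    (hG : Tendsto (fun n => A n * (A n).transpose) atTop (𝓝 (covLimit S)))
    {ε : ℕ → ℝ} (hε : ∀ n, 0 < ε n) (hε0 : Tendsto ε atTop (𝓝 0)) :
    Tendsto (fun n => ∫⁻ x, ofReal (scaledKernel (ε n) ((A n).mulVec x)) ∂gaussVec (κ n))
      atTop (𝓝 (ofReal ((1 / (12 * π)) ^ card S))) := by
  set G : ℕ → Matrix (Fin 4 × S) (Fin 4 × S) ℝ := fun n => A n * (A n).transpose with hGdef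
  have hdet0 : 0 < (covLimit S).det := by rw [det_covLimit]; positivity
  have hdet : Tendsto (fun n => (G n).det) atTop (𝓝 (covLimit S).det) :=
    ((continuous_id.matrix_det).tendsto _).comp hG
  have hinv := tendsto_matrix_inv hG hdet0.ne'
  have htr : Tendsto (fun n => (G n).trace) atTop (𝓝 (covLimit S).trace) :=
    ((continuous_id.matrix_trace).tendsto _).comp hG
  have hPD : ∀ᶠ n in atTop, (G n).PosDef := by
    filter_upwards [hdet.eventually (lt_mem_nhds hdet0)] with n hn
    have hps : (G n).PosSemidef := by
      have := Matrix.posSemidef_self_mul_conjTranspose (A n)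
      rwa [Matrix.conjTranspose_eq_transpose_of_trivial] at this
    exact (hps.posDef_iff_det_ne_zero).2 hn.ne'
  set c : ℕ → ℝ := fun n => (√(2 * π))⁻¹ ^ card (Fin 4 × S) * (√(G n).det)⁻¹ with hc
  set c₀ : ℝ := (√(2 * π))⁻¹ ^ card (Fin 4 × S) * (√(covLimit S).det)⁻¹ with hc₀
  have hclim : Tendsto c atTop (𝓝 c₀) :=
    tendsto_const_nhds.mul ((hdet.sqrt).inv₀ (Real.sqrt_pos.2 hdet0).ne')
  have hc0 : ∀ n, 0 ≤ c n := fun n => by simp only [hc]; positivity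
  -- Rescaling the value coordinates by `e` absorbs the singular factor `1 / e²` of the kernel. The
  -- parameter `ε n` then only enters the exponent, where it can be set to `0` in the limit.
  set T : ℝ → (Fin 4 × S → ℝ) → (Fin 4 × S → ℝ) :=
    fun e v i => ![e, e, 1, 1] i.1 * v i with hT
  have hTm : ∀ e v, (Matrix.diagonal fun i : Fin 4 × S => (![e, e, 1, 1] : Fin 4 → ℝ) i.1).mulVec v
      = T e v := by
    intro e v; ext i; rw [Matrix.mulVec_diagonal]
  have hTdet : ∀ e : ℝ, (Matrix.diagonal fun i : Fin 4 × S => (![e, e, 1, 1] : Fin 4 → ℝ) i.1).det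
      = (e ^ 2) ^ card S := by
    intro e
    rw [Matrix.det_diagonal, Fintype.prod_prod_type_right]
    simp [Fin.prod_univ_four, sq]
  have hker : ∀ e : ℝ, 0 < e → ∀ v : Fin 4 × S → ℝ,
      (e ^ 2) ^ card S * scaledKernel e (T e v) = unitKernel v := by
    intro e he v
    rw [scaledKernel, unitKernel, card, ← prod_const, ← prod_mul_distrib]
    refine prod_congr rfl fun s _ => ?_
    have e0 : T e v (0, s) = e * v (0, s) := rfl
    have e1 : T e v (1, s) = e * v (1, s) := rfl
    have e2 : T e v (2, s) = v (2, s) := by simp [hT]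
    have e3 : T e v (3, s) = v (3, s) := by simp [hT]
    rw [e0, e1, e2, e3]
    have : (e * v (0, s)) ^ 2 + (e * v (1, s)) ^ 2 < e ^ 2 ↔ v (0, s) ^ 2 + v (1, s) ^ 2 < 1 := by
      rw [show (e * v (0, s)) ^ 2 + (e * v (1, s)) ^ 2 =
        (v (0, s) ^ 2 + v (1, s) ^ 2) * e ^ 2 by ring]
      exact mul_lt_iff_lt_one_left (by positivity)
    simp only [this]
    split_ifs
    · field_simp
    · simp
  have hform : ∀ᶠ n in atTop, ∫⁻ x, ofReal (scaledKernel (ε n) ((A n).mulVec x)) ∂gaussVec (κ n) =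
      ∫⁻ v, ofReal (c n * Real.exp (-(T (ε n) v ⬝ᵥ (G n)⁻¹.mulVec (T (ε n) v)) / 2) *
        unitKernel v) := by
    filter_upwards [hPD] with n hn
    have hFm : Measurable fun v : Fin 4 × S → ℝ => ofReal (scaledKernel (ε n) v) :=
      (measurable_scaledKernel _).ennreal_ofReal
    rw [lintegral_gaussVec_comp_mulVec (A n) hn hFm]
    have hd0 : (Matrix.diagonal fun i : Fin 4 × S => (![ε n, ε n, 1, 1] : Fin 4 → ℝ) i.1).det ≠ 0 := by
      rw [hTdet]; have := hε n; positivity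
    have hg : Measurable fun v : Fin 4 × S → ℝ => ofReal
        ((√(2 * π))⁻¹ ^ card (Fin 4 × S) * (√(A n * (A n).transpose).det)⁻¹ *
        Real.exp (-(v ⬝ᵥ (A n * (A n).transpose)⁻¹.mulVec v) / 2)) *
        ofReal (scaledKernel (ε n) v) := by
      refine Measurable.mul ?_ hFm
      unfold mulVec dotProduct
      fun_prop
    have h := lintegral_comp_mulVec _ hd0 hg
    rw [hTdet] at h
    have hpos : 0 < (ε n ^ 2) ^ card S := by have := hε n; positivity
    rw [abs_of_pos hpos] at h
    have h2 := congrArg (fun r => ofReal ((ε n ^ 2) ^ card S) * r) h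
    rw [← mul_assoc, ← ofReal_mul hpos.le, mul_inv_cancel₀ hpos.ne', ofReal_one, one_mul] at h2
    rw [← h2, ← lintegral_const_mul' _ _ (by simp)]
    refine lintegral_congr fun v => ?_
    simp only [hTm]
    rw [← hker (ε n) (hε n) v, ← ofReal_mul (mul_nonneg (hc0 n) (Real.exp_pos _).le),
      ← ofReal_mul hpos.le]
    congr 1
    simp only [hc, hGdef]
    ring
  refine Tendsto.congr' (hform.mono fun n h => h.symm) ?_
  set K : ℝ := (covLimit S).trace + 1 with hK
  have hwT : ∀ e v, ∑ s, (v (2, s) ^ 2 + v (3, s) ^ 2) ≤ T e v ⬝ᵥ T e v := by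
    intro e v
    simp only [dotProduct, Fintype.sum_prod_type_right, Fin.sum_univ_four]
    refine sum_le_sum fun s _ => ?_
    have e2 : T e v (2, s) = v (2, s) := by simp [hT]
    have e3 : T e v (3, s) = v (3, s) := by simp [hT]
    rw [e2, e3]
    nlinarith [mul_self_nonneg (T e v (0, s)), mul_self_nonneg (T e v (1, s))]
  have hK0 : 0 < K := by
    have : 0 ≤ (covLimit S).trace := by
      refine ge_of_tendsto' htr fun n => ?_
      simp only [hGdef, Matrix.trace, Matrix.diag, Matrix.mul_apply, Matrix.transpose_apply]
      exact sum_nonneg fun i _ => sum_nonneg fun j _ => mul_self_nonneg _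
    linarith
  -- With the values set to `0`, the exponent is `-24 |w|² / 2 = -12 |w|²`. Each index contributes
  -- `48 / (2π)²` from the normalisation and `π / 144` from the integral, hence `1 / (12 π)`.
  have hlimval : ∫⁻ v : Fin 4 × S → ℝ, ofReal (c₀ * Real.exp (-(T 0 v ⬝ᵥ
      (covLimit S)⁻¹.mulVec (T 0 v)) / 2) * unitKernel v) =
      ofReal ((1 / (12 * π)) ^ card S) := by
    have hc₀0 : 0 ≤ c₀ := by simp only [hc₀]; positivity
    have h1 : ∀ v : Fin 4 × S → ℝ, T 0 v ⬝ᵥ (covLimit S)⁻¹.mulVec (T 0 v) =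
        24 * ∑ s, (v (2, s) ^ 2 + v (3, s) ^ 2) := by
      intro v
      rw [inv_covLimit]
      have hmv : ∀ i s, (Matrix.blockDiagonal fun _ : S => covBlockInv).mulVec (T 0 v) (i, s) =
          ∑ j, covBlockInv i j * T 0 v (j, s) := by
        intro i s
        rw [mulVec, dotProduct, Fintype.sum_prod_type]
        refine sum_congr rfl fun j _ => ?_
        simp [Matrix.blockDiagonal_apply]
      simp only [dotProduct, Fintype.sum_prod_type_right, Fin.sum_univ_four, hmv, mul_sum]
      refine sum_congr rfl fun s _ => ?_
      simp [hT, covBlockInv]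
      ring
    have h2 : ∀ v : Fin 4 × S → ℝ, ofReal (c₀ * Real.exp (-(T 0 v ⬝ᵥ
      (covLimit S)⁻¹.mulVec (T 0 v)) / 2) * unitKernel v) = ofReal c₀ * ofReal
        (unitKernel v * Real.exp (-12 * ∑ s, (v (2, s) ^ 2 + v (3, s) ^ 2))) := by
      intro v
      rw [← ofReal_mul hc₀0, h1]
      congr 1
      rw [mul_assoc, mul_comm (Real.exp _)]
      congr 3
      ring
    simp_rw [h2]
    rw [lintegral_const_mul' _ _ (by simp), lintegral_unitKernel_exp (by norm_num),
      ← ofReal_mul hc₀0]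
    congr 1
    simp only [hc₀, det_covLimit]
    rw [← pow_mul, mul_comm 2 (card S), pow_mul, Real.sqrt_sq (by positivity), Fintype.card_prod,
      Fintype.card_fin, pow_mul, ← inv_pow, ← mul_pow, ← mul_pow]
    congr 1
    have : (√(2 * π))⁻¹ ^ 4 = (2 * π)⁻¹ ^ 2 := by
      rw [show (4 : ℕ) = 2 * 2 from rfl, pow_mul, inv_pow, sq_sqrt (by positivity)]
    rw [this]
    have := pi_pos
    field_simp
    norm_num
  rw [← hlimval]
  -- The traces are eventually below `K`, so the quadratic form is at least `|w|² / K`. No decay in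
  -- `u` is needed because the kernel confines `u` to the unit disc.
  refine tendsto_lintegral_filter_of_dominated_convergence
    (fun v => ofReal (c₀ + 1) * ofReal (unitKernel v *
      Real.exp (-(1 / (2 * K)) * ∑ s, (v (2, s) ^ 2 + v (3, s) ^ 2)))) ?_ ?_ ?_ ?_
  · refine Eventually.of_forall fun n => Measurable.ennreal_ofReal ?_
    refine Measurable.mul ?_ measurable_unitKernel
    simp only [hT]
    unfold mulVec dotProduct
    fun_prop
  · filter_upwards [hPD, htr.eventually (gt_mem_nhds (show (covLimit S).trace < K by linarith)),
      hclim.eventually (gt_mem_nhds (show c₀ < c₀ + 1 by linarith))] with n hn htn hcn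
    refine Eventually.of_forall fun v => ?_
    rw [← ofReal_mul (by linarith [hc0 n])]
    refine ofReal_le_ofReal ?_
    rw [mul_assoc, mul_comm (Real.exp _)]
    refine mul_le_mul hcn.le (mul_le_mul_of_nonneg_left (Real.exp_le_exp.2 ?_)
      (unitKernel_nonneg v)) (mul_nonneg (unitKernel_nonneg v) (Real.exp_pos _).le)
      (by linarith [hc0 n])
    have h1 := dotProduct_self_le_trace_mul hn (T (ε n) v)
    have h2 := hwT (ε n) v
    have h3 : 0 ≤ T (ε n) v ⬝ᵥ (G n)⁻¹.mulVec (T (ε n) v) := by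
      have := hn.inv.posSemidef.dotProduct_mulVec_nonneg (T (ε n) v)
      simpa using this
    have h4 : ∑ s, (v (2, s) ^ 2 + v (3, s) ^ 2) ≤ K * (T (ε n) v ⬝ᵥ (G n)⁻¹.mulVec (T (ε n) v)) := by
      refine h2.trans (h1.trans ?_)
      gcongr
    have h5 : (1 / K) * ∑ s, (v (2, s) ^ 2 + v (3, s) ^ 2) ≤
        T (ε n) v ⬝ᵥ (G n)⁻¹.mulVec (T (ε n) v) := by
      rw [one_div, inv_mul_le_iff₀ hK0]; exact h4
    have h6 : (1 / (2 * K)) = (1 / K) / 2 := by field_simp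
    rw [h6]
    linarith
  · rw [lintegral_const_mul' _ _ (by simp), lintegral_unitKernel_exp (by positivity)]
    exact ENNReal.mul_ne_top (by simp) (by simp)
  · refine Eventually.of_forall fun v => ?_
    refine (ENNReal.continuous_ofReal.tendsto _).comp ?_
    refine Tendsto.mul (hclim.mul ?_) tendsto_const_nhds
    refine (Real.continuous_exp.tendsto _).comp ?_
    have hTt : Tendsto (fun n => T (ε n) v) atTop (𝓝 (T 0 v)) := by
      refine tendsto_pi_nhds.2 fun i => ?_
      obtain ⟨i, s⟩ := i
      simp only [hT]
      refine Tendsto.mul_const _ ?_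
      fin_cases i
      · simpa using hε0
      · simpa using hε0
      · simp
      · simp
    refine Tendsto.div_const (Tendsto.neg ?_) _
    simp only [dotProduct, mulVec]
    refine tendsto_finsetSum _ fun i _ => (tendsto_pi_nhds.1 hTt i).mul ?_
    refine tendsto_finsetSum _ fun j _ => Tendsto.mul ?_ (tendsto_pi_nhds.1 hTt j)
    exact tendsto_pi_nhds.1 (tendsto_pi_nhds.1 hinv i) j

/-! ### Exponential sums and lower bounds for quadratic forms of powers. -/

/-- Summation by parts bound for exponential sums with slowly varying coefficients. -/
theorem norm_sum_mul_pow_le {n : ℕ} {d : ℕ → ℂ} {q : ℂ} {D V κ : ℝ} (hκ : 0 < κ)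
    (hD : ∀ k ≤ n, ‖d k‖ ≤ D) (hV : ∑ k ∈ range n, ‖d (k + 1) - d k‖ ≤ V)
    (hq : ∀ k ≤ n + 1, ‖q‖ ^ k ≤ 4) (hqκ : κ ≤ ‖1 - q‖) :
    ‖∑ k ∈ range (n + 1), d k * q ^ k‖ ≤ (5 * D + 4 * V) / κ := by
  -- Abel summation. The two boundary terms contribute `D` and `4 D`, the variation contributes `4
  -- V`.
  have key : ∀ m : ℕ, (1 - q) * ∑ k ∈ range (m + 1), d k * q ^ k =
      d 0 + ∑ k ∈ range m, (d (k + 1) - d k) * q ^ (k + 1) - d m * q ^ (m + 1) := by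
    intro m
    induction m with
    | zero => simp; ring
    | succ m ih =>
      rw [Finset.sum_range_succ, mul_add, ih, Finset.sum_range_succ]
      ring
  have h1 : ‖(1 - q) * ∑ k ∈ range (n + 1), d k * q ^ k‖ ≤ 5 * D + 4 * V := by
    rw [key]
    have hs : ‖∑ k ∈ range n, (d (k + 1) - d k) * q ^ (k + 1)‖ ≤ 4 * V := by
      refine (norm_sum_le _ _).trans ?_
      refine le_trans (sum_le_sum (g := fun k => 4 * ‖d (k + 1) - d k‖) fun k hk => ?_) ?_
      · rw [norm_mul, norm_pow, mul_comm]
        have := hq (k + 1) (by have := mem_range.1 hk; omega)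
        gcongr
      · rw [← mul_sum]; gcongr
    have hn : ‖d n * q ^ (n + 1)‖ ≤ D * 4 := by
      rw [norm_mul, norm_pow]
      have h4 := hq (n + 1) le_rfl
      have hd := hD n le_rfl
      have := norm_nonneg (d n)
      gcongr
      linarith
    calc _ ≤ ‖d 0‖ + ‖∑ k ∈ range n, (d (k + 1) - d k) * q ^ (k + 1)‖
          + ‖d n * q ^ (n + 1)‖ := (norm_sub_le _ _).trans (by gcongr; exact norm_add_le _ _)
      _ ≤ D + 4 * V + D * 4 := by gcongr; exact hD 0 (Nat.zero_le _)
      _ = _ := by ring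
  rw [norm_mul] at h1
  rw [le_div_iff₀ hκ]
  nlinarith [norm_nonneg (∑ k ∈ range (n + 1), d k * q ^ k)]

theorem norm_pow_sub_one_le {p : ℂ} {n : ℕ} (hp : ∀ k ≤ n, ‖p‖ ^ k ≤ 4) :
    ∀ k ≤ n + 1, ‖p ^ k - 1‖ ≤ 4 * k * ‖p - 1‖ := by
  intro k hk
  rw [← geom_sum_mul, norm_mul]
  gcongr
  refine (norm_sum_le _ _).trans ((sum_le_card_nsmul _ _ 4 fun i hi => ?_).trans (le_of_eq ?_))
  · rw [norm_pow]; exact hp i (by have := mem_range.1 hi; omega)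
  · simp [mul_comm]

/-- Some power of `p` up to `n / 2` is quantitatively away from one. -/
theorem exists_pow_sub_one_ge {p : ℂ} {n : ℕ} (hn : 2 ≤ n) (hp : ∀ k ≤ n, ‖p‖ ^ k ≤ 4) :
    ∃ j, 1 ≤ j ∧ 2 * j ≤ n ∧ 1 / 32 * min 1 (n * ‖p - 1‖) ≤ ‖p ^ j - 1‖ := by
  set h := ‖p - 1‖ with hh
  have h0 : 0 ≤ h := norm_nonneg _
  by_cases h8 : 1 / 8 ≤ h
  · refine ⟨1, le_rfl, by omega, ?_⟩
    rw [pow_one, ← hh]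
    linarith [min_le_left (1 : ℝ) (n * h)]
  push Not at h8
  rcases h0.eq_or_lt with hz | hpos
  · refine ⟨1, le_rfl, by omega, ?_⟩
    rw [← hz]; simp
  -- The largest exponent with `j h ≤ 1/8`, up to `n / 2`: the summands of `1 + p + ... + p ^ (j -
  -- 1)` are still within `1/2` of one, so `|p ^ j - 1|` is at least `j h / 2`.
  set j := min (n / 2) ⌊1 / (8 * h)⌋₊ with hj
  have hge1 : 1 ≤ 1 / (8 * h) := by rw [le_div_iff₀ (by positivity)]; linarith
  have hfl1 : 1 ≤ ⌊1 / (8 * h)⌋₊ := Nat.le_floor (by simpa using hge1)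
  have hj1 : 1 ≤ j := le_min (by omega) hfl1
  have hjn : 2 * j ≤ n := by have := min_le_left (n / 2) ⌊1 / (8 * h)⌋₊; omega
  have hjh : (j : ℝ) * h ≤ 1 / 8 := by
    have h1 : (j : ℝ) ≤ 1 / (8 * h) :=
      (Nat.cast_le.2 (min_le_right _ _)).trans (Nat.floor_le (by positivity))
    calc (j : ℝ) * h ≤ 1 / (8 * h) * h := by gcongr
      _ = 1 / 8 := by field_simp
  have hjlow : 1 / 16 * min 1 (n * h) ≤ j * h := by
    rcases min_choice (n / 2) ⌊1 / (8 * h)⌋₊ with hc | hc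
    · have hjc : j = n / 2 := hc
      have : (n : ℝ) ≤ 3 * j := by
        have : n ≤ 3 * j := by omega
        exact_mod_cast this
      have h2 := min_le_right (1 : ℝ) (n * h)
      nlinarith
    · have hjc : j = ⌊1 / (8 * h)⌋₊ := hc
      have h1 : 1 / (8 * h) < j + 1 := by rw [hjc]; exact Nat.lt_floor_add_one _
      have h2 : (1 : ℝ) ≤ j := by exact_mod_cast hj1
      have h3 : 1 / (8 * h) * h = 1 / 8 := by field_simp
      have h4 : 1 / (8 * h) * h < (j + 1) * h := by gcongr
      have := min_le_left (1 : ℝ) (n * h)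
      nlinarith
  refine ⟨j, hj1, hjn, ?_⟩
  rw [← geom_sum_mul, norm_mul, ← hh]
  have hsum : (j : ℝ) / 2 ≤ ‖∑ i ∈ range j, p ^ i‖ := by
    have h1 : ‖∑ i ∈ range j, (p ^ i - 1)‖ ≤ j * (4 * j * h) := by
      refine (norm_sum_le _ _).trans ((sum_le_card_nsmul _ _ (4 * j * h) fun i hi => ?_).trans
        (le_of_eq ?_))
      · have hi' := mem_range.1 hi
        refine (norm_pow_sub_one_le hp i (by omega)).trans ?_
        gcongr
      · simp
    rw [sum_sub_distrib] at h1
    simp only [sum_const, card_range, nsmul_eq_mul, mul_one] at h1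
    have h2 : ‖(j : ℂ)‖ ≤ ‖∑ i ∈ range j, p ^ i‖ + ‖∑ i ∈ range j, p ^ i - (j : ℂ)‖ := by
      rw [norm_sub_rev]
      simpa using norm_add_le (∑ i ∈ range j, p ^ i) ((j : ℂ) - ∑ i ∈ range j, p ^ i)
    rw [norm_natCast] at h2
    have : (j : ℝ) * (4 * j * h) ≤ j / 2 := by nlinarith [Nat.cast_nonneg (α := ℝ) j]
    linarith
  nlinarith

/-- Lower bound for the quadratic form of two exponentials with ratio `p`. -/
theorem sum_sq_norm_add_mul_pow_ge {p : ℂ} {n : ℕ} (hn : 2 ≤ n)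
    (hp : ∀ k ≤ n, ‖p‖ ^ k ≤ 4) (hp' : ∀ k ≤ n, 1 / 4 ≤ ‖p‖ ^ k) (α β : ℂ) :
    1 / 10 ^ 8 * n * (‖α + β‖ ^ 2 + (min 1 (n * ‖p - 1‖)) ^ 2 * ‖β‖ ^ 2) ≤
      ∑ k ∈ range (n + 1), ‖α + β * p ^ k‖ ^ 2 := by
  set m := min 1 (n * ‖p - 1‖) with hm
  have hm0 : 0 ≤ m := le_min zero_le_one (by positivity)
  set g : ℕ → ℂ := fun k => α + β * p ^ k with hg
  set Q := ∑ k ∈ range (n + 1), ‖g k‖ ^ 2 with hQ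
  obtain ⟨j, hj1, hjn, hj⟩ := exists_pow_sub_one_ge hn hp
  have hn0 : (2 : ℝ) ≤ n := by exact_mod_cast hn
  -- The difference `g (k + j) - g k = β p ^ k (p ^ j - 1)` eliminates `α`, and at least `n / 2`
  -- indices `k` are available. Here `131072 = 8 * 128²` and `1/128 = 1/4 * 1/32`.
  have hβ : n * (m ^ 2 * ‖β‖ ^ 2) ≤ 131072 * Q := by
    have h1 : ∀ k ∈ range (n + 1 - j), 1 / 16384 * (m ^ 2 * ‖β‖ ^ 2) ≤
        2 * ‖g (k + j)‖ ^ 2 + 2 * ‖g k‖ ^ 2 := by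
      intro k hk
      have hk' := mem_range.1 hk
      have e : g (k + j) - g k = β * p ^ k * (p ^ j - 1) := by simp only [hg]; ring
      have e1 : ‖β‖ * (1 / 4) * (1 / 32 * m) ≤ ‖g (k + j) - g k‖ := by
        rw [e, norm_mul, norm_mul, norm_pow]
        have := hp' k (by omega)
        gcongr
      have e2 := e1.trans (norm_sub_le (g (k + j)) (g k))
      have e3 : 0 ≤ ‖β‖ * (1 / 4) * (1 / 32 * m) := by positivity
      nlinarith [sq_nonneg (‖g (k + j)‖ - ‖g k‖), mul_self_le_mul_self e3 e2]
    have h2 := sum_le_sum h1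
    rw [sum_const, card_range, nsmul_eq_mul, sum_add_distrib, ← mul_sum, ← mul_sum] at h2
    have h3 : ∑ k ∈ range (n + 1 - j), ‖g k‖ ^ 2 ≤ Q :=
      Finset.sum_le_sum_of_subset_of_nonneg (Finset.range_mono (by omega)) fun _ _ _ => by positivity
    have h4 : ∑ k ∈ range (n + 1 - j), ‖g (k + j)‖ ^ 2 ≤ Q := by
      rw [hQ, ← Finset.sum_image (f := fun k => ‖g k‖ ^ 2) (g := fun k => k + j)
        (fun a _ b _ hab => by simpa using hab)]
      refine Finset.sum_le_sum_of_subset_of_nonneg ?_ fun _ _ _ => by positivity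
      intro x hx
      obtain ⟨y, hy, rfl⟩ := mem_image.1 hx
      have := mem_range.1 hy
      exact mem_range.2 (by omega)
    have h5 : (n : ℝ) / 2 ≤ ((n + 1 - j : ℕ) : ℝ) := by
      rw [div_le_iff₀ (by norm_num)]
      have : n ≤ (n + 1 - j) * 2 := by omega
      exact_mod_cast this
    have h6 : 0 ≤ 1 / 16384 * (m ^ 2 * ‖β‖ ^ 2) := by positivity
    nlinarith [mul_le_mul_of_nonneg_right h5 h6]
  have hpm : ∀ k ≤ n, ‖p ^ k - 1‖ ≤ 5 * m := by
    intro k hk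
    rcases min_choice 1 (n * ‖p - 1‖) with hc | hc
    · have hm1 : m = 1 := hc
      rw [hm1]
      refine (norm_sub_le _ _).trans ?_
      rw [norm_pow, norm_one]
      linarith [hp k hk]
    · have hm1 : m = n * ‖p - 1‖ := hc
      rw [hm1]
      refine (norm_pow_sub_one_le hp k (by omega)).trans ?_
      have : (k : ℝ) ≤ n := by exact_mod_cast hk
      nlinarith [norm_nonneg (p - 1), mul_le_mul_of_nonneg_right this (norm_nonneg (p - 1))]
  -- `α + β` differs from each `g k` by `β (p ^ k - 1) = O(m |β|)`, which has just been controlled.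
  have hα : n * ‖α + β‖ ^ 2 ≤ 2 * Q + 100 * (131072 * Q) := by
    have h1 : ∀ k ∈ range (n + 1), ‖α + β‖ ^ 2 ≤ 2 * ‖g k‖ ^ 2 + 50 * (m ^ 2 * ‖β‖ ^ 2) := by
      intro k hk
      have hk' := mem_range.1 hk
      have e : α + β = g k - β * (p ^ k - 1) := by simp only [hg]; ring
      have e1 : ‖α + β‖ ≤ ‖g k‖ + ‖β‖ * (5 * m) := by
        rw [e]
        refine (norm_sub_le _ _).trans ?_
        rw [norm_mul]
        have := hpm k (by omega)
        gcongr
      nlinarith [norm_nonneg (α + β), sq_nonneg (‖g k‖ - ‖β‖ * (5 * m))]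
    have h2 := sum_le_sum h1
    rw [sum_const, card_range, nsmul_eq_mul, sum_add_distrib, ← mul_sum,
      sum_const, card_range, nsmul_eq_mul] at h2
    push_cast at h2
    have h6 : 0 ≤ m ^ 2 * ‖β‖ ^ 2 := by positivity
    nlinarith [sq_nonneg ‖α + β‖]
  have hQ0 : 0 ≤ Q := sum_nonneg fun _ _ => by positivity
  have : n * (‖α + β‖ ^ 2 + m ^ 2 * ‖β‖ ^ 2) ≤ 10 ^ 8 * Q := by nlinarith
  calc _ = 1 / 10 ^ 8 * (n * (‖α + β‖ ^ 2 + m ^ 2 * ‖β‖ ^ 2)) := by ring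
    _ ≤ 1 / 10 ^ 8 * (10 ^ 8 * Q) := by gcongr
    _ = Q := by ring

/-- The points whose first powers have modulus in `[1/2, 2]`. -/
def NearCircle (n : ℕ) (z : ℂ) : Prop := ∀ k ≤ n + 1, ‖z‖ ^ k ≤ 2 ∧ 1 / 2 ≤ ‖z‖ ^ k

theorem NearCircle.ne_zero {n : ℕ} {z : ℂ} (h : NearCircle n z) : z ≠ 0 := by
  rintro rfl
  have := (h 1 (by omega)).2
  norm_num at this

theorem NearCircle.conj {n : ℕ} {z : ℂ} (h : NearCircle n z) : NearCircle n (starRingEnd ℂ z) := by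
  intro k hk; rw [RCLike.norm_conj]; exact h k hk

theorem NearCircle.mul_le {n : ℕ} {z w : ℂ} (hz : NearCircle n z) (hw : NearCircle n w) :
    ∀ k ≤ n + 1, ‖z * w‖ ^ k ≤ 4 := by
  intro k hk
  rw [norm_mul, mul_pow]
  have h1 := (hz k hk).1
  have h2 := (hw k hk).1
  have : 0 ≤ ‖w‖ ^ k := by positivity
  have : 0 ≤ ‖z‖ ^ k := by positivity
  nlinarith

theorem NearCircle.div_le {n : ℕ} {z w : ℂ} (hz : NearCircle n z) (hw : NearCircle n w) :
    ∀ k ≤ n + 1, ‖z / w‖ ^ k ≤ 4 ∧ 1 / 4 ≤ ‖z / w‖ ^ k := by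
  intro k hk
  rw [norm_div, div_pow]
  obtain ⟨h1, h2⟩ := hz k hk
  obtain ⟨h3, h4⟩ := hw k hk
  constructor
  · rw [div_le_iff₀ (by linarith)]; linarith
  · rw [le_div_iff₀ (by linarith)]; linarith

/-- Lower bound for the quadratic form of `z^k` and `w^k`. -/
theorem NearCircle.sum_sq_norm_ge {n : ℕ} (hn : 2 ≤ n) {z w : ℂ} (hz : NearCircle n z)
    (hw : NearCircle n w) (α β : ℂ) :
    1 / (4 * 10 ^ 8) * n * (‖α + β‖ ^ 2 + (min 1 (n * ‖w / z - 1‖)) ^ 2 * ‖β‖ ^ 2) ≤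
      ∑ k ∈ range (n + 1), ‖α * z ^ k + β * w ^ k‖ ^ 2 := by
  have h := sum_sq_norm_add_mul_pow_ge hn (p := w / z)
    (fun k hk => (hw.div_le hz k (by omega)).1) (fun k hk => (hw.div_le hz k (by omega)).2) α β
  have h2 : ∑ k ∈ range (n + 1), ‖α + β * (w / z) ^ k‖ ^ 2 ≤
      ∑ k ∈ range (n + 1), 4 * ‖α * z ^ k + β * w ^ k‖ ^ 2 := by
    refine sum_le_sum fun k hk => ?_
    have hk' := mem_range.1 hk
    have hzk : z ^ k ≠ 0 := pow_ne_zero _ hz.ne_zero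
    have e : α * z ^ k + β * w ^ k = z ^ k * (α + β * (w / z) ^ k) := by
      rw [div_pow]; field_simp
    rw [e, norm_mul, mul_pow, norm_pow]
    have h3 := (hz k (by omega)).2
    nlinarith [mul_le_mul h3 h3 (by norm_num) (by positivity), sq_nonneg ‖α + β * (w / z) ^ k‖]
  rw [← mul_sum] at h2
  calc _ = 1 / 4 * (1 / 10 ^ 8 * n *
        (‖α + β‖ ^ 2 + (min 1 (n * ‖w / z - 1‖)) ^ 2 * ‖β‖ ^ 2)) := by ring
    _ ≤ _ := by linarith

/-- Lower bound for the quadratic form of the rows `Re z^k`, `Im z^k / m`, uniform near the real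
axis. -/
theorem NearCircle.sum_sq_re_im_ge {n : ℕ} (hn : 2 ≤ n) {z : ℂ} (hz : NearCircle n z) {m : ℝ}
    (hm : m = min 1 (n * ‖starRingEnd ℂ z / z - 1‖)) (hm0 : 0 < m) (c₁ c₂ : ℝ) :
    1 / (16 * 10 ^ 8) * n * (c₁ ^ 2 + c₂ ^ 2) ≤
      ∑ k ∈ range (n + 1), (c₁ * (z ^ k).re + c₂ * ((z ^ k).im / m)) ^ 2 := by
  -- With these conjugate coefficients, the combination of `z ^ k` and its conjugate is the real
  -- number `2 (c₁ Re z ^ k + c₂ Im z ^ k / m)`. The factor `m²` of the lower bound cancels the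
  -- division by `m`.
  have h := hz.sum_sq_norm_ge hn hz.conj ⟨c₁, -c₂ / m⟩ ⟨c₁, c₂ / m⟩
  rw [← hm] at h
  have e : ∀ k, ‖(⟨c₁, -c₂ / m⟩ : ℂ) * z ^ k + ⟨c₁, c₂ / m⟩ * (starRingEnd ℂ z) ^ k‖ ^ 2 =
      4 * (c₁ * (z ^ k).re + c₂ * ((z ^ k).im / m)) ^ 2 := by
    intro k
    have : (⟨c₁, -c₂ / m⟩ : ℂ) * z ^ k + ⟨c₁, c₂ / m⟩ * (starRingEnd ℂ z) ^ k =
        ((2 * (c₁ * (z ^ k).re + c₂ * ((z ^ k).im / m)) : ℝ) : ℂ) := by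
      rw [← map_pow]
      generalize z ^ k = u
      apply Complex.ext <;> simp <;> ring
    rw [this, norm_real, norm_eq_abs, sq_abs]; ring
  simp_rw [e] at h
  rw [← mul_sum] at h
  have e1 : ‖(⟨c₁, -c₂ / m⟩ : ℂ) + ⟨c₁, c₂ / m⟩‖ ^ 2 = 4 * c₁ ^ 2 := by
    rw [← normSq_eq_norm_sq, normSq_apply]; simp; ring
  have e2 : m ^ 2 * ‖(⟨c₁, c₂ / m⟩ : ℂ)‖ ^ 2 = m ^ 2 * c₁ ^ 2 + c₂ ^ 2 := by
    rw [← normSq_eq_norm_sq, normSq_apply]; field_simp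
  rw [e1, e2] at h
  have hn0 : (0 : ℝ) ≤ n := Nat.cast_nonneg n
  have h3 : (n : ℝ) * (c₁ ^ 2 + c₂ ^ 2) ≤ n * (4 * c₁ ^ 2 + (m ^ 2 * c₁ ^ 2 + c₂ ^ 2)) := by
    
    refine mul_le_mul_of_nonneg_left ?_ hn0
    nlinarith [sq_nonneg c₁, sq_nonneg (m * c₁)]
  linarith

/-- Lower bound for the quadratic form of the real parts of complex rows that come in nearly
orthogonal clusters. -/
theorem sum_sq_re_ge_of_clusters {O S : Type*} [Fintype O] [Fintype S] [DecidableEq S]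
    (cl : O → S) (n : ℕ) (e : O → ℕ → ℂ) {c₁ B : ℝ}
    (hcl : ∀ s (c : O → ℂ), c₁ * ∑ o, (if cl o = s then ‖c o‖ ^ 2 else 0) ≤
      ∑ k ∈ range n, ‖∑ o, if cl o = s then c o * e o k else 0‖ ^ 2)
    (hcross : ∀ o o', cl o ≠ cl o' → ‖∑ k ∈ range n, e o k * starRingEnd ℂ (e o' k)‖ ≤ B)
    (hsq : ∀ o o', ‖∑ k ∈ range n, e o k * e o' k‖ ≤ B) (hB : 0 ≤ B) (c : O → ℂ) :
    1 / 2 * (c₁ - 2 * B * card O) * ∑ o, ‖c o‖ ^ 2 ≤ ∑ k ∈ range n, (∑ o, c o * e o k).re ^ 2 := by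
  have hCS : ∑ o, ∑ o', ‖c o‖ * ‖c o'‖ ≤ card O * ∑ o, ‖c o‖ ^ 2 := by
    rw [← Finset.sum_mul_sum, ← sq]
    have := sq_sum_le_card_mul_sum_sq (s := (univ : Finset O)) (f := fun o => ‖c o‖)
    simpa using this
  -- In `(Re w)² = |w|² / 2 + Re(w²) / 2` the second term is an error, since all products `e o * e
  -- o'` oscillate, those with `o = o'` included.
  have hsqsum : ‖∑ k ∈ range n, (∑ o, c o * e o k) ^ 2‖ ≤ B * (card O * ∑ o, ‖c o‖ ^ 2) := by
    have e1 : ∑ k ∈ range n, (∑ o, c o * e o k) ^ 2 =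
        ∑ o, ∑ o', c o * c o' * ∑ k ∈ range n, e o k * e o' k := by
      simp_rw [mul_sum, sq, Finset.sum_mul_sum]
      rw [sum_comm]
      refine sum_congr rfl fun o _ => ?_
      rw [sum_comm]
      exact sum_congr rfl fun _ _ => sum_congr rfl fun _ _ => by ring
    rw [e1]
    refine le_trans ?_ (mul_le_mul_of_nonneg_left hCS hB)
    rw [mul_sum]
    refine (norm_sum_le _ _).trans (sum_le_sum fun o _ => ?_)
    rw [mul_sum]
    refine (norm_sum_le _ _).trans (sum_le_sum fun o' _ => ?_)
    rw [norm_mul, norm_mul, mul_comm B]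
    gcongr
    exact hsq o o'
  have hexp : ∀ (c : O → ℂ), ((∑ k ∈ range n, ‖∑ o, c o * e o k‖ ^ 2 : ℝ) : ℂ) =
      ∑ o, ∑ o', c o * starRingEnd ℂ (c o') * ∑ k ∈ range n, e o k * starRingEnd ℂ (e o' k) := by
    intro c
    have hw : ∀ w : ℂ, ((‖w‖ ^ 2 : ℝ) : ℂ) = w * starRingEnd ℂ w := fun w => by
      rw [Complex.mul_conj, normSq_eq_norm_sq]
    rw [ofReal_sum]
    simp only [hw, map_sum, Finset.sum_mul_sum]
    simp only [mul_sum]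
    rw [sum_comm]
    refine sum_congr rfl fun o _ => ?_
    rw [sum_comm]
    refine sum_congr rfl fun o' _ => sum_congr rfl fun k _ => ?_
    rw [map_mul]; ring
  -- In `|w|²` only the terms with both indices in one cluster survive, and `hcl` bounds these from
  -- below. The remaining ones are near orthogonal by `hcross`.
  have hdiff : ∑ s, ∑ k ∈ range n, ‖∑ o, if cl o = s then c o * e o k else 0‖ ^ 2 -
      B * (card O * ∑ o, ‖c o‖ ^ 2) ≤ ∑ k ∈ range n, ‖∑ o, c o * e o k‖ ^ 2 := by
    have e1 : ((∑ s, ∑ k ∈ range n, ‖∑ o, if cl o = s then c o * e o k else 0‖ ^ 2 : ℝ) : ℂ) =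
        ∑ o, ∑ o', if cl o = cl o' then c o * starRingEnd ℂ (c o') *
          ∑ k ∈ range n, e o k * starRingEnd ℂ (e o' k) else 0 := by
      rw [ofReal_sum]
      have e2 : ∀ s, ((∑ k ∈ range n, ‖∑ o, if cl o = s then c o * e o k else 0‖ ^ 2 : ℝ) : ℂ) =
          ∑ o, ∑ o', if cl o = s then (if cl o' = s then c o * starRingEnd ℂ (c o') *
          ∑ k ∈ range n, e o k * starRingEnd ℂ (e o' k) else 0) else 0 := by
        intro s
        have := hexp fun o => if cl o = s then c o else 0
        simp only [ite_mul, zero_mul] at this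
        rw [this]
        refine sum_congr rfl fun o _ => ?_
        split_ifs with h1
        · refine sum_congr rfl fun o' _ => ?_
          split_ifs <;> simp
        · simp
      simp_rw [e2]
      rw [sum_comm]
      refine sum_congr rfl fun o _ => ?_
      rw [sum_comm]
      refine sum_congr rfl fun o' _ => ?_
      rw [Finset.sum_ite_eq univ (cl o)]
      simp [eq_comm]
    have e3 : ‖((∑ k ∈ range n, ‖∑ o, c o * e o k‖ ^ 2 : ℝ) : ℂ) - ((∑ s, ∑ k ∈ range n,
        ‖∑ o, if cl o = s then c o * e o k else 0‖ ^ 2 : ℝ) : ℂ)‖ ≤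
        B * (card O * ∑ o, ‖c o‖ ^ 2) := by
      rw [e1, hexp, ← sum_sub_distrib]
      refine le_trans ?_ (mul_le_mul_of_nonneg_left hCS hB)
      rw [mul_sum]
      refine (norm_sum_le _ _).trans (sum_le_sum fun o _ => ?_)
      rw [mul_sum, ← sum_sub_distrib]
      refine (norm_sum_le _ _).trans (sum_le_sum fun o' _ => ?_)
      split_ifs with h
      · simp; positivity
      · rw [sub_zero, norm_mul, norm_mul, RCLike.norm_conj, mul_comm B]
        gcongr
        exact hcross o o' h
    rw [← Complex.ofReal_sub, norm_real, norm_eq_abs] at e3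
    have := (abs_le.1 e3).1
    linarith
  have hlow : c₁ * ∑ o, ‖c o‖ ^ 2 ≤
      ∑ s, ∑ k ∈ range n, ‖∑ o, if cl o = s then c o * e o k else 0‖ ^ 2 := by
    refine le_trans (le_of_eq ?_) (sum_le_sum fun s _ => hcl s c)
    rw [← mul_sum, sum_comm]
    congr 1
    refine sum_congr rfl fun o _ => ?_
    rw [Finset.sum_ite_eq univ (cl o)]; simp
  have hre : ∀ w : ℂ, w.re ^ 2 = 1 / 2 * ‖w‖ ^ 2 + 1 / 2 * (w ^ 2).re := by
    intro w
    rw [← normSq_eq_norm_sq, normSq_apply, sq w, Complex.mul_re]; ring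
  simp_rw [hre]
  rw [sum_add_distrib, ← mul_sum, ← mul_sum, ← re_sum]
  have h1 := (abs_le.1 (abs_re_le_norm (∑ k ∈ range n, (∑ o, c o * e o k) ^ 2))).1
  nlinarith

/-- The sequence `e` is the exponential `ζ ^ k` times a slowly varying bounded sequence. -/
def SlowExp (n : ℕ) (ζ : ℂ) (e : ℕ → ℂ) : Prop :=
  ∃ d : ℕ → ℂ, (∀ k, e k = d k * ζ ^ k) ∧ (∀ k ≤ n, ‖d k‖ ≤ 4) ∧
    ∑ k ∈ range n, ‖d (k + 1) - d k‖ ≤ 4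

theorem SlowExp.pow (n : ℕ) (ζ : ℂ) : SlowExp n ζ fun k => ζ ^ k :=
  ⟨fun _ => 1, by simp, by simp, by simp⟩

theorem SlowExp.conj {n : ℕ} {ζ : ℂ} {e : ℕ → ℂ} (h : SlowExp n ζ e) :
    SlowExp n (starRingEnd ℂ ζ) fun k => starRingEnd ℂ (e k) := by
  obtain ⟨d, h1, h2, h3⟩ := h
  refine ⟨fun k => starRingEnd ℂ (d k), fun k => by simp [h1], fun k hk => ?_, ?_⟩
  · rw [RCLike.norm_conj]; exact h2 k hk
  · simp_rw [← map_sub, RCLike.norm_conj]; exact h3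

/-- The product is a slowly varying multiple of `(ζ ζ') ^ k`, with bound `16` and variation `32` by
the Leibniz rule, and `5 * 16 + 4 * 32 = 208`. -/
theorem SlowExp.norm_sum_mul_le {n : ℕ} {ζ ζ' : ℂ} {e e' : ℕ → ℂ} (h : SlowExp n ζ e)
    (h' : SlowExp n ζ' e') (hζ : NearCircle n ζ) (hζ' : NearCircle n ζ') {κ : ℝ} (hκ : 0 < κ)
    (hk : κ ≤ ‖1 - ζ * ζ'‖) : ‖∑ k ∈ range (n + 1), e k * e' k‖ ≤ 208 / κ := by
  obtain ⟨d, h1, h2, h3⟩ := h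
  obtain ⟨d', h1', h2', h3'⟩ := h'
  have := norm_sum_mul_pow_le (n := n) (d := fun k => d k * d' k) (D := 16) (V := 32) hκ
    (fun k hk => by
      rw [norm_mul]
      have := h2 k hk; have := h2' k hk; have := norm_nonneg (d k); have := norm_nonneg (d' k)
      nlinarith) ?_ (hζ.mul_le hζ') hk
  · refine le_trans (le_of_eq ?_) (this.trans (le_of_eq (by norm_num)))
    congr 1
    refine sum_congr rfl fun k _ => ?_
    rw [h1, h1', mul_pow]; ring
  · have : ∀ k ∈ range n, ‖d (k + 1) * d' (k + 1) - d k * d' k‖ ≤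
        4 * ‖d' (k + 1) - d' k‖ + 4 * ‖d (k + 1) - d k‖ := by
      intro k hk
      have hk' := mem_range.1 hk
      have e : d (k + 1) * d' (k + 1) - d k * d' k =
          d (k + 1) * (d' (k + 1) - d' k) + d' k * (d (k + 1) - d k) := by ring
      rw [e]
      refine (norm_add_le _ _).trans ?_
      rw [norm_mul, norm_mul]
      have := h2 (k + 1) (by omega)
      have := h2' k (by omega)
      gcongr
    refine (sum_le_sum this).trans ?_
    rw [sum_add_distrib, ← mul_sum, ← mul_sum]
    linarith

/-- The normalized difference of two nearby exponentials is slowly varying. -/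
theorem SlowExp.sub_div {n : ℕ} {z w : ℂ} (hz : NearCircle n z) (hw : NearCircle n w) {m : ℝ}
    (hm : m = n * ‖w / z - 1‖) (hm0 : 0 < m) : SlowExp n z fun k => (w ^ k - z ^ k) / m := by
  have hmc : (m : ℂ) ≠ 0 := by exact_mod_cast hm0.ne'
  refine ⟨fun k => ((w / z) ^ k - 1) / m, fun k => ?_, fun k hk => ?_, ?_⟩
  · have := pow_ne_zero k hz.ne_zero
    beta_reduce
    rw [div_pow]; field_simp
  · rw [norm_div, norm_real, norm_of_nonneg hm0.le, div_le_iff₀ hm0, hm]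
    refine (norm_pow_sub_one_le (n := n) (fun k hk => (hw.div_le hz k (by omega)).1) k
      (by omega)).trans ?_
    have : (k : ℝ) ≤ n := by exact_mod_cast hk
    have := norm_nonneg (w / z - 1)
    rw [← mul_assoc]; gcongr
  · refine (sum_le_card_nsmul _ _ (4 * ‖w / z - 1‖ / m) fun k hk => ?_).trans (le_of_eq ?_)
    · have e : ((w / z) ^ (k + 1) - 1) / (m : ℂ) - ((w / z) ^ k - 1) / m =
          (w / z) ^ k * (w / z - 1) / m := by rw [pow_succ]; ring
      rw [e, norm_div, norm_mul, norm_pow, norm_real, norm_of_nonneg hm0.le]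
      have := (hw.div_le hz k (by have := mem_range.1 hk; omega)).1
      gcongr
    · rw [card_range, nsmul_eq_mul, hm]
      rw [hm] at hm0
      have : ‖w / z - 1‖ ≠ 0 := fun h => by simp [h] at hm0
      have : (n : ℝ) ≠ 0 := fun h => by simp [h] at hm0
      field_simp

/-! ### Upper bounds for mollified intensities, uniform at close pairs and near the real axis. -/

/-- The polynomial with the coefficients `a 0, …, a n`. -/
def vecPoly {n : ℕ} (a : Fin (n + 1) → ℝ) : ℂ[X] :=
  ∑ i, Polynomial.C (a i : ℂ) * Polynomial.X ^ (i : ℕ)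

theorem eval_vecPoly {n : ℕ} (a : Fin (n + 1) → ℝ) (z : ℂ) :
    (vecPoly a).eval z = ∑ i, (a i : ℂ) * z ^ (i : ℕ) := by
  simp [vecPoly, Polynomial.eval_finsetSum]

theorem eval_derivative_vecPoly {n : ℕ} (a : Fin (n + 1) → ℝ) (z : ℂ) :
    (vecPoly a).derivative.eval z = ∑ i, (a i : ℂ) * ((i : ℕ) * z ^ ((i : ℕ) - 1)) := by
  simp [vecPoly, Polynomial.eval_finsetSum, Polynomial.derivative_X_pow]

theorem eval_conj_vecPoly {n : ℕ} (a : Fin (n + 1) → ℝ) (z : ℂ) :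
    (vecPoly a).eval (starRingEnd ℂ z) = starRingEnd ℂ ((vecPoly a).eval z) := by
  simp [eval_vecPoly]

/-- Upper bound for products of mollified root counts in terms of a system of rows that are small
where the polynomial is. -/
theorem lintegral_prod_rootKernel_le {O : Type*} [Fintype O] {n : ℕ} (z : O → ℂ)
    (e : O → Fin (n + 1) → ℂ) {lam ε : ℝ} (hlam : 0 < lam) (hε : 0 < ε)
    (hlow : ∀ c : O → ℂ, lam * ∑ o, ‖c o‖ ^ 2 ≤ ∑ i, (∑ o, c o * e o i).re ^ 2)
    (η : O → ℝ) (hη : ∀ o, 0 < η o) (q : O → Fin (n + 1) → ℂ) (k t : O → ℝ) (hk : ∀ o, 0 ≤ k o)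
    (ht : ∀ o, 0 < t o) (hkt : ∀ o, k o + ∑ i, ‖q o i‖ ^ 2 ≤ t o)
    (hrow : ∀ x : Fin (n + 1) → ℝ, (∀ o, ‖(vecPoly x).eval (z o)‖ < ε) →
      ∀ o, ‖∑ i, (x i : ℂ) * e o i‖ ≤ η o)
    (hder : ∀ x : Fin (n + 1) → ℝ, (∀ o, ‖(vecPoly x).eval (z o)‖ < ε) →
      ∀ o, ‖(vecPoly x).derivative.eval (z o)‖ ^ 2 ≤ k o + ‖∑ i, (x i : ℂ) * q o i‖ ^ 2) :
    ∫⁻ x, ∏ o, ofReal (rootKernel (vecPoly x) ε (z o)) ∂γ[n] ≤ ubConst (2 * card O) (card O) *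
        ofReal (∏ o, t o * η o ^ 2 / (π * ε ^ 2 * lam)) := by
  classical
  -- The real and imaginary parts of the rows are separate real rows. As `Re (c e) = Re c Re e - Im
  -- c Im e`, the sign in `hlow` below makes complex coefficients correspond to arbitrary real ones.
  set A : Matrix (O × Bool) (Fin (n + 1)) ℝ :=
    fun p i => if p.2 then (e p.1 i).im else (e p.1 i).re with hA
  have hAc : ∀ c : O × Bool → ℝ, lam * (c ⬝ᵥ c) ≤ A.transpose.mulVec c ⬝ᵥ A.transpose.mulVec c := by
    intro c
    have h := hlow fun o => ⟨c (o, false), -c (o, true)⟩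
    have e1 : ∑ o, ‖(⟨c (o, false), -c (o, true)⟩ : ℂ)‖ ^ 2 = c ⬝ᵥ c := by
      rw [dotProduct, Fintype.sum_prod_type]
      refine sum_congr rfl fun o _ => ?_
      rw [← normSq_eq_norm_sq, normSq_apply, Fintype.sum_bool]; simp; ring
    rw [e1] at h
    refine h.trans (le_of_eq ?_)
    rw [dotProduct]
    refine sum_congr rfl fun i _ => ?_
    rw [← sq]
    congr 1
    rw [re_sum, mulVec, dotProduct, Fintype.sum_prod_type]
    refine sum_congr rfl fun o _ => ?_
    rw [Fintype.sum_bool]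
    simp [hA, Matrix.transpose]; ring
  have hmain := lintegral_gaussVec_prod_le A hlam hAc (fun p => η p.1) (fun p => hη p.1) q k t hk ht hkt
  have hπ := pi_pos
  have hle : ∀ x : Fin (n + 1) → ℝ, ∏ o, ofReal (rootKernel (vecPoly x) ε (z o)) ≤
      ofReal ((π * ε ^ 2)⁻¹ ^ card O) *
      ((∏ o, ofReal (k o + ‖∑ i, (x i : ℂ) * q o i‖ ^ 2)) *
        {x | ∀ p : O × Bool, |A.mulVec x p| ≤ η p.1}.indicator 1 x) := by
    intro x
    by_cases hx : ∀ o, ‖(vecPoly x).eval (z o)‖ < ε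
    · have hmem : x ∈ {x | ∀ p : O × Bool, |A.mulVec x p| ≤ η p.1} := by
        rintro ⟨o, b⟩
        refine le_trans ?_ (hrow x hx o)
        cases b
        · refine le_trans (le_of_eq ?_) (abs_re_le_norm _)
          simp [mulVec, dotProduct, hA, re_sum, mul_comm]
        · refine le_trans (le_of_eq ?_) (Complex.abs_im_le_norm _)
          simp [mulVec, dotProduct, hA, Complex.im_sum, mul_comm]
      rw [indicator_of_mem hmem, Pi.one_apply, mul_one, ofReal_pow (by positivity),
        ← card_univ, ← prod_const, ← prod_mul_distrib]
      refine Finset.prod_le_prod' fun o _ => ?_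
      rw [← ofReal_mul (by positivity)]
      refine ofReal_le_ofReal ?_
      rw [rootKernel, if_pos (hx o), div_eq_inv_mul]
      exact mul_le_mul_of_nonneg_left (hder x hx o) (by positivity)
    · push Not at hx
      obtain ⟨o, ho⟩ := hx
      refine le_of_eq_of_le (prod_eq_zero (mem_univ o) ?_) bot_le
      rw [rootKernel, if_neg (not_lt.2 ho), ofReal_zero]
  calc _ ≤ _ := lintegral_mono hle
    _ ≤ ofReal ((π * ε ^ 2)⁻¹ ^ card O) * (ubConst (card (O × Bool)) (card O) * ofReal (∏ j, t j) *
          ofReal ((∏ i : O × Bool, η i.1) / √lam ^ card (O × Bool))) := by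
        rw [lintegral_const_mul' _ _ ofReal_ne_top]
        gcongr
    _ = _ := by
        have hcard : card (O × Bool) = 2 * card O := by
          rw [Fintype.card_prod, Fintype.card_bool, mul_comm]
        have hs : √lam ^ (2 * card O) = lam ^ card O := by
          rw [pow_mul, sq_sqrt hlam.le]
        have hpe : ∏ p : O × Bool, η p.1 = ∏ o, η o ^ 2 := by
          rw [Fintype.prod_prod_type]
          exact prod_congr rfl fun o _ => by simp [sq]
        have ht0 : 0 ≤ ∏ o, t o := prod_nonneg fun o _ => (ht o).le
        rw [hcard, hs, hpe, mul_assoc, ← ofReal_mul ht0, mul_left_comm,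
          ← ofReal_mul (by positivity)]
        congr 2
        rw [Finset.prod_div_distrib, prod_mul_distrib, prod_const, card_univ, mul_pow, inv_pow]
        field_simp

theorem NearCircle.norm_ge {n : ℕ} {z : ℂ} (h : NearCircle n z) : 1 / 2 ≤ ‖z‖ := by
  simpa using (h 1 (by omega)).2

theorem NearCircle.norm_le {n : ℕ} {z : ℂ} (h : NearCircle n z) : ‖z‖ ≤ 2 := by
  simpa using (h 1 (by omega)).1

/-- This is the bound `O(n³)` for the variance of `f'(z)`, the default choice of `t` below. -/
theorem sum_sq_norm_mul_pow_le {n : ℕ} (hn : 1 ≤ n) {z : ℂ} (hz : NearCircle n z) :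
    ∑ i : Fin (n + 1), ‖((i : ℕ) : ℂ) * z ^ ((i : ℕ) - 1)‖ ^ 2 ≤ 8 * n ^ 3 := by
  have hn1 : (1 : ℝ) ≤ n := by exact_mod_cast hn
  refine (sum_le_card_nsmul _ _ (4 * (n : ℝ) ^ 2) fun i _ => ?_).trans ?_
  · have hi : ((i : ℕ) : ℝ) ≤ n := by exact_mod_cast Nat.lt_succ_iff.1 i.2
    rw [norm_mul, norm_natCast, norm_pow, mul_pow]
    have h1 := (hz (i - 1) (by omega)).1
    have h0 : 0 ≤ ‖z‖ ^ ((i : ℕ) - 1) := by positivity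
    have : (((i : ℕ) : ℝ)) ^ 2 ≤ (n : ℝ) ^ 2 := by gcongr
    have h2 : (‖z‖ ^ ((i : ℕ) - 1)) ^ 2 ≤ 4 := by nlinarith
    calc _ ≤ (n : ℝ) ^ 2 * 4 := by gcongr
      _ = _ := by ring
  · simp only [card_univ, Fintype.card_fin, nsmul_eq_mul]
    push_cast
    nlinarith [sq_nonneg (n : ℝ)]

/-- First order Taylor expansion of `k`-th powers. -/
theorem exists_taylor_pow {n : ℕ} {z w : ℂ} (hz : NearCircle n z) (hw : NearCircle n w)
    (hzw : w ≠ z) : ∃ R : ℕ → ℂ, (∀ k ≤ n, ‖R k‖ ≤ 32 * n ^ 2) ∧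
      ∀ k : ℕ, (k : ℂ) * z ^ (k - 1) = (w ^ k - z ^ k) / (w - z) - (w - z) * R k := by
  have hz0 := hz.ne_zero
  have hwz : w - z ≠ 0 := sub_ne_zero.2 hzw
  refine ⟨fun k => ((w ^ k - z ^ k) / (w - z) - k * z ^ (k - 1)) / (w - z), fun k hk => ?_,
    fun k => by field_simp; ring⟩
  obtain ⟨p, rfl⟩ : ∃ p, w = z * p := ⟨w / z, by field_simp⟩
  have hp : p - 1 ≠ 0 := by
    intro h; apply hzw; rw [sub_eq_zero.1 h, mul_one]
  -- With `w = z p` the remainder becomes a sum of the `k` quotients `(p ^ i - 1) / (p - 1)`, each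
  -- at most `4 n`, multiplied by `z ^ (k - 2)`.
  have e : (((z * p) ^ k - z ^ k) / (z * p - z) - k * z ^ (k - 1)) / (z * p - z) =
      z ^ k / z ^ 2 * ((∑ i ∈ range k, (p ^ i - 1)) / (p - 1)) := by
    have e1 : ∑ i ∈ range k, (p ^ i - 1) = (p ^ k - 1) / (p - 1) - k := by
      rw [sum_sub_distrib, geom_sum_eq (fun h => hp (by rw [h, sub_self]))]; simp
    have e2 : (k : ℂ) * z ^ (k - 1) = k * (z ^ k / z) := by
      rcases k with _ | k
      · simp
      · rw [Nat.add_sub_cancel, pow_succ]; field_simp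
    rw [e1, e2, mul_pow, show z * p - z = z * (p - 1) by ring]
    field_simp
  beta_reduce
  rw [e, norm_mul, norm_div, norm_div, norm_pow, norm_pow]
  have hpp : ∀ j ≤ n, ‖p‖ ^ j ≤ 4 := fun j hj => by
    have := (hw.div_le hz j (by omega)).1
    rwa [mul_div_cancel_left₀ _ hz0] at this
  have hp0 : 0 < ‖p - 1‖ := norm_pos_iff.2 hp
  have h1 : ‖∑ i ∈ range k, (p ^ i - 1)‖ / ‖p - 1‖ ≤ 4 * n ^ 2 := by
    rw [div_le_iff₀ hp0]
    refine (norm_sum_le _ _).trans ((sum_le_card_nsmul _ _ (4 * n * ‖p - 1‖)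
      fun i hi => ?_).trans ?_)
    · have hi' := mem_range.1 hi
      refine (norm_pow_sub_one_le hpp i (by omega)).trans ?_
      have : (i : ℝ) ≤ n := by exact_mod_cast (by omega : i ≤ n)
      gcongr
    · rw [card_range, nsmul_eq_mul]
      have : (k : ℝ) ≤ n := by exact_mod_cast hk
      calc (k : ℝ) * (4 * n * ‖p - 1‖) ≤ n * (4 * n * ‖p - 1‖) := by gcongr
        _ = _ := by ring
  have h2 : ‖z‖ ^ k / ‖z‖ ^ 2 ≤ 8 := by
    have := (hz k (by omega)).1
    have := hz.norm_ge
    rw [div_le_iff₀ (by positivity)]; nlinarith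
  calc _ ≤ 8 * (4 * (n : ℝ) ^ 2) := by gcongr
    _ = _ := by ring

/-- At a point where a polynomial is small at two points, the derivative is comparable to a
remainder term of size proportional to the distance. -/
theorem exists_derivative_row {n : ℕ} (hn : 1 ≤ n) {z w : ℂ} (hz : NearCircle n z)
    (hw : NearCircle n w) (hzw : w ≠ z) {ε : ℝ} (hε : ε ≤ ‖w - z‖ ^ 2) (hε0 : 0 < ε) :
    ∃ q : Fin (n + 1) → ℂ, ∃ k : ℝ, 0 ≤ k ∧ k + ∑ i, ‖q i‖ ^ 2 ≤ 5000 * ‖w - z‖ ^ 2 * n ^ 5 ∧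
      ∀ x : Fin (n + 1) → ℝ, ‖(vecPoly x).eval z‖ < ε → ‖(vecPoly x).eval w‖ < ε →
        ‖(vecPoly x).derivative.eval z‖ ^ 2 ≤ k + ‖∑ i, (x i : ℂ) * q i‖ ^ 2 := by
  obtain ⟨R, hR, hRe⟩ := exists_taylor_pow hz hw hzw
  set s := ‖w - z‖ with hs
  have hs0 : 0 < s := norm_pos_iff.2 (sub_ne_zero.2 hzw)
  have hn1 : (1 : ℝ) ≤ n := by exact_mod_cast hn
  -- The derivative is a divided difference of size at most `2 ε / s` minus `s` times the remainder
  -- form. The inequality `(x + y)² ≤ 2 x² + 2 y²` produces the `√2` and `8 ε² / s²`, and `ε ≤ s²`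
  -- keeps the constant part of order `s²`.
  refine ⟨fun i => (√2 * s : ℝ) * R i, 8 * ε ^ 2 / s ^ 2, by positivity, ?_, ?_⟩
  · have h1 : ∑ i : Fin (n + 1), ‖((√2 * s : ℝ) : ℂ) * R i‖ ^ 2 ≤ 4096 * s ^ 2 * n ^ 5 := by
      refine (sum_le_card_nsmul _ _ (2048 * s ^ 2 * n ^ 4) fun i _ => ?_).trans ?_
      · rw [norm_mul, norm_real, norm_of_nonneg (by positivity), mul_pow, mul_pow,
          sq_sqrt (by norm_num)]
        have := hR i (Nat.lt_succ_iff.1 i.2)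
        calc _ ≤ 2 * s ^ 2 * (32 * (n : ℝ) ^ 2) ^ 2 := by gcongr
          _ = _ := by ring
      · simp only [card_univ, Fintype.card_fin, nsmul_eq_mul]
        push_cast
        have h0 : 0 ≤ 2048 * s ^ 2 * (n : ℝ) ^ 4 := by positivity
        nlinarith
    have h2 : 8 * ε ^ 2 / s ^ 2 ≤ 8 * s ^ 2 * n ^ 5 := by
      rw [div_le_iff₀ (by positivity)]
      have h5 : (1 : ℝ) ≤ n ^ 5 := one_le_pow₀ hn1
      have h3 : ε ^ 2 ≤ (s ^ 2) ^ 2 := by gcongr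
      calc 8 * ε ^ 2 ≤ 8 * (s ^ 2) ^ 2 * 1 := by linarith
        _ ≤ 8 * (s ^ 2) ^ 2 * n ^ 5 := by gcongr
        _ = _ := by ring
    have h4 : 0 ≤ s ^ 2 * (n : ℝ) ^ 5 := by positivity
    nlinarith
  · intro x hxz hxw
    have e1 : (vecPoly x).derivative.eval z =
        ((vecPoly x).eval w - (vecPoly x).eval z) / (w - z) - (w - z) * ∑ i, (x i : ℂ) * R i := by
      rw [eval_derivative_vecPoly, eval_vecPoly, eval_vecPoly, ← sum_sub_distrib,
        sum_div, mul_sum, ← sum_sub_distrib]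
      refine sum_congr rfl fun i _ => ?_
      rw [hRe]; ring
    have e2 : ‖∑ i, (x i : ℂ) * (((√2 * s : ℝ) : ℂ) * R i)‖ ^ 2 =
        2 * (s * ‖∑ i, (x i : ℂ) * R i‖) ^ 2 := by
      have : ∑ i, (x i : ℂ) * (((√2 * s : ℝ) : ℂ) * R i) =
          ((√2 * s : ℝ) : ℂ) * ∑ i, (x i : ℂ) * R i := by
        rw [mul_sum]; exact sum_congr rfl fun _ _ => by ring
      rw [this, norm_mul, norm_real, norm_of_nonneg (by positivity), mul_pow, mul_pow,
        mul_pow, sq_sqrt (by norm_num)]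
      ring
    have h3 : ‖((vecPoly x).eval w - (vecPoly x).eval z) / (w - z)‖ ≤ 2 * ε / s := by
      rw [norm_div, ← hs]
      gcongr
      exact (norm_sub_le _ _).trans (by linarith)
    have h4 : ‖(vecPoly x).derivative.eval z‖ ≤ 2 * ε / s + s * ‖∑ i, (x i : ℂ) * R i‖ := by
      rw [e1]
      refine (norm_sub_le _ _).trans ?_
      rw [norm_mul (w - z), ← hs]
      gcongr
    rw [e2]
    have h5 : 8 * ε ^ 2 / s ^ 2 = 2 * (2 * ε / s) ^ 2 := by ring
    rw [h5]
    nlinarith [norm_nonneg ((vecPoly x).derivative.eval z),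
      sq_nonneg (2 * ε / s - s * ‖∑ i, (x i : ℂ) * R i‖)]

/-- Points `z o` that are separated, except within the clusters given by `cl`, from each other and
from the conjugates of each other. -/
def SeparatedBy {O S : Type*} (κ : ℝ) (cl : O → S) (z : O → ℂ) : Prop :=
  (∀ o o', cl o ≠ cl o' → κ ≤ ‖1 - z o * starRingEnd ℂ (z o')‖) ∧ ∀ o o', κ ≤ ‖1 - z o * z o'‖

/-- Separation makes every oscillating sum at most `208 / κ`, independently of `n`, while the
cluster bound grows like `n`. Since `832 = 4 * 208`, half of the main term survives for such `n`. -/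
theorem half_mul_le_sum_sq_re {O S : Type*} [Fintype O] [Fintype S] [DecidableEq S] {n : ℕ}
    (cl : O → S) (ζ : O → ℂ) (e : O → ℕ → ℂ) {κ c₁ : ℝ} (hκ : 0 < κ)
    (hsep : SeparatedBy κ cl ζ) (hζ : ∀ o, NearCircle n (ζ o)) (he : ∀ o, SlowExp n (ζ o) (e o))
    (hn : 832 / κ * card O ≤ c₁ * n)
    (hcl : ∀ s (c : O → ℂ), c₁ * n * ∑ o, (if cl o = s then ‖c o‖ ^ 2 else 0) ≤
      ∑ k ∈ range (n + 1), ‖∑ o, if cl o = s then c o * e o k else 0‖ ^ 2) (c : O → ℂ) :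
    c₁ * n / 4 * ∑ o, ‖c o‖ ^ 2 ≤ ∑ i : Fin (n + 1), (∑ o, c o * e o i).re ^ 2 := by
  have h := sum_sq_re_ge_of_clusters cl (n + 1) e (c₁ := c₁ * n) (B := 208 / κ) hcl
    (fun o o' hoo => (he o).norm_sum_mul_le (he o').conj (hζ o) (hζ o').conj hκ (hsep.1 o o' hoo))
    (fun o o' => (he o).norm_sum_mul_le (he o') (hζ o) (hζ o') hκ (hsep.2 o o'))
    (by positivity) c
  rw [Finset.sum_range fun k => (∑ o, c o * e o k).re ^ 2] at h
  refine le_trans ?_ h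
  have h0 : 0 ≤ ∑ o, ‖c o‖ ^ 2 := sum_nonneg fun _ _ => by positivity
  refine mul_le_mul_of_nonneg_right ?_ h0
  have : 832 / κ * card O = 4 * (208 / κ * card O) := by ring
  linarith

/-- The constant in the upper bounds for the intensities of the root process. -/
def intensityConst (m : ℕ) : ℝ≥0∞ := ubConst (2 * m) m * ofReal ((10 ^ 14) ^ m)

theorem intensityConst_ne_top (m : ℕ) : intensityConst m ≠ ∞ :=
  ENNReal.mul_ne_top (ubConst_ne_top _ _) ofReal_ne_top

/-- Upper bound for the mollified intensities of the root process at separated points. -/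
theorem lintegral_prod_rootKernel_le_of_separated {S : Type*} [Fintype S] [DecidableEq S] {n : ℕ}
    (hn1 : 1 ≤ n) (z : S → ℂ) (hz : ∀ s, NearCircle n (z s)) {κ : ℝ} (hκ : 0 < κ)
    (hsep : SeparatedBy κ id z) (hn : 10 ^ 13 / κ * card S ≤ n) {ε : ℝ} (hε : 0 < ε) :
    ∫⁻ x, ∏ s, ofReal (rootKernel (vecPoly x) ε (z s)) ∂γ[n] ≤
      intensityConst (card S) * ofReal ((n : ℝ) ^ (2 * card S)) := by
  have hn1' : (1 : ℝ) ≤ n := by exact_mod_cast hn1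
  have hlow := half_mul_le_sum_sq_re id z (fun s k => z s ^ k) (c₁ := 1 / 4) hκ hsep hz
    (fun s => SlowExp.pow n (z s)) (by
      have : 10 ^ 13 / κ * card S = 10 ^ 13 * (κ⁻¹ * card S) := by ring
      have h2 : 832 / κ * card S = 832 * (κ⁻¹ * card S) := by ring
      have : 0 ≤ κ⁻¹ * card S := by positivity
      linarith) (by
      intro s c
      simp only [id, Finset.sum_ite_eq', mem_univ, if_true]
      simp_rw [norm_mul, mul_pow]
      rw [← mul_sum]
      have : (1 / 4 : ℝ) * n ≤ ∑ k ∈ range (n + 1), ‖z s ^ k‖ ^ 2 := by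
        refine le_trans ?_ (Finset.card_nsmul_le_sum _ _ (1 / 4) fun k hk => ?_)
        · rw [card_range, nsmul_eq_mul]; push_cast; linarith
        · rw [norm_pow]
          have := (hz s k (by have := mem_range.1 hk; omega)).2
          nlinarith
      nlinarith [sq_nonneg ‖c s‖])
  -- Each point contributes `8 n³ ε² / (π ε² n / 16)`, which is of order `n²` and free of `ε`.
  refine (lintegral_prod_rootKernel_le z (fun s i => z s ^ (i : ℕ)) (lam := 1 / 4 * n / 4)
    (by positivity) hε hlow (fun _ => ε) (fun _ => hε)
    (fun s i => ((i : ℕ) : ℂ) * z s ^ ((i : ℕ) - 1)) (fun _ => 0) (fun _ => 8 * n ^ 3)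
    (fun _ => le_rfl) (fun _ => by positivity)
    (fun s => by rw [zero_add]; exact sum_sq_norm_mul_pow_le hn1 (hz s))
    (fun x hx s => by rw [← eval_vecPoly]; exact (hx s).le)
    (fun x _ s => by rw [zero_add, eval_derivative_vecPoly])).trans ?_
  rw [intensityConst, mul_assoc (ubConst _ _), ← ofReal_mul (by positivity)]
  refine mul_le_mul' le_rfl ?_
  refine ofReal_le_ofReal ?_
  rw [prod_const, card_univ, pow_mul, ← mul_pow]
  have hπ := Real.pi_gt_three
  gcongr
  rw [div_le_iff₀ (by positivity)]
  have h0 : 0 ≤ ε ^ 2 * (n : ℝ) ^ 3 := by positivity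
  have : (10 : ℝ) ^ 14 * n ^ 2 * (π * ε ^ 2 * (1 / 4 * n / 4)) =
      (10 ^ 14 / 16 * π) * (ε ^ 2 * n ^ 3) := by ring
  rw [this]
  nlinarith

/-- Upper bound for the mollified intensities of the root process at separated points and one
additional point `w` near the point `z s₀`. -/
theorem lintegral_rootKernel_mul_prod_le {S : Type*} [Fintype S] [DecidableEq S] {n : ℕ}
    (hn2 : 2 ≤ n) (z : S → ℂ) (w : ℂ) (s₀ : S) (hz : ∀ s, NearCircle n (z s))
    (hw : NearCircle n w) (hwz : w ≠ z s₀) {κ : ℝ} (hκ : 0 < κ)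
    (hsep : SeparatedBy κ (fun o : Option S => o.getD s₀) (fun o => o.elim w z))
    (hn : 10 ^ 13 / κ * (card S + 1) ≤ n) {ε : ℝ} (hε : 0 < ε)
    (hε2 : ε ≤ ‖w - z s₀‖ ^ 2) :
    ∫⁻ x, ∏ o : Option S, ofReal (rootKernel (vecPoly x) ε (o.elim w z)) ∂γ[n] ≤
      intensityConst (card S + 1) * ofReal ((n : ℝ) ^ (2 * (card S + 1))) := by
  have hn1 : 1 ≤ n := by omega
  have hn1' : (1 : ℝ) ≤ n := by exact_mod_cast hn1
  have hcard : card (Option S) = card S + 1 := Fintype.card_option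
  have hzz : ∀ o : Option S, NearCircle n (o.elim w z) := by
    rintro (_ | s)
    · exact hw
    · exact hz s
  have hn' : 832 / κ * card (Option S) ≤ 1 / (12 * 10 ^ 8) * n := by
    rw [hcard]
    push_cast
    have : 10 ^ 13 / κ * (card S + 1) = 10 ^ 13 * (κ⁻¹ * (card S + 1)) := by ring
    have h2 : 832 / κ * (card S + 1) = 832 * (κ⁻¹ * (card S + 1)) := by ring
    have : 0 ≤ κ⁻¹ * ((card S : ℝ) + 1) := by positivity
    rw [h2]; linarith
  have hsingle : ∀ s (c : ℂ), 1 / (12 * 10 ^ 8) * n * ‖c‖ ^ 2 ≤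
      ∑ k ∈ range (n + 1), ‖c * z s ^ k‖ ^ 2 := by
    intro s c
    simp_rw [norm_mul, mul_pow]
    rw [← mul_sum]
    have : (1 / 4 : ℝ) * n ≤ ∑ k ∈ range (n + 1), ‖z s ^ k‖ ^ 2 := by
      refine le_trans ?_ (Finset.card_nsmul_le_sum _ _ (1 / 4) fun k hk => ?_)
      · rw [card_range, nsmul_eq_mul]; push_cast; linarith
      · rw [norm_pow]
        have := (hz s k (by have := mem_range.1 hk; omega)).2
        nlinarith
    nlinarith [sq_nonneg ‖c‖]
  have hπ := Real.pi_gt_three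
  set m := n * ‖w / z s₀ - 1‖ with hm
  have hzs : z s₀ ≠ 0 := (hz s₀).ne_zero
  have hmpos : 0 < m := by
    have : w / z s₀ - 1 ≠ 0 := by
      rw [sub_ne_zero]; intro h; exact hwz ((div_eq_one_iff_eq hzs).1 h)
    have := norm_pos_iff.2 this
    positivity
  -- Common end of both cases. For the close pair only the product of the two factors `t η²` has to
  -- be of order `(n³ ε²)²`, since a loss at one point may be compensated at the other.
  have hfinal : ∀ t η : Option S → ℝ, (∀ o, 0 ≤ t o) →
      (∀ s, s ≠ s₀ → t (some s) * η (some s) ^ 2 ≤ 8 * (n ^ 3 * ε ^ 2)) →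
      t none * η none ^ 2 * (t (some s₀) * η (some s₀) ^ 2) ≤ (5 * 10 ^ 4 * (n ^ 3 * ε ^ 2)) ^ 2 →
      ubConst (2 * card (Option S)) (card (Option S)) * ofReal
        (∏ o, t o * η o ^ 2 / (π * ε ^ 2 * (1 / (12 * 10 ^ 8) * n / 4))) ≤
      intensityConst (card S + 1) * ofReal ((n : ℝ) ^ (2 * (card S + 1))) := by
    intro t η ht h1 h2
    rw [intensityConst, mul_assoc (ubConst _ _), hcard, ← ofReal_mul (by positivity)]
    refine mul_le_mul' le_rfl ?_
    refine ofReal_le_ofReal ?_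
    set D := π * ε ^ 2 * (1 / (12 * 10 ^ 8) * n / 4) with hD
    have hD0 : 0 < D := by positivity
    set X := (10 : ℝ) ^ 14 * n ^ 2 with hX
    have hX0 : 0 < X := by positivity
    have hu : 0 ≤ (n : ℝ) ^ 3 * ε ^ 2 := by positivity
    have hDle : 5 * 10 ^ 4 * (n ^ 3 * ε ^ 2) ≤ X * D := by
      have : X * D = (10 ^ 14 / (48 * 10 ^ 8) * π) * (n ^ 3 * ε ^ 2) := by rw [hX, hD]; ring
      rw [this]
      refine mul_le_mul_of_nonneg_right ?_ hu
      linarith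
    rw [pow_mul, ← mul_pow, ← hX, Fintype.prod_option,
      ← mul_prod_erase univ _ (mem_univ s₀), ← mul_assoc]
    have h3 : t none * η none ^ 2 / D * (t (some s₀) * η (some s₀) ^ 2 / D) ≤ X ^ 2 := by
      rw [div_mul_div_comm, div_le_iff₀ (by positivity)]
      refine h2.trans ?_
      calc _ ≤ (X * D) ^ 2 := by gcongr
        _ = _ := by ring
    have h4 : ∏ s ∈ univ.erase s₀, (t (some s) * η (some s) ^ 2 / D) ≤ X ^ (card S - 1) := by
      refine (prod_le_prod (g := fun _ => X) (fun s _ => ?_) fun s hs => ?_).trans (le_of_eq ?_)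
      · have := ht (some s); positivity
      · rw [div_le_iff₀ hD0]
        have := h1 s (Finset.ne_of_mem_erase hs)
        linarith
      · rw [prod_const, Finset.card_erase_of_mem (mem_univ _), card_univ]
    have hS : card S + 1 = 2 + (card S - 1) := by
      have : 0 < card S := Fintype.card_pos_iff.2 ⟨s₀⟩
      omega
    rw [hS, pow_add]
    have h5 : 0 ≤ ∏ s ∈ univ.erase s₀, (t (some s) * η (some s) ^ 2 / D) :=
      prod_nonneg fun s _ => by have := ht (some s); positivity
    gcongr
  have hcluster : ∀ (e₀ : ℕ → ℂ), (∀ c c' : ℂ, 1 / (12 * 10 ^ 8) * n * (‖c‖ ^ 2 + ‖c'‖ ^ 2) ≤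
      ∑ k ∈ range (n + 1), ‖c * e₀ k + c' * z s₀ ^ k‖ ^ 2) →
      ∀ s (c : Option S → ℂ), 1 / (12 * 10 ^ 8) * n *
        ∑ o, (if o.getD s₀ = s then ‖c o‖ ^ 2 else 0) ≤
      ∑ k ∈ range (n + 1),
        ‖∑ o : Option S, if o.getD s₀ = s then c o * o.elim (e₀ k) (fun s => z s ^ k) else 0‖ ^ 2 := by
    intro e₀ he₀ s c
    simp only [Fintype.sum_option, Option.getD_none, Option.getD_some, Option.elim_none,
      Option.elim_some, Finset.sum_ite_eq', mem_univ, if_true]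
    by_cases hs : s₀ = s
    · subst hs
      simpa using he₀ (c none) (c (some s₀))
    · simpa [hs] using hsingle s (c (some s))
  have hq : ∀ s (x : Fin (n + 1) → ℝ), ‖(vecPoly x).derivative.eval (z s)‖ ^ 2 ≤
      0 + ‖∑ i : Fin (n + 1), (x i : ℂ) * (((i : ℕ) : ℂ) * z s ^ ((i : ℕ) - 1))‖ ^ 2 :=
    fun s x => by rw [zero_add, eval_derivative_vecPoly]
  -- If `m ≤ 1`, the rows of `w` and `z s₀` are nearly parallel, and the row of `w` is replaced by
  -- the divided difference `(w ^ k - z s₀ ^ k) / m`. Its size bound grows to `2 ε / m`, but both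
  -- derivatives have variance proxies of order `m² n³`, so a factor `m²` is even gained. If `m >
  -- 1`, the original rows are independent enough.
  rcases le_or_gt m 1 with hm1 | hm1
  · have hs : ‖w - z s₀‖ = ‖z s₀‖ * m / n := by
      have : w - z s₀ = z s₀ * (w / z s₀ - 1) := by field_simp
      rw [this, norm_mul, hm]; field_simp
    have hs2 : ‖w - z s₀‖ ≤ 2 * m / n := by
      rw [hs]; have := (hz s₀).norm_le; gcongr
    have ht : 5000 * ‖w - z s₀‖ ^ 2 * n ^ 5 ≤ 20000 * m ^ 2 * n ^ 3 := by
      calc 5000 * ‖w - z s₀‖ ^ 2 * n ^ 5 ≤ 5000 * (2 * m / n) ^ 2 * n ^ 5 := by gcongr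
        _ = _ := by field_simp; ring
    obtain ⟨q, k, hk0, hkq, hqd⟩ := exists_derivative_row hn1 (hz s₀) hw hwz hε2 hε
    obtain ⟨q', k', hk0', hkq', hqd'⟩ := exists_derivative_row hn1 hw (hz s₀) hwz.symm
      (by rwa [norm_sub_rev]) hε
    rw [norm_sub_rev] at hkq'
    set e₀ : ℕ → ℂ := fun k => (w ^ k - z s₀ ^ k) / m with he₀
    have hmc : (m : ℂ) ≠ 0 := by exact_mod_cast hmpos.ne'
    have hlow := half_mul_le_sum_sq_re (fun o : Option S => o.getD s₀)
      (fun o => o.elim (z s₀) z) (fun o k => o.elim (e₀ k) (fun s => z s ^ k)) hκ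
      ⟨by
        have := hsep.1
        rintro (_ | s) (_ | s') h
        · exact absurd rfl h
        · exact this (some s₀) (some s') h
        · exact this (some s) (some s₀) h
        · exact this (some s) (some s') h, by
        have := hsep.2
        rintro (_ | s) (_ | s')
        · exact this (some s₀) (some s₀)
        · exact this (some s₀) (some s')
        · exact this (some s) (some s₀)
        · exact this (some s) (some s')⟩
      (by
        rintro (_ | s)
        · exact hz s₀
        · exact hz s)
      (by
        rintro (_ | s)
        · exact SlowExp.sub_div (hz s₀) hw hm hmpos
        · exact SlowExp.pow n (z s)) hn' (hcluster e₀ (by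
        intro c c'
        have h := (hz s₀).sum_sq_norm_ge hn2 hw (c' - c / m) (c / m)
        rw [← hm, min_eq_right hm1] at h
        have e1 : m ^ 2 * ‖c / (m : ℂ)‖ ^ 2 = ‖c‖ ^ 2 := by
          rw [norm_div, norm_real, norm_of_nonneg hmpos.le]; field_simp
        rw [e1, sub_add_cancel] at h
        have e2 : ∀ k, c * e₀ k + c' * z s₀ ^ k = (c' - c / m) * z s₀ ^ k + c / m * w ^ k := by
          intro k; rw [he₀]; ring
        simp_rw [e2]
        refine le_trans ?_ h
        have : 0 ≤ (n : ℝ) * (‖c‖ ^ 2 + ‖c'‖ ^ 2) := by positivity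
        linarith))
    refine (lintegral_prod_rootKernel_le (fun o : Option S => o.elim w z)
      (fun o i => o.elim (e₀ i) (fun s => z s ^ (i : ℕ))) (by positivity) hε hlow
      (fun o => o.elim (2 * ε / m) fun _ => ε)
      (by rintro (_ | s) <;> simp only [Option.elim] <;> positivity)
      (fun o => o.elim q' fun s => if s = s₀ then q else
        fun i => ((i : ℕ) : ℂ) * z s ^ ((i : ℕ) - 1))
      (fun o => o.elim k' fun s => if s = s₀ then k else 0)
      (fun o => o.elim (20000 * m ^ 2 * n ^ 3) fun s => if s = s₀ then 20000 * m ^ 2 * n ^ 3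
        else 8 * n ^ 3) ?_ ?_ ?_ ?_ ?_).trans (hfinal _ _ ?_ ?_ ?_)
    · rintro (_ | s)
      · exact hk0'
      · simp only [Option.elim]; split_ifs; exacts [hk0, le_rfl]
    · rintro (_ | s)
      · simp only [Option.elim]; positivity
      · simp only [Option.elim]; split_ifs <;> positivity
    · rintro (_ | s)
      · exact hkq'.trans ht
      · simp only [Option.elim]
        split_ifs
        · exact hkq.trans ht
        · rw [zero_add]; exact sum_sq_norm_mul_pow_le hn1 (hz s)
    · intro x hx
      have hx0 := hx none
      rintro (_ | s)
      · have hx1 := hx (some s₀)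
        have e3 : ∑ i, (x i : ℂ) * e₀ (i : ℕ) =
            ((vecPoly x).eval w - (vecPoly x).eval (z s₀)) / m := by
          rw [eval_vecPoly, eval_vecPoly, ← sum_sub_distrib, sum_div]
          exact sum_congr rfl fun i _ => by rw [he₀]; ring
        simp only [Option.elim] at hx0 hx1 ⊢
        rw [e3, norm_div, norm_real, norm_of_nonneg hmpos.le]
        gcongr
        exact (norm_sub_le _ _).trans (by linarith)
      · simp only [Option.elim]
        rw [← eval_vecPoly]; exact (hx (some s)).le
    · intro x hx
      rintro (_ | s)
      · exact hqd' x (hx none) (hx (some s₀))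
      · simp only [Option.elim]
        split_ifs with h
        · rw [h]; exact hqd x (hx (some s₀)) (hx none)
        · exact hq s x
    · rintro (_ | s)
      · simp only [Option.elim]; positivity
      · simp only [Option.elim]; split_ifs <;> positivity
    · intro s hs
      simp only [Option.elim, if_neg hs]
      exact le_of_eq (by ring)
    · simp only [Option.elim, if_true]
      have e4 : 20000 * m ^ 2 * n ^ 3 * (2 * ε / m) ^ 2 * (20000 * m ^ 2 * n ^ 3 * ε ^ 2) =
          m ^ 2 * (4 * 10 ^ 4 * (n ^ 3 * ε ^ 2)) ^ 2 := by field_simp; ring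
      rw [e4]
      calc _ ≤ (1 : ℝ) ^ 2 * (5 * 10 ^ 4 * (n ^ 3 * ε ^ 2)) ^ 2 := by gcongr; norm_num
        _ = _ := by ring
  · have hlow := half_mul_le_sum_sq_re (fun o : Option S => o.getD s₀)
      (fun o => o.elim w z) (fun o k => o.elim (w ^ k) (fun s => z s ^ k)) hκ hsep hzz
      (by
        rintro (_ | s)
        · exact SlowExp.pow n w
        · exact SlowExp.pow n (z s)) hn' (hcluster (fun k => w ^ k) (by
        intro c c'
        have h := (hz s₀).sum_sq_norm_ge hn2 hw c' c
        rw [← hm, min_eq_left hm1.le, one_pow, one_mul] at h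
        simp_rw [add_comm (c * _)]
        refine le_trans ?_ h
        have e1 : ‖c‖ ^ 2 + ‖c'‖ ^ 2 ≤ 3 * (‖c' + c‖ ^ 2 + ‖c‖ ^ 2) := by
          have : ‖c'‖ ≤ ‖c' + c‖ + ‖c‖ := by
            simpa using norm_sub_le (c' + c) c
          nlinarith [sq_nonneg (‖c' + c‖ - ‖c‖), norm_nonneg c', norm_nonneg c,
            norm_nonneg (c' + c)]
        have : (n : ℝ) * (‖c‖ ^ 2 + ‖c'‖ ^ 2) ≤ n * (3 * (‖c' + c‖ ^ 2 + ‖c‖ ^ 2)) := by gcongr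
        linarith))
    refine (lintegral_prod_rootKernel_le (fun o : Option S => o.elim w z)
      (fun o i => o.elim (w ^ (i : ℕ)) (fun s => z s ^ (i : ℕ))) (by positivity) hε hlow
      (fun o => ε) (fun _ => hε)
      (fun o i => ((i : ℕ) : ℂ) * (o.elim w z) ^ ((i : ℕ) - 1)) (fun o => 0)
      (fun o => 8 * n ^ 3) (fun _ => le_rfl) (fun _ => by positivity) ?_ ?_ ?_).trans
      (hfinal _ _ (fun _ => by positivity) ?_ ?_)
    · intro o
      rw [zero_add]; exact sum_sq_norm_mul_pow_le hn1 (hzz o)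
    · intro x hx
      rintro (_ | s)
      · simp only [Option.elim]; rw [← eval_vecPoly]; exact (hx none).le
      · simp only [Option.elim]; rw [← eval_vecPoly]; exact (hx (some s)).le
    · intro x _ o
      rw [zero_add, eval_derivative_vecPoly]
    · intro s _
      exact le_of_eq (by ring)
    · have : 8 * (n : ℝ) ^ 3 * ε ^ 2 * (8 * n ^ 3 * ε ^ 2) = (8 * (n ^ 3 * ε ^ 2)) ^ 2 := by ring
      rw [this]
      gcongr; norm_num

/-- Upper bound for the mollified intensity of the root process, uniform near the real axis. -/
theorem lintegral_rootKernel_le {n : ℕ} (hn2 : 2 ≤ n) {z : ℂ} (hz : NearCircle n z)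
    (him : z.im ≠ 0) {ε : ℝ} (hε : 0 < ε) (hε2 : ε ≤ z.im ^ 2) :
    ∫⁻ x, ofReal (rootKernel (vecPoly x) ε z) ∂γ[n] ≤ intensityConst 1 * ofReal ((n : ℝ) ^ 2) := by
  have hn1 : 1 ≤ n := by omega
  have hn1' : (1 : ℝ) ≤ n := by exact_mod_cast hn1
  have hz0 := hz.ne_zero
  have hπ := Real.pi_gt_three
  set w := starRingEnd ℂ z with hw
  have hwz : w ≠ z := fun h => him (Complex.conj_eq_iff_im.1 h)
  have hnorm : ‖w - z‖ = 2 * |z.im| := by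
    have : w - z = ((-2 * z.im : ℝ) : ℂ) * I := by
      apply Complex.ext <;> simp [hw]; ring
    rw [this, norm_mul, Complex.norm_I, mul_one, norm_real, norm_eq_abs, abs_mul]
    norm_num
  set m := min 1 (n * ‖w / z - 1‖) with hm
  have hratio : 0 < ‖w / z - 1‖ := by
    rw [norm_pos_iff, sub_ne_zero]; intro h; exact hwz ((div_eq_one_iff_eq hz0).1 h)
  have hmpos : 0 < m := lt_min one_pos (by positivity)
  -- The conjugate of `z` serves as the nearby second point: `f` is real, so it is small at both
  -- points simultaneously. The derivative gains `m² ≤ m`, while only one real row, the imaginary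
  -- part, is divided by `m`.
  obtain ⟨q, k, t, hk, ht, hkt, htm, hder⟩ : ∃ (q : Fin (n + 1) → ℂ) (k t : ℝ), 0 ≤ k ∧ 0 < t ∧
      k + ∑ i, ‖q i‖ ^ 2 ≤ t ∧ t ≤ 20000 * m * n ^ 3 ∧ ∀ x : Fin (n + 1) → ℝ,
        ‖(vecPoly x).eval z‖ < ε →
        ‖(vecPoly x).derivative.eval z‖ ^ 2 ≤ k + ‖∑ i, (x i : ℂ) * q i‖ ^ 2 := by
    rcases min_choice 1 (n * ‖w / z - 1‖) with hc | hc
    · refine ⟨fun i => ((i : ℕ) : ℂ) * z ^ ((i : ℕ) - 1), 0, 8 * n ^ 3, le_rfl, by positivity, ?_,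
        ?_, fun x _ => ?_⟩
      · rw [zero_add]; exact sum_sq_norm_mul_pow_le hn1 hz
      · rw [hm, hc]; nlinarith [pow_pos (lt_of_lt_of_le one_pos hn1') 3]
      · rw [zero_add, eval_derivative_vecPoly]
    · have hm' : m = n * ‖w / z - 1‖ := hc
      have hm1 : m ≤ 1 := min_le_left _ _
      have hε' : ε ≤ ‖w - z‖ ^ 2 := by
        rw [hnorm, mul_pow, sq_abs]; nlinarith [sq_nonneg z.im]
      obtain ⟨q, k, hk0, hkq, hqd⟩ := exists_derivative_row hn1 hz hz.conj hwz hε' hε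
      have hs : ‖w - z‖ = ‖z‖ * m / n := by
        have : w - z = z * (w / z - 1) := by field_simp
        rw [this, norm_mul, hm']; field_simp
      have hs2 : ‖w - z‖ ≤ 2 * m / n := by
        rw [hs]; have := hz.norm_le; gcongr
      refine ⟨q, k, 20000 * m ^ 2 * n ^ 3, hk0, by positivity, hkq.trans ?_, ?_, fun x hx => ?_⟩
      · calc 5000 * ‖w - z‖ ^ 2 * n ^ 5 ≤ 5000 * (2 * m / n) ^ 2 * n ^ 5 := by gcongr
          _ = _ := by field_simp; ring
      · have : m ^ 2 ≤ m := by nlinarith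
        gcongr
      · refine hqd x hx ?_
        rw [eval_conj_vecPoly, RCLike.norm_conj]; exact hx
  set A : Matrix Bool (Fin (n + 1)) ℝ :=
    fun b i => if b then (z ^ (i : ℕ)).im / m else (z ^ (i : ℕ)).re with hA
  set lam : ℝ := 1 / (16 * 10 ^ 8) * n with hlamd
  have hlam : 0 < lam := by positivity
  have hAc : ∀ c : Bool → ℝ, lam * (c ⬝ᵥ c) ≤ A.transpose.mulVec c ⬝ᵥ A.transpose.mulVec c := by
    intro c
    have h := hz.sum_sq_re_im_ge hn2 hm hmpos (c false) (c true)
    rw [Finset.sum_range fun k => (c false * (z ^ k).re + c true * ((z ^ k).im / m)) ^ 2] at h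
    refine le_trans (le_of_eq ?_) (h.trans (le_of_eq ?_))
    · rw [dotProduct, Fintype.sum_bool]; ring
    · rw [dotProduct]
      refine sum_congr rfl fun i _ => ?_
      rw [mulVec, dotProduct, Fintype.sum_bool]
      simp [hA, Matrix.transpose]; ring
  have hmain := lintegral_gaussVec_prod_le A hlam hAc (fun b => if b then ε / m else ε)
    (fun b => by split_ifs <;> positivity) (fun _ : Unit => q) (fun _ => k)
    (fun _ => t) (fun _ => hk) (fun _ => ht) (fun _ => hkt)
  have hle : ∀ x : Fin (n + 1) → ℝ, ofReal (rootKernel (vecPoly x) ε z) ≤ ofReal ((π * ε ^ 2)⁻¹) *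
      ((∏ _j : Unit, ofReal (k + ‖∑ i, (x i : ℂ) * q i‖ ^ 2)) *
        {x | ∀ b : Bool, |A.mulVec x b| ≤ if b then ε / m else ε}.indicator 1 x) := by
    intro x
    by_cases hx : ‖(vecPoly x).eval z‖ < ε
    · have hmem : x ∈ {x | ∀ b : Bool, |A.mulVec x b| ≤ if b then ε / m else ε} := by
        rintro (_ | _)
        · refine le_trans (le_trans (le_of_eq ?_) (abs_re_le_norm _)) hx.le
          rw [eval_vecPoly]
          simp [mulVec, dotProduct, hA, re_sum, mul_comm]
        · have e : A.mulVec x true = ((vecPoly x).eval z).im / m := by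
            rw [eval_vecPoly]
            simp only [mulVec, dotProduct, hA, if_true, Complex.im_sum, sum_div]
            refine sum_congr rfl fun i _ => ?_
            rw [Complex.im_ofReal_mul]; ring
          rw [e, abs_div, abs_of_pos hmpos, if_pos rfl]
          gcongr
          exact (Complex.abs_im_le_norm _).trans hx.le
      rw [indicator_of_mem hmem, Pi.one_apply, mul_one, Finset.univ_unique,
        Finset.prod_singleton, ← ofReal_mul (by positivity)]
      refine ofReal_le_ofReal ?_
      rw [rootKernel, if_pos hx, div_eq_inv_mul]
      exact mul_le_mul_of_nonneg_left (hder x hx) (by positivity)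
    · rw [rootKernel, if_neg hx, ofReal_zero]; exact bot_le
  refine (lintegral_mono hle).trans ?_
  rw [lintegral_const_mul' _ _ ofReal_ne_top]
  refine (mul_le_mul' le_rfl hmain).trans ?_
  have hs : √lam ^ 2 = lam := sq_sqrt hlam.le
  rw [Fintype.card_bool, Fintype.card_unit, hs, mul_assoc, ← ofReal_mul (by positivity),
    mul_left_comm, ← ofReal_mul (by positivity), intensityConst, mul_assoc,
    ← ofReal_mul (by positivity)]
  refine mul_le_mul' le_rfl (ofReal_le_ofReal ?_)
  rw [Finset.univ_unique, Finset.prod_singleton, Fintype.prod_bool, if_pos rfl, if_neg (by simp),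
    pow_one]
  have e : (π * ε ^ 2)⁻¹ * (t * (ε / m * ε / lam)) = t * (16 * 10 ^ 8) / (π * m * n) := by
    rw [hlamd]; field_simp
  rw [e, div_le_iff₀ (by positivity)]
  have h0 : 0 ≤ m * (n : ℝ) ^ 3 := by positivity
  nlinarith

/-! ### Almost sure simplicity, measurability, and expected sums over roots. -/

theorem continuous_eval_vecPoly (n : ℕ) :
    Continuous fun x : (Fin (n + 1) → ℝ) × ℂ => (vecPoly x.1).eval x.2 := by
  simp_rw [eval_vecPoly]; fun_prop

theorem continuous_eval_derivative_vecPoly (n : ℕ) :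
    Continuous fun x : (Fin (n + 1) → ℝ) × ℂ => (vecPoly x.1).derivative.eval x.2 := by
  simp_rw [eval_derivative_vecPoly]; fun_prop

theorem coeff_vecPoly {n : ℕ} (a : Fin (n + 1) → ℝ) (i : Fin (n + 1)) :
    (vecPoly a).coeff i = a i := by
  simp only [vecPoly, Polynomial.finsetSum_coeff, Polynomial.coeff_C_mul_X_pow]
  rw [sum_eq_single i]
  · simp
  · intro j _ hj
    rw [if_neg]; intro h; exact hj (Fin.ext h.symm)
  · simp

theorem natDegree_vecPoly {n : ℕ} {a : Fin (n + 1) → ℝ} (h : a (Fin.last n) ≠ 0) :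
    (vecPoly a).natDegree = n := by
  refine le_antisymm ?_ (Polynomial.le_natDegree_of_ne_zero ?_)
  · refine Polynomial.natDegree_sum_le_of_forall_le _ _ fun i _ => ?_
    exact (Polynomial.natDegree_C_mul_X_pow_le _ _).trans (Nat.lt_succ_iff.1 i.2)
  · have := coeff_vecPoly a (Fin.last n)
    rw [Fin.val_last] at this
    rw [this]; exact_mod_cast h

/-- The set is a projection. Restricting the root to the closed disc of radius `m` makes the
projection closed by compactness, and the discs exhaust the plane. -/
theorem measurableSet_multiple_root (n : ℕ) :
    MeasurableSet {a : Fin (n + 1) → ℝ | ∃ p, (vecPoly a).eval p = 0 ∧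
      (vecPoly a).derivative.eval p = 0} := by
  have : {a : Fin (n + 1) → ℝ | ∃ p, (vecPoly a).eval p = 0 ∧
      (vecPoly a).derivative.eval p = 0} = ⋃ m : ℕ, (Prod.fst : (Fin (n + 1) → ℝ) ×
        Metric.closedBall (0 : ℂ) m → (Fin (n + 1) → ℝ)) ''
      {x | (vecPoly x.1).eval (x.2 : ℂ) = 0 ∧ (vecPoly x.1).derivative.eval (x.2 : ℂ) = 0} := by
    ext a
    simp only [Set.mem_ofPred_eq, Set.mem_iUnion, Set.mem_image, Prod.exists, exists_and_right,
      exists_eq_right]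
    constructor
    · rintro ⟨p, hp⟩
      obtain ⟨m, hm⟩ := exists_nat_ge ‖p‖
      exact ⟨m, ⟨p, by simpa using hm⟩, hp⟩
    · rintro ⟨m, p, hp⟩
      exact ⟨p, hp⟩
  rw [this]
  refine MeasurableSet.iUnion fun m => ?_
  have : CompactSpace (Metric.closedBall (0 : ℂ) m) :=
    isCompact_iff_compactSpace.1 (isCompact_closedBall 0 (m : ℝ))
  refine (isClosedMap_fst_of_compactSpace _ ?_).measurableSet
  have h1 : Continuous fun x : (Fin (n + 1) → ℝ) × Metric.closedBall (0 : ℂ) m =>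
      (vecPoly x.1).eval (x.2 : ℂ) :=
    (continuous_eval_vecPoly n).comp (by fun_prop : Continuous fun x : (Fin (n + 1) → ℝ) ×
      Metric.closedBall (0 : ℂ) m => (x.1, (x.2 : ℂ)))
  have h2 : Continuous fun x : (Fin (n + 1) → ℝ) × Metric.closedBall (0 : ℂ) m =>
      (vecPoly x.1).derivative.eval (x.2 : ℂ) :=
    (continuous_eval_derivative_vecPoly n).comp (by fun_prop : Continuous fun x :
      (Fin (n + 1) → ℝ) × Metric.closedBall (0 : ℂ) m => (x.1, (x.2 : ℂ)))
  exact (isClosed_eq h1 continuous_const).inter (isClosed_eq h2 continuous_const)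

theorem ae_gaussVec_apply_ne_zero {κ : Type*} [Fintype κ] (i : κ) : ∀ᵐ a ∂gaussVec κ, a i ≠ 0 := by
  have h : MeasurePreserving (Function.eval i) (gaussVec κ) (gaussianReal 0 1) :=
    measurePreserving_eval _ i
  have hna : NullSingletonClass (gaussianReal 0 1) :=
    nullSingletonClass_gaussianReal one_ne_zero
  refine h.quasiMeasurePreserving.ae (p := fun x => x ≠ 0) ?_
  exact compl_mem_ae_iff.2 (measure_singleton (0 : ℝ))

/-- Almost surely, a random polynomial with independent Gaussian coefficients has full degree and
only simple roots. -/
theorem ae_vecPoly_simple {n : ℕ} (hn : 1 ≤ n) : ∀ᵐ a ∂γ[n],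
    (vecPoly a).natDegree = n ∧ ∀ p ∈ (vecPoly a).roots, (vecPoly a).derivative.eval p ≠ 0 := by
  have hna : NullSingletonClass (gaussianReal 0 1) :=
    nullSingletonClass_gaussianReal one_ne_zero
  have h1 := ae_gaussVec_apply_ne_zero (Fin.last n)
  have h2 : ∀ᵐ a ∂γ[n], ¬ ∃ p, (vecPoly a).eval p = 0 ∧ (vecPoly a).derivative.eval p = 0 := by
    have hmp := measurePreserving_piFinSuccAbove (n := n) (α := fun _ => ℝ)
      (fun _ => gaussianReal 0 1) 0
    set Q : ℝ → (Fin n → ℝ) → Prop := fun x b => ¬ ∃ p,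
      (vecPoly (Fin.cons x b : Fin (n + 1) → ℝ)).eval p = 0 ∧
      (vecPoly (Fin.cons x b : Fin (n + 1) → ℝ)).derivative.eval p = 0 with hQ
    have hQm : MeasurableSet {y : ℝ × (Fin n → ℝ) | Q y.1 y.2} := by
      have : Measurable fun y : ℝ × (Fin n → ℝ) => (Fin.cons y.1 y.2 : Fin (n + 1) → ℝ) := by
        refine measurable_pi_lambda _ fun i => ?_
        refine Fin.cases ?_ (fun j => ?_) i
        · simpa using measurable_fst
        · simp only [Fin.cons_succ]; fun_prop
      exact this (measurableSet_multiple_root n).compl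
    have h3 : ∀ᵐ y ∂(gaussianReal 0 1).prod (Measure.pi fun _ : Fin n => gaussianReal 0 1),
        Q y.1 y.2 := by
      -- With the other coefficients fixed, a multiple root of `x + g` is one of the finitely many
      -- zeros `p` of `g'`, and it determines `x = -g p`. So only finitely many constant
      -- coefficients are bad.
      rw [Measure.ae_prod_iff_ae_ae hQm, Measure.ae_ae_comm hQm]
      obtain ⟨m, rfl⟩ : ∃ m, n = m + 1 := ⟨n - 1, by omega⟩
      filter_upwards [ae_gaussVec_apply_ne_zero (Fin.last m)] with b hb
      set g := vecPoly (Fin.cons 0 b : Fin (m + 1 + 1) → ℝ) with hg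
      have hcons : ∀ x : ℝ, vecPoly (Fin.cons x b : Fin (m + 1 + 1) → ℝ) =
          Polynomial.C (x : ℂ) + g := by
        have h : ∀ y : ℝ, vecPoly (Fin.cons y b : Fin (m + 1 + 1) → ℝ) = Polynomial.C (y : ℂ) +
            ∑ i : Fin (m + 1), Polynomial.C (b i : ℂ) * Polynomial.X ^ ((i : ℕ) + 1) := by
          intro y; rw [vecPoly, Fin.sum_univ_succ]; simp only [Fin.cons_zero, Fin.cons_succ,
            Fin.val_zero, pow_zero, mul_one, Fin.val_succ]
        intro x
        rw [hg, h, h]; simp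
      have hg0 : g.derivative ≠ 0 := by
        intro h
        have hdeg : g.natDegree = m + 1 := natDegree_vecPoly (by
          rw [← Fin.succ_last, Fin.cons_succ]; exact hb)
        have := Polynomial.derivative_eq_zero.1 h
        omega
      have hfin : ((fun p : ℂ => (-g.eval p).re) '' {p | p ∈ g.derivative.roots}).Finite := by
        refine Set.Finite.image _ ?_
        exact (g.derivative.roots.toFinset.finite_toSet).subset fun p hp => by simpa using hp
      refine measure_mono_null ?_ (hfin.measure_zero (gaussianReal 0 1))
      intro x hx
      simp only [hQ, Set.mem_compl_iff, Set.mem_ofPred_eq, not_not] at hx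
      obtain ⟨p, hp1, hp2⟩ := hx
      rw [hcons] at hp1 hp2
      refine ⟨p, ?_, ?_⟩
      · simp only [Polynomial.derivative_add, Polynomial.derivative_C, zero_add] at hp2
        simpa [Polynomial.mem_roots hg0] using hp2
      · simp only [Polynomial.eval_add, Polynomial.eval_C] at hp1
        have : -g.eval p = x := by linear_combination -hp1
        simp [this]
    have h4 := hmp.quasiMeasurePreserving.ae h3
    filter_upwards [h4] with a ha
    have e : (Fin.cons (a 0) fun j : Fin n => a j.succ) = a := Fin.cons_self_tail a
    have ha' : Q (a 0) (fun j => a j.succ) := ha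
    rw [hQ] at ha'
    simpa only [e] using ha'
  filter_upwards [h1, h2] with a ha1 ha2
  have hdeg := natDegree_vecPoly ha1
  refine ⟨hdeg, fun p hp hp2 => ha2 ⟨p, ?_, hp2⟩⟩
  have : vecPoly a ≠ 0 := by
    intro h; rw [h] at hdeg; simp at hdeg; omega
  exact (Polynomial.mem_roots this).1 hp

theorem measurable_rootKernel_vecPoly (n : ℕ) (ε : ℝ) :
    Measurable fun x : (Fin (n + 1) → ℝ) × ℂ => rootKernel (vecPoly x.1) ε x.2 := by
  unfold rootKernel
  refine Measurable.ite ?_ ?_ measurable_const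
  · exact measurableSet_lt (continuous_eval_vecPoly n).norm.measurable measurable_const
  · exact ((continuous_eval_derivative_vecPoly n).norm.measurable.pow_const 2).div_const _

theorem measurable_prod_rootKernel {ι : Type*} [Fintype ι] (n : ℕ) (ε : ℝ) :
    Measurable fun x : (Fin (n + 1) → ℝ) × (ι → ℂ) =>
      ∏ i, rootKernel (vecPoly x.1) ε (x.2 i) := by
  refine measurable_fun_prod _ fun i _ => ?_
  exact (measurable_rootKernel_vecPoly n ε).comp
    (by fun_prop : Measurable fun x : (Fin (n + 1) → ℝ) × (ι → ℂ) => (x.1, x.2 i))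

theorem integrable_rootKernel (f : ℂ[X]) (hf : 0 < f.natDegree) {ε : ℝ} (hε : 0 < ε) :
    Integrable (rootKernel f ε) := by
  refine ⟨(measurable_rootKernel f ε).aestronglyMeasurable, ?_⟩
  rw [hasFiniteIntegral_iff_ofReal (ae_of_all _ (rootKernel_nonneg f ε))]
  have := rootMeasure_univ_le f hf hε
  rw [rootMeasure, withDensity_apply _ MeasurableSet.univ, Measure.restrict_univ] at this
  exact this.trans_lt (by simp)

theorem pi_rootMeasure_eq {ι : Type*} [Fintype ι] (f : ℂ[X]) (hf : 0 < f.natDegree) {ε : ℝ}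
    (hε : 0 < ε) : Measure.pi (fun _ : ι => rootMeasure f ε) =
      (volume : Measure (ι → ℂ)).withDensity fun z =>
        ofReal (∏ i, rootKernel f ε (z i)) :=
  pi_withDensity_ofReal (fun _ => rootKernel f ε) (fun _ => rootKernel_nonneg f ε)
    fun _ => integrable_rootKernel f hf hε

/-- The tuples of roots of a polynomial. -/
def rootTuples (ι : Type*) [Fintype ι] [DecidableEq ι] (f : ℂ[X]) : Finset (ι → ℂ) :=
  Fintype.piFinset fun _ => f.roots.toFinset

theorem tendsto_lintegral_prod_rootKernel {ι : Type*} [Fintype ι] [DecidableEq ι] (f : ℂ[X])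
    (hf : 0 < f.natDegree) (hsep : ∀ p ∈ f.roots, f.derivative.eval p ≠ 0)
    (Φ : BoundedContinuousFunction (ι → ℂ) ℝ≥0) :
    Tendsto (fun ε => ∫⁻ z : ι → ℂ, ofReal (∏ i, rootKernel f ε (z i)) * Φ z) (𝓝[>] 0)
      (𝓝 (∑ p ∈ rootTuples ι f, (Φ p : ℝ≥0∞))) := by
  have h := tendsto_integral_pi_rootMeasure (ι := ι) f hf hsep
    (Φ := fun z => ((Φ z : ℝ) : ℂ)) (by fun_prop)
  have h2 := (ENNReal.continuous_ofReal.comp Complex.continuous_re).continuousAt.tendsto.comp h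
  have e1 : (ofReal ∘ Complex.re)
      (∑ p ∈ Fintype.piFinset (fun _ : ι => f.roots.toFinset), ((Φ p : ℝ) : ℂ)) =
      ∑ p ∈ rootTuples ι f, (Φ p : ℝ≥0∞) := by
    rw [Function.comp, re_sum, ofReal_sum_of_nonneg]
    · exact sum_congr rfl fun p _ => by simp
    · intro p _; simp
  rw [e1] at h2
  refine h2.congr' ?_
  filter_upwards [self_mem_nhdsWithin] with ε hε
  have hfin := isFiniteMeasure_rootMeasure f hf hε
  have hfi := integrable_rootKernel f hf hε
  have hint : Integrable (fun z => (Φ z : ℝ)) (Measure.pi fun _ : ι => rootMeasure f ε) := by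
    obtain ⟨C, hC⟩ := Φ.bounded
    refine Integrable.of_bound (C := C + Φ 0) (by fun_prop : Continuous fun z => (Φ z : ℝ)).aestronglyMeasurable
      (ae_of_all _ fun z => ?_)
    have h1 := hC z 0
    rw [NNReal.dist_eq] at h1
    have h2 := abs_le.1 h1
    simp only [norm_eq_abs, NNReal.abs_eq]
    linarith
  simp only [Function.comp]
  rw [integral_complex_ofReal, Complex.ofReal_re, ofReal_integral_eq_lintegral_ofReal hint
    (ae_of_all _ fun z => NNReal.coe_nonneg _), pi_rootMeasure_eq f hf hε,
    lintegral_withDensity_eq_lintegral_mul _ _ (by fun_prop)]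
  · simp
  · refine Measurable.ennreal_ofReal (measurable_fun_prod _ fun i _ => ?_)
    exact (measurable_rootKernel f ε).comp (measurable_pi_apply i)

/-- Upper bound for expected sums over tuples of roots in terms of a bound for mollified
intensities. -/
theorem lintegral_sum_rootTuples_le {ι : Type*} [Fintype ι] [DecidableEq ι] {n : ℕ} (hn : 1 ≤ n)
    (Φ : BoundedContinuousFunction (ι → ℂ) ℝ≥0) {B : ℝ≥0∞}
    (hB : ∀ᶠ ε in 𝓝[>] (0 : ℝ), ∀ z, Φ z ≠ 0 →
      ∫⁻ a, ∏ i, ofReal (rootKernel (vecPoly a) ε (z i)) ∂γ[n] ≤ B) :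
    ∫⁻ a, ∑ p ∈ rootTuples ι (vecPoly a), (Φ p : ℝ≥0∞) ∂γ[n] ≤ B * ∫⁻ z, (Φ z : ℝ≥0∞) := by
  obtain ⟨u, hu⟩ := exists_seq_tendsto (𝓝[>] (0 : ℝ))
  have hjm : ∀ ε : ℝ, Measurable fun x : (Fin (n + 1) → ℝ) × (ι → ℂ) =>
      ofReal (∏ i, rootKernel (vecPoly x.1) ε (x.2 i)) * Φ x.2 := fun ε =>
    (measurable_prod_rootKernel n ε).ennreal_ofReal.mul
      ((by fun_prop : Measurable fun z => (Φ z : ℝ≥0∞)).comp measurable_snd)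
  -- Fatou along a sequence of `ε`, then Tonelli: only an upper bound of the mollified intensities
  -- on the support of `Φ`, for small `ε`, is used.
  calc _ ≤ ∫⁻ a, liminf (fun j => ∫⁻ z : ι → ℂ,
        ofReal (∏ i, rootKernel (vecPoly a) (u j) (z i)) * Φ z) atTop ∂γ[n] := by
        refine lintegral_mono_ae ?_
        filter_upwards [ae_vecPoly_simple hn] with a ha
        exact ((tendsto_lintegral_prod_rootKernel (vecPoly a) (by omega) ha.2 Φ).comp
          hu).liminf_eq.symm.le
    _ ≤ liminf (fun j => ∫⁻ a, (∫⁻ z : ι → ℂ,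
        ofReal (∏ i, rootKernel (vecPoly a) (u j) (z i)) * Φ z) ∂γ[n]) atTop :=
        lintegral_liminf_le fun j => (hjm (u j)).lintegral_prod_right'
    _ ≤ _ := by
        refine liminf_le_of_frequently_le' (Eventually.frequently ?_)
        filter_upwards [hu.eventually hB] with j hj
        rw [lintegral_lintegral_swap (hjm (u j)).aemeasurable,
          ← lintegral_const_mul _ (by fun_prop)]
        refine lintegral_mono fun z => ?_
        rw [lintegral_mul_const]
        · by_cases hz : Φ z = 0
          · simp [hz]
          · refine mul_le_mul' (le_trans (le_of_eq ?_) (hj z hz)) le_rfl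
            refine lintegral_congr fun a => ?_
            rw [ofReal_prod_of_nonneg fun i _ => rootKernel_nonneg _ _ _]
        · exact ((measurable_prod_rootKernel n (u j)).comp
            (by fun_prop : Measurable fun a : Fin (n + 1) → ℝ => (a, z))).ennreal_ofReal

/-- The counting measure of the tuples of roots depends measurably on the coefficients. -/
theorem aemeasurable_sum_dirac_rootTuples (ι : Type*) [Fintype ι] [DecidableEq ι] {n : ℕ}
    (hn : 1 ≤ n) : AEMeasurable (fun a : Fin (n + 1) → ℝ =>
      ∑ p ∈ rootTuples ι (vecPoly a), Measure.dirac p) (γ[n]) := by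
  classical
  set G := {a : Fin (n + 1) → ℝ | (vecPoly a).natDegree = n ∧
    ∀ p ∈ (vecPoly a).roots, (vecPoly a).derivative.eval p ≠ 0}
  have hG : γ[n] Gᶜ = 0 := ae_vecPoly_simple hn
  -- Off a measurable null set the mollified integrals converge, so the integrals of bounded
  -- continuous functions against the root measures are measurable. Closed sets follow by thickened
  -- indicators, Borel sets by the π-λ theorem.
  set N := toMeasurable (γ[n]) Gᶜ with hN
  have hNm : MeasurableSet N := measurableSet_toMeasurable _ _
  have hN0 : γ[n] N = 0 := by rw [hN, measure_toMeasurable, hG]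
  have hNG : ∀ a, a ∉ N → a ∈ G := fun a ha => by
    by_contra h; exact ha (subset_toMeasurable _ _ h)
  set m : (Fin (n + 1) → ℝ) → Measure (ι → ℂ) := fun a =>
    if a ∈ N then 0 else ∑ p ∈ rootTuples ι (vecPoly a), Measure.dirac p with hm
  refine ⟨m, ?_, ?_⟩
  · have hfin : ∀ a, IsFiniteMeasure (m a) := by
      intro a; simp only [hm]; split_ifs <;> infer_instance
    obtain ⟨u, hu⟩ := exists_seq_tendsto (𝓝[>] (0 : ℝ))
    have hint : ∀ Φ : BoundedContinuousFunction (ι → ℂ) ℝ≥0,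
        Measurable fun a => ∫⁻ z, Φ z ∂m a := by
      intro Φ
      refine measurable_of_tendsto_metrizable (f := fun j a => Nᶜ.indicator (fun a => ∫⁻ z : ι → ℂ,
        ofReal (∏ i, rootKernel (vecPoly a) (u j) (z i)) * Φ z) a) (fun j => ?_) ?_
      · refine Measurable.indicator ?_ hNm.compl
        exact Measurable.lintegral_prod_right' (f := fun x : (Fin (n + 1) → ℝ) × (ι → ℂ) =>
          ofReal (∏ i, rootKernel (vecPoly x.1) (u j) (x.2 i)) * Φ x.2)
          ((measurable_prod_rootKernel n (u j)).ennreal_ofReal.mul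
            ((by fun_prop : Measurable fun z => (Φ z : ℝ≥0∞)).comp measurable_snd))
      · rw [tendsto_pi_nhds]
        intro a
        by_cases ha : a ∈ N
        · simp [hm, ha]
        · have hg := hNG a ha
          simp only [hm, if_neg ha, indicator_of_mem (show a ∈ Nᶜ from ha)]
          rw [lintegral_finsetSum_measure]
          simp_rw [lintegral_dirac' _ (by fun_prop : Measurable fun z => (Φ z : ℝ≥0∞))]
          exact (tendsto_lintegral_prod_rootKernel (vecPoly a) (by have := hg.1; omega) hg.2
            Φ).comp hu
    refine Measurable.measure_of_isPiSystem (S := {s | IsClosed s})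
      (by rw [← borel_eq_generateFrom_isClosed]; exact BorelSpace.measurable_eq)
      isPiSystem_isClosed (fun F hF => ?_) ?_
    · have hδ : ∀ j : ℕ, (0 : ℝ) < 1 / (j + 1) := fun j => by positivity
      refine measurable_of_tendsto_metrizable (fun j => hint (thickenedIndicator (hδ j) F)) ?_
      rw [tendsto_pi_nhds]
      intro a
      exact tendsto_lintegral_thickenedIndicator_of_isClosed (m a) hF hδ
        tendsto_one_div_add_atTop_nhds_zero_nat
    · have := hint (BoundedContinuousFunction.const _ 1)
      simpa using this
  · have : ∀ᵐ a ∂γ[n], a ∉ N := measure_eq_zero_iff_ae_notMem.1 hN0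
    filter_upwards [this] with a ha
    simp [hm, ha]

theorem aemeasurable_sum_rootTuples {ι : Type*} [Fintype ι] [DecidableEq ι] {n : ℕ}
    (hn : 1 ≤ n) {G : (ι → ℂ) → ℝ≥0∞} (hG : Measurable G) :
    AEMeasurable (fun a : Fin (n + 1) → ℝ => ∑ p ∈ rootTuples ι (vecPoly a), G p) (γ[n]) := by
  have h := (Measure.measurable_lintegral hG).comp_aemeasurable
    (aemeasurable_sum_dirac_rootTuples ι hn)
  refine h.congr (ae_of_all _ fun a => ?_)
  simp only [Function.comp]
  rw [lintegral_finsetSum_measure]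
  simp_rw [lintegral_dirac' _ hG]

/-- Expected sums over tuples of roots as limits of integrals against mollified intensities. -/
theorem tendsto_integral_mul_rootKernel {ι : Type*} [Fintype ι] [DecidableEq ι] {n : ℕ}
    (hn : 1 ≤ n) {Φ : (ι → ℂ) → ℂ} (hΦ : Continuous Φ) {C : ℝ} (hC : ∀ z, ‖Φ z‖ ≤ C) :
    Tendsto (fun ε => ∫ z, (∫⁻ a, ∏ i, ofReal (rootKernel (vecPoly a) ε (z i))
      ∂γ[n]).toReal • Φ z) (𝓝[>] 0)
      (𝓝 (∫ a, ∑ p ∈ rootTuples ι (vecPoly a), Φ p ∂γ[n])) := by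
  have hC0 : 0 ≤ C := (norm_nonneg _).trans (hC 0)
  have hjm : ∀ ε : ℝ, StronglyMeasurable fun x : (Fin (n + 1) → ℝ) × (ι → ℂ) =>
      (∏ i, rootKernel (vecPoly x.1) ε (x.2 i)) • Φ x.2 := fun ε =>
    ((measurable_prod_rootKernel n ε).smul (hΦ.measurable.comp measurable_snd)).stronglyMeasurable
  have hform : ∀ (a : Fin (n + 1) → ℝ) {ε : ℝ}, 0 < ε → 0 < (vecPoly a).natDegree →
      ∫ z, Φ z ∂Measure.pi (fun _ : ι => rootMeasure (vecPoly a) ε) =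
        ∫ z : ι → ℂ, (∏ i, rootKernel (vecPoly a) ε (z i)) • Φ z := by
    intro a ε hε ha
    rw [pi_rootMeasure_eq _ ha hε, integral_withDensity_eq_integral_toReal_smul]
    · refine integral_congr_ae (ae_of_all _ fun z => ?_)
      simp only
      rw [toReal_ofReal (prod_nonneg fun i _ => rootKernel_nonneg _ _ _)]
    · refine Measurable.ennreal_ofReal (measurable_fun_prod _ fun i _ => ?_)
      exact (measurable_rootKernel _ ε).comp (measurable_pi_apply i)
    · simp
  -- The deterministic mass bound by the degree dominates everything at fixed `n`. It justifies both
  -- the limit in `ε` and the exchange of the integrals.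
  have hmass : ∀ (a : Fin (n + 1) → ℝ) {ε : ℝ}, 0 < ε → (vecPoly a).natDegree = n →
      Measure.pi (fun _ : ι => rootMeasure (vecPoly a) ε) Set.univ ≤ (n : ℝ≥0∞) ^ card ι := by
    intro a ε hε ha
    rw [Measure.pi_univ]
    refine (Finset.prod_le_prod' fun i _ =>
      rootMeasure_univ_le (vecPoly a) (by omega) hε).trans ?_
    rw [ha, prod_const, card_univ]
  have h1 : Tendsto (fun ε => ∫ a, (∫ z : ι → ℂ, (∏ i, rootKernel (vecPoly a) ε (z i)) • Φ z)
      ∂γ[n]) (𝓝[>] 0)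
      (𝓝 (∫ a, ∑ p ∈ rootTuples ι (vecPoly a), Φ p ∂γ[n])) := by
    refine tendsto_integral_filter_of_dominated_convergence
      (fun _ => C * (n : ℝ) ^ card ι) ?_ ?_ (integrable_const _) ?_
    · filter_upwards with ε
      exact (hjm ε).integral_prod_right'.aestronglyMeasurable
    · filter_upwards [self_mem_nhdsWithin] with ε hε
      filter_upwards [ae_vecPoly_simple hn] with a ha
      rw [← hform a hε (by omega)]
      have hfin := isFiniteMeasure_rootMeasure (vecPoly a) (by omega) hε
      refine (norm_integral_le_of_norm_le_const (ae_of_all _ hC)).trans ?_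
      gcongr
      refine toReal_le_of_le_ofReal (by positivity) ((hmass a hε ha.1).trans ?_)
      rw [ofReal_pow (by positivity), ENNReal.ofReal_natCast]
    · filter_upwards [ae_vecPoly_simple hn] with a ha
      refine (tendsto_integral_pi_rootMeasure (ι := ι) (vecPoly a) (by omega) ha.2 hΦ).congr' ?_
      filter_upwards [self_mem_nhdsWithin] with ε hε
      exact hform a hε (by omega)
  refine h1.congr' ?_
  filter_upwards [self_mem_nhdsWithin] with ε hε
  have hprod : ∀ (a : Fin (n + 1) → ℝ) (z : ι → ℂ), ofReal (∏ i, rootKernel (vecPoly a) ε (z i)) =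
      ∏ i, ofReal (rootKernel (vecPoly a) ε (z i)) := fun a z =>
    ofReal_prod_of_nonneg fun i _ => rootKernel_nonneg _ _ _
  rw [integral_integral_swap]
  · refine integral_congr_ae (ae_of_all _ fun z => ?_)
    simp only
    rw [integral_smul_const, integral_eq_lintegral_of_nonneg_ae]
    · simp_rw [hprod]
    · exact ae_of_all _ fun a => prod_nonneg fun i _ => rootKernel_nonneg _ _ _
    · exact ((measurable_prod_rootKernel n ε).comp (by fun_prop : Measurable
        fun a : Fin (n + 1) → ℝ => (a, z))).aestronglyMeasurable
  · refine ⟨(hjm ε).aestronglyMeasurable, ?_⟩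
    have hm := (hjm ε).enorm.aemeasurable (μ := (γ[n]).prod volume)
    rw [hasFiniteIntegral_iff_enorm]
    simp only [Function.uncurry_def]
    rw [lintegral_prod _ hm]
    calc _ ≤ ∫⁻ a, ofReal C * (n : ℝ≥0∞) ^ card ι ∂γ[n] := by
          refine lintegral_mono_ae ?_
          filter_upwards [ae_vecPoly_simple hn] with a ha
          have h2 := hmass a hε ha.1
          rw [pi_rootMeasure_eq _ (by omega) hε, withDensity_apply _ MeasurableSet.univ,
            Measure.restrict_univ] at h2
          refine le_trans ?_ (mul_le_mul' le_rfl h2)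
          rw [← lintegral_const_mul']
          · refine lintegral_mono fun z => ?_
            simp only [enorm_smul]
            rw [mul_comm]
            refine mul_le_mul' ?_ ?_
            · rw [← ofReal_norm]; exact ofReal_le_ofReal (hC z)
            · rw [Real.enorm_of_nonneg (prod_nonneg fun i _ => rootKernel_nonneg _ _ _)]
          · exact ofReal_ne_top
      _ < ∞ := by
          rw [lintegral_const, measure_univ, mul_one]
          exact ENNReal.mul_lt_top ofReal_lt_top (ENNReal.pow_lt_top (by simp))

/-! ### Polar coordinates on the rescaled annulus. -/

/-- The point with rescaled distance `x` to the unit circle and argument `θ`. -/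
def annulusPoint (n : ℕ) (y : ℝ × ℝ) : ℂ :=
  ((1 - y.1 / (n : ℝ) ^ 2 : ℝ) : ℂ) * exp (y.2 * I)

theorem continuous_annulusPoint (n : ℕ) : Continuous (annulusPoint n) := by
  unfold annulusPoint; fun_prop

/-- The area density in the coordinates of `annulusPoint`. -/
def annulusDensity (n : ℕ) (A : ℝ) (y : ℝ × ℝ) : ℝ :=
  (Icc (-A) A ×ˢ Ioo (-π) π).indicator (fun y => (1 - y.1 / (n : ℝ) ^ 2) / (n : ℝ) ^ 2) y

theorem annulusDensity_nonneg {n : ℕ} {A : ℝ} (hA : A < (n : ℝ) ^ 2) (y : ℝ × ℝ) :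
    0 ≤ annulusDensity n A y := by
  refine Set.indicator_nonneg (fun y hy => ?_) y
  have h1 := hy.1.2
  have h2 := hy.1.1
  have hn : 0 < (n : ℝ) ^ 2 := by linarith
  have : y.1 / (n : ℝ) ^ 2 ≤ 1 := by rw [div_le_one hn]; linarith
  have : 0 ≤ 1 - y.1 / (n : ℝ) ^ 2 := by linarith
  positivity

theorem measurable_annulusDensity (n : ℕ) (A : ℝ) : Measurable (annulusDensity n A) :=
  Measurable.indicator (by fun_prop) (measurableSet_Icc.prod measurableSet_Ioo)

theorem integrable_annulusDensity (n : ℕ) (A : ℝ) : Integrable (annulusDensity n A) := by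
  unfold annulusDensity
  rw [integrable_indicator_iff (measurableSet_Icc.prod measurableSet_Ioo)]
  have hc : IntegrableOn (fun y : ℝ × ℝ => (1 - y.1 / (n : ℝ) ^ 2) / (n : ℝ) ^ 2)
      (Icc (-A) A ×ˢ Icc (-π) π) :=
    ContinuousOn.integrableOn_compact (isCompact_Icc.prod isCompact_Icc)
      (by fun_prop : Continuous fun y : ℝ × ℝ =>
        (1 - y.1 / (n : ℝ) ^ 2) / (n : ℝ) ^ 2).continuousOn
  exact hc.mono_set (Set.prod_mono le_rfl Set.Ioo_subset_Icc_self)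

/-- The annulus of points with rescaled distance at most `A` to the unit circle. -/
def annulus (n : ℕ) (A : ℝ) : Set ℂ := {z | |rescaledModulus n z| ≤ A}

theorem continuous_rescaledModulus (n : ℕ) : Continuous (rescaledModulus n) := by
  unfold rescaledModulus; fun_prop

theorem measurableSet_annulus (n : ℕ) (A : ℝ) : MeasurableSet (annulus n A) :=
  (isClosed_le (continuous_rescaledModulus n).abs continuous_const).measurableSet

/-- Polar coordinates with `r = 1 - x / n²`, so that `r dr dθ` becomes `(1 - x / n²) / n² dx dθ`.
The condition `A < n²` keeps the radius positive on the annulus. -/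
theorem restrict_annulus_eq_map {n : ℕ} {A : ℝ} (hA : A < (n : ℝ) ^ 2) (hn : 1 ≤ n) :
    (volume : Measure ℂ).restrict (annulus n A) = ((volume : Measure (ℝ × ℝ)).withDensity
        (fun y => ofReal (annulusDensity n A y))).map (annulusPoint n) := by
  classical
  have hn1 : (1 : ℝ) ≤ n := by exact_mod_cast hn
  have hn0 : 0 < (n : ℝ) ^ 2 := by positivity
  refine Measure.ext fun s hs => ?_
  have hsA := hs.inter (measurableSet_annulus n A)
  rw [Measure.restrict_apply hs, Measure.map_apply (continuous_annulusPoint n).measurable hs,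
    withDensity_apply _ ((continuous_annulusPoint n).measurable hs),
    ← lintegral_indicator ((continuous_annulusPoint n).measurable hs),
    ← lintegral_indicator_one hsA, ← Complex.lintegral_comp_polarCoord_symm,
    ← lintegral_indicator polarCoord.open_target.measurableSet]
  set F : ℝ × ℝ → ℝ≥0∞ := polarCoord.target.indicator fun p =>
    ofReal p.1 • (s ∩ annulus n A).indicator 1 (Complex.polarCoord.symm p) with hF
  have hFm : Measurable F := by
    refine Measurable.indicator ?_ polarCoord.open_target.measurableSet
    refine Measurable.smul (f := fun p : ℝ × ℝ => ofReal p.1) (by fun_prop) ?_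
    refine (measurable_one.indicator hsA).comp ?_
    simp_rw [funext Complex.polarCoord_symm_apply]
    fun_prop
  have hsub : ∀ G : ℝ → ℝ≥0∞, Measurable G → ∫⁻ r, G r =
      ∫⁻ x, ofReal ((n : ℝ) ^ 2)⁻¹ * G (1 - x / (n : ℝ) ^ 2) := by
    intro G hG
    have h1 := lintegral_sub_left_eq_self (μ := (volume : Measure ℝ)) G 1
    rw [← h1, lintegral_const_mul _ (by fun_prop)]
    have h2 := Real.smul_map_volume_mul_left (a := ((n : ℝ) ^ 2)⁻¹) (by positivity)
    conv_lhs => rw [← h2]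
    rw [lintegral_smul_measure, lintegral_map (by fun_prop) (by fun_prop),
      abs_of_pos (by positivity), smul_eq_mul]
    congr 1
    refine lintegral_congr fun x => ?_
    rw [inv_mul_eq_div]
  rw [Measure.volume_eq_prod, lintegral_prod_symm _ hFm.aemeasurable, lintegral_prod_symm]
  · refine lintegral_congr fun θ => ?_
    rw [hsub (fun r => F (r, θ)) (hFm.comp (by fun_prop : Measurable fun r : ℝ => (r, θ)))]
    refine lintegral_congr fun x => ?_
    have hpt : annulusPoint n (x, θ) = Complex.polarCoord.symm (1 - x / (n : ℝ) ^ 2, θ) := by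
      rw [annulusPoint, Complex.polarCoord_symm_apply, Complex.exp_mul_I]
      push_cast; ring
    by_cases hθ : θ ∈ Ioo (-π) π
    · by_cases hx : 0 < 1 - x / (n : ℝ) ^ 2
      · have hmem : ((1 - x / (n : ℝ) ^ 2, θ) : ℝ × ℝ) ∈ polarCoord.target := ⟨hx, hθ⟩
        simp only [hF, indicator_of_mem hmem, ← hpt]
        have hmod : rescaledModulus n (annulusPoint n (x, θ)) = x := by
          rw [rescaledModulus, annulusPoint, norm_mul, norm_exp_ofReal_mul_I, mul_one,
            norm_real, norm_of_nonneg hx.le]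
          field_simp; ring
        have hann : annulusPoint n (x, θ) ∈ annulus n A ↔ x ∈ Icc (-A) A := by
          simp only [annulus, Set.mem_ofPred_eq]
          rw [hmod, abs_le, Set.mem_Icc]
        by_cases hxs : annulusPoint n (x, θ) ∈ s
        · have hxs' : ((x, θ) : ℝ × ℝ) ∈ annulusPoint n ⁻¹' s := hxs
          rw [indicator_of_mem hxs']
          by_cases hxA : x ∈ Icc (-A) A
          · have hmem' : annulusPoint n (x, θ) ∈ s ∩ annulus n A := ⟨hxs, hann.2 hxA⟩
            have hmem'' : ((x, θ) : ℝ × ℝ) ∈ Icc (-A) A ×ˢ Ioo (-π) π :=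
              ⟨hxA, hθ⟩
            rw [indicator_of_mem hmem', annulusDensity, indicator_of_mem hmem'', Pi.one_apply, smul_eq_mul,
              mul_one, ← ofReal_mul (by positivity)]
            congr 1
            simp only; ring
          · rw [indicator_of_notMem (fun h => hxA (hann.1 h.2)), annulusDensity,
              indicator_of_notMem (fun h => hxA h.1)]
            simp
        · have hxs' : ((x, θ) : ℝ × ℝ) ∉ annulusPoint n ⁻¹' s := hxs
          rw [indicator_of_notMem hxs', indicator_of_notMem (fun h => hxs h.1)]
          simp
      · have h1 : ((1 - x / (n : ℝ) ^ 2, θ) : ℝ × ℝ) ∉ polarCoord.target :=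
          fun h => hx h.1
        have h2 : x ∉ Icc (-A) A := by
          intro h; apply hx
          have : x / (n : ℝ) ^ 2 < 1 := by rw [div_lt_one hn0]; linarith [h.2]
          linarith
        simp only [hF, indicator_of_notMem h1]
        rw [Set.indicator_apply, annulusDensity, indicator_of_notMem (fun h => h2 h.1)]
        simp
    · have h1 : ((1 - x / (n : ℝ) ^ 2, θ) : ℝ × ℝ) ∉ polarCoord.target :=
        fun h => hθ h.2
      simp only [hF, indicator_of_notMem h1]
      rw [Set.indicator_apply, annulusDensity, indicator_of_notMem (fun h => hθ h.2)]
      simp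
  · exact ((measurable_annulusDensity n A).ennreal_ofReal.indicator
      ((continuous_annulusPoint n).measurable hs)).aemeasurable

theorem restrict_pi_annulus_eq_map (ι : Type*) [Fintype ι] {n : ℕ} {A : ℝ} (hA : A < (n : ℝ) ^ 2)
    (hn : 1 ≤ n) :
    (volume : Measure (ι → ℂ)).restrict (Set.univ.pi fun _ => annulus n A) =
      ((volume : Measure (ι → ℝ × ℝ)).withDensity
        (fun y => ofReal (∏ i, annulusDensity n A (y i)))).map
        (fun y i => annulusPoint n (y i)) := by
  rw [volume_pi, Measure.restrict_pi_pi, restrict_annulus_eq_map hA hn,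
    ← pi_withDensity_ofReal (fun _ : ι => annulusDensity n A)
      (fun _ => annulusDensity_nonneg hA) (fun _ => integrable_annulusDensity n A)]
  have hs : SigmaFinite (((volume : Measure (ℝ × ℝ)).withDensity
        (fun y => ofReal (annulusDensity n A y))).map (annulusPoint n)) := by
    rw [← restrict_annulus_eq_map hA hn]; infer_instance
  have hs' : SigmaFinite ((volume : Measure (ℝ × ℝ)).withDensity
        (fun y => ofReal (annulusDensity n A y))) := SigmaFinite.withDensity_ofReal _
  exact (Measure.pi_map_pi fun _ => (continuous_annulusPoint n).measurable.aemeasurable).symm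

theorem rescaledModulus_annulusPoint {n : ℕ} (hn : 1 ≤ n) {x θ : ℝ} (hx : x < (n : ℝ) ^ 2) :
    rescaledModulus n (annulusPoint n (x, θ)) = x := by
  have hn0 : 0 < (n : ℝ) ^ 2 := by have : (1 : ℝ) ≤ n := by exact_mod_cast hn
                                   positivity
  have h1 : x / (n : ℝ) ^ 2 < 1 := (div_lt_one hn0).2 hx
  rw [rescaledModulus, annulusPoint, norm_mul, norm_exp_ofReal_mul_I, mul_one,
    norm_real, norm_of_nonneg (by linarith)]
  field_simp; ring

theorem arg_annulusPoint {n : ℕ} (hn : 1 ≤ n) {x θ : ℝ} (hx : x < (n : ℝ) ^ 2)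
    (hθ : θ ∈ Set.Ioc (-π) π) : arg (annulusPoint n (x, θ)) = θ := by
  have hn0 : 0 < (n : ℝ) ^ 2 := by have : (1 : ℝ) ≤ n := by exact_mod_cast hn
                                   positivity
  have h1 : x / (n : ℝ) ^ 2 < 1 := (div_lt_one hn0).2 hx
  rw [annulusPoint, Complex.exp_mul_I]
  exact Complex.arg_mul_cos_add_sin_mul_I (by simpa using h1) hθ

theorem norm_annulusPoint {n : ℕ} (hn : 1 ≤ n) {x θ : ℝ} (hx : x < (n : ℝ) ^ 2) :
    ‖annulusPoint n (x, θ)‖ = 1 - x / (n : ℝ) ^ 2 := by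
  have hn0 : 0 < (n : ℝ) ^ 2 := by have : (1 : ℝ) ≤ n := by exact_mod_cast hn
                                   positivity
  have h1 : x / (n : ℝ) ^ 2 < 1 := (div_lt_one hn0).2 hx
  rw [annulusPoint, norm_mul, norm_exp_ofReal_mul_I, mul_one,
    norm_real, norm_of_nonneg (by linarith)]

/-- Points of a fixed rescaled annulus have powers of modulus close to one. -/
theorem nearCircle_of_mem_annulus {n : ℕ} (hn : 1 ≤ n) {A : ℝ} (hA : 2 * A * (n + 1) ≤ (n : ℝ) ^ 2)
    {z : ℂ} (hz : z ∈ annulus n A) : NearCircle n z := by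
  have hn1 : (1 : ℝ) ≤ n := by exact_mod_cast hn
  have hn0 : 0 < (n : ℝ) ^ 2 := by positivity
  have hA0 : 0 ≤ A := (abs_nonneg _).trans hz
  set t := A / (n : ℝ) ^ 2 with ht
  have ht0 : 0 ≤ t := by positivity
  have htn : t * (n + 1) ≤ 1 / 2 := by
    rw [ht, div_mul_eq_mul_div, div_le_iff₀ hn0]; linarith
  have hz1 : |1 - ‖z‖| ≤ t := by
    have : |(n : ℝ) ^ 2 * (1 - ‖z‖)| ≤ A := hz
    rw [abs_mul, abs_of_pos hn0] at this
    rw [ht, le_div_iff₀ hn0]; linarith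
  obtain ⟨h1, h2⟩ := abs_le.1 hz1
  intro k hk
  have hkn : (k : ℝ) ≤ n + 1 := by exact_mod_cast hk
  have hkt : t * k ≤ 1 / 2 := (mul_le_mul_of_nonneg_left hkn ht0).trans htn
  have ht1 : t ≤ 1 / 2 := by nlinarith
  constructor
  · calc ‖z‖ ^ k ≤ (Real.exp t) ^ k := by
          gcongr
          linarith [Real.add_one_le_exp t]
      _ = Real.exp (t * k) := by rw [← Real.exp_nat_mul]; ring_nf
      _ ≤ Real.exp (1 / 2) := by gcongr
      _ ≤ 2 := by
          have h3 : Real.exp (1 / 2) ^ 2 = Real.exp 1 := by rw [← Real.exp_nat_mul]; norm_num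
          have h4 := Real.exp_one_lt_d9
          nlinarith [Real.exp_pos (1 / 2)]
  · calc (1 / 2 : ℝ) ≤ 1 + k * (-t) := by linarith
      _ ≤ (1 + -t) ^ k := one_add_mul_le_pow (by linarith) k
      _ ≤ ‖z‖ ^ k := by gcongr <;> linarith

theorem norm_one_sub_sq (ρ φ : ℝ) :
    ‖1 - (ρ : ℂ) * exp (φ * I)‖ ^ 2 = (1 - ρ) ^ 2 + 2 * ρ * (1 - cos φ) := by
  rw [← normSq_eq_norm_sq, normSq_apply]
  simp only [Complex.sub_re, Complex.one_re, Complex.re_ofReal_mul, Complex.exp_ofReal_mul_I_re,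
    Complex.sub_im, Complex.one_im, Complex.im_ofReal_mul, Complex.exp_ofReal_mul_I_im]
  linear_combination ρ ^ 2 * Real.sin_sq_add_cos_sq φ

/-- By the law of cosines the square is at least `2 ρ (1 - cos φ) ≥ (1/2) (2 κ²)`. -/
theorem le_norm_one_sub_mul_exp {ρ φ κ : ℝ} (hρ : 1 / 4 ≤ ρ) (hκ : 0 ≤ κ)
    (h : cos φ ≤ 1 - 2 * κ ^ 2) : κ ≤ ‖1 - (ρ : ℂ) * exp (φ * I)‖ := by
  have := norm_one_sub_sq ρ φ
  have h2 : κ ^ 2 ≤ ‖1 - (ρ : ℂ) * exp (φ * I)‖ ^ 2 := by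
    rw [this]; nlinarith [sq_nonneg (1 - ρ), sq_nonneg κ]
  exact (pow_le_pow_iff_left₀ hκ (norm_nonneg _) two_ne_zero).1 h2

/-- Arguments `θ o` that are separated, except within clusters, from each other and from the
negatives of each other modulo `2π`. -/
def AngleSeparated {O S : Type*} (κ : ℝ) (cl : O → S) (θ : O → ℝ) : Prop :=
  (∀ o o', cl o ≠ cl o' → cos (θ o - θ o') ≤ 1 - 2 * κ ^ 2) ∧
    ∀ o o', cos (θ o + θ o') ≤ 1 - 2 * κ ^ 2

theorem AngleSeparated.separatedBy {O S : Type*} {κ : ℝ} (hκ : 0 ≤ κ) {cl : O → S} {z : O → ℂ}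
    (h : AngleSeparated κ cl fun o => arg (z o)) (hz : ∀ o, 1 / 2 ≤ ‖z o‖) :
    SeparatedBy κ cl z := by
  have hpol : ∀ o, z o = (‖z o‖ : ℂ) * exp (arg (z o) * I) := fun o =>
    (Complex.norm_mul_exp_arg_mul_I (z o)).symm
  have hq : ∀ o o', 1 / 4 ≤ ‖z o‖ * ‖z o'‖ := fun o o' => by nlinarith [hz o, hz o']
  refine ⟨fun o o' hoo => ?_, fun o o' => ?_⟩
  · have : z o * starRingEnd ℂ (z o') = ((‖z o‖ * ‖z o'‖ : ℝ) : ℂ) *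
        exp ((arg (z o) - arg (z o') : ℝ) * I) := by
      conv_lhs => rw [hpol o, hpol o']
      rw [map_mul, Complex.conj_ofReal, ← Complex.exp_conj, map_mul, Complex.conj_I,
        Complex.conj_ofReal, mul_mul_mul_comm, ← Complex.exp_add]
      push_cast; ring_nf
    rw [this]
    exact le_norm_one_sub_mul_exp (hq o o') hκ (h.1 o o' hoo)
  · have : z o * z o' = ((‖z o‖ * ‖z o'‖ : ℝ) : ℂ) * exp ((arg (z o) + arg (z o') : ℝ) * I) := by
      conv_lhs => rw [hpol o, hpol o']
      rw [mul_mul_mul_comm, ← Complex.exp_add]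
      push_cast; ring_nf
    rw [this]
    exact le_norm_one_sub_mul_exp (hq o o') hκ (h.2 o o')

/-- Intervals that are compactly contained in `(0, π)` and pairwise separated by `δ` give
separated arguments. -/
theorem angleSeparated_of_mem_Icc {O S : Type*} {cl : O → S} {θ : O → ℝ} {α β : S → ℝ} {δ : ℝ}
    (hδ : 0 < δ) (hα : ∀ s, δ ≤ α s) (hβ : ∀ s, β s ≤ π - δ)
    (hsep : ∀ s s', s ≠ s' → β s + δ ≤ α s' ∨ β s' + δ ≤ α s)
    (hθ : ∀ o, θ o ∈ Icc (α (cl o)) (β (cl o))) :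
    AngleSeparated (√((1 - cos δ) / 2)) cl θ := by
  have hsq : 1 - 2 * √((1 - cos δ) / 2) ^ 2 = cos δ := by
    rw [sq_sqrt (by linarith [Real.cos_le_one δ])]; ring
  have h0 : ∀ o, δ ≤ θ o := fun o => (hα _).trans (hθ o).1
  have h1 : ∀ o, θ o ≤ π - δ := fun o => (hθ o).2.trans (hβ _)
  refine ⟨fun o o' hoo => ?_, fun o o' => ?_⟩
  · rw [hsq, ← Real.cos_abs]
    have hle : δ ≤ |θ o - θ o'| := by
      rcases hsep _ _ hoo with h | h
      · rw [abs_sub_comm]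
        exact le_trans (by linarith [(hθ o).2, (hθ o').1]) (le_abs_self _)
      · exact le_trans (by linarith [(hθ o').2, (hθ o).1]) (le_abs_self _)
    refine Real.cos_le_cos_of_nonneg_of_le_pi hδ.le ?_ hle
    rw [abs_le]; constructor <;> linarith [h0 o, h0 o', h1 o, h1 o']
  · rw [hsq]
    rcases le_total (θ o + θ o') π with h | h
    · exact Real.cos_le_cos_of_nonneg_of_le_pi hδ.le h (by linarith [h0 o, h0 o'])
    · rw [← Real.cos_two_pi_sub]
      exact Real.cos_le_cos_of_nonneg_of_le_pi hδ.le (by linarith) (by linarith [h1 o, h1 o'])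

theorem sqrt_one_sub_cos_pos {δ : ℝ} (hδ : 0 < δ) (hδπ : δ ≤ π) : 0 < √((1 - cos δ) / 2) := by
  refine Real.sqrt_pos.2 ?_
  have := Real.cos_lt_cos_of_nonneg_of_le_pi le_rfl hδπ hδ
  rw [Real.cos_zero] at this; linarith

/-- The test function `ψ(x) χ(θ)` in the coordinates of the rescaled annulus. -/
def blockFn (n : ℕ) (ψ : ℝ → ℂ) (χ : ℝ → ℝ) (z : ℂ) : ℂ :=
  ψ (rescaledModulus n z) * χ (arg z)

/-- `arg` fails to be continuous only on the closed negative half line, and there the function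
vanishes locally: near `0` because the rescaled modulus exceeds `A`, near negative numbers because
the argument is close to `π` or negative. -/
theorem continuous_blockFn {n : ℕ} {ψ : ℝ → ℂ} {χ : ℝ → ℝ} {A α β : ℝ} (hA : A < (n : ℝ) ^ 2)
    (hψ : Continuous ψ) (hψA : ∀ x, A < |x| → ψ x = 0) (hχ : Continuous χ) (hα : 0 < α)
    (hβ : β < π) (hχs : ∀ θ, θ ∉ Icc α β → χ θ = 0) : Continuous (blockFn n ψ χ) := by
  have hr := continuous_rescaledModulus n
  rw [continuous_iff_continuousAt]
  intro z
  by_cases hz : z ∈ Complex.slitPlane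
  · refine ContinuousAt.mul (hψ.comp hr).continuousAt ?_
    exact continuous_ofReal.continuousAt.comp (hχ.continuousAt.comp (Complex.continuousAt_arg hz))
  · suffices h : ∀ᶠ w in 𝓝 z, blockFn n ψ χ w = 0 from
      (continuousAt_const (y := (0 : ℂ))).congr (h.mono fun w hw => hw.symm)
    rw [Complex.mem_slitPlane_iff, not_or, not_lt, not_not] at hz
    obtain ⟨hre, him⟩ := hz
    rcases hre.eq_or_lt with hre | hre
    · have hz0 : z = 0 := Complex.ext hre him
      have h1 : A < rescaledModulus n z := by rw [hz0, rescaledModulus]; simpa using hA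
      filter_upwards [hr.continuousAt.eventually (lt_mem_nhds h1)] with w hw
      rw [blockFn, hψA _ (hw.trans_le (le_abs_self _)), zero_mul]
    · have h1 := Complex.continuousWithinAt_arg_of_re_neg_of_im_zero hre him
      have harg : arg z = π := Complex.arg_eq_pi_iff.2 ⟨hre, him⟩
      have h2 : ∀ᶠ w in 𝓝[{z : ℂ | 0 ≤ z.im}] z, β < arg w :=
        h1.eventually (lt_mem_nhds (by rwa [harg]))
      rw [eventually_nhdsWithin_iff] at h2
      filter_upwards [h2] with w hw
      rw [blockFn, hχs, Complex.ofReal_zero, mul_zero]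
      rintro ⟨h3, h4⟩
      rcases lt_or_ge w.im 0 with h5 | h5
      · have := Complex.arg_neg_iff.2 h5; linarith
      · have := hw h5; linarith

theorem measurable_blockFn {n : ℕ} {ψ : ℝ → ℂ} {χ : ℝ → ℝ} (hψ : Continuous ψ)
    (hχ : Continuous χ) : Measurable (blockFn n ψ χ) := by
  have hr := continuous_rescaledModulus n
  exact (hψ.comp hr).measurable.mul (measurable_ofReal.comp
    (hχ.measurable.comp Complex.measurable_arg))

theorem lintegral_le_of_annulus {n : ℕ} (hn : 1 ≤ n) {A : ℝ} (hA : A < (n : ℝ) ^ 2)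
    {G : ℝ × ℝ → ℝ≥0∞} (hG : Measurable G) {F : ℂ → ℝ≥0∞} (hF : Measurable F)
    (hFA : ∀ z, z ∉ annulus n A → F z = 0)
    (hFG : ∀ z, F z ≤ G (rescaledModulus n z, arg z)) :
    ∫⁻ z, F z ≤ ofReal (2 / (n : ℝ) ^ 2) * ∫⁻ y in Icc (-A) A ×ˢ Ioo (-π) π, G y := by
  have hn1 : (1 : ℝ) ≤ n := by exact_mod_cast hn
  have hn0 : 0 < (n : ℝ) ^ 2 := by positivity
  have h1 : ∫⁻ z, F z = ∫⁻ z in annulus n A, F z := by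
    rw [← lintegral_indicator (measurableSet_annulus n A)]
    refine lintegral_congr fun z => ?_
    by_cases hz : z ∈ annulus n A
    · rw [indicator_of_mem hz]
    · rw [indicator_of_notMem hz, hFA z hz]
  rw [h1, restrict_annulus_eq_map hA hn, lintegral_map hF (continuous_annulusPoint n).measurable,
    lintegral_withDensity_eq_lintegral_mul _ (measurable_annulusDensity n A).ennreal_ofReal
      (g := fun y => F (annulusPoint n y)) (hF.comp (continuous_annulusPoint n).measurable),
    ← lintegral_const_mul _ hG, ← lintegral_indicator (measurableSet_Icc.prod measurableSet_Ioo)]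
  refine lintegral_mono fun y => ?_
  obtain ⟨x, θ⟩ := y
  simp only [Pi.mul_apply]
  by_cases hy : ((x, θ) : ℝ × ℝ) ∈ Icc (-A) A ×ˢ Ioo (-π) π
  · have hx : x < (n : ℝ) ^ 2 := hy.1.2.trans_lt hA
    rw [indicator_of_mem hy, annulusDensity, indicator_of_mem hy]
    refine mul_le_mul' (ofReal_le_ofReal ?_) ?_
    · gcongr
      have h2 : -1 ≤ x / (n : ℝ) ^ 2 := by
        rw [le_div_iff₀ hn0]; linarith [hy.1.1]
      simp only; linarith
    · have := hFG (annulusPoint n (x, θ))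
      rwa [rescaledModulus_annulusPoint hn hx,
        arg_annulusPoint hn hx (Set.Ioo_subset_Ioc_self hy.2)] at this
  · rw [indicator_of_notMem hy, annulusDensity, indicator_of_notMem hy]
    simp

/-- Form of `lintegral_sum_rootTuples_le` for real-valued functions. -/
theorem lintegral_sum_rootTuples_ofReal_le {ι : Type*} [Fintype ι] [DecidableEq ι] {n : ℕ}
    (hn : 1 ≤ n) {Φ : (ι → ℂ) → ℝ} (hΦ : Continuous Φ) (h0 : ∀ z, 0 ≤ Φ z) {C : ℝ}
    (hC : ∀ z, Φ z ≤ C) {B : ℝ≥0∞}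
    (hB : ∀ᶠ ε in 𝓝[>] (0 : ℝ), ∀ z, Φ z ≠ 0 →
      ∫⁻ a, ∏ i, ofReal (rootKernel (vecPoly a) ε (z i)) ∂γ[n] ≤ B) :
    ∫⁻ a, ∑ p ∈ rootTuples ι (vecPoly a), ofReal (Φ p) ∂γ[n] ≤ B * ∫⁻ z, ofReal (Φ z) := by
  set Ψ : BoundedContinuousFunction (ι → ℂ) ℝ≥0 := BoundedContinuousFunction.mkOfBound
    ⟨fun z => (Φ z).toNNReal, by fun_prop⟩ C (fun z w => by
      simp only [ContinuousMap.coe_mk]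
      rw [NNReal.dist_eq, Real.coe_toNNReal _ (h0 z), Real.coe_toNNReal _ (h0 w), abs_le]
      constructor <;> linarith [h0 z, h0 w, hC z, hC w]) with hΨ
  have h := lintegral_sum_rootTuples_le hn Ψ (B := B) (hB.mono fun ε hε z hz => hε z fun h => by
    apply hz; simp [hΨ, h])
  exact h

theorem sum_rootTuples_prod {ι R : Type*} [Fintype ι] [DecidableEq ι] [CommSemiring R] (f : ℂ[X])
    (g : ι → ℂ → R) :
    ∑ p ∈ rootTuples ι f, ∏ i, g i (p i) = ∏ i, ∑ p ∈ f.roots.toFinset, g i p :=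
  (Finset.prod_univ_sum (fun _ => f.roots.toFinset) fun i p => g i p).symm

theorem sum_rootTuples_unit {R : Type*} [CommSemiring R] (f : ℂ[X]) (g : ℂ → R) :
    ∑ p ∈ rootTuples Unit f, g (p ()) = ∑ p ∈ f.roots.toFinset, g p := by
  have := sum_rootTuples_prod (ι := Unit) f fun _ => g
  simpa using this

theorem eventually_annulus (A : ℝ) : ∀ᶠ n : ℕ in atTop, 2 ≤ n ∧ A < (n : ℝ) ^ 2 ∧
    2 * A * (n + 1) ≤ (n : ℝ) ^ 2 := by
  filter_upwards [eventually_ge_atTop (max 2 ⌈4 * |A| + 2⌉₊)] with n hn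
  have h1 : 2 ≤ n := le_of_max_le_left hn
  have h2 : 4 * |A| + 2 ≤ n := (Nat.le_ceil _).trans (by exact_mod_cast le_of_max_le_right hn)
  have h3 := le_abs_self A
  have h4 := abs_nonneg A
  refine ⟨h1, by nlinarith, ?_⟩
  have h5 : 2 * A * (n + 1) ≤ 2 * |A| * (n + 1) := by gcongr
  nlinarith

/-! ### Block systems; bounds for pairs in a block and for roots near the real axis. -/

/-- A family of test functions `ψ s (x)`, `χ s (θ)` where the `χ s` are supported in separated
intervals of length at most `h`. -/
structure IsBlockSystem {S : Type*} (A h δ : ℝ) (ψ : S → ℝ → ℂ) (χ : S → ℝ → ℝ) (α β : S → ℝ) :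
    Prop where
  continuous_fst : ∀ s, Continuous (ψ s)
  fst_eq_zero : ∀ s x, A < |x| → ψ s x = 0
  norm_fst_le : ∀ s x, ‖ψ s x‖ ≤ 2
  continuous_snd : ∀ s, Continuous (χ s)
  snd_nonneg : ∀ s θ, 0 ≤ χ s θ
  snd_le_one : ∀ s θ, χ s θ ≤ 1
  snd_eq_zero : ∀ s θ, θ ∉ Icc (α s) (β s) → χ s θ = 0
  pos : 0 < δ
  le_pi : δ ≤ π
  le_left : ∀ s, δ ≤ α s
  right_le : ∀ s, β s ≤ π - δ
  separated : ∀ s s', s ≠ s' → β s + δ ≤ α s' ∨ β s' + δ ≤ α s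
  length_le : ∀ s, β s - α s ≤ h
  nonneg_left : 0 ≤ A
  nonneg_length : 0 ≤ h

namespace IsBlockSystem

variable {S : Type*} {A h δ : ℝ} {ψ : S → ℝ → ℂ} {χ : S → ℝ → ℝ} {α β : S → ℝ}

theorem continuous_blockFn (H : IsBlockSystem A h δ ψ χ α β) {n : ℕ} (hA : A < (n : ℝ) ^ 2)
    (s : S) : Continuous (blockFn n (ψ s) (χ s)) :=
  _root_.continuous_blockFn hA (H.continuous_fst s) (H.fst_eq_zero s) (H.continuous_snd s)
    (H.pos.trans_le (H.le_left s)) (by linarith [H.right_le s, H.pos]) (H.snd_eq_zero s)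

theorem norm_blockFn_le (H : IsBlockSystem A h δ ψ χ α β) (n : ℕ) (s : S) (z : ℂ) :
    ‖blockFn n (ψ s) (χ s) z‖ ≤ 2 := by
  rw [blockFn, norm_mul, norm_real, norm_of_nonneg (H.snd_nonneg s _)]
  have := H.norm_fst_le s (rescaledModulus n z)
  have := H.snd_le_one s (arg z)
  have := H.snd_nonneg s (arg z)
  have := norm_nonneg (ψ s (rescaledModulus n z))
  nlinarith

theorem mem_of_blockFn_ne_zero (H : IsBlockSystem A h δ ψ χ α β) {n : ℕ} {s : S} {z : ℂ}
    (hz : blockFn n (ψ s) (χ s) z ≠ 0) :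
    z ∈ annulus n A ∧ arg z ∈ Icc (α s) (β s) := by
  constructor
  · by_contra h1
    exact hz (by rw [blockFn, H.fst_eq_zero s _ (not_le.1 h1), zero_mul])
  · by_contra h1
    exact hz (by rw [blockFn, H.snd_eq_zero s _ h1, Complex.ofReal_zero, mul_zero])

/-- The constant collects the density bound `2 / n²`, the bound `2` for the function, and the
lengths `2 A` and `h` of the sides of its support. -/
theorem lintegral_blockFn_le (H : IsBlockSystem A h δ ψ χ α β) {n : ℕ} (hn : 1 ≤ n)
    (hA : A < (n : ℝ) ^ 2) (s : S) :
    ∫⁻ z, ofReal ‖blockFn n (ψ s) (χ s) z‖ ≤ ofReal (8 * A * h / (n : ℝ) ^ 2) := by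
  have hA0 := H.nonneg_left
  have hh := H.nonneg_length
  refine (lintegral_le_of_annulus hn hA
    (G := fun y => (Set.univ ×ˢ Icc (α s) (β s)).indicator (fun _ => ofReal 2) y)
    (measurable_const.indicator (MeasurableSet.univ.prod measurableSet_Icc))
    (measurable_blockFn (H.continuous_fst s) (H.continuous_snd s)).norm.ennreal_ofReal
    (fun z hz => ?_) fun z => ?_).trans ?_
  · by_contra h1
    exact hz (H.mem_of_blockFn_ne_zero (s := s) fun h2 => h1 (by simp [h2])).1
  · by_cases hz : blockFn n (ψ s) (χ s) z = 0
    · simp [hz]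
    · have hmem : (rescaledModulus n z, arg z) ∈ Set.univ ×ˢ Icc (α s) (β s) :=
        ⟨trivial, (H.mem_of_blockFn_ne_zero hz).2⟩
      rw [indicator_of_mem hmem]
      exact ofReal_le_ofReal (H.norm_blockFn_le n s z)
  · rw [lintegral_indicator (MeasurableSet.univ.prod measurableSet_Icc), setLIntegral_const,
      Measure.restrict_apply (MeasurableSet.univ.prod measurableSet_Icc), Set.prod_inter_prod]
    calc _ ≤ ofReal (2 / (n : ℝ) ^ 2) * (ofReal 2 * volume (Icc (-A) A ×ˢ Icc (α s) (β s))) := by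
          gcongr
          · exact Set.inter_subset_right
          · exact Set.inter_subset_left
      _ ≤ ofReal (2 / (n : ℝ) ^ 2) * (ofReal 2 * (ofReal (2 * A) * ofReal h)) := by
          rw [Measure.volume_eq_prod, Measure.prod_prod, Real.volume_Icc, Real.volume_Icc]
          gcongr
          · linarith
          · exact H.length_le s
      _ = _ := by
          rw [← ofReal_mul (by positivity), ← ofReal_mul (by positivity),
            ← ofReal_mul (by positivity)]
          congr 1; ring

/-- The expected number of tuples of roots with one point in each block and an additional point
in one block. -/
theorem lintegral_pair_le [Fintype S] [DecidableEq S] (H : IsBlockSystem A h δ ψ χ α β) :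
    ∀ᶠ n : ℕ in atTop, ∀ s₀ : S, ∫⁻ a, ∑ p ∈ rootTuples (Option S) (vecPoly a),
      (if p none = p (some s₀) then 0 else
        ∏ o : Option S, ofReal ‖blockFn n (ψ (o.getD s₀)) (χ (o.getD s₀)) (p o)‖)
        ∂γ[n] ≤
      intensityConst (card S + 1) * ofReal ((8 * A * h) ^ (card S + 1)) := by
  have hA0 := H.nonneg_left
  have hh := H.nonneg_length
  set κ := √((1 - cos δ) / 2) with hκ
  have hκ0 : 0 < κ := sqrt_one_sub_cos_pos H.pos H.le_pi
  filter_upwards [eventually_annulus A, eventually_ge_atTop ⌈10 ^ 13 / κ * (card S + 1)⌉₊]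
    with n hn hnκ s₀
  obtain ⟨hn2, hnA, hnA'⟩ := hn
  have hn1 : 1 ≤ n := by omega
  have hn1' : (1 : ℝ) ≤ n := by exact_mod_cast hn1
  have hnκ' : 10 ^ 13 / κ * (card S + 1) ≤ n :=
    (Nat.le_ceil _).trans (by exact_mod_cast hnκ)
  set y : Option S → ℂ → ℝ := fun o z => ‖blockFn n (ψ (o.getD s₀)) (χ (o.getD s₀)) z‖ with hy
  have hyc : ∀ o, Continuous (y o) := fun o => (H.continuous_blockFn hnA _).norm
  have hy0 : ∀ o z, 0 ≤ y o z := fun o z => norm_nonneg _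
  have hy2 : ∀ o z, y o z ≤ 2 := fun o z => H.norm_blockFn_le n _ z
  -- A continuous cutoff away from the diagonal. On its support the two points are at distance at
  -- least `1 / (j + 1)`, so the requirement `ε ≤ ‖w - z‖²` holds for small `ε`. The resulting bound
  -- does not depend on `j`, and Fatou removes the cutoff.
  set ramp : ℕ → (Option S → ℂ) → ℝ := fun j p =>
    max 0 (min 1 (j * ‖p none - p (some s₀)‖ - 1)) with hramp
  have hr0 : ∀ j p, 0 ≤ ramp j p := fun j p => le_max_left _ _
  have hr1 : ∀ j p, ramp j p ≤ 1 := fun j p => max_le zero_le_one (min_le_left _ _)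
  have hrc : ∀ j, Continuous (ramp j) := fun j => by simp only [hramp]; fun_prop
  set Φ : ℕ → (Option S → ℂ) → ℝ := fun j p => ramp j p * ∏ o, y o (p o) with hΦ
  have hprod0 : ∀ p : Option S → ℂ, 0 ≤ ∏ o, y o (p o) := fun p =>
    prod_nonneg fun o _ => hy0 o _
  have hΦc : ∀ j, Continuous (Φ j) := fun j =>
    (hrc j).mul (continuous_finsetProd _ fun o _ => (hyc o).comp (continuous_apply o))
  have hΦ0 : ∀ j p, 0 ≤ Φ j p := fun j p => mul_nonneg (hr0 j p) (hprod0 p)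
  have hΦle : ∀ j p, Φ j p ≤ ∏ o, y o (p o) := fun j p =>
    mul_le_of_le_one_left (hprod0 p) (hr1 j p)
  have hint : ∀ j, ∫⁻ z, ofReal (Φ j z) ≤ ofReal ((8 * A * h / (n : ℝ) ^ 2) ^ (card S + 1)) := by
    intro j
    calc _ ≤ ∫⁻ z : Option S → ℂ, ofReal (∏ o, y o (z o)) :=
          lintegral_mono fun z => ofReal_le_ofReal (hΦle j z)
      _ = ∏ o, ∫⁻ z, ofReal (y o z) :=
          lintegral_fintype_prod_ofReal y hy0 fun o => ⟨(hyc o).aestronglyMeasurable, by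
            rw [hasFiniteIntegral_iff_ofReal (ae_of_all _ (hy0 o))]
            exact (H.lintegral_blockFn_le hn1 hnA _).trans_lt ofReal_lt_top⟩
      _ ≤ ∏ _o : Option S, ofReal (8 * A * h / (n : ℝ) ^ 2) :=
          Finset.prod_le_prod' fun o _ => H.lintegral_blockFn_le hn1 hnA _
      _ = _ := by
          rw [prod_const, card_univ, Fintype.card_option, ofReal_pow (by positivity)]
  have hj : ∀ j : ℕ, ∫⁻ a, ∑ p ∈ rootTuples (Option S) (vecPoly a), ofReal (Φ j p)
      ∂γ[n] ≤ intensityConst (card S + 1) * ofReal ((8 * A * h) ^ (card S + 1)) := by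
    intro j
    have hB := lintegral_sum_rootTuples_ofReal_le hn1 (hΦc j) (hΦ0 j)
      (C := 2 ^ card (Option S)) (fun p => (hΦle j p).trans
        ((prod_le_prod (fun o _ => hy0 o _) fun o _ => hy2 o _).trans (by simp)))
      (B := intensityConst (card S + 1) * ofReal ((n : ℝ) ^ (2 * (card S + 1)))) (by
        have hε : ∀ᶠ ε in 𝓝[>] (0 : ℝ), ε < (1 / ((j : ℝ) + 1)) ^ 2 :=
          eventually_nhdsWithin_of_eventually_nhds (gt_mem_nhds (by positivity))
        filter_upwards [self_mem_nhdsWithin, hε] with ε hε0 hε1 z hz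
        have hz1 : ramp j z ≠ 0 := left_ne_zero_of_mul hz
        have hz2 : ∀ o, blockFn n (ψ (o.getD s₀)) (χ (o.getD s₀)) (z o) ≠ 0 := fun o h0 =>
          right_ne_zero_of_mul hz (prod_eq_zero (mem_univ o) (by simp [hy, h0]))
        have hz3 := fun o => H.mem_of_blockFn_ne_zero (hz2 o)
        have hnc : ∀ o, NearCircle n (z o) := fun o => nearCircle_of_mem_annulus hn1 hnA' (hz3 o).1
        have hdist : 1 / (j + 1 : ℝ) ≤ ‖z none - z (some s₀)‖ := by
          by_contra hcon
          push Not at hcon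
          apply hz1
          have : (j : ℝ) * ‖z none - z (some s₀)‖ ≤ 1 := by
            rw [lt_div_iff₀ (by positivity)] at hcon
            nlinarith [norm_nonneg (z none - z (some s₀))]
          simp only [hramp]
          rw [max_eq_left]
          exact (min_le_right _ _).trans (by linarith)
        have hsep : SeparatedBy κ (fun o : Option S => o.getD s₀) z :=
          (angleSeparated_of_mem_Icc H.pos H.le_left H.right_le H.separated
            (cl := fun o : Option S => o.getD s₀) fun o => (hz3 o).2).separatedBy hκ0.le
            fun o => (hnc o).norm_ge
        have hzz : (fun o : Option S => o.elim (z none) fun s => z (some s)) = z := by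
          funext o; cases o <;> rfl
        have := lintegral_rootKernel_mul_prod_le hn2 (fun s => z (some s)) (z none) s₀
          (fun s => hnc (some s)) (hnc none) (fun h0 => by
            rw [h0, sub_self, norm_zero] at hdist
            have : (0 : ℝ) < 1 / (j + 1) := by positivity
            linarith) hκ0 (by rw [hzz]; exact hsep) hnκ' hε0
          (hε1.le.trans (by gcongr))
        refine le_trans (le_of_eq ?_) this
        refine lintegral_congr fun a => prod_congr rfl fun o _ => ?_
        exact congrArg (fun w => ofReal (rootKernel (vecPoly a) ε w)) (congrFun hzz o).symm)
    refine hB.trans ((mul_le_mul' le_rfl (hint j)).trans ?_)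
    rw [mul_assoc, ← ofReal_mul (by positivity)]
    refine mul_le_mul' le_rfl (ofReal_le_ofReal (le_of_eq ?_))
    rw [pow_mul, ← mul_pow]
    congr 1
    field_simp
  calc _ ≤ ∫⁻ a, liminf (fun j : ℕ => ∑ p ∈ rootTuples (Option S) (vecPoly a),
        ofReal (Φ j p)) atTop ∂γ[n] := by
        refine lintegral_mono fun a => ?_
        have : Tendsto (fun j : ℕ => ∑ p ∈ rootTuples (Option S) (vecPoly a),
          ofReal (Φ j p)) atTop (𝓝 (∑ p ∈ rootTuples (Option S) (vecPoly a),
            (if p none = p (some s₀) then 0 else ∏ o : Option S, ofReal (y o (p o))))) := by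
          refine tendsto_finsetSum _ fun p _ => ?_
          refine tendsto_const_nhds.congr' ?_
          split_ifs with hp
          · filter_upwards with j
            simp [hΦ, hramp, hp]
          · have hpos : 0 < ‖p none - p (some s₀)‖ := norm_pos_iff.2 (sub_ne_zero.2 hp)
            filter_upwards [eventually_ge_atTop ⌈2 / ‖p none - p (some s₀)‖⌉₊] with j hj
            have : 2 / ‖p none - p (some s₀)‖ ≤ j := Nat.ceil_le.1 hj
            rw [div_le_iff₀ hpos] at this
            have hr : ramp j p = 1 := by
              simp only [hramp]
              rw [min_eq_left (by linarith), max_eq_right zero_le_one]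
            simp only [hΦ]
            rw [hr, one_mul, ofReal_prod_of_nonneg fun o _ => hy0 o _]
        exact this.liminf_eq.symm.le
    _ ≤ liminf (fun j : ℕ => ∫⁻ a, ∑ p ∈ rootTuples (Option S) (vecPoly a),
        ofReal (Φ j p) ∂γ[n]) atTop :=
        lintegral_liminf_le' fun j => aemeasurable_sum_rootTuples hn1
          (hΦc j).measurable.ennreal_ofReal
    _ ≤ _ := liminf_le_of_frequently_le' (Frequently.of_forall hj)

end IsBlockSystem

/-- Upper bound for the expected number of roots in the upper half plane, uniform near the real
axis. -/
theorem lintegral_sum_upper_roots_le {n : ℕ} {A : ℝ} (hn2 : 2 ≤ n)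
    (hnA : A < (n : ℝ) ^ 2) (hnA' : 2 * A * (n + 1) ≤ (n : ℝ) ^ 2) {ψ v : ℝ → ℝ}
    (hψ : Continuous ψ) (hψA : ∀ x, A < |x| → ψ x = 0) (hψ0 : ∀ x, 0 ≤ ψ x) (hψ2 : ∀ x, ψ x ≤ 2)
    (hv : Continuous v) (hv0 : ∀ x, 0 ≤ v x) (hv1 : ∀ x, v x ≤ 1) :
    ∫⁻ a, ∑ p ∈ (vecPoly a).roots.toFinset, (if 0 < p.im then
        ofReal (ψ (rescaledModulus n p) * v (arg p)) else 0)
        ∂γ[n] ≤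
      intensityConst 1 * (ofReal (8 * A) * ∫⁻ θ in Ioo 0 π, ofReal (v θ)) := by
  have hn1 : 1 ≤ n := by omega
  have hn1' : (1 : ℝ) ≤ n := by exact_mod_cast hn1
  -- A cutoff away from the real axis. It makes the test function continuous across the cut of `arg`
  -- and ensures `ε ≤ z.im²` for small `ε`; the bound is uniform in `j`, so Fatou removes the
  -- cutoff.
  set ramp : ℕ → ℂ → ℝ := fun j z => max 0 (min 1 (j * z.im - 1)) with hramp
  have hr0 : ∀ j p, 0 ≤ ramp j p := fun j p => le_max_left _ _
  have hr1 : ∀ j p, ramp j p ≤ 1 := fun j p => max_le zero_le_one (min_le_left _ _)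
  have hrc : ∀ j, Continuous (ramp j) := fun j => by simp only [hramp]; fun_prop
  have hrim : ∀ j p, ramp j p ≠ 0 → 1 / (j + 1 : ℝ) < p.im := by
    intro j p hp
    by_contra hcon
    push Not at hcon
    apply hp
    have : (j : ℝ) * p.im ≤ 1 := by
      rw [le_div_iff₀ (by positivity)] at hcon
      rcases le_total p.im 0 with h | h
      · nlinarith [Nat.cast_nonneg (α := ℝ) j]
      · linarith
    simp only [hramp]
    rw [max_eq_left]
    exact (min_le_right _ _).trans (by linarith)
  set w : ℂ → ℝ := fun z => ψ (rescaledModulus n z) * v (arg z) with hw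
  have hw0 : ∀ z, 0 ≤ w z := fun z => mul_nonneg (hψ0 _) (hv0 _)
  have hw2 : ∀ z, w z ≤ 2 * v (arg z) := fun z =>
    mul_le_mul_of_nonneg_right (hψ2 _) (hv0 _)
  set φ : ℕ → ℂ → ℝ := fun j z => ramp j z * w z with hφ
  have hφ0 : ∀ j z, 0 ≤ φ j z := fun j z => mul_nonneg (hr0 j z) (hw0 z)
  have hφw : ∀ j z, φ j z ≤ w z := fun j z => mul_le_of_le_one_left (hw0 z) (hr1 j z)
  have hφc : ∀ j, Continuous (φ j) := by
    intro j
    rw [continuous_iff_continuousAt]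
    intro z
    rcases lt_or_ge 0 z.im with hz | hz
    · refine (hrc j).continuousAt.mul ((hψ.comp (continuous_rescaledModulus n)).continuousAt.mul
        (hv.continuousAt.comp (Complex.continuousAt_arg ?_)))
      rw [Complex.mem_slitPlane_iff]; exact Or.inr hz.ne'
    · have h1 : ∀ᶠ u : ℂ in 𝓝 z, u.im < 1 / (j + 1 : ℝ) :=
        Complex.continuous_im.continuousAt.eventually (gt_mem_nhds (hz.trans_lt (by positivity)))
      refine (continuousAt_const (y := (0 : ℝ))).congr ?_
      filter_upwards [h1] with u hu
      by_contra h2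
      exact absurd (hrim j u fun h3 => h2 (by simp [hφ, h3])) (not_lt.2 hu.le)
  have hm2 : Measurable fun y : ℝ × ℝ =>
      (Ioo 0 π).indicator (fun θ => ofReal (v θ)) y.2 :=
    (hv.measurable.ennreal_ofReal.indicator measurableSet_Ioo).comp measurable_snd
  have hint : ∀ j, ∫⁻ z, ofReal (φ j z) ≤ ofReal ((n : ℝ) ^ 2)⁻¹ * (ofReal (8 * A) *
        ∫⁻ θ in Ioo 0 π, ofReal (v θ)) := by
    intro j
    refine (lintegral_le_of_annulus hn1 hnA (G := fun y => ofReal 2 *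
        (Ioo 0 π).indicator (fun θ => ofReal (v θ)) y.2)
      (measurable_const.mul hm2) (hφc j).measurable.ennreal_ofReal (fun z hz => ?_) fun z => ?_).trans ?_
    · have : ψ (rescaledModulus n z) = 0 := hψA _ (not_le.1 hz)
      simp [hφ, hw, this]
    · by_cases hz : ramp j z = 0
      · simp [hφ, hz]
      · have him : 0 < z.im := lt_trans (by positivity) (hrim j z hz)
        have hmem : arg z ∈ Ioo 0 π := by
          refine ⟨lt_of_le_of_ne (Complex.arg_nonneg_iff.2 him.le) fun h => ?_,
            lt_of_le_of_ne (Complex.arg_le_pi z) fun h => ?_⟩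
          · exact him.ne' (Complex.arg_eq_zero_iff.1 h.symm).2
          · exact him.ne' (Complex.arg_eq_pi_iff.1 h).2
        rw [indicator_of_mem hmem, ← ofReal_mul (by norm_num)]
        exact ofReal_le_ofReal ((hφw j z).trans (hw2 z))
    · rw [lintegral_const_mul _ hm2]
      have hset : ∫⁻ y in Icc (-A) A ×ˢ Ioo (-π) π,
          (Ioo 0 π).indicator (fun θ => ofReal (v θ)) y.2 ≤
          ofReal (2 * A) * ∫⁻ θ in Ioo 0 π, ofReal (v θ) := by
        rw [Measure.volume_eq_prod, ← Measure.prod_restrict, lintegral_prod _ hm2.aemeasurable]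
        simp only [lintegral_const, Measure.restrict_apply MeasurableSet.univ, Set.univ_inter,
          Real.volume_Icc]
        rw [mul_comm]
        refine mul_le_mul' (le_of_eq (by congr 1; ring)) ?_
        refine (setLIntegral_le_lintegral _ _).trans (le_of_eq ?_)
        rw [lintegral_indicator measurableSet_Ioo]
      refine (mul_le_mul' le_rfl (mul_le_mul' le_rfl hset)).trans (le_of_eq ?_)
      rw [← mul_assoc, ← mul_assoc, ← mul_assoc, ← ofReal_mul (by positivity),
        ← ofReal_mul (by positivity), ← ofReal_mul (by positivity)]
      congr 2
      ring
  have hj : ∀ j : ℕ, ∫⁻ a, ∑ p ∈ (vecPoly a).roots.toFinset, ofReal (φ j p)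
      ∂γ[n] ≤ intensityConst 1 * (ofReal (8 * A) * ∫⁻ θ in Ioo 0 π, ofReal (v θ)) := by
    intro j
    have hB := lintegral_sum_rootTuples_ofReal_le (ι := Unit) hn1 (Φ := fun z => φ j (z ()))
      ((hφc j).comp (continuous_apply ())) (fun z => hφ0 j _) (C := 2)
      (fun z => (hφw j _).trans ((hw2 _).trans (by linarith [hv1 (arg (z ()))])))
      (B := intensityConst 1 * ofReal ((n : ℝ) ^ 2)) (by
        have hε : ∀ᶠ ε in 𝓝[>] (0 : ℝ), ε < (1 / ((j : ℝ) + 1)) ^ 2 :=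
          eventually_nhdsWithin_of_eventually_nhds (gt_mem_nhds (by positivity))
        filter_upwards [self_mem_nhdsWithin, hε] with ε hε0 hε1 z hz
        have hz1 := hrim j _ (left_ne_zero_of_mul hz)
        have him : 0 < (z ()).im := lt_trans (by positivity) hz1
        have hz2 : ψ (rescaledModulus n (z ())) ≠ 0 :=
          left_ne_zero_of_mul (right_ne_zero_of_mul hz)
        have hz3 : z () ∈ annulus n A := by
          by_contra h; exact hz2 (hψA _ (not_le.1 h))
        have := lintegral_rootKernel_le hn2 (nearCircle_of_mem_annulus hn1 hnA' hz3) him.ne' hε0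
          (hε1.le.trans (by gcongr))
        simpa using this)
    have e1 : ∀ a : Fin (n + 1) → ℝ, ∑ p ∈ rootTuples Unit (vecPoly a), ofReal (φ j (p ())) =
        ∑ p ∈ (vecPoly a).roots.toFinset, ofReal (φ j p) := fun a =>
      sum_rootTuples_unit (vecPoly a) fun p => ofReal (φ j p)
    simp_rw [e1] at hB
    have e2 : ∫⁻ z : Unit → ℂ, ofReal (φ j (z ())) = ∫⁻ z, ofReal (φ j z) := by
      have := lintegral_fintype_prod_ofReal (ι := Unit) (fun _ => φ j) (fun _ => hφ0 j)
        fun _ => ⟨(hφc j).aestronglyMeasurable, by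
          rw [hasFiniteIntegral_iff_ofReal (ae_of_all _ (hφ0 j))]
          refine (hint j).trans_lt (ENNReal.mul_lt_top ofReal_lt_top
            (ENNReal.mul_lt_top ofReal_lt_top ?_))
          calc _ ≤ ∫⁻ θ in Ioo 0 π, 1 :=
                lintegral_mono fun θ => by
                  rw [← ofReal_one]; exact ofReal_le_ofReal (hv1 θ)
            _ < ∞ := by simp⟩
      simpa using this
    rw [e2] at hB
    refine hB.trans ((mul_le_mul' le_rfl (hint j)).trans (le_of_eq ?_))
    rw [mul_assoc, ← mul_assoc (ofReal ((n : ℝ) ^ 2)), ← ofReal_mul (by positivity),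
      mul_inv_cancel₀ (by positivity), ofReal_one, one_mul]
  calc _ ≤ ∫⁻ a, liminf (fun j : ℕ => ∑ p ∈ (vecPoly a).roots.toFinset,
        ofReal (φ j p)) atTop ∂γ[n] := by
        refine lintegral_mono fun a => ?_
        have : Tendsto (fun j : ℕ => ∑ p ∈ (vecPoly a).roots.toFinset, ofReal (φ j p)) atTop
            (𝓝 (∑ p ∈ (vecPoly a).roots.toFinset, (if 0 < p.im then ofReal (w p) else 0))) := by
          refine tendsto_finsetSum _ fun p _ => ?_
          refine tendsto_const_nhds.congr' ?_
          split_ifs with hp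
          · filter_upwards [eventually_ge_atTop ⌈2 / p.im⌉₊] with j hj
            have : 2 / p.im ≤ j := Nat.ceil_le.1 hj
            rw [div_le_iff₀ hp] at this
            have hr : ramp j p = 1 := by
              simp only [hramp]
              rw [min_eq_left (by linarith), max_eq_right zero_le_one]
            simp only [hφ]
            rw [hr, one_mul]
          · filter_upwards with j
            have hr : ramp j p = 0 := by
              by_contra h
              exact hp (lt_trans (by positivity) (hrim j p h))
            simp [hφ, hr]
        exact this.liminf_eq.symm.le
    _ ≤ liminf (fun j : ℕ => ∫⁻ a, ∑ p ∈ (vecPoly a).roots.toFinset,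
        ofReal (φ j p) ∂γ[n]) atTop := by
        refine lintegral_liminf_le' fun j => ?_
        refine (aemeasurable_sum_rootTuples (ι := Unit) hn1 (G := fun z => ofReal (φ j (z ())))
          ((hφc j).measurable.ennreal_ofReal.comp (measurable_pi_apply ()))).congr
          (ae_of_all _ fun a => ?_)
        exact sum_rootTuples_unit (vecPoly a) fun p => ofReal (φ j p)
    _ ≤ _ := liminf_le_of_frequently_le' (Frequently.of_forall hj)

/-! ### Asymptotic covariances and the limiting intensities. -/

/-- The average of `(k / n) ^ m q ^ k`. -/
def weightedMean (m n : ℕ) (q : ℂ) : ℂ :=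
  (∑ k ∈ range (n + 1), (((k : ℝ) / n) ^ m : ℝ) * q ^ k) / n

/-- The weights are monotone with values in `[0, 1]`, so their variation is at most one and
summation by parts bounds the sum uniformly in `n`. Division by `n` does the rest. -/
theorem tendsto_weightedMean_zero (m : ℕ) {q : ℕ → ℂ} {κ : ℝ} (hκ : 0 < κ)
    (hq : ∀ᶠ n : ℕ in atTop, (∀ k ≤ n + 1, ‖q n‖ ^ k ≤ 4) ∧ κ ≤ ‖1 - q n‖) :
    Tendsto (fun n => weightedMean m n (q n)) atTop (𝓝 0) := by
  have hlim : Tendsto (fun n : ℕ => (5 * 1 + 4 * 1) / κ / (n : ℝ)) atTop (𝓝 0) :=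
    tendsto_const_div_atTop_nhds_zero_nat _
  refine squeeze_zero_norm' ?_ hlim
  filter_upwards [hq, eventually_ge_atTop 1] with n hn hn1
  have hn0 : (0 : ℝ) < n := by exact_mod_cast hn1
  rw [weightedMean, norm_div, norm_natCast]
  gcongr
  have hmono : ∀ k : ℕ, ((k : ℝ) / n) ^ m ≤ (((k + 1 : ℕ) : ℝ) / n) ^ m := fun k => by
    push_cast; gcongr; linarith
  refine norm_sum_mul_pow_le hκ (fun k hk => ?_) ?_ hn.1 hn.2
  · rw [norm_real, norm_of_nonneg (by positivity)]
    refine pow_le_one₀ (by positivity) ?_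
    rw [div_le_one hn0]; exact_mod_cast hk
  · have : ∀ k ∈ range n, ‖(((((k + 1 : ℕ) : ℝ) / n) ^ m : ℝ) : ℂ) - (((k : ℝ) / n) ^ m : ℝ)‖ =
        (((k + 1 : ℕ) : ℝ) / n) ^ m - ((k : ℝ) / n) ^ m := by
      intro k _
      rw [← Complex.ofReal_sub, norm_real, norm_of_nonneg (sub_nonneg.2 (hmono k))]
    rw [sum_congr rfl this, Finset.sum_range_sub (fun k : ℕ => ((k : ℝ) / n) ^ m),
      div_self hn0.ne', one_pow]
    have : (0 : ℝ) ≤ (((0 : ℕ) : ℝ) / n) ^ m := by positivity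
    linarith

theorem tendsto_weightedMean_one {m : ℕ} (hm : m ≤ 2) :
    Tendsto (fun n => weightedMean m n 1) atTop (𝓝 (1 / ((m : ℂ) + 1))) := by
  have h1 : Tendsto (fun n : ℕ => ((1 : ℝ) / n : ℝ)) atTop (𝓝 0) :=
    tendsto_const_div_atTop_nhds_zero_nat _
  have h2 : Tendsto (fun n : ℕ => (∑ k ∈ range (n + 1), ((k : ℝ) / n) ^ m) / n) atTop
      (𝓝 (1 / ((m : ℝ) + 1))) := by
    interval_cases m
    · have : Tendsto (fun n : ℕ => 1 + (1 : ℝ) / n) atTop (𝓝 (1 + 0)) := h1.const_add 1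
      refine (this.congr' ?_).trans_eq (by norm_num)
      filter_upwards [eventually_ge_atTop 1] with n hn
      have : (n : ℝ) ≠ 0 := by positivity
      simp; field_simp
    · have : Tendsto (fun n : ℕ => (1 + (1 : ℝ) / n) / 2) atTop (𝓝 ((1 + 0) / 2)) :=
        (h1.const_add 1).div_const 2
      refine (this.congr' ?_).trans_eq (by norm_num)
      filter_upwards [eventually_ge_atTop 1] with n hn
      have : (n : ℝ) ≠ 0 := by positivity
      have hs : ∀ n : ℕ, ∑ k ∈ range (n + 1), (k : ℝ) = n * (n + 1) / 2 := by
        intro n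
        induction n with
        | zero => simp
        | succ n ih => rw [Finset.sum_range_succ, ih]; push_cast; ring
      simp_rw [pow_one]
      rw [← sum_div, hs]; field_simp
    · have : Tendsto (fun n : ℕ => (1 + (1 : ℝ) / n) * (2 + 1 / n) / 6) atTop
          (𝓝 ((1 + 0) * (2 + 0) / 6)) := ((h1.const_add 1).mul (h1.const_add 2)).div_const 6
      refine (this.congr' ?_).trans_eq (by norm_num)
      filter_upwards [eventually_ge_atTop 1] with n hn
      have : (n : ℝ) ≠ 0 := by positivity
      have hs : ∀ n : ℕ, ∑ k ∈ range (n + 1), (k : ℝ) ^ 2 = n * (n + 1) * (2 * n + 1) / 6 := by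
        intro n
        induction n with
        | zero => simp
        | succ n ih => rw [Finset.sum_range_succ, ih]; push_cast; ring
      simp_rw [div_pow]
      rw [← sum_div, hs]; field_simp
  have h3 := (continuous_ofReal.tendsto _).comp h2
  refine (h3.congr fun n => ?_).trans_eq (by push_cast; rfl)
  simp [weightedMean]

/-- For `k ≤ n` one has `|q ^ k - 1| ≤ 4 k |q - 1| = O(1 / n)`, so the mean has the same limit as
for `q = 1`, namely the integral of `t ^ m` over `[0, 1]`. -/
theorem tendsto_weightedMean_of_near_one {m : ℕ} (hm : m ≤ 2) {q : ℕ → ℂ} {C : ℝ}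
    (hq : ∀ᶠ n : ℕ in atTop, (∀ k ≤ n + 1, ‖q n‖ ^ k ≤ 4) ∧ ‖q n - 1‖ ≤ C / (n : ℝ) ^ 2) :
    Tendsto (fun n => weightedMean m n (q n)) atTop (𝓝 (1 / ((m : ℂ) + 1))) := by
  have h : Tendsto (fun n => weightedMean m n (q n) - weightedMean m n 1) atTop (𝓝 0) := by
    have hlim : Tendsto (fun n : ℕ => 8 * C / (n : ℝ)) atTop (𝓝 0) :=
      tendsto_const_div_atTop_nhds_zero_nat _
    refine squeeze_zero_norm' ?_ hlim
    filter_upwards [hq, eventually_ge_atTop 1] with n hn hn1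
    have hn0 : (1 : ℝ) ≤ n := by exact_mod_cast hn1
    rw [weightedMean, weightedMean, ← sub_div, ← sum_sub_distrib, norm_div, norm_natCast]
    have hC : 0 ≤ C / (n : ℝ) ^ 2 := (norm_nonneg _).trans hn.2
    rw [div_le_div_iff_of_pos_right (by linarith)]
    refine (norm_sum_le _ _).trans ((sum_le_card_nsmul _ _ (4 * n * (C / (n : ℝ) ^ 2))
      fun k hk => ?_).trans ?_)
    · have hk' := mem_range.1 hk
      have hkn : (k : ℝ) ≤ n := by exact_mod_cast (by omega : k ≤ n)
      rw [one_pow, ← mul_sub, norm_mul, norm_real, norm_of_nonneg (by positivity)]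
      have h1 : ((k : ℝ) / n) ^ m ≤ 1 :=
        pow_le_one₀ (by positivity) ((div_le_one (by linarith)).2 hkn)
      have h2 := norm_pow_sub_one_le (n := n + 1) (p := q n) hn.1 k (by omega)
      calc _ ≤ 1 * (4 * k * ‖q n - 1‖) := by gcongr
        _ ≤ 1 * (4 * n * (C / (n : ℝ) ^ 2)) := by gcongr; exact hn.2
        _ = _ := one_mul _
    · rw [card_range, nsmul_eq_mul]
      have hC' : 0 ≤ C := by
        by_contra hneg
        have := div_neg_of_neg_of_pos (not_le.1 hneg) (by positivity : (0 : ℝ) < (n : ℝ) ^ 2)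
        linarith
      push_cast
      have e : ((n : ℝ) + 1) * (4 * n * (C / (n : ℝ) ^ 2)) = 4 * C * ((n + 1) / n) := by
        field_simp
      rw [e]
      have : ((n : ℝ) + 1) / n ≤ 2 := by rw [div_le_iff₀ (by linarith)]; linarith
      nlinarith
  have := h.add (tendsto_weightedMean_one hm)
  simpa using this

/-- The row `r` of the block of a point `z` contains the real parts of `rowCoef r * z ^ i`. -/
def rowCoef : Fin 4 → ℂ := ![1, -I, 1, -I]

/-- The order of the derivative in row `r`. -/
def rowExp : Fin 4 → ℕ := ![0, 0, 1, 1]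

/-- The coefficient rows of the real and imaginary parts of `f(z s) / √n` and of
`z s * f'(z s) / (n √n)`. -/
def gramRows {S : Type*} (n : ℕ) (z : S → ℂ) : Matrix (Fin 4 × S) (Fin (n + 1)) ℝ :=
  Matrix.of fun r i => ((i : ℕ) / n : ℝ) ^ rowExp r.1 * (rowCoef r.1 * z r.2 ^ (i : ℕ)).re / √n

theorem re_mul_re_eq (u v : ℂ) : u.re * v.re = (u * v + u * starRingEnd ℂ v).re / 2 := by
  simp

/-- The identity `Re u Re v = Re (u v + u v̄) / 2` reduces every covariance to means of powers of `z
z'` and of `z` times the conjugate of `z'`. -/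
theorem gramRows_mul_transpose {S : Type*} (n : ℕ) (z : S → ℂ) (r r' : Fin 4 × S) :
    (gramRows n z * (gramRows n z).transpose) r r' =
      (rowCoef r.1 * rowCoef r'.1 * weightedMean (rowExp r.1 + rowExp r'.1) n (z r.2 * z r'.2) +
      rowCoef r.1 * starRingEnd ℂ (rowCoef r'.1) * weightedMean (rowExp r.1 + rowExp r'.1) n
          (z r.2 * starRingEnd ℂ (z r'.2))).re / 2 := by
  have h1 : ∀ i : Fin (n + 1), gramRows n z r i * (gramRows n z).transpose i r' =
      ((rowCoef r.1 * rowCoef r'.1 * (((((i : ℕ) : ℝ) / n) ^ (rowExp r.1 + rowExp r'.1) : ℝ) *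
        (z r.2 * z r'.2) ^ (i : ℕ) / n) +
      rowCoef r.1 * starRingEnd ℂ (rowCoef r'.1) *
        (((((i : ℕ) : ℝ) / n) ^ (rowExp r.1 + rowExp r'.1) : ℝ) *
          (z r.2 * starRingEnd ℂ (z r'.2)) ^ (i : ℕ) / n))).re / 2 := by
    intro i
    simp only [gramRows, Matrix.transpose_apply, Matrix.of_apply]
    have e1 : ∀ a b x y : ℝ, a * x / √n * (b * y / √n) = a * b / n * (x * y) := by
      intro a b x y
      rw [div_mul_div_comm, Real.mul_self_sqrt (Nat.cast_nonneg n)]; ring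
    rw [e1, ← pow_add, re_mul_re_eq, ← mul_div_assoc, ← Complex.re_ofReal_mul]
    congr 2
    simp only [map_mul, map_pow]
    push_cast
    ring
  rw [Matrix.mul_apply, sum_congr rfl fun i _ => h1 i, ← sum_div, ← re_sum,
    sum_add_distrib, ← mul_sum, ← mul_sum, ← sum_div, ← sum_div,
    weightedMean, weightedMean,
    Fin.sum_univ_eq_sum_range (fun k => ((((k : ℝ) / n) ^ (rowExp r.1 + rowExp r'.1) : ℝ) : ℂ) *
        (z r.2 * z r'.2) ^ k),
    Fin.sum_univ_eq_sum_range (fun k => ((((k : ℝ) / n) ^ (rowExp r.1 + rowExp r'.1) : ℝ) : ℂ) *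
        (z r.2 * starRingEnd ℂ (z r'.2)) ^ k)]

/-- By separation all means oscillate away except those of `|z|²`, which is one up to `O(n⁻²)`.
These give the diagonal blocks with the moments `1, 1/2, 1/3`. -/
theorem tendsto_gramRows {S : Type*} [DecidableEq S] {z : ℕ → S → ℂ} {κ C : ℝ}
    (hκ : 0 < κ) (hz : ∀ᶠ n : ℕ in atTop, (∀ s, NearCircle n (z n s)) ∧ SeparatedBy κ id (z n) ∧
      ∀ s, ‖z n s * starRingEnd ℂ (z n s) - 1‖ ≤ C / (n : ℝ) ^ 2) :
    Tendsto (fun n => gramRows n (z n) * (gramRows n (z n)).transpose) atTop (𝓝 (covLimit S)) := by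
  refine tendsto_pi_nhds.2 fun r => tendsto_pi_nhds.2 fun r' => ?_
  simp only [gramRows_mul_transpose]
  have h1 : Tendsto (fun n => weightedMean (rowExp r.1 + rowExp r'.1) n (z n r.2 * z n r'.2)) atTop
      (𝓝 0) := by
    refine tendsto_weightedMean_zero _ hκ ?_
    filter_upwards [hz] with n hn
    exact ⟨(hn.1 _).mul_le (hn.1 _), hn.2.1.2 _ _⟩
  have hlim : covLimit S r r' = (rowCoef r.1 * rowCoef r'.1 * 0 + rowCoef r.1 *
      starRingEnd ℂ (rowCoef r'.1) * (if r.2 = r'.2 then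
        1 / (((rowExp r.1 + rowExp r'.1 : ℕ) : ℂ) + 1) else 0)).re / 2 := by
    obtain ⟨i, s⟩ := r
    obtain ⟨j, s'⟩ := r'
    simp only [covLimit, Matrix.blockDiagonal_apply]
    split_ifs with h
    · fin_cases i <;> fin_cases j <;> simp [covBlock, rowCoef, rowExp] <;> norm_num
    · simp
  rw [hlim]
  refine ((Complex.continuous_re.tendsto _).comp ((h1.const_mul _).add
    (Tendsto.const_mul _ ?_))).div_const 2
  split_ifs with h
  · have hm : rowExp r.1 + rowExp r'.1 ≤ 2 := by
      have : ∀ i, rowExp i ≤ 1 := by decide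
      linarith [this r.1, this r'.1]
    refine tendsto_weightedMean_of_near_one hm (C := C) ?_
    filter_upwards [hz] with n hn
    exact ⟨(hn.1 _).mul_le (hn.1 _).conj, h ▸ hn.2.2 r.2⟩
  · refine tendsto_weightedMean_zero _ hκ ?_
    filter_upwards [hz] with n hn
    exact ⟨(hn.1 _).mul_le (hn.1 _).conj, hn.2.1.1 _ _ h⟩

/-- The normalised value is `f / √n`, so the threshold becomes `ε / √n`. The normalised derivative
is `z f' / (n √n)`, so the factor `|z|² / n²` remains after the powers of `√n` cancel. -/
theorem scaledKernel_gramRows {S : Type*} [Fintype S] {n : ℕ} (hn : 1 ≤ n) (z : S → ℂ)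
    (ε : ℝ) (hε : 0 < ε) (a : Fin (n + 1) → ℝ) :
    scaledKernel (ε / √n) ((gramRows n z).mulVec a) =
      ∏ s, ‖z s‖ ^ 2 / (n : ℝ) ^ 2 * rootKernel (vecPoly a) ε (z s) := by
  have hn0 : (0 : ℝ) < n := by exact_mod_cast hn
  have hrow : ∀ r s, (gramRows n z).mulVec a (r, s) = (rowCoef r *
      ∑ i : Fin (n + 1), (a i : ℂ) * ((((i : ℕ) : ℝ) / n) ^ rowExp r : ℝ) * z s ^ (i : ℕ)).re / √n := by
    intro r s
    simp only [mulVec, dotProduct, gramRows, Matrix.of_apply, mul_sum, re_sum, sum_div]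
    refine sum_congr rfl fun i _ => ?_
    rw [show rowCoef r * ((a i : ℂ) * ((((i : ℕ) : ℝ) / n) ^ rowExp r : ℝ) * z s ^ (i : ℕ)) =
      ((((((i : ℕ) : ℝ) / n) ^ rowExp r) * a i : ℝ) : ℂ) * (rowCoef r * z s ^ (i : ℕ)) by
        push_cast; ring, Complex.re_ofReal_mul]
    ring
  have hder : ∀ s, ∑ i : Fin (n + 1), (a i : ℂ) * ((((i : ℕ) : ℝ) / n) ^ 1 : ℝ) * z s ^ (i : ℕ) =
      z s * (vecPoly a).derivative.eval (z s) / n := by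
    intro s
    rw [eval_derivative_vecPoly, mul_sum, sum_div]
    refine sum_congr rfl fun i _ => ?_
    rcases Nat.eq_zero_or_pos (i : ℕ) with h | h
    · simp [h]
    · obtain ⟨k, hk⟩ := Nat.exists_eq_succ_of_ne_zero h.ne'
      rw [hk]; push_cast; simp; ring
  have hval : ∀ s, ∑ i : Fin (n + 1), (a i : ℂ) * ((((i : ℕ) : ℝ) / n) ^ 0 : ℝ) * z s ^ (i : ℕ) =
      (vecPoly a).eval (z s) := by
    intro s; rw [eval_vecPoly]; simp
  have hsq : ∀ u : ℂ, (u.re / √n) ^ 2 + ((-I * u).re / √n) ^ 2 = ‖u‖ ^ 2 / n := by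
    intro u
    rw [← normSq_eq_norm_sq, normSq_apply, div_pow, div_pow, sq_sqrt hn0.le]
    simp; ring
  unfold scaledKernel
  refine prod_congr rfl fun s _ => ?_
  have e0 : ((gramRows n z).mulVec a (0, s)) ^ 2 + ((gramRows n z).mulVec a (1, s)) ^ 2 =
      ‖(vecPoly a).eval (z s)‖ ^ 2 / n := by
    rw [hrow, hrow, ← hsq, ← hval]; simp [rowCoef, rowExp]
  have e1 : ((gramRows n z).mulVec a (2, s)) ^ 2 + ((gramRows n z).mulVec a (3, s)) ^ 2 =
      ‖z s * (vecPoly a).derivative.eval (z s) / n‖ ^ 2 / n := by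
    rw [hrow, hrow, ← hsq, ← hder]; simp [rowCoef, rowExp]
  rw [e0, e1, rootKernel, div_pow ε, sq_sqrt hn0.le]
  have hiff : ‖(vecPoly a).eval (z s)‖ ^ 2 / n < ε ^ 2 / n ↔ ‖(vecPoly a).eval (z s)‖ < ε := by
    rw [div_lt_div_iff_of_pos_right hn0, pow_lt_pow_iff_left₀ (norm_nonneg _) hε.le two_ne_zero]
  simp only [hiff]
  split_ifs
  · rw [norm_div, norm_mul, norm_natCast]
    have := pi_pos
    field_simp
  · simp

/-- The mean of the product of the mollified root counts at separated points near the circle. -/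
theorem tendsto_lintegral_prod_rootKernel_of_separated {S : Type*} [Fintype S] [DecidableEq S]
    {z : ℕ → S → ℂ} {κ C : ℝ} (hκ : 0 < κ) (hz : ∀ᶠ n : ℕ in atTop, (∀ s, NearCircle n (z n s)) ∧
      SeparatedBy κ id (z n) ∧ ∀ s, ‖z n s * starRingEnd ℂ (z n s) - 1‖ ≤ C / (n : ℝ) ^ 2)
    {ε : ℕ → ℝ} (hε : ∀ n, 0 < ε n) (hε1 : ∀ n, ε n ≤ 1) :
    Tendsto (fun n => (∏ s, ‖z n s‖ ^ 2 / (n : ℝ) ^ 2) *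
      (∫⁻ a, ∏ s, ofReal (rootKernel (vecPoly a) (ε n) (z n s))
        ∂γ[n]).toReal) atTop (𝓝 ((1 / (12 * π)) ^ card S)) := by
  -- The maximum with `1` only serves `n = 0`, where the threshold would otherwise be the default
  -- value `0`.
  have hlim : Tendsto (fun n : ℕ => ε n / √(max n 1 : ℕ)) atTop (𝓝 0) := by
    have h1 : Tendsto (fun n : ℕ => 1 / √(n : ℝ)) atTop (𝓝 0) :=
      (tendsto_const_nhds (x := (1 : ℝ))).div_atTop
        (Real.tendsto_sqrt_atTop.comp tendsto_natCast_atTop_atTop)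
    refine tendsto_of_tendsto_of_tendsto_of_le_of_le' tendsto_const_nhds h1
      (Eventually.of_forall fun n => by have := hε n; positivity) ?_
    filter_upwards [eventually_ge_atTop 1] with n hn
    rw [max_eq_left hn]
    gcongr
    exact hε1 n
  have key := tendsto_lintegral_scaledKernel (fun n => gramRows n (z n)) (tendsto_gramRows hκ hz)
    (ε := fun n : ℕ => ε n / √(max n 1 : ℕ)) (fun n => by
      have := hε n
      have : 0 < √((max n 1 : ℕ) : ℝ) := Real.sqrt_pos.2 (by positivity)
      positivity) hlim
  have key2 := (ENNReal.tendsto_toReal ofReal_ne_top).comp key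
  rw [toReal_ofReal (by positivity)] at key2
  refine key2.congr' ?_
  filter_upwards [hz, eventually_ge_atTop 1] with n hn hn1
  simp only [Function.comp_def, max_eq_left hn1]
  have hP : 0 ≤ ∏ s, ‖z n s‖ ^ 2 / (n : ℝ) ^ 2 := prod_nonneg fun s _ => by positivity
  rw [← toReal_ofReal hP, ← ENNReal.toReal_mul, ← lintegral_const_mul _ (by
    exact Finset.measurable_prod _ fun s _ =>
      ((measurable_rootKernel_vecPoly n (ε n)).comp
        (measurable_id.prodMk measurable_const)).ennreal_ofReal)]
  congr 1
  refine lintegral_congr fun a => ?_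
  rw [scaledKernel_gramRows hn1 _ _ (hε n), prod_mul_distrib, ofReal_mul hP,
    ofReal_prod_of_nonneg fun s _ => rootKernel_nonneg _ _ _]

/-! ### Mixed moments of root counts in separated blocks. -/

/-- The mean of a product of mollified root counts. -/
def meanKernel {S : Type*} [Fintype S] (n : ℕ) (ε : ℝ) (z : S → ℂ) : ℝ :=
  (∫⁻ a, ∏ s, ofReal (rootKernel (vecPoly a) ε (z s)) ∂γ[n]).toReal

theorem meanKernel_nonneg {S : Type*} [Fintype S] (n : ℕ) (ε : ℝ) (z : S → ℂ) :
    0 ≤ meanKernel n ε z := ENNReal.toReal_nonneg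

theorem measurable_meanKernel {S : Type*} [Fintype S] (n : ℕ) (ε : ℝ) :
    Measurable (meanKernel (S := S) n ε) := by
  refine ENNReal.measurable_toReal.comp (Measurable.lintegral_prod_left' (f := fun
    x : (Fin (n + 1) → ℝ) × (S → ℂ) => ∏ s, ofReal (rootKernel (vecPoly x.1) ε (x.2 s))) ?_)
  exact measurable_fun_prod _ fun s _ => ((measurable_rootKernel_vecPoly n ε).comp
    (by fun_prop : Measurable fun x : (Fin (n + 1) → ℝ) × (S → ℂ) => (x.1, x.2 s))).ennreal_ofReal

namespace IsBlockSystem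

variable {S : Type*} {A h δ : ℝ} {ψ : S → ℝ → ℂ} {χ : S → ℝ → ℝ} {α β : S → ℝ}

theorem mem_of_ne_zero (H : IsBlockSystem A h δ ψ χ α β) {s : S} {y : ℝ × ℝ}
    (hy : ψ s y.1 * (χ s y.2 : ℂ) ≠ 0) : |y.1| ≤ A ∧ y.2 ∈ Icc (α s) (β s) := by
  constructor
  · by_contra h1
    exact hy (by rw [H.fst_eq_zero s _ (not_le.1 h1), zero_mul])
  · by_contra h1
    exact hy (by rw [H.snd_eq_zero s _ h1, Complex.ofReal_zero, mul_zero])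

theorem annulusDensity_eq (H : IsBlockSystem A h δ ψ χ α β) (n : ℕ) {s : S} {y : ℝ × ℝ}
    (hy : |y.1| ≤ A ∧ y.2 ∈ Icc (α s) (β s)) :
    annulusDensity n A y = (1 - y.1 / (n : ℝ) ^ 2) / (n : ℝ) ^ 2 := by
  have h1 := H.le_left s
  have h2 := H.right_le s
  have h3 := H.pos
  have hmem : y ∈ Icc (-A) A ×ˢ Ioo (-π) π :=
    ⟨abs_le.1 hy.1, by linarith [hy.2.1, pi_pos], by linarith [hy.2.2]⟩
  rw [annulusDensity, indicator_of_mem hmem]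

theorem integral_mul_blockFn_eq [Fintype S] (H : IsBlockSystem A h δ ψ χ α β) {n : ℕ} (hn : 1 ≤ n)
    (hA : A < (n : ℝ) ^ 2) (ε : ℝ) :
    ∫ z, meanKernel n ε z • ∏ s, blockFn n (ψ s) (χ s) (z s) =
      ∫ y : S → ℝ × ℝ, ((∏ s, annulusDensity n A (y s)) *
        meanKernel n ε fun s => annulusPoint n (y s)) • ∏ s, (ψ s (y s).1 * (χ s (y s).2 : ℂ)) := by
  have hm : AEStronglyMeasurable (fun z : S → ℂ => meanKernel n ε z •
      ∏ s, blockFn n (ψ s) (χ s) (z s)) ((volume : Measure (S → ℂ)).restrict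
        (Set.univ.pi fun _ => annulus n A)) :=
    ((measurable_meanKernel n ε).smul (measurable_fun_prod _ fun s _ =>
      (H.continuous_blockFn hA s).measurable.comp (measurable_pi_apply s))).aestronglyMeasurable
  rw [← setIntegral_eq_integral_of_forall_compl_eq_zero (s := Set.univ.pi fun _ => annulus n A),
    restrict_pi_annulus_eq_map S hA hn, integral_map]
  · rw [integral_withDensity_eq_integral_toReal_smul₀]
    · refine integral_congr_ae (ae_of_all _ fun y => ?_)
      simp only
      rw [toReal_ofReal (prod_nonneg fun s _ => annulusDensity_nonneg hA _), mul_smul]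
      by_cases hy : ∀ s, (y s) ∈ Icc (-A) A ×ˢ Ioo (-π) π
      · congr 2
        refine prod_congr rfl fun s _ => ?_
        have h1 : (y s).1 < (n : ℝ) ^ 2 := (hy s).1.2.trans_lt hA
        rw [blockFn]
        congr 2
        · exact rescaledModulus_annulusPoint (θ := (y s).2) hn h1
        · exact congrArg (χ s) (arg_annulusPoint hn h1 ⟨(hy s).2.1, (hy s).2.2.le⟩)
      · obtain ⟨s, hs⟩ := not_forall.1 hy
        have h0 : ∏ s, annulusDensity n A (y s) = 0 :=
          prod_eq_zero (mem_univ s) (indicator_of_notMem hs _)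
        rw [h0, zero_smul, zero_smul]
    · exact (measurable_fun_prod _ fun s _ => (measurable_annulusDensity n A).comp
        (measurable_pi_apply s)).ennreal_ofReal.aemeasurable
    · exact ae_of_all _ fun y => ofReal_lt_top
  · exact (measurable_pi_lambda _ fun s => (continuous_annulusPoint n).measurable.comp
      (measurable_pi_apply s)).aemeasurable
  · rwa [← restrict_pi_annulus_eq_map S hA hn]
  · intro z hz
    obtain ⟨s, hs⟩ : ∃ s, z s ∉ annulus n A := by simpa using hz
    rw [prod_eq_zero (mem_univ s), smul_zero]
    by_contra h1
    exact hs (H.mem_of_blockFn_ne_zero h1).1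

theorem nearCircle_and_separatedBy (H : IsBlockSystem A h δ ψ χ α β) {n : ℕ} (hn : 1 ≤ n)
    (hA : A < (n : ℝ) ^ 2) (hA' : 2 * A * (n + 1) ≤ (n : ℝ) ^ 2) {y : S → ℝ × ℝ}
    (hy : ∀ s, |(y s).1| ≤ A ∧ (y s).2 ∈ Icc (α s) (β s)) :
    (∀ s, NearCircle n (annulusPoint n (y s))) ∧
      SeparatedBy √((1 - cos δ) / 2) id fun s => annulusPoint n (y s) := by
  have h1 : ∀ s, (y s).1 < (n : ℝ) ^ 2 := fun s => ((abs_le.1 (hy s).1).2).trans_lt hA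
  have h2 : ∀ s, NearCircle n (annulusPoint n (y s)) := fun s =>
    nearCircle_of_mem_annulus hn hA' (by
      show |rescaledModulus n (annulusPoint n ((y s).1, (y s).2))| ≤ A
      rw [rescaledModulus_annulusPoint hn (h1 s)]; exact (hy s).1)
  refine ⟨h2, AngleSeparated.separatedBy (Real.sqrt_nonneg _) ?_ fun s => (h2 s).norm_ge⟩
  have h3 : ∀ s, arg (annulusPoint n (y s)) = (y s).2 := fun s =>
    arg_annulusPoint hn (h1 s) ⟨by linarith [(hy s).2.1, H.le_left s, H.pos, pi_pos],
      by linarith [(hy s).2.2, H.right_le s, H.pos]⟩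
  simp only [h3]
  exact angleSeparated_of_mem_Icc H.pos H.le_left H.right_le H.separated fun s => (hy s).2

theorem integrable_mul (H : IsBlockSystem A h δ ψ χ α β) (s : S) :
    Integrable fun y : ℝ × ℝ => ψ s y.1 * (χ s y.2 : ℂ) := by
  refine Integrable.mul_prod (f := ψ s) (g := fun θ => (χ s θ : ℂ)) ?_ ?_
  · exact (H.continuous_fst s).integrable_of_hasCompactSupport
      (HasCompactSupport.intro (isCompact_Icc (a := -A) (b := A)) fun x hx =>
        H.fst_eq_zero s x (not_le.1 fun h => hx (abs_le.1 h)))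
  · exact (continuous_ofReal.comp (H.continuous_snd s)).integrable_of_hasCompactSupport
      (HasCompactSupport.intro (isCompact_Icc (a := α s) (b := β s)) fun x hx => by
        simp [H.snd_eq_zero s x hx])

/-- Dominated convergence in the coordinates `(x, θ)`: the intensity bound of order `n ^ (2 card S)`
cancels against the area density, and the pointwise limit is the product intensity. The sequence `ε`
is arbitrary in `(0, 1]` so that it may be chosen depending on `n` afterwards. -/
theorem tendsto_integral_mul_blockFn [Fintype S] [DecidableEq S]
    (H : IsBlockSystem A h δ ψ χ α β) {ε : ℕ → ℝ} (hε : ∀ n, 0 < ε n) (hε1 : ∀ n, ε n ≤ 1) :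
    Tendsto (fun n : ℕ => ∫ z, meanKernel n (ε n) z • ∏ s, blockFn n (ψ s) (χ s) (z s)) atTop
      (𝓝 (∏ s, ((1 / (12 * π) : ℝ) * (∫ x, ψ s x) * (∫ θ, (χ s θ : ℂ))))) := by
  set κ := √((1 - cos δ) / 2)
  have hκ : 0 < κ := sqrt_one_sub_cos_pos H.pos H.le_pi
  have hlim : ∏ s, ((1 / (12 * π) : ℝ) * (∫ x, ψ s x) * (∫ θ, (χ s θ : ℂ))) =
      ∫ y : S → ℝ × ℝ, ((1 / (12 * π)) ^ card S : ℝ) • ∏ s, (ψ s (y s).1 * (χ s (y s).2 : ℂ)) := by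
    rw [integral_smul, integral_fintype_prod_volume_eq_prod fun s (y : ℝ × ℝ) => ψ s y.1 * (χ s y.2 : ℂ)]
    have : ∀ s, ∫ y : ℝ × ℝ, ψ s y.1 * (χ s y.2 : ℂ) = (∫ x, ψ s x) * ∫ θ, (χ s θ : ℂ) := fun s =>
      integral_prod_mul (ψ s) fun θ => (χ s θ : ℂ)
    simp only [this, mul_assoc]
    rw [prod_mul_distrib, prod_const, card_univ, Complex.real_smul]
    push_cast; rfl
  rw [hlim]
  have hev : ∀ᶠ n : ℕ in atTop, 10 ^ 13 / κ * card S ≤ n :=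
    tendsto_natCast_atTop_atTop.eventually_ge_atTop _
  refine Tendsto.congr' (f₁ := fun n : ℕ => ∫ y : S → ℝ × ℝ, ((∏ s, annulusDensity n A (y s)) *
        meanKernel n (ε n) fun s => annulusPoint n (y s)) • ∏ s, (ψ s (y s).1 * (χ s (y s).2 : ℂ)))
    ?_ ?_
  · filter_upwards [eventually_annulus A] with n hn
    exact (H.integral_mul_blockFn_eq (by omega) hn.2.1 _).symm
  have hintprod : Integrable fun y : S → ℝ × ℝ => ∏ s, (ψ s (y s).1 * (χ s (y s).2 : ℂ)) :=
    Integrable.fintype_prod fun s => H.integrable_mul s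
  refine tendsto_integral_filter_of_dominated_convergence (fun y => 2 ^ card S *
    (intensityConst (card S)).toReal * ‖∏ s, (ψ s (y s).1 * (χ s (y s).2 : ℂ))‖)
    (Eventually.of_forall fun n => ?_) ?_ (hintprod.norm.const_mul _) (ae_of_all _ fun y => ?_)
  · suffices hm : Measurable fun y : S → ℝ × ℝ => (∏ s, annulusDensity n A (y s)) *
        meanKernel n (ε n) fun s => annulusPoint n (y s) from
      hm.aestronglyMeasurable.smul hintprod.aestronglyMeasurable
    refine (measurable_fun_prod _ fun s _ => (measurable_annulusDensity n A).comp
      (measurable_pi_apply s)).mul ((measurable_meanKernel n (ε n)).comp ?_)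
    exact measurable_pi_lambda _ fun s => (continuous_annulusPoint n).measurable.comp
      (measurable_pi_apply s)
  · filter_upwards [eventually_annulus A, hev] with n hn hn2
    refine ae_of_all _ fun y => ?_
    by_cases hy : ∏ s, (ψ s (y s).1 * (χ s (y s).2 : ℂ)) = 0
    · rw [hy]; simp
    have hy' : ∀ s, |(y s).1| ≤ A ∧ (y s).2 ∈ Icc (α s) (β s) := fun s =>
      H.mem_of_ne_zero (Finset.prod_ne_zero_iff.1 hy s (mem_univ s))
    have hn1 : 1 ≤ n := by omega
    have hn0 : (1 : ℝ) ≤ n := by exact_mod_cast hn1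
    obtain ⟨hz, hsep⟩ := H.nearCircle_and_separatedBy hn1 hn.2.1 hn.2.2 hy'
    have hM : meanKernel n (ε n) (fun s => annulusPoint n (y s)) ≤
        (intensityConst (card S)).toReal * (n : ℝ) ^ (2 * card S) := by
      have h1 := lintegral_prod_rootKernel_le_of_separated hn1 _ hz hκ hsep hn2 (hε n)
      have h2 := ENNReal.toReal_mono (ENNReal.mul_ne_top (intensityConst_ne_top _) ofReal_ne_top) h1
      rwa [ENNReal.toReal_mul, toReal_ofReal (by positivity)] at h2
    have hD : ∏ s, annulusDensity n A (y s) ≤ (2 / (n : ℝ) ^ 2) ^ card S := by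
      rw [← card_univ, ← prod_const]
      refine prod_le_prod (fun s _ => annulusDensity_nonneg hn.2.1 _) fun s _ => ?_
      rw [H.annulusDensity_eq n (hy' s)]
      gcongr
      have : -1 ≤ (y s).1 / (n : ℝ) ^ 2 := by
        rw [le_div_iff₀ (by positivity)]; linarith [(abs_le.1 (hy' s).1).1]
      linarith
    have hD0 : 0 ≤ ∏ s, annulusDensity n A (y s) :=
      prod_nonneg fun s _ => annulusDensity_nonneg hn.2.1 _
    rw [norm_smul, norm_of_nonneg (mul_nonneg hD0 (meanKernel_nonneg _ _ _))]
    refine mul_le_mul_of_nonneg_right ?_ (norm_nonneg _)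
    refine (mul_le_mul hD hM (meanKernel_nonneg _ _ _) (by positivity)).trans (le_of_eq ?_)
    rw [div_pow, ← pow_mul]
    field_simp
  · by_cases hy : ∏ s, (ψ s (y s).1 * (χ s (y s).2 : ℂ)) = 0
    · rw [hy]; simp
    have hy' : ∀ s, |(y s).1| ≤ A ∧ (y s).2 ∈ Icc (α s) (β s) := fun s =>
      H.mem_of_ne_zero (Finset.prod_ne_zero_iff.1 hy s (mem_univ s))
    refine Tendsto.smul_const ?_ _
    have hA0 := H.nonneg_left
    have hlim1 : Tendsto (fun n : ℕ => ∏ s, (1 - (y s).1 / (n : ℝ) ^ 2)⁻¹) atTop (𝓝 (∏ _s : S, 1)) := by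
      refine tendsto_finsetProd _ fun s _ => ?_
      have h1 : Tendsto (fun n : ℕ => (y s).1 / (n : ℝ) ^ 2) atTop (𝓝 0) :=
        tendsto_const_nhds.div_atTop
          ((tendsto_pow_atTop two_ne_zero).comp tendsto_natCast_atTop_atTop)
      have h2 := ((tendsto_const_nhds (x := (1 : ℝ))).sub h1).inv₀ (by norm_num)
      simpa using h2
    have hlim2 := tendsto_lintegral_prod_rootKernel_of_separated (S := S)
      (z := fun n s => annulusPoint n (y s)) (C := 3 * A) hκ (by
        filter_upwards [eventually_annulus A] with n hn
        obtain ⟨hz, hsep⟩ := H.nearCircle_and_separatedBy (by omega) hn.2.1 hn.2.2 hy'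
        refine ⟨hz, hsep, fun s => ?_⟩
        have h1 : (y s).1 < (n : ℝ) ^ 2 := ((abs_le.1 (hy' s).1).2).trans_lt hn.2.1
        have h0 : 0 < (n : ℝ) ^ 2 := hA0.trans_lt hn.2.1
        have hnorm : ‖annulusPoint n (y s)‖ = 1 - (y s).1 / (n : ℝ) ^ 2 :=
          norm_annulusPoint (θ := (y s).2) (by omega) h1
        rw [Complex.mul_conj, normSq_eq_norm_sq, hnorm, ← Complex.ofReal_one,
          ← Complex.ofReal_sub, norm_real, norm_eq_abs]
        have ht : |(y s).1 / (n : ℝ) ^ 2| ≤ A / (n : ℝ) ^ 2 := by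
          rw [abs_div, abs_of_pos h0]; gcongr; exact (hy' s).1
        have ht1 : A / (n : ℝ) ^ 2 ≤ 1 := by rw [div_le_one h0]; exact hn.2.1.le
        rw [show 3 * A / (n : ℝ) ^ 2 = 3 * (A / (n : ℝ) ^ 2) by ring]
        generalize (y s).1 / (n : ℝ) ^ 2 = t at *
        rw [show (1 - t) ^ 2 - 1 = t * (t - 2) by ring, abs_mul, mul_comm]
        have : |t - 2| ≤ 3 := by
          rw [abs_le]; constructor <;> linarith [(abs_le.1 (ht.trans ht1)).1, (abs_le.1 (ht.trans ht1)).2]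
        exact mul_le_mul this ht (abs_nonneg _) (by norm_num)) hε hε1
    have := hlim1.mul hlim2
    rw [Finset.prod_const_one, one_mul] at this
    refine this.congr' ?_
    filter_upwards [eventually_annulus A] with n hn
    rw [← mul_assoc, ← prod_mul_distrib]
    refine congrArg₂ _ (prod_congr rfl fun s _ => ?_) rfl
    have h1 : (y s).1 < (n : ℝ) ^ 2 := ((abs_le.1 (hy' s).1).2).trans_lt hn.2.1
    have h0 : 0 < (n : ℝ) ^ 2 := hA0.trans_lt hn.2.1
    have h2 : 1 - (y s).1 / (n : ℝ) ^ 2 ≠ 0 := by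
      have := (div_lt_one h0).2 h1
      linarith
    have hnorm : ‖annulusPoint n (y s)‖ = 1 - (y s).1 / (n : ℝ) ^ 2 :=
      norm_annulusPoint (θ := (y s).2) (by omega) h1
    rw [H.annulusDensity_eq n (hy' s), hnorm, ← mul_div_assoc, pow_two (1 - _), inv_mul_cancel_left₀ h2]

/-- The mixed moments of the root counts of separated blocks. -/
theorem tendsto_integral_prod_sum [Fintype S] [DecidableEq S] (H : IsBlockSystem A h δ ψ χ α β) :
    Tendsto (fun n : ℕ => ∫ a, ∏ s, ∑ p ∈ (vecPoly a).roots.toFinset, blockFn n (ψ s) (χ s) p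
      ∂γ[n]) atTop
      (𝓝 (∏ s, ((1 / (12 * π) : ℝ) * (∫ x, ψ s x) * (∫ θ, (χ s θ : ℂ))))) := by
  set F : ℕ → ℂ := fun n => ∫ a, ∏ s, ∑ p ∈ (vecPoly a).roots.toFinset, blockFn n (ψ s) (χ s) p
      ∂γ[n] with hF
  -- For each `n` the mollification is chosen so fine that its error is below `1 / (n + 1)`. This
  -- avoids any uniformity of the limit `ε → 0` in `n`.
  have hex : ∀ n : ℕ, ∃ ε : ℝ, 0 < ε ∧ ε ≤ 1 ∧ (1 ≤ n → A < (n : ℝ) ^ 2 →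
      dist (∫ z, meanKernel n ε z • ∏ s, blockFn n (ψ s) (χ s) (z s)) (F n) < 1 / ((n : ℝ) + 1)) := by
    intro n
    by_cases hn : 1 ≤ n ∧ A < (n : ℝ) ^ 2
    · have ht := tendsto_integral_mul_rootKernel hn.1 (Φ := fun z : S → ℂ =>
        ∏ s, blockFn n (ψ s) (χ s) (z s)) (continuous_finsetProd _ fun s _ =>
          (H.continuous_blockFn hn.2 s).comp (continuous_apply s)) (C := 2 ^ card S)
          (fun z => by
            rw [norm_prod, ← card_univ, ← prod_const]
            exact prod_le_prod (fun s _ => norm_nonneg _) fun s _ => H.norm_blockFn_le n s _)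
      simp only [sum_rootTuples_prod (ι := S)] at ht
      have h1 := ht.eventually (Metric.ball_mem_nhds _ (by positivity : 0 < 1 / ((n : ℝ) + 1)))
      have h2 : ∀ᶠ ε : ℝ in 𝓝[>] 0, ε < 1 :=
        eventually_nhdsWithin_of_eventually_nhds (gt_mem_nhds one_pos)
      obtain ⟨ε, h3, h4, h5⟩ := (h1.and (h2.and self_mem_nhdsWithin)).exists
      exact ⟨ε, h5, h4.le, fun _ _ => h3⟩
    · exact ⟨1, one_pos, le_rfl, fun h1 h2 => absurd ⟨h1, h2⟩ hn⟩
  choose ε hε hε1 hd using hex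
  have hlim := H.tendsto_integral_mul_blockFn hε hε1
  refine hlim.congr_dist (squeeze_zero' (Eventually.of_forall fun n => dist_nonneg) ?_
    tendsto_one_div_add_atTop_nhds_zero_nat)
  filter_upwards [eventually_annulus A] with n hn
  exact (hd n (by omega) hn.2.1).le

end IsBlockSystem

/-! ### Bonferroni inequalities and sums over tuples. -/

theorem sum_powersetCard_succ_insert {β R : Type*} [DecidableEq β] [CommSemiring R] (f : β → R)
    {b : β} {T : Finset β} (hb : b ∉ T) (k : ℕ) :
    ∑ S ∈ (insert b T).powersetCard (k + 1), ∏ c ∈ S, f c =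
      ∑ S ∈ T.powersetCard (k + 1), ∏ c ∈ S, f c + f b * ∑ S ∈ T.powersetCard k, ∏ c ∈ S, f c := by
  have hbS : ∀ {j}, ∀ S ∈ T.powersetCard j, b ∉ S := fun S hS h =>
    hb ((Finset.mem_powersetCard.1 hS).1 h)
  rw [Finset.powersetCard_succ_insert hb, Finset.sum_union, Finset.sum_image, mul_sum]
  · exact congrArg _ (sum_congr rfl fun S hS => prod_insert (hbS S hS))
  · intro S hS S' hS' h
    rw [← Finset.erase_insert (hbS S hS), h, Finset.erase_insert (hbS S' hS')]
  · refine Finset.disjoint_left.2 fun S hS hS' => ?_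
    obtain ⟨S', -, rfl⟩ := mem_image.1 hS'
    exact hbS _ hS (Finset.mem_insert_self b S')

/-- The Bonferroni inequality for products of complex numbers in the unit disc. -/
theorem norm_prod_one_add_sub_sum_powersetCard_le {β : Type*} [DecidableEq β] (T : Finset β)
    (ψ : β → ℂ) (hψ : ∀ b, ‖1 + ψ b‖ ≤ 1) (K : ℕ) :
    ‖∏ b ∈ T, (1 + ψ b) - ∑ k ∈ range K, ∑ S ∈ T.powersetCard k, ∏ b ∈ S, ψ b‖ ≤
      ∑ S ∈ T.powersetCard K, ∏ b ∈ S, ‖ψ b‖ := by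
  induction T using Finset.induction_on generalizing K with
  | empty =>
    cases K with
    | zero => simp
    | succ K =>
      rw [Finset.sum_range_succ']
      have h0 : ∀ k, Finset.powersetCard (k + 1) (∅ : Finset β) = ∅ := fun k =>
        Finset.powersetCard_eq_empty.2 (by simp)
      simp [h0]
  | insert b T hb ih =>
    cases K with
    | zero =>
      simp only [Finset.range_zero, Finset.sum_empty, sub_zero, Finset.powersetCard_zero,
        Finset.sum_singleton, Finset.prod_empty]
      rw [norm_prod]
      exact Finset.prod_le_one (fun c _ => norm_nonneg _) fun c _ => hψ c
    | succ K =>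
      -- Splitting according to whether `b` belongs to the subset, the error of order `K + 1` for
      -- `insert b T` is that of order `K + 1` for `T` plus `ψ b` times that of order `K`. The
      -- bounds obey the same recursion.
      have e : ∏ c ∈ insert b T, (1 + ψ c) -
          ∑ k ∈ range (K + 1), ∑ S ∈ (insert b T).powersetCard k, ∏ c ∈ S, ψ c =
          (∏ c ∈ T, (1 + ψ c) - ∑ k ∈ range (K + 1), ∑ S ∈ T.powersetCard k, ∏ c ∈ S, ψ c) +
          ψ b * (∏ c ∈ T, (1 + ψ c) - ∑ k ∈ range K, ∑ S ∈ T.powersetCard k, ∏ c ∈ S, ψ c) := by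
        rw [prod_insert hb, Finset.sum_range_succ', Finset.sum_range_succ']
        simp only [sum_powersetCard_succ_insert ψ hb, sum_add_distrib, ← mul_sum,
          Finset.powersetCard_zero]
        ring
      rw [e, sum_powersetCard_succ_insert (fun c => ‖ψ c‖) hb]
      refine (norm_add_le _ _).trans (add_le_add (ih _) ?_)
      rw [norm_mul]
      exact mul_le_mul_of_nonneg_left (ih _) (norm_nonneg _)

theorem norm_prod_one_add_sub_one_le {β : Type*} [DecidableEq β] (T : Finset β)
    (y : β → ℂ) (hy : ∀ b, ‖1 + y b‖ ≤ 1) : ‖∏ b ∈ T, (1 + y b) - 1‖ ≤ ∑ b ∈ T, ‖y b‖ := by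
  have := norm_prod_one_add_sub_sum_powersetCard_le T y hy 1
  simpa [Finset.powersetCard_one] using this

/-- Adjoining `b` changes the remainder by `y b` times a product minus one, which is at most the sum
over pairs containing `b`. It is applied to the roots in one block, where pairs are rare. -/
theorem norm_prod_one_add_sub_one_sub_sum_le {β : Type*} [DecidableEq β] (T : Finset β)
    (y : β → ℂ) (hy : ∀ b, ‖1 + y b‖ ≤ 1) : ‖∏ b ∈ T, (1 + y b) - 1 - ∑ b ∈ T, y b‖ ≤
      ∑ p ∈ T, ∑ q ∈ T, if p = q then 0 else ‖y p‖ * ‖y q‖ := by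
  induction T using Finset.induction_on with
  | empty => simp
  | insert b T hb ih =>
    have hbq : ∀ q ∈ T, b ≠ q := fun q hq h => hb (h ▸ hq)
    have e : ∏ c ∈ insert b T, (1 + y c) - 1 - ∑ c ∈ insert b T, y c =
        (∏ c ∈ T, (1 + y c) - 1 - ∑ c ∈ T, y c) + y b * (∏ c ∈ T, (1 + y c) - 1) := by
      rw [prod_insert hb, sum_insert hb]; ring
    rw [e]
    refine (norm_add_le _ _).trans ?_
    have h1 : ‖y b * (∏ c ∈ T, (1 + y c) - 1)‖ ≤ ∑ q ∈ T, ‖y b‖ * ‖y q‖ := by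
      rw [norm_mul, ← mul_sum]
      exact mul_le_mul_of_nonneg_left (norm_prod_one_add_sub_one_le T y hy) (norm_nonneg _)
    have h2 : ∑ q ∈ insert b T, (if b = q then 0 else ‖y b‖ * ‖y q‖) = ∑ q ∈ T, ‖y b‖ * ‖y q‖ := by
      rw [sum_insert hb, if_pos rfl, zero_add]
      exact sum_congr rfl fun q hq => if_neg (hbq q hq)
    rw [sum_insert hb, h2, add_comm]
    refine add_le_add h1 (ih.trans (sum_le_sum fun p _ => ?_))
    rw [sum_insert hb]
    refine le_add_of_nonneg_left ?_
    split_ifs <;> positivity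

/-- The factors are exchanged one at a time; the error of each exchange is multiplied by the bounds
`L` of all other factors. -/
theorem norm_prod_sub_prod_le_sum {β : Type*} [DecidableEq β] (T : Finset β) (u w : β → ℂ)
    (L Q : β → ℝ) (hu : ∀ b, ‖u b‖ ≤ L b) (hw : ∀ b, ‖w b‖ ≤ L b) (hQ : ∀ b, ‖u b - w b‖ ≤ Q b) :
    ‖∏ b ∈ T, u b - ∏ b ∈ T, w b‖ ≤ ∑ b ∈ T, Q b * ∏ c ∈ T.erase b, L c := by
  have hL : ∀ b, 0 ≤ L b := fun b => (norm_nonneg _).trans (hu b)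
  have hP : ∀ (T : Finset β), ‖∏ c ∈ T, w c‖ ≤ ∏ c ∈ T, L c := fun T => by
    rw [norm_prod]; exact prod_le_prod (fun c _ => norm_nonneg _) fun c _ => hw c
  induction T using Finset.induction_on with
  | empty => simp
  | insert b T hb ih =>
    rw [prod_insert hb, prod_insert hb, sum_insert hb, Finset.erase_insert hb,
      show u b * ∏ c ∈ T, u c - w b * ∏ c ∈ T, w c =
        (u b - w b) * ∏ c ∈ T, w c + u b * (∏ c ∈ T, u c - ∏ c ∈ T, w c) by ring]
    refine (norm_add_le _ _).trans (add_le_add ?_ ?_)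
    · rw [norm_mul]
      exact mul_le_mul (hQ b) (hP T) (norm_nonneg _) ((norm_nonneg _).trans (hQ b))
    · rw [norm_mul]
      refine (mul_le_mul (hu b) ih (norm_nonneg _) (hL b)).trans (le_of_eq ?_)
      rw [mul_sum]
      refine sum_congr rfl fun c hc => ?_
      have hbc : b ≠ c := fun h => hb (h ▸ hc)
      rw [Finset.erase_insert_of_ne hbc, prod_insert (fun h => hb (Finset.mem_of_mem_erase h))]
      ring

theorem norm_prod_sub_prod_le_sum_norm {β : Type*} [DecidableEq β] (T : Finset β) (u w : β → ℂ)
    (hu : ∀ b, ‖u b‖ ≤ 1) (hw : ∀ b, ‖w b‖ ≤ 1) :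
    ‖∏ b ∈ T, u b - ∏ b ∈ T, w b‖ ≤ ∑ b ∈ T, ‖u b - w b‖ := by
  have := norm_prod_sub_prod_le_sum T u w (fun _ => 1) (fun b => ‖u b - w b‖) hu hw fun _ => le_rfl
  simpa using this

/-- The extra point `none` is coupled only to the coordinate `s₀`, so the sum factorises. This
connects pairs in a block with the tuples indexed by `Option S`. -/
theorem sum_rootTuples_option {S R : Type*} [Fintype S] [DecidableEq S] [CommSemiring R]
    (f : ℂ[X]) (y : S → ℂ → R) (s₀ : S) :
    ∑ p ∈ rootTuples (Option S) f, (if p none = p (some s₀) then 0 else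
        ∏ o : Option S, y (o.getD s₀) (p o)) =
      (∑ p ∈ f.roots.toFinset, ∑ q ∈ f.roots.toFinset, if p = q then 0 else y s₀ p * y s₀ q) *
        ∏ s ∈ univ.erase s₀, ∑ p ∈ f.roots.toFinset, y s p := by
  have h1 : ∑ p ∈ rootTuples (Option S) f, (if p none = p (some s₀) then 0 else
        ∏ o : Option S, y (o.getD s₀) (p o)) =
      ∑ x ∈ f.roots.toFinset ×ˢ rootTuples S f, (if x.1 = x.2 s₀ then 0 else
        y s₀ x.1 * ∏ s, y s (x.2 s)) := by
    refine Finset.sum_equiv (Equiv.piOptionEquivProd (β := fun _ => ℂ)) (fun p => ?_) fun p _ => ?_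
    · simp [rootTuples, Fintype.mem_piFinset, Option.forall]
    · simp only [Fintype.prod_option, Option.getD_none, Option.getD_some]
      rfl
  rw [h1, Finset.sum_product, sum_mul]
  refine sum_congr rfl fun u _ => ?_
  have h2 : ∀ p : S → ℂ, (if u = p s₀ then 0 else y s₀ u * ∏ s, y s (p s)) =
      ∏ s, if s = s₀ then (if u = p s then 0 else y s₀ u * y s (p s)) else y s (p s) := by
    intro p
    rw [← mul_prod_erase _ (fun s => y s (p s)) (mem_univ s₀),
      ← mul_prod_erase _ (fun s => if s = s₀ then _ else _) (mem_univ s₀), if_pos rfl,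
      prod_congr rfl fun s hs => if_neg (Finset.ne_of_mem_erase hs)]
    split_ifs
    · rw [zero_mul]
    · rw [mul_assoc]
  rw [sum_congr rfl fun p _ => h2 p, sum_rootTuples_prod f fun s q =>
    if s = s₀ then (if u = q then 0 else y s₀ u * y s q) else y s q,
    ← mul_prod_erase _ _ (mem_univ s₀)]
  congr 1
  · exact sum_congr rfl fun q _ => if_pos rfl
  · exact prod_congr rfl fun s hs =>
      sum_congr rfl fun q _ => if_neg (Finset.ne_of_mem_erase hs)

/-! ### Cutting `(0, π)` into blocks. -/

/-- A continuous bump of `(0, h)` that is one outside of the `2η`-neighbourhood of the boundary and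
zero on the `η`-neighbourhood. -/
def bump (η h x : ℝ) : ℝ := max 0 (min 1 ((min x (h - x) - η) / η))

theorem continuous_bump (η h : ℝ) : Continuous (bump η h) := by unfold bump; fun_prop

theorem bump_nonneg (η h x : ℝ) : 0 ≤ bump η h x := le_max_left _ _

theorem bump_le_one (η h x : ℝ) : bump η h x ≤ 1 := max_le zero_le_one (min_le_left _ _)

theorem bump_eq_zero {η h x : ℝ} (hη : 0 < η) (hx : x ∉ Icc η (h - η)) : bump η h x = 0 := by
  have h1 : min x (h - x) ≤ η := by
    by_contra hcon
    obtain ⟨h1, h2⟩ := lt_min_iff.1 (not_le.1 hcon)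
    exact hx ⟨h1.le, by linarith⟩
  refine max_eq_left ((min_le_right _ _).trans ?_)
  exact div_nonpos_of_nonpos_of_nonneg (by linarith) hη.le

theorem bump_eq_one {η h x : ℝ} (hη : 0 < η) (hx : x ∈ Icc (2 * η) (h - 2 * η)) :
    bump η h x = 1 := by
  have h1 : 2 * η ≤ min x (h - x) := le_min hx.1 (by linarith [hx.2])
  have h2 : 1 ≤ (min x (h - x) - η) / η := by rw [le_div_iff₀ hη]; linarith
  rw [bump, min_eq_left h2, max_eq_right zero_le_one]

theorem integrable_bump {η : ℝ} (hη : 0 < η) (h : ℝ) : Integrable (bump η h) :=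
  (continuous_bump η h).integrable_of_hasCompactSupport
    (HasCompactSupport.intro isCompact_Icc fun _ hx => bump_eq_zero hη hx)

theorem integral_bump_le {η h : ℝ} (hη : 0 < η) (hh : 0 ≤ h) : ∫ x, bump η h x ≤ h := by
  have hle : ∀ x, bump η h x ≤ (Icc 0 h).indicator 1 x := fun x => by
    by_cases hx : x ∈ Icc 0 h
    · rw [indicator_of_mem hx]; exact bump_le_one _ _ _
    · rw [bump_eq_zero hη fun h1 => hx ⟨by linarith [h1.1], by linarith [h1.2]⟩,
        indicator_of_notMem hx]
  refine (integral_mono (integrable_bump hη h) ?_ hle).trans (le_of_eq ?_)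
  · exact (integrable_indicator_iff measurableSet_Icc).2 (integrableOn_const (by simp))
  · rw [integral_indicator_one measurableSet_Icc, measureReal_def, Real.volume_Icc]
    simp [hh]

theorem le_integral_bump {η h : ℝ} (hη : 0 < η) : h - 4 * η ≤ ∫ x, bump η h x := by
  have hle : ∀ x, (Icc (2 * η) (h - 2 * η)).indicator 1 x ≤ bump η h x := fun x => by
    by_cases hx : x ∈ Icc (2 * η) (h - 2 * η)
    · rw [indicator_of_mem hx, bump_eq_one hη hx]; rfl
    · rw [indicator_of_notMem hx]; exact bump_nonneg _ _ _
  refine le_trans ?_ (integral_mono ?_ (integrable_bump hη h) hle)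
  · rw [integral_indicator_one measurableSet_Icc, measureReal_def, Real.volume_Icc]
    rw [ENNReal.toReal_ofReal']
    exact le_trans (by linarith) (le_max_left _ _)
  · exact (integrable_indicator_iff measurableSet_Icc).2 (integrableOn_const (by simp))

theorem card_rootTuples_le (ι : Type*) [Fintype ι] [DecidableEq ι] {n : ℕ} (a : Fin (n + 1) → ℝ) :
    (rootTuples ι (vecPoly a)).card ≤ n ^ card ι := by
  rw [rootTuples, Fintype.card_piFinset, prod_const, card_univ]
  refine Nat.pow_le_pow_left ((Multiset.toFinset_card_le _).trans
    ((Polynomial.card_roots' _).trans ?_)) _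
  refine Polynomial.natDegree_sum_le_of_forall_le _ _ fun i _ => ?_
  exact (Polynomial.natDegree_C_mul_X_pow_le _ _).trans (by have := i.2; omega)

theorem integrable_sum_rootTuples {ι : Type*} [Fintype ι] [DecidableEq ι] {n : ℕ} (hn : 1 ≤ n)
    {Φ : (ι → ℂ) → ℝ} (hΦ : Measurable Φ) {C : ℝ} (hC : ∀ z, |Φ z| ≤ C) :
    Integrable (fun a => ∑ p ∈ rootTuples ι (vecPoly a), Φ p) (γ[n]) := by
  have hC0 : 0 ≤ C := (abs_nonneg _).trans (hC 0)
  have hpos : ∀ f : (ι → ℂ) → ℝ, Measurable f →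
      AEMeasurable (fun a => ∑ p ∈ rootTuples ι (vecPoly a), max (f p) 0) (γ[n]) := by
    intro f hf
    refine (aemeasurable_sum_rootTuples hn (G := fun p => ofReal (f p))
      hf.ennreal_ofReal).ennreal_toReal.congr (ae_of_all _ fun a => ?_)
    simp only
    rw [ENNReal.toReal_sum fun _ _ => ofReal_ne_top]
    exact sum_congr rfl fun p _ => ENNReal.toReal_ofReal'
  refine Integrable.of_bound (((hpos Φ hΦ).sub (hpos (fun p => -Φ p) hΦ.neg)).congr
    (ae_of_all _ fun a => ?_)).aestronglyMeasurable ((n : ℝ) ^ card ι * C)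
    (ae_of_all _ fun a => ?_)
  · simp only [Pi.sub_apply]
    rw [← sum_sub_distrib]
    refine sum_congr rfl fun p _ => ?_
    rcases le_total (Φ p) 0 with h | h
    · rw [max_eq_right h, max_eq_left (by linarith)]; ring
    · rw [max_eq_left h, max_eq_right (by linarith)]; ring
  · refine (norm_sum_le _ _).trans ((sum_le_card_nsmul _ _ C fun p _ => hC p).trans ?_)
    rw [nsmul_eq_mul]
    gcongr
    exact_mod_cast card_rootTuples_le ι a

theorem integrable_sum_rootTuples_complex {ι : Type*} [Fintype ι] [DecidableEq ι] {n : ℕ}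
    (hn : 1 ≤ n) {Φ : (ι → ℂ) → ℂ} (hΦ : Measurable Φ) {C : ℝ} (hC : ∀ z, ‖Φ z‖ ≤ C) :
    Integrable (fun a => ∑ p ∈ rootTuples ι (vecPoly a), Φ p) (γ[n]) := by
  have h1 := integrable_sum_rootTuples hn (Complex.measurable_re.comp hΦ) (C := C)
    fun z => (abs_re_le_norm _).trans (hC z)
  have h2 := integrable_sum_rootTuples hn (measurable_im.comp hΦ) (C := C)
    fun z => (Complex.abs_im_le_norm _).trans (hC z)
  refine (h1.ofReal.add (h2.ofReal.mul_const I)).congr (ae_of_all _ fun a => ?_)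
  simp only [Pi.add_apply, Function.comp_apply]
  push_cast
  rw [sum_mul, ← sum_add_distrib]
  exact sum_congr rfl fun p _ => Complex.re_add_im _

/-- The cutoff function of the `b`-th of `M` blocks of the interval `(0, π)`. -/
def blockBump (M : ℕ) (b : ℕ) (θ : ℝ) : ℝ :=
  bump (π / M / M) (π / M) (θ - b * (π / M))

theorem blockBump_mem {M b : ℕ} (hM : 1 ≤ M) {θ : ℝ} (h : blockBump M b θ ≠ 0) :
    θ ∈ Icc (b * (π / M) + π / M / M) ((b + 1) * (π / M) - π / M / M) := by
  have hM0 : (0 : ℝ) < M := by exact_mod_cast hM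
  have hmem : θ - b * (π / M) ∈ Icc (π / M / M) (π / M - π / M / M) := by
    by_contra hcon
    exact h (bump_eq_zero (by have := pi_pos; positivity) hcon)
  exact ⟨by linarith [hmem.1], by linarith [hmem.2]⟩

theorem block_separated {M b b' : ℕ} (h : b < b') : (b + 1 : ℝ) * (π / M) ≤ b' * (π / M) := by
  have := pi_pos
  gcongr
  exact_mod_cast h

theorem blockBump_eq_zero {M b b' : ℕ} (hM : 1 ≤ M) (hbb : b ≠ b') {θ : ℝ}
    (h : blockBump M b θ ≠ 0) : blockBump M b' θ = 0 := by
  by_contra h'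
  have h1 := blockBump_mem hM h
  have h2 := blockBump_mem hM h'
  have hM0 : (0 : ℝ) < M := by exact_mod_cast hM
  have hη : 0 < π / M / M := by have := pi_pos; positivity
  rcases lt_or_gt_of_ne hbb with h3 | h3
  · have := block_separated (M := M) h3
    linarith [h1.2, h2.1]
  · have := block_separated (M := M) h3
    linarith [h2.2, h1.1]

theorem isBlockSystem_blockBump {M : ℕ} (hM : 1 ≤ M) {A : ℝ} (hA : 0 ≤ A) {ψ : ℝ → ℂ}
    (hψ : Continuous ψ) (hψA : ∀ x, A < |x| → ψ x = 0) (hψ2 : ∀ x, ‖ψ x‖ ≤ 2)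
    (S : Finset (Fin M)) :
    IsBlockSystem A (π / M) (π / M / M) (fun _ : S => ψ)
      (fun s => blockBump M (s : Fin M)) (fun s => (s : Fin M) * (π / M) + π / M / M)
      (fun s => ((s : Fin M) + 1) * (π / M) - π / M / M) := by
  have hM0 : (1 : ℝ) ≤ M := by exact_mod_cast hM
  have hπ := pi_pos
  have hη : 0 < π / M / M := by positivity
  refine ⟨fun _ => hψ, fun _ => hψA, fun _ => hψ2, fun s => ?_, fun s θ => bump_nonneg _ _ _,
    fun s θ => bump_le_one _ _ _, fun s θ hθ => ?_, hη, ?_, fun s => ?_, fun s => ?_,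
    fun s s' hs => ?_, fun s => ?_, hA, by positivity⟩
  · exact (continuous_bump _ _).comp (continuous_id.sub continuous_const)
  · by_contra h
    exact hθ (blockBump_mem hM h)
  · rw [div_div]
    exact div_le_self hπ.le (one_le_mul_of_one_le_of_one_le hM0 hM0)
  · have : 0 ≤ ((s : Fin M) : ℝ) * (π / M) := by positivity
    linarith
  · have := block_separated (M := M) (s : Fin M).2
    have h2 : (M : ℝ) * (π / M) = π := by field_simp
    linarith
  · have hne : ((s : Fin M) : ℕ) ≠ ((s' : Fin M) : ℕ) := fun h => hs (Subtype.ext (Fin.ext h))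
    rcases lt_or_gt_of_ne hne with h | h
    · left; have := block_separated (M := M) h; linarith
    · right; have := block_separated (M := M) h; linarith
  · linarith

theorem sum_blockBump_le_one {M : ℕ} (hM : 1 ≤ M) (θ : ℝ) : ∑ b : Fin M, blockBump M b θ ≤ 1 := by
  by_cases h : ∃ b : Fin M, blockBump M b θ ≠ 0
  · obtain ⟨b, hb⟩ := h
    rw [sum_eq_single b (fun c _ hc => blockBump_eq_zero hM
      (fun h => hc (Fin.ext h.symm)) hb) (by simp)]
    exact bump_le_one _ _ _
  · push Not at h
    simp [h]

/-- The part of `(0, π)` that is not covered by the cutoff functions. -/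
def blockGap (M : ℕ) (θ : ℝ) : ℝ := 1 - ∑ b : Fin M, blockBump M b θ

theorem continuous_blockBump (M b : ℕ) : Continuous (blockBump M b) :=
  (continuous_bump _ _).comp (continuous_id.sub continuous_const)

/-- The integral of a cutoff function. -/
def blockMass (M : ℕ) : ℝ := ∫ x, bump (π / M / M) (π / M) x

theorem integral_blockBump (M b : ℕ) : ∫ θ, blockBump M b θ = blockMass M :=
  integral_sub_right_eq_self (fun x => bump (π / M / M) (π / M) x) _

theorem blockMass_nonneg (M : ℕ) : 0 ≤ blockMass M := integral_nonneg fun _ => bump_nonneg _ _ _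

theorem mul_blockMass_le {M : ℕ} (hM : 1 ≤ M) : M * blockMass M ≤ π := by
  have hM0 : (0 : ℝ) < M := by exact_mod_cast hM
  have hπ := pi_pos
  have := integral_bump_le (η := π / M / M) (h := π / M) (by positivity) (by positivity)
  calc M * blockMass M ≤ M * (π / M) := by gcongr; exact this
    _ = π := by field_simp

theorem le_mul_blockMass {M : ℕ} (hM : 1 ≤ M) : π - 4 * π / M ≤ M * blockMass M := by
  have hM0 : (0 : ℝ) < M := by exact_mod_cast hM
  have hπ := pi_pos
  have := le_integral_bump (η := π / M / M) (h := π / M) (by positivity)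
  calc π - 4 * π / M = M * (π / M - 4 * (π / M / M)) := by field_simp
    _ ≤ M * blockMass M := by gcongr; exact this

theorem tendsto_mul_blockMass : Tendsto (fun M : ℕ => M * blockMass M) atTop (𝓝 π) := by
  have h1 : Tendsto (fun M : ℕ => π - 4 * π / M) atTop (𝓝 (π - 0)) :=
    tendsto_const_nhds.sub (tendsto_const_div_atTop_nhds_zero_nat _)
  rw [sub_zero] at h1
  refine tendsto_of_tendsto_of_tendsto_of_le_of_le' h1 tendsto_const_nhds ?_ ?_
  · filter_upwards [eventually_ge_atTop 1] with M hM using le_mul_blockMass hM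
  · filter_upwards [eventually_ge_atTop 1] with M hM using mul_blockMass_le hM

/-- Each of the `M` blocks loses at most `4 π / M²`, since its margin is `π / M²`. -/
theorem lintegral_blockGap_le {M : ℕ} (hM : 1 ≤ M) :
    ∫⁻ θ in Ioo 0 π, ofReal (blockGap M θ) ≤ ofReal (4 * π / M) := by
  have hM0 : (0 : ℝ) < M := by exact_mod_cast hM
  have hπ := pi_pos
  have hη : 0 < π / M / M := by positivity
  have hi : ∀ b : Fin M, Integrable (blockBump M b) := fun b =>
    (integrable_bump hη _).comp_sub_right _
  have h1 : ∫ θ in Ioo 0 π, blockGap M θ = π - M * blockMass M := by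
    unfold blockGap
    rw [integral_sub (integrable_const _) (integrable_finsetSum _ fun b _ => (hi b).integrableOn),
      integral_finsetSum _ fun b _ => (hi b).integrableOn]
    have : ∀ b : Fin M, ∫ θ in Ioo 0 π, blockBump M b θ = blockMass M := by
      intro b
      rw [setIntegral_eq_integral_of_forall_compl_eq_zero, integral_blockBump]
      intro θ hθ
      by_contra hcon
      have h2 := blockBump_mem hM hcon
      have h3 := block_separated (M := M) b.2
      have h4 : (M : ℝ) * (π / M) = π := by field_simp
      have h5 : 0 ≤ ((b : ℕ) : ℝ) * (π / M) := by positivity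
      exact hθ ⟨by linarith [h2.1], by linarith [h2.2]⟩
    simp [this, hπ.le]
  rw [← ofReal_integral_eq_lintegral_ofReal, h1]
  · exact ofReal_le_ofReal (by linarith [le_mul_blockMass hM])
  · exact (integrable_const _).sub (integrable_finsetSum _ fun b _ => (hi b).integrableOn)
  · exact ae_of_all _ fun θ => sub_nonneg.2 (sum_blockBump_le_one hM θ)

theorem blockFn_blockBump_of_im_nonpos {n M : ℕ} (hM : 1 ≤ M) (ψ : ℝ → ℂ) (b : Fin M) {p : ℂ}
    (hp : ¬ 0 < p.im) : blockFn n ψ (blockBump M b) p = 0 := by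
  have : blockBump M b (arg p) = 0 := by
    by_contra hcon
    have hM0 : (0 : ℝ) < M := by exact_mod_cast hM
    have hπ := pi_pos
    have hη : 0 < π / M / M := by positivity
    have h2 := blockBump_mem hM hcon
    have h3 := block_separated (M := M) b.2
    have h4 : (M : ℝ) * (π / M) = π := by field_simp
    have h5 : 0 ≤ ((b : ℕ) : ℝ) * (π / M) := by positivity
    have h6 : 0 ≤ p.im := Complex.arg_nonneg_iff.1 (by linarith [h2.1])
    have h7 : p.im = 0 := le_antisymm (not_lt.1 hp) h6
    rcases le_or_gt 0 p.re with h8 | h8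
    · have := Complex.arg_eq_zero_iff.2 ⟨h8, h7⟩
      linarith [h2.1]
    · have := Complex.arg_eq_pi_iff.2 ⟨h8, h7⟩
      linarith [h2.2]
  rw [blockFn, this, Complex.ofReal_zero, mul_zero]

/-! ### Multiplicative functionals of the roots in the upper half plane. -/

theorem norm_one_add_mul_le {w : ℂ} {t : ℝ} (hw : ‖1 + w‖ ≤ 1) (ht0 : 0 ≤ t) (ht1 : t ≤ 1) :
    ‖1 + w * t‖ ≤ 1 := by
  have : 1 + w * t = (t : ℂ) * (1 + w) + ((1 - t : ℝ) : ℂ) := by push_cast; ring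
  rw [this]
  refine (norm_add_le _ _).trans ?_
  rw [norm_mul, norm_real, norm_real, norm_of_nonneg ht0, norm_of_nonneg (by linarith)]
  nlinarith

/-- The deterministic comparison of a product over the roots in the upper half plane with products
of sums over the blocks. -/
theorem norm_prod_roots_sub_le {M : ℕ} (hM : 1 ≤ M) (n K : ℕ) (R : Finset ℂ) {ψ : ℝ → ℂ}
    (hψ : ∀ x, ‖1 + ψ x‖ ≤ 1) :
    ‖∏ p ∈ R, (1 + if 0 < p.im then ψ (rescaledModulus n p) else 0) -
      ∑ k ∈ range K, ∑ S ∈ (univ : Finset (Fin M)).powersetCard k,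
        ∏ b : S, ∑ p ∈ R, blockFn n ψ (blockBump M (b : Fin M)) p‖ ≤
    ∑ p ∈ R, (if 0 < p.im then ‖ψ (rescaledModulus n p)‖ * blockGap M (arg p) else 0) +
    ∑ S ∈ (univ : Finset (Fin M)).powersetCard K,
      ∏ b : S, ∑ p ∈ R, ‖blockFn n ψ (blockBump M (b : Fin M)) p‖ +
    ∑ k ∈ range K, ∑ S ∈ (univ : Finset (Fin M)).powersetCard k, ∑ b : S,
      (∑ p ∈ R, ∑ q ∈ R, if p = q then 0 else ‖blockFn n ψ (blockBump M (b : Fin M)) p‖ *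
        ‖blockFn n ψ (blockBump M (b : Fin M)) q‖) *
      ∏ c ∈ univ.erase b, ∑ p ∈ R, ‖blockFn n ψ (blockBump M (c : Fin M)) p‖ := by
  set y : Fin M → ℂ → ℂ := fun b p => blockFn n ψ (blockBump M b) p with hy
  have hy1 : ∀ b p, ‖1 + y b p‖ ≤ 1 := fun b p =>
    norm_one_add_mul_le (hψ _) (bump_nonneg _ _ _) (bump_le_one _ _ _)
  -- Three comparisons follow: the product over roots with the product of the `1 + u b`, at the cost
  -- of roots in the gaps; that product with its truncated expansion in the `u b`, by Bonferroni;
  -- and each `u b` with its linear part `w b`, at the cost of pairs in the block `b`.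
  set u : Fin M → ℂ := fun b => ∏ p ∈ R, (1 + y b p) - 1 with hu
  set w : Fin M → ℂ := fun b => ∑ p ∈ R, y b p with hw
  set L : Fin M → ℝ := fun b => ∑ p ∈ R, ‖y b p‖ with hL
  have huL : ∀ b, ‖u b‖ ≤ L b := fun b => norm_prod_one_add_sub_one_le R _ (hy1 b)
  have hwL : ∀ b, ‖w b‖ ≤ L b := fun b => norm_sum_le _ _
  have hu1 : ∀ b, ‖1 + u b‖ ≤ 1 := fun b => by
    simp only [hu]
    rw [add_sub_cancel, norm_prod]
    exact Finset.prod_le_one (fun _ _ => norm_nonneg _) fun p _ => hy1 b p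
  have hgap : ‖∏ p ∈ R, (1 + if 0 < p.im then ψ (rescaledModulus n p) else 0) -
      ∏ b, (1 + u b)‖ ≤ ∑ p ∈ R, (if 0 < p.im then ‖ψ (rescaledModulus n p)‖ *
        blockGap M (arg p) else 0) := by
    have e : ∏ b, (1 + u b) = ∏ p ∈ R, ∏ b, (1 + y b p) := by
      rw [Finset.prod_comm]
      exact prod_congr rfl fun b _ => by simp only [hu]; ring
    rw [e]
    refine (norm_prod_sub_prod_le_sum_norm R _ _ (fun p => ?_) fun p => ?_).trans
      (sum_le_sum fun p _ => ?_)
    · split_ifs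
      · exact hψ _
      · simp
    · rw [norm_prod]
      exact Finset.prod_le_one (fun _ _ => norm_nonneg _) fun b _ => hy1 b p
    · split_ifs with hp
      -- At most one cutoff function is nonzero at a given argument, so the product over the blocks
      -- is linear in their sum.
      · have hprod : ∏ b, (1 + y b p) = 1 + ψ (rescaledModulus n p) *
            ((∑ b : Fin M, blockBump M b (arg p) : ℝ) : ℂ) := by
          by_cases h : ∃ b : Fin M, blockBump M b (arg p) ≠ 0
          · obtain ⟨b, hb⟩ := h
            have h0 : ∀ c ≠ b, blockBump M c (arg p) = 0 := fun c hc =>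
              blockBump_eq_zero hM (fun h => hc (Fin.ext h.symm)) hb
            rw [Finset.prod_eq_single b (fun c _ hc => by simp [hy, blockFn, h0 c hc]) (by simp),
              sum_eq_single b (fun c _ hc => h0 c hc) (by simp)]
            rfl
          · push Not at h
            simp [hy, blockFn, h]
        rw [hprod, add_sub_add_left_eq_sub, ← mul_one_sub, ← Complex.ofReal_one,
          ← Complex.ofReal_sub, norm_mul, norm_real,
          norm_of_nonneg (sub_nonneg.2 (sum_blockBump_le_one hM _))]
        rfl
      · have : ∀ b, y b p = 0 := fun b => blockFn_blockBump_of_im_nonpos hM ψ b hp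
        simp [this]
  have hbon := norm_prod_one_add_sub_sum_powersetCard_le univ u hu1 K
  have hpair : ‖∑ k ∈ range K, ∑ S ∈ (univ : Finset (Fin M)).powersetCard k,
      ∏ b ∈ S, u b - ∑ k ∈ range K, ∑ S ∈ (univ : Finset (Fin M)).powersetCard k,
        ∏ b : S, w b‖ ≤ ∑ k ∈ range K,
        ∑ S ∈ (univ : Finset (Fin M)).powersetCard k, ∑ b : S,
      (∑ p ∈ R, ∑ q ∈ R, if p = q then 0 else ‖y b p‖ * ‖y b q‖) *
      ∏ c ∈ univ.erase b, L c := by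
    rw [← sum_sub_distrib]
    refine (norm_sum_le _ _).trans (sum_le_sum fun k _ => ?_)
    rw [← sum_sub_distrib]
    refine (norm_sum_le _ _).trans (sum_le_sum fun S _ => ?_)
    rw [← Finset.prod_coe_sort S u]
    exact norm_prod_sub_prod_le_sum univ (fun b : S => u b) (fun b => w b) (fun b => L b)
      (fun b => ∑ p ∈ R, ∑ q ∈ R, if p = q then 0 else ‖y b p‖ * ‖y b q‖) (fun b => huL b)
      (fun b => hwL b) fun b => norm_prod_one_add_sub_one_sub_sum_le R _ (hy1 b)
  have hbon' : ∑ S ∈ (univ : Finset (Fin M)).powersetCard K, ∏ b ∈ S, ‖u b‖ ≤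
      ∑ S ∈ (univ : Finset (Fin M)).powersetCard K, ∏ b : S, L b := by
    refine sum_le_sum fun S _ => ?_
    rw [Finset.prod_coe_sort S L]
    exact prod_le_prod (fun _ _ => norm_nonneg _) fun b _ => huL b
  refine (norm_sub_le_norm_sub_add_norm_sub _ (∏ b, (1 + u b)) _).trans ?_
  rw [add_assoc]
  refine add_le_add hgap ?_
  refine (norm_sub_le_norm_sub_add_norm_sub _ (∑ k ∈ range K,
    ∑ S ∈ (univ : Finset (Fin M)).powersetCard k, ∏ b ∈ S, u b) _).trans ?_
  exact add_le_add (hbon.trans hbon') hpair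

theorem integrable_sum_roots {n : ℕ} (hn : 1 ≤ n) {φ : ℂ → ℝ} (hφ : Measurable φ) {C : ℝ}
    (hC : ∀ z, |φ z| ≤ C) :
    Integrable (fun a => ∑ p ∈ (vecPoly a).roots.toFinset, φ p) (γ[n]) :=
  (integrable_sum_rootTuples (ι := Unit) hn (hφ.comp (measurable_pi_apply ())) (C := C)
    fun _ => hC _).congr (ae_of_all _ fun a => sum_rootTuples_unit (vecPoly a) φ)

namespace IsBlockSystem

variable {S : Type*} {A h δ : ℝ} {ψ : S → ℝ → ℂ} {χ : S → ℝ → ℝ} {α β : S → ℝ}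

theorem measurable_blockFn (H : IsBlockSystem A h δ ψ χ α β) (n : ℕ) (s : S) :
    Measurable (blockFn n (ψ s) (χ s)) :=
  _root_.measurable_blockFn (H.continuous_fst s) (H.continuous_snd s)

theorem norm (H : IsBlockSystem A h δ ψ χ α β) :
    IsBlockSystem A h δ (fun s x => ((‖ψ s x‖ : ℝ) : ℂ)) χ α β :=
  { H with
    continuous_fst := fun s => continuous_ofReal.comp (H.continuous_fst s).norm
    fst_eq_zero := fun s x hx => by simp [H.fst_eq_zero s x hx]
    norm_fst_le := fun s x => by simpa using H.norm_fst_le s x }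

theorem ofReal_norm_blockFn (H : IsBlockSystem A h δ ψ χ α β) (n : ℕ) (s : S) (z : ℂ) :
    ((‖blockFn n (ψ s) (χ s) z‖ : ℝ) : ℂ) = blockFn n (fun x => ((‖ψ s x‖ : ℝ) : ℂ)) (χ s) z := by
  rw [blockFn, blockFn, norm_mul, norm_real, norm_of_nonneg (H.snd_nonneg s _), Complex.ofReal_mul]

variable [Fintype S] [DecidableEq S]

theorem integrable_prod_sum (H : IsBlockSystem A h δ ψ χ α β) {n : ℕ} (hn : 1 ≤ n) :
    Integrable (fun a => ∏ s, ∑ p ∈ (vecPoly a).roots.toFinset, blockFn n (ψ s) (χ s) p)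
      (γ[n]) := by
  refine (integrable_sum_rootTuples_complex hn (Φ := fun p : S → ℂ =>
    ∏ s, blockFn n (ψ s) (χ s) (p s)) (measurable_fun_prod _ fun s _ =>
      (H.measurable_blockFn n s).comp (measurable_pi_apply s)) (C := 2 ^ card S)
      fun z => ?_).congr (ae_of_all _ fun a => sum_rootTuples_prod _ _)
  rw [norm_prod, ← card_univ, ← prod_const]
  exact prod_le_prod (fun s _ => norm_nonneg _) fun s _ => H.norm_blockFn_le n s _

theorem integrable_prod_sum_norm (H : IsBlockSystem A h δ ψ χ α β) {n : ℕ} (hn : 1 ≤ n) :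
    Integrable (fun a => ∏ s, ∑ p ∈ (vecPoly a).roots.toFinset, ‖blockFn n (ψ s) (χ s) p‖)
      (γ[n]) := by
  refine ((H.norm.integrable_prod_sum hn).re).congr (ae_of_all _ fun a => ?_)
  simp only [← H.ofReal_norm_blockFn]
  simp only [← ofReal_sum, ← Complex.ofReal_prod]
  exact Complex.ofReal_re _

theorem tendsto_integral_prod_sum_norm (H : IsBlockSystem A h δ ψ χ α β) :
    Tendsto (fun n : ℕ => ∫ a, ∏ s, ∑ p ∈ (vecPoly a).roots.toFinset, ‖blockFn n (ψ s) (χ s) p‖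
      ∂γ[n]) atTop
      (𝓝 (∏ s, ((1 / (12 * π)) * (∫ x, ‖ψ s x‖) * ∫ θ, χ s θ))) := by
  have h1 := (Complex.continuous_re.tendsto _).comp H.norm.tendsto_integral_prod_sum
  refine (h1.congr fun n => ?_).trans_eq ?_
  · simp only [Function.comp_apply, ← H.ofReal_norm_blockFn]
    simp only [← ofReal_sum, ← Complex.ofReal_prod]
    rw [integral_complex_ofReal, Complex.ofReal_re]
  · simp only [integral_complex_ofReal, ← Complex.ofReal_mul, ← Complex.ofReal_prod,
      Complex.ofReal_re]

/-- The number of pairs of roots in the same block. -/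
theorem integral_pair_le (H : IsBlockSystem A h δ ψ χ α β) : ∀ᶠ n : ℕ in atTop, ∀ s₀ : S,
      Integrable (fun a => (∑ p ∈ (vecPoly a).roots.toFinset, ∑ q ∈ (vecPoly a).roots.toFinset,
        if p = q then 0 else ‖blockFn n (ψ s₀) (χ s₀) p‖ * ‖blockFn n (ψ s₀) (χ s₀) q‖) *
        ∏ s ∈ univ.erase s₀, ∑ p ∈ (vecPoly a).roots.toFinset, ‖blockFn n (ψ s) (χ s) p‖)
        (γ[n]) ∧
      ∫ a, (∑ p ∈ (vecPoly a).roots.toFinset, ∑ q ∈ (vecPoly a).roots.toFinset,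
        if p = q then 0 else ‖blockFn n (ψ s₀) (χ s₀) p‖ * ‖blockFn n (ψ s₀) (χ s₀) q‖) *
        ∏ s ∈ univ.erase s₀, ∑ p ∈ (vecPoly a).roots.toFinset, ‖blockFn n (ψ s) (χ s) p‖
        ∂γ[n] ≤
      (intensityConst (card S + 1)).toReal * (8 * A * h) ^ (card S + 1) := by
  filter_upwards [H.lintegral_pair_le, eventually_ge_atTop 1] with n hn hn1 s₀
  set Φ : (Option S → ℂ) → ℝ := fun p => if p none = p (some s₀) then 0 else
    ∏ o : Option S, ‖blockFn n (ψ (o.getD s₀)) (χ (o.getD s₀)) (p o)‖ with hΦ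
  have hsum : ∀ a : Fin (n + 1) → ℝ, (∑ p ∈ (vecPoly a).roots.toFinset,
      ∑ q ∈ (vecPoly a).roots.toFinset, if p = q then 0 else
        ‖blockFn n (ψ s₀) (χ s₀) p‖ * ‖blockFn n (ψ s₀) (χ s₀) q‖) *
        ∏ s ∈ univ.erase s₀, ∑ p ∈ (vecPoly a).roots.toFinset, ‖blockFn n (ψ s) (χ s) p‖ =
      ∑ p ∈ rootTuples (Option S) (vecPoly a), Φ p := fun a =>
    (sum_rootTuples_option (vecPoly a) (fun s p => ‖blockFn n (ψ s) (χ s) p‖) s₀).symm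
  have hΦ0 : ∀ p, 0 ≤ Φ p := fun p => by
    simp only [hΦ]
    split_ifs
    · exact le_rfl
    · exact prod_nonneg fun _ _ => norm_nonneg _
  have hΦm : Measurable Φ := by
    refine Measurable.ite (measurableSet_eq_fun (measurable_pi_apply _) (measurable_pi_apply _))
      measurable_const (measurable_fun_prod _ fun o _ => ?_)
    exact ((H.measurable_blockFn n _).comp (measurable_pi_apply o)).norm
  have hint := integrable_sum_rootTuples hn1 hΦm (C := 2 ^ card (Option S)) fun z => by
    rw [abs_of_nonneg (hΦ0 z)]
    simp only [hΦ]
    split_ifs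
    · positivity
    · rw [← card_univ, ← prod_const]
      exact prod_le_prod (fun s _ => norm_nonneg _) fun s _ => H.norm_blockFn_le n _ _
  simp only [hsum]
  refine ⟨hint, ?_⟩
  have hA := H.nonneg_left
  have hh := H.nonneg_length
  rw [integral_eq_lintegral_of_nonneg_ae (ae_of_all _ fun a => sum_nonneg fun p _ => hΦ0 p)
    hint.aestronglyMeasurable]
  refine toReal_le_of_le_ofReal (by positivity) ?_
  rw [ofReal_mul ENNReal.toReal_nonneg, ofReal_toReal (intensityConst_ne_top _)]
  refine le_trans (le_of_eq (lintegral_congr fun a => ?_)) (hn s₀)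
  rw [ofReal_sum_of_nonneg fun p _ => hΦ0 p]
  refine sum_congr rfl fun p _ => ?_
  simp only [hΦ]
  split_ifs
  · exact ofReal_zero
  · exact ofReal_prod_of_nonneg fun _ _ => norm_nonneg _

end IsBlockSystem

/-- The product of `1 + ψ` over the roots in the upper half plane. -/
def rootProduct (n : ℕ) (ψ : ℝ → ℂ) (a : Fin (n + 1) → ℝ) : ℂ :=
  ∏ p ∈ (vecPoly a).roots.toFinset, (1 + if 0 < p.im then ψ (rescaledModulus n p) else 0)

/-- The gaps include the arcs next to `0` and `π`, where the limiting intensity is not available.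
The bound uniform near the real axis still charges them in proportion to their length. -/
theorem integral_gap_le {A : ℝ} (hA : 0 ≤ A) {M : ℕ} (hM : 1 ≤ M) {ψ : ℝ → ℂ} (hψc : Continuous ψ)
    (hψA : ∀ x, A < |x| → ψ x = 0) (hψ2 : ∀ x, ‖ψ x‖ ≤ 2) :
    ∀ᶠ n : ℕ in atTop, Integrable (fun a => ∑ p ∈ (vecPoly a).roots.toFinset, if 0 < p.im then
        ‖ψ (rescaledModulus n p)‖ * blockGap M (arg p) else 0) (γ[n]) ∧
      ∫ a, ∑ p ∈ (vecPoly a).roots.toFinset, (if 0 < p.im then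
        ‖ψ (rescaledModulus n p)‖ * blockGap M (arg p) else 0) ∂γ[n] ≤
      (intensityConst 1).toReal * (8 * A * (4 * π / M)) := by
  filter_upwards [eventually_annulus A] with n hn
  have hπ := pi_pos
  have hgc : Continuous (blockGap M) :=
    continuous_const.sub (continuous_finsetSum _ fun b _ => continuous_blockBump M b)
  have hg0 : ∀ θ, 0 ≤ blockGap M θ := fun θ => sub_nonneg.2 (sum_blockBump_le_one hM θ)
  have hg1 : ∀ θ, blockGap M θ ≤ 1 := fun θ =>
    sub_le_self _ (sum_nonneg fun b _ => bump_nonneg _ _ _)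
  set φ : ℂ → ℝ := fun p => if 0 < p.im then
    ‖ψ (rescaledModulus n p)‖ * blockGap M (arg p) else 0 with hφ
  have hφ0 : ∀ p, 0 ≤ φ p := fun p => by
    simp only [hφ]; split_ifs
    · exact mul_nonneg (norm_nonneg _) (hg0 _)
    · exact le_rfl
  have hint : Integrable (fun a => ∑ p ∈ (vecPoly a).roots.toFinset, φ p) (γ[n]) := by
    refine integrable_sum_roots (by omega) (C := 2) ?_ fun z => ?_
    · refine Measurable.ite (measurableSet_lt measurable_const measurable_im) ?_ measurable_const
      exact (hψc.comp (continuous_rescaledModulus n)).norm.measurable.mul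
        (hgc.measurable.comp Complex.measurable_arg)
    · rw [abs_of_nonneg (hφ0 z)]
      simp only [hφ]; split_ifs
      · nlinarith [hψ2 (rescaledModulus n z), hg0 (arg z), hg1 (arg z),
          norm_nonneg (ψ (rescaledModulus n z))]
      · norm_num
  refine ⟨hint, ?_⟩
  rw [integral_eq_lintegral_of_nonneg_ae (ae_of_all _ fun a => sum_nonneg fun p _ => hφ0 p)
    hint.aestronglyMeasurable]
  refine toReal_le_of_le_ofReal (by positivity) ?_
  rw [ofReal_mul ENNReal.toReal_nonneg, ofReal_toReal (intensityConst_ne_top _),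
    ofReal_mul (by positivity)]
  refine le_trans (le_of_eq (lintegral_congr fun a => ?_)) ((lintegral_sum_upper_roots_le hn.1
    hn.2.1 hn.2.2 hψc.norm (fun x hx => by rw [hψA x hx, norm_zero]) (fun x => norm_nonneg _) hψ2
    hgc hg0 hg1).trans (mul_le_mul' le_rfl (mul_le_mul' le_rfl (lintegral_blockGap_le hM))))
  rw [ofReal_sum_of_nonneg fun p _ => hφ0 p]
  refine sum_congr rfl fun p _ => ?_
  simp only [hφ]
  split_ifs
  · rfl
  · exact ofReal_zero

theorem choose_mul_le (M k : ℕ) {x : ℝ} (hx : 0 ≤ x) :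
    (M.choose k : ℝ) * x ^ k ≤ (M * x) ^ k / k.factorial := by
  have := Nat.choose_le_pow_div (α := ℝ) k M
  calc _ ≤ ((M : ℝ) ^ k / k.factorial) * x ^ k := by gcongr
    _ = _ := by rw [mul_pow]; ring

/-- Approximation of the mean of the product over the roots by a truncated exponential series. -/
theorem norm_integral_rootProduct_sub_le {A : ℝ} (hA : 0 ≤ A) {M : ℕ} (hM : 1 ≤ M) (K : ℕ)
    {ψ : ℝ → ℂ} (hψc : Continuous ψ) (hψA : ∀ x, A < |x| → ψ x = 0) (hψ1 : ∀ x, ‖1 + ψ x‖ ≤ 1)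
    (hint : ∀ n : ℕ, 1 ≤ n → Integrable (rootProduct n ψ) (γ[n]))
    {η : ℝ} (hη : 0 < η) :
    ∀ᶠ n : ℕ in atTop, ‖∫ a, rootProduct n ψ a ∂γ[n] - ∑ k ∈ range K, (M.choose k : ℂ) *
          ((1 / (12 * π) : ℝ) * (∫ x, ψ x) * blockMass M) ^ k‖ ≤
      (intensityConst 1).toReal * (8 * A * (4 * π / M)) +
      (1 / (12 * π) * (∫ x, ‖ψ x‖) * π) ^ K / K.factorial +
      (∑ k ∈ range K, k * (intensityConst (k + 1)).toReal * (8 * A * π) ^ (k + 1)) / M + η := by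
  have hψ2 : ∀ x, ‖ψ x‖ ≤ 2 := fun x => by
    have : ψ x = (1 + ψ x) - 1 := by ring
    rw [this]
    refine (norm_sub_le _ _).trans ?_
    rw [norm_one]; linarith [hψ1 x]
  have hM0 : (0 : ℝ) < M := by exact_mod_cast hM
  have hπ := pi_pos
  have hc : 0 ≤ 1 / (12 * π) * ∫ x, ‖ψ x‖ :=
    mul_nonneg (by positivity) (integral_nonneg fun _ => norm_nonneg _)
  have HS : ∀ S : Finset (Fin M), _ := fun S => isBlockSystem_blockBump hM hA hψc hψA hψ2 S
  -- The truncated and linearised expansion. Its mean converges for fixed `M` and `K`, each of the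
  -- `M.choose k` sets of blocks having the same limit.
  set G : ∀ n : ℕ, (Fin (n + 1) → ℝ) → ℂ := fun n a => ∑ k ∈ range K,
    ∑ S ∈ (univ : Finset (Fin M)).powersetCard k, ∏ b : S,
      ∑ p ∈ (vecPoly a).roots.toFinset, blockFn n ψ (blockBump M (b : Fin M)) p with hG
  have hGi : ∀ n, 1 ≤ n → Integrable (G n) (γ[n]) := fun n hn =>
    integrable_finsetSum _ fun k _ => integrable_finsetSum _ fun S _ => (HS S).integrable_prod_sum hn
  have hcard : ∀ k, ∀ S ∈ (univ : Finset (Fin M)).powersetCard k, card S = k :=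
    fun k S hS => by rw [Fintype.card_coe]; exact (Finset.mem_powersetCard.1 hS).2
  have hGlim : Tendsto (fun n => ∫ a, G n a ∂γ[n]) atTop (𝓝 (∑ k ∈ range K, (M.choose k : ℂ) *
          ((1 / (12 * π) : ℝ) * (∫ x, ψ x) * blockMass M) ^ k)) := by
    have h1 : Tendsto (fun n => ∑ k ∈ range K,
        ∑ S ∈ (univ : Finset (Fin M)).powersetCard k, ∫ a, ∏ b : S,
        ∑ p ∈ (vecPoly a).roots.toFinset, blockFn n ψ (blockBump M (b : Fin M)) p ∂γ[n]) atTop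
        (𝓝 (∑ k ∈ range K, ∑ S ∈ (univ : Finset (Fin M)).powersetCard k,
          ((1 / (12 * π) : ℝ) * (∫ x, ψ x) * blockMass M) ^ k)) := by
      refine tendsto_finsetSum _ fun k _ => tendsto_finsetSum _ fun S hS => ?_
      refine ((HS S).tendsto_integral_prod_sum).trans_eq ?_
      simp only [integral_complex_ofReal, integral_blockBump, prod_const, card_univ, hcard k S hS]
    refine (h1.congr' ?_).trans_eq ?_
    · filter_upwards [eventually_ge_atTop 1] with n hn
      simp only [hG]
      rw [integral_finsetSum _ fun k _ => integrable_finsetSum _ fun S _ =>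
        (HS S).integrable_prod_sum hn]
      exact sum_congr rfl fun k _ =>
        (integral_finsetSum _ fun S _ => (HS S).integrable_prod_sum hn).symm
    · congr 1
      refine sum_congr rfl fun k _ => ?_
      rw [sum_const, Finset.card_powersetCard, card_univ, Fintype.card_fin, nsmul_eq_mul]
  have hBlim : Tendsto (fun n => ∑ S ∈ (univ : Finset (Fin M)).powersetCard K, ∫ a, ∏ b : S,
        ∑ p ∈ (vecPoly a).roots.toFinset, ‖blockFn n ψ (blockBump M (b : Fin M)) p‖
          ∂γ[n]) atTop (𝓝 ((M.choose K : ℝ) *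
          (1 / (12 * π) * (∫ x, ‖ψ x‖) * blockMass M) ^ K)) := by
    have h1 : Tendsto (fun n => ∑ S ∈ (univ : Finset (Fin M)).powersetCard K, ∫ a, ∏ b : S,
        ∑ p ∈ (vecPoly a).roots.toFinset, ‖blockFn n ψ (blockBump M (b : Fin M)) p‖ ∂γ[n]) atTop
        (𝓝 (∑ S ∈ (univ : Finset (Fin M)).powersetCard K,
          (1 / (12 * π) * (∫ x, ‖ψ x‖) * blockMass M) ^ K)) := by
      refine tendsto_finsetSum _ fun S hS => ?_
      refine ((HS S).tendsto_integral_prod_sum_norm).trans_eq ?_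
      simp only [integral_blockBump, prod_const, card_univ, hcard K S hS]
    refine h1.trans_eq ?_
    rw [sum_const, Finset.card_powersetCard, card_univ, Fintype.card_fin, nsmul_eq_mul]
  have hBle : (M.choose K : ℝ) * (1 / (12 * π) * (∫ x, ‖ψ x‖) * blockMass M) ^ K ≤
      (1 / (12 * π) * (∫ x, ‖ψ x‖) * π) ^ K / K.factorial := by
    refine (choose_mul_le M K (mul_nonneg hc (blockMass_nonneg M))).trans ?_
    have h0 := blockMass_nonneg M
    rw [mul_left_comm]
    gcongr
    exact mul_blockMass_le hM
  have hpair : ∀ᶠ n : ℕ in atTop, ∀ S : Finset (Fin M), _ :=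
    eventually_all.2 fun S => (HS S).integral_pair_le
  filter_upwards [integral_gap_le hA hM hψc hψA hψ2, hpair, eventually_ge_atTop 1,
    hBlim.eventually_le_const (lt_add_of_pos_right _ (half_pos hη)),
    (Metric.tendsto_nhds.1 hGlim) (η / 2) (by positivity)] with n hgap hpair hn1 hB hGd
  have hBi := fun S : Finset (Fin M) => (HS S).integrable_prod_sum_norm hn1
  have hBs := integrable_finsetSum ((univ : Finset (Fin M)).powersetCard K) fun S _ => hBi S
  have hPk := fun k : ℕ => integrable_finsetSum ((univ : Finset (Fin M)).powersetCard k)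
    fun S _ => integrable_finsetSum univ fun b _ => (hpair S b).1
  have hPs := integrable_finsetSum (range K) fun k _ => hPk k
  have hmono := (norm_integral_le_integral_norm _).trans (integral_mono_of_nonneg
    (ae_of_all _ fun a => norm_nonneg (rootProduct n ψ a - G n a)) ((hgap.1.add hBs).add hPs)
    (ae_of_all _ fun a => norm_prod_roots_sub_le hM n K (vecPoly a).roots.toFinset hψ1))
  rw [integral_sub (hint n hn1) (hGi n hn1), integral_add' (hgap.1.add hBs) hPs,
    integral_add' hgap.1 hBs, integral_finsetSum _ fun S _ => hBi S,
    integral_finsetSum _ fun k _ => hPk k] at hmono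
  have hP : ∑ k ∈ range K, ∫ a, ∑ S ∈ (univ : Finset (Fin M)).powersetCard k,
      ∑ b : S, (∑ p ∈ (vecPoly a).roots.toFinset, ∑ q ∈ (vecPoly a).roots.toFinset,
        if p = q then 0 else ‖blockFn n ψ (blockBump M (b : Fin M)) p‖ *
        ‖blockFn n ψ (blockBump M (b : Fin M)) q‖) * ∏ c ∈ univ.erase b,
        ∑ p ∈ (vecPoly a).roots.toFinset, ‖blockFn n ψ (blockBump M (c : Fin M)) p‖
        ∂γ[n] ≤ (∑ k ∈ range K, k * (intensityConst (k + 1)).toReal *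
        (8 * A * π) ^ (k + 1)) / M := by
    rw [sum_div]
    refine sum_le_sum fun k _ => ?_
    rw [integral_finsetSum _ fun S _ => integrable_finsetSum _ fun b _ => (hpair S b).1]
    have h1 : ∀ S ∈ (univ : Finset (Fin M)).powersetCard k, ∫ a,
      ∑ b : S, (∑ p ∈ (vecPoly a).roots.toFinset, ∑ q ∈ (vecPoly a).roots.toFinset,
        if p = q then 0 else ‖blockFn n ψ (blockBump M (b : Fin M)) p‖ *
        ‖blockFn n ψ (blockBump M (b : Fin M)) q‖) * ∏ c ∈ univ.erase b,
        ∑ p ∈ (vecPoly a).roots.toFinset, ‖blockFn n ψ (blockBump M (c : Fin M)) p‖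
        ∂γ[n] ≤
        k * ((intensityConst (k + 1)).toReal * (8 * A * (π / M)) ^ (k + 1)) := by
      intro S hS
      rw [integral_finsetSum _ fun b _ => (hpair S b).1]
      refine (sum_le_card_nsmul _ _ _ fun b _ => (hpair S b).2).trans (le_of_eq ?_)
      rw [hcard k S hS, card_univ, hcard k S hS, nsmul_eq_mul]
    refine (sum_le_card_nsmul _ _ _ h1).trans ?_
    rw [Finset.card_powersetCard, card_univ, Fintype.card_fin, nsmul_eq_mul]
    have h2 : (M.choose k : ℝ) ≤ (M : ℝ) ^ k := by exact_mod_cast Nat.choose_le_pow M k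
    -- There are at most `M ^ k` sets of `k` blocks, and an additional root in one block costs `M ^
    -- (-(k + 1))` in total; one factor `1 / M` remains.
    calc _ ≤ (M : ℝ) ^ k * (k * ((intensityConst (k + 1)).toReal *
          (8 * A * (π / M)) ^ (k + 1))) := by gcongr
      _ = _ := by
          rw [show 8 * A * (π / M) = 8 * A * π / M by ring, div_pow]
          generalize 8 * A * π = X
          rw [pow_succ (M : ℝ)]
          field_simp
  rw [dist_eq_norm] at hGd
  refine (norm_sub_le_norm_sub_add_norm_sub _ (∫ a, G n a ∂γ[n]) _).trans ?_
  linarith [hgap.2]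

/-- `M.choose k` is asymptotic to `M ^ k / k!`, and `M * blockMass M` tends to the full length `π`.
-/
theorem tendsto_sum_choose_mul_blockMass (K : ℕ) (x : ℂ) :
    Tendsto (fun M : ℕ => ∑ k ∈ range K, (M.choose k : ℂ) * (x * blockMass M) ^ k) atTop
      (𝓝 (∑ k ∈ range K, (x * π) ^ k / k.factorial)) := by
  refine tendsto_finsetSum _ fun k _ => ?_
  have h1 := (continuous_ofReal.tendsto _).comp
    (tendsto_choose_mul_pow_atTop (k := k) tendsto_mul_blockMass)
  refine ((h1.const_mul (x ^ k)).congr fun M => ?_).trans_eq ?_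
  · simp only [Function.comp_apply]; push_cast; ring
  · congr 1; push_cast; ring

/-- Convergence of the mean of multiplicative functionals of the roots in the upper half plane. -/
theorem tendsto_integral_rootProduct {A : ℝ} (hA : 0 ≤ A) {ψ : ℝ → ℂ} (hψc : Continuous ψ)
    (hψA : ∀ x, A < |x| → ψ x = 0) (hψ1 : ∀ x, ‖1 + ψ x‖ ≤ 1)
    (hint : ∀ n : ℕ, 1 ≤ n → Integrable (rootProduct n ψ) (γ[n])) :
    Tendsto (fun n : ℕ => ∫ a, rootProduct n ψ a ∂γ[n]) atTop (𝓝 (exp (1 / 12 * ∫ x, ψ x))) := by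
  have hπ := pi_pos
  set x : ℂ := (1 / (12 * π) : ℝ) * ∫ x, ψ x with hx
  have hxπ : x * π = 1 / 12 * ∫ x, ψ x := by
    have : (π : ℂ) ≠ 0 := by exact_mod_cast hπ.ne'
    rw [hx]; push_cast; field_simp
  rw [← hxπ, Metric.tendsto_nhds]
  intro ε hε
  have h1 : Tendsto (fun K : ℕ => ∑ k ∈ range K, (x * π) ^ k / k.factorial) atTop
      (𝓝 (exp (x * π))) := by
    rw [Complex.exp_eq_exp_ℂ]
    exact (NormedSpace.expSeries_div_hasSum_exp (x * π)).tendsto_sum_nat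
  have h2 := FloorSemiring.tendsto_pow_div_factorial_atTop (1 / (12 * π) * (∫ x, ‖ψ x‖) * π)
  -- The order of choice matters: `K` controls the exponential tail and the Bonferroni remainder,
  -- then `M` the gaps and pairs for that `K`, and finally `n` is large.
  obtain ⟨K, hK1, hK2⟩ := ((Metric.tendsto_nhds.1 h1 (ε / 6) (by positivity)).and
    (h2.eventually_lt_const (by positivity : 0 < ε / 6))).exists
  have h3 := Metric.tendsto_nhds.1 (tendsto_sum_choose_mul_blockMass K x) (ε / 6) (by positivity)
  have h4 : Tendsto (fun M : ℕ => (intensityConst 1).toReal * (8 * A * (4 * π / M)) +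
      (∑ k ∈ range K, k * (intensityConst (k + 1)).toReal *
        (8 * A * π) ^ (k + 1)) / M) atTop (𝓝 (_ * (_ * 0) + 0)) :=
    (((tendsto_const_div_atTop_nhds_zero_nat _).const_mul _).const_mul _).add
      (tendsto_const_div_atTop_nhds_zero_nat _)
  obtain ⟨M, ⟨hM1, hM2⟩, hM⟩ := ((h3.and (h4.eventually_lt_const (by
    rw [mul_zero, mul_zero, add_zero]; positivity : _ < ε / 6))).and (eventually_ge_atTop 1)).exists
  filter_upwards [norm_integral_rootProduct_sub_le hA hM K hψc hψA hψ1 hint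
    (by positivity : 0 < ε / 6)] with n hn
  rw [dist_eq_norm] at hK1 hM1 ⊢
  rw [← hx] at hn
  have := norm_sub_le_norm_sub_add_norm_sub (∫ a, rootProduct n ψ a ∂γ[n])
    (∑ k ∈ range K, (M.choose k : ℂ) * (x * blockMass M) ^ k) (exp (x * π))
  have := norm_sub_le_norm_sub_add_norm_sub (∑ k ∈ range K, (M.choose k : ℂ) *
    (x * blockMass M) ^ k) (∑ k ∈ range K, (x * π) ^ k / k.factorial)
    (exp (x * π))
  linarith

/-- The sum of a test function over the roots in the upper half plane. -/
def upperSum (n : ℕ) (g : ℝ → ℝ) (a : Fin (n + 1) → ℝ) : ℝ :=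
  ∑ p ∈ (vecPoly a).roots.toFinset, if 0 < p.im then g (rescaledModulus n p) else 0

/-- Convergence of the characteristic functionals. -/
theorem tendsto_integral_exp_upperSum {A : ℝ} (hA : 0 ≤ A) {g : ℝ → ℝ} (hg : Continuous g)
    (hgA : ∀ x, A < |x| → g x = 0) :
    Tendsto (fun n : ℕ => ∫ a, exp (upperSum n g a * I) ∂γ[n])
      atTop (𝓝 (exp (1 / 12 * ∫ x, (exp (g x * I) - 1)))) := by
  have hprod : ∀ (n : ℕ) (a : Fin (n + 1) → ℝ), exp (upperSum n g a * I) =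
      rootProduct n (fun x => exp (g x * I) - 1) a := by
    intro n a
    rw [upperSum, rootProduct, ofReal_sum, sum_mul, exp_sum]
    refine prod_congr rfl fun p _ => ?_
    split_ifs <;> simp
  obtain ⟨B, hB⟩ : ∃ B, ∀ x, |g x| ≤ B := by
    have hc : HasCompactSupport g := HasCompactSupport.intro (isCompact_Icc (a := -A) (b := A))
      fun x hx => hgA x (not_le.1 fun h => hx (abs_le.1 h))
    exact hc.exists_bound_of_continuous hg
  simp only [hprod]
  refine tendsto_integral_rootProduct hA (by fun_prop) (fun x hx => by simp [hgA x hx])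
    (fun x => by simp [norm_exp_ofReal_mul_I]) fun n hn => ?_
  simp only [funext fun a => (hprod n a).symm]
  have hm : AEStronglyMeasurable (upperSum n g) (γ[n]) := by
    refine (integrable_sum_roots hn (C := B) ?_ fun z => ?_).aestronglyMeasurable
    · exact Measurable.ite (measurableSet_lt measurable_const measurable_im)
        (hg.comp (continuous_rescaledModulus n)).measurable measurable_const
    · split_ifs
      · exact hB _
      · simpa using (abs_nonneg _).trans (hB 0)
  refine Integrable.of_bound (((Complex.continuous_exp.comp (continuous_id.mul
    continuous_const)).comp continuous_ofReal).comp_aestronglyMeasurable hm) 1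
    (ae_of_all _ fun a => (norm_exp_ofReal_mul_I _).le)

/-! ### Absence of real roots near the unit circle. -/

theorem gaussianReal_Icc_le {v : ℝ≥0} (hv : v ≠ 0) (t : ℝ) :
    gaussianReal 0 v (Icc (-t) t) ≤ ofReal (2 * t / √v) := by
  have hv0 : (0 : ℝ) < v := by exact_mod_cast pos_iff_ne_zero.2 hv
  have hs : 0 < √(v : ℝ) := Real.sqrt_pos.2 hv0
  have hle : ∀ x, gaussianPDF 0 v x ≤ ofReal (1 / √v) := fun x => by
    refine ofReal_le_ofReal ?_
    rw [gaussianPDFReal, one_div]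
    refine (mul_le_of_le_one_right (by positivity) (Real.exp_le_one_iff.2 ?_)).trans
      (inv_anti₀ hs (Real.sqrt_le_sqrt ?_))
    · exact div_nonpos_of_nonpos_of_nonneg (neg_nonpos.2 (sq_nonneg _)) (by positivity)
    · nlinarith [Real.pi_gt_three]
  rw [gaussianReal_apply _ hv]
  calc _ ≤ ∫⁻ _ in Icc (-t) t, ofReal (1 / √v) := lintegral_mono fun x => hle x
    _ = _ := by
      rw [setLIntegral_const, Real.volume_Icc, ← ofReal_mul (by positivity)]
      congr 1; ring

theorem lintegral_sum_abs_gaussVec (n : ℕ) :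
    ∫⁻ a, ∑ k, ‖a k‖ₑ ∂γ[n] = (n + 1 : ℕ) * ∫⁻ x, ‖x‖ₑ ∂gaussianReal 0 1 := by
  rw [lintegral_finsetSum _ fun k _ => (measurable_pi_apply k).enorm]
  have : ∀ k, ∫⁻ a : Fin (n + 1) → ℝ, ‖a k‖ₑ ∂γ[n] = ∫⁻ x, ‖x‖ₑ ∂gaussianReal 0 1 := fun k =>
    (measurePreserving_eval (fun _ : Fin (n + 1) => gaussianReal 0 1) k).lintegral_comp
      measurable_enorm
  simp [this]

theorem lintegral_enorm_gaussianReal_ne_top : ∫⁻ x, ‖x‖ₑ ∂gaussianReal 0 1 ≠ ∞ :=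
  ((memLp_id_gaussianReal 1).integrable le_rfl).2.ne

/-- A real point of the annulus is within `A / n²` of the sign `σ`, so its powers up to `n` differ
from those of `σ` by at most `4 A / n`. -/
theorem norm_eval_sub_eval_sign_le {n : ℕ} {A x σ : ℝ} (hσ : σ = 1 ∨ σ = -1) (hx0 : 0 ≤ σ * x)
    (hn : 1 ≤ n) (hA : 2 * A * (n + 1) ≤ (n : ℝ) ^ 2) (hx : (x : ℂ) ∈ annulus n A)
    (a : Fin (n + 1) → ℝ) :
    ‖(vecPoly a).eval (x : ℂ) - (vecPoly a).eval (σ : ℂ)‖ ≤ 4 * A / n * ∑ k, ‖a k‖ := by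
  have hn0 : (0 : ℝ) < n := by exact_mod_cast hn
  have hσ2 : σ * σ = 1 := by rcases hσ with rfl | rfl <;> norm_num
  have hσ1 : ‖(σ : ℂ)‖ = 1 := by rcases hσ with rfl | rfl <;> simp
  have hnc := nearCircle_of_mem_annulus hn hA hx
  have hp : ∀ k ≤ n, ‖((σ * x : ℝ) : ℂ)‖ ^ k ≤ 4 := fun k hk => by
    rw [Complex.ofReal_mul, norm_mul, hσ1, one_mul]
    linarith [(hnc k (by omega)).1]
  have hd : ‖((σ * x : ℝ) : ℂ) - 1‖ ≤ A / (n : ℝ) ^ 2 := by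
    rw [← Complex.ofReal_one, ← Complex.ofReal_sub, norm_real, norm_eq_abs,
      le_div_iff₀ (by positivity)]
    have : rescaledModulus n (x : ℂ) = (n : ℝ) ^ 2 * (1 - σ * x) := by
      have h1 : ‖(x : ℂ)‖ = σ * x := by
        rw [norm_real, norm_eq_abs, ← abs_of_nonneg hx0, abs_mul]
        rcases hσ with rfl | rfl <;> simp
      rw [rescaledModulus, h1]
    have h2 : |rescaledModulus n (x : ℂ)| ≤ A := hx
    rw [this, abs_mul, abs_of_nonneg (by positivity : (0 : ℝ) ≤ (n : ℝ) ^ 2), abs_sub_comm] at h2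
    linarith
  rw [eval_vecPoly, eval_vecPoly, ← sum_sub_distrib, mul_sum]
  refine (norm_sum_le _ _).trans (sum_le_sum fun k _ => ?_)
  have hk : ((k : ℕ) : ℝ) ≤ n := by exact_mod_cast Nat.lt_succ_iff.1 k.2
  have e : (x : ℂ) ^ (k : ℕ) - (σ : ℂ) ^ (k : ℕ) =
      (σ : ℂ) ^ (k : ℕ) * (((σ * x : ℝ) : ℂ) ^ (k : ℕ) - 1) := by
    rw [mul_sub, mul_one, ← mul_pow, ← Complex.ofReal_mul, ← mul_assoc, hσ2, one_mul]
  rw [← mul_sub, e, norm_mul, norm_mul, norm_pow, hσ1, one_pow, one_mul, norm_real, mul_comm]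
  refine mul_le_mul_of_nonneg_right ?_ (norm_nonneg _)
  calc _ ≤ 4 * ((k : ℕ) : ℝ) * ‖((σ * x : ℝ) : ℂ) - 1‖ :=
        norm_pow_sub_one_le hp k (by have := k.2; omega)
    _ ≤ 4 * n * (A / (n : ℝ) ^ 2) := by gcongr
    _ = 4 * A / n := by field_simp

/-- Real roots near the unit circle disappear. -/
theorem tendsto_measure_real_root {A : ℝ} (hA0 : 0 < A) : Tendsto (fun n : ℕ => γ[n]
      {a | ∃ x : ℝ, (x : ℂ) ∈ annulus n A ∧ (vecPoly a).eval (x : ℂ) = 0}) atTop (𝓝 0) := by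
  set D := ∫⁻ x, ‖x‖ₑ ∂gaussianReal 0 1 with hD
  have hsq : Tendsto (fun n : ℕ => √√(n : ℝ)) atTop atTop :=
    Real.tendsto_sqrt_atTop.comp (Real.tendsto_sqrt_atTop.comp tendsto_natCast_atTop_atTop)
  have hlim : Tendsto (fun n : ℕ => ofReal (4 / √√(n : ℝ)) +
      ofReal (8 * A / √√(n : ℝ)) * D) atTop (𝓝 0) := by
    have h1 : ∀ c : ℝ, Tendsto (fun n : ℕ => ofReal (c / √√(n : ℝ))) atTop (𝓝 0) := fun c =>
      (ENNReal.tendsto_ofReal (tendsto_const_nhds.div_atTop hsq)).trans_eq (by simp)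
    simpa using (h1 4).add (ENNReal.Tendsto.mul_const (h1 (8 * A))
      (Or.inr lintegral_enorm_gaussianReal_ne_top))
  refine tendsto_of_tendsto_of_tendsto_of_le_of_le' tendsto_const_nhds hlim
    (Eventually.of_forall fun n => bot_le) ?_
  filter_upwards [eventually_annulus A] with n hn
  have hn1 : 1 ≤ n := by omega
  have hn0 : (1 : ℝ) ≤ n := by exact_mod_cast hn1
  -- A real root in the annulus forces `|f(1)| ≤ t` or `|f(-1)| ≤ t`, unless the sum of the `|a k|`
  -- is at least `t n / (4 A)`. The variables `f(±1)` have variance `n + 1`, so the first events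
  -- have probability `O(t / √n)`; the last one has `O(1 / t)` by Markov. The choice `t = n ^ (1/4)`
  -- balances the two.
  set t := √√(n : ℝ) with ht
  have ht0 : 0 < t := Real.sqrt_pos.2 (Real.sqrt_pos.2 (by linarith))
  have htt : t * t = √(n : ℝ) := Real.mul_self_sqrt (Real.sqrt_nonneg _)
  set E : ℝ → Set (Fin (n + 1) → ℝ) := fun σ =>
    (fun a => (fun k : Fin (n + 1) => σ ^ (k : ℕ)) ⬝ᵥ a) ⁻¹' Icc (-t) t with hE
  set F : Set (Fin (n + 1) → ℝ) := {a | ofReal (t * n / (4 * A)) ≤ ∑ k, ‖a k‖ₑ} with hF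
  have hsub : {a : Fin (n + 1) → ℝ | ∃ x : ℝ, (x : ℂ) ∈ annulus n A ∧
      (vecPoly a).eval (x : ℂ) = 0} ⊆ (E 1 ∪ E (-1)) ∪ F := by
    rintro a ⟨x, hx, h0⟩
    by_cases hF' : a ∈ F
    · exact Or.inr hF'
    left
    have hsum : ∑ k, ‖a k‖ ≤ t * n / (4 * A) := by
      have h1 : ∑ k, ‖a k‖ₑ < ofReal (t * n / (4 * A)) := not_le.1 hF'
      have h2 : ∑ k, ‖a k‖ₑ = ofReal (∑ k, ‖a k‖) := by
        rw [ofReal_sum_of_nonneg fun _ _ => norm_nonneg _]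
        exact sum_congr rfl fun k _ => (ofReal_norm _).symm
      rw [h2] at h1
      exact ((ENNReal.ofReal_lt_ofReal_iff_of_nonneg (sum_nonneg fun _ _ => norm_nonneg _)).1 h1).le
    have key : ∀ σ : ℝ, (σ = 1 ∨ σ = -1) → 0 ≤ σ * x → a ∈ E σ := by
      intro σ hσ hσx
      have h1 := norm_eval_sub_eval_sign_le hσ hσx hn1 hn.2.2 hx a
      have h2 : (vecPoly a).eval (σ : ℂ) =
          (((fun k : Fin (n + 1) => σ ^ (k : ℕ)) ⬝ᵥ a : ℝ) : ℂ) := by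
        rw [eval_vecPoly, dotProduct]; push_cast
        exact sum_congr rfl fun k _ => mul_comm _ _
      rw [h0, zero_sub, norm_neg, h2, norm_real] at h1
      refine abs_le.1 (h1.trans ?_)
      calc 4 * A / n * ∑ k, ‖a k‖ ≤ 4 * A / n * (t * n / (4 * A)) := by gcongr
        _ = t := by field_simp
    rcases le_total 0 x with h | h
    · exact Or.inl (key 1 (Or.inl rfl) (by linarith))
    · exact Or.inr (key (-1) (Or.inr rfl) (by linarith))
  have hEle : ∀ σ : ℝ, (σ = 1 ∨ σ = -1) → γ[n] (E σ) ≤ ofReal (2 / t) := by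
    intro σ hσ
    have hm : Measurable fun a : Fin (n + 1) → ℝ => (fun k : Fin (n + 1) => σ ^ (k : ℕ)) ⬝ᵥ a := by
      unfold dotProduct; fun_prop
    have hσ2 : σ * σ = 1 := by rcases hσ with rfl | rfl <;> norm_num
    have hl : (fun k : Fin (n + 1) => σ ^ (k : ℕ)) ⬝ᵥ (fun k => σ ^ (k : ℕ)) = (n : ℝ) + 1 := by
      simp [dotProduct, ← mul_pow, hσ2]
    have hv : (((n : ℝ) + 1).toNNReal : ℝ) = n + 1 := Real.coe_toNNReal _ (by linarith)
    rw [hE, ← Measure.map_apply hm measurableSet_Icc, map_dotProduct_gaussVec, hl]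
    refine (gaussianReal_Icc_le (by positivity) t).trans (ofReal_le_ofReal ?_)
    rw [hv]
    calc 2 * t / √((n : ℝ) + 1) ≤ 2 * t / √(n : ℝ) := by
          gcongr
          linarith
      _ = 2 / t := by rw [← htt]; field_simp
  have hFle : γ[n] F ≤ ofReal (8 * A / t) * D := by
    refine (meas_ge_le_lintegral_div (measurable_fun_sum _ fun k _ =>
      (measurable_pi_apply k).enorm).aemeasurable (by
        rw [Ne, ENNReal.ofReal_eq_zero, not_le]; positivity) ofReal_ne_top).trans ?_
    rw [lintegral_sum_abs_gaussVec, ← hD, mul_comm, mul_div_assoc, mul_comm]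
    refine mul_le_mul' ?_ le_rfl
    rw [← ENNReal.ofReal_natCast, ← ENNReal.ofReal_div_of_pos (by positivity)]
    refine ofReal_le_ofReal ?_
    rw [div_div_eq_mul_div, div_le_div_iff₀ (by positivity) ht0]
    push_cast
    nlinarith [mul_pos hA0 ht0]
  calc _ ≤ γ[n] (E 1) + γ[n] (E (-1)) + γ[n] F :=
        (measure_mono hsub).trans ((measure_union_le _ _).trans
          (add_le_add (measure_union_le _ _) le_rfl))
    _ ≤ ofReal (2 / t) + ofReal (2 / t) + ofReal (8 * A / t) * D :=
        add_le_add (add_le_add (hEle 1 (Or.inl rfl)) (hEle (-1) (Or.inr rfl))) hFle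
    _ = _ := by
        rw [← ofReal_add (by positivity) (by positivity)]
        congr 3; ring

/-! ### The vague topology and convergence of characteristic functionals. -/

namespace LocFinMeasure

instance (μ : LocFinMeasure) : IsLocallyFiniteMeasure μ.toMeasure := μ.2

/-- The integral of a test function. -/
def testIntegral (g : C_c(ℝ, ℝ)) (μ : LocFinMeasure) : ℝ := ∫ x, g x ∂μ.toMeasure

theorem continuous_testIntegral (g : C_c(ℝ, ℝ)) : Continuous (testIntegral g) :=
  continuous_iff_le_induced.2 (iInf_le _ g)

theorem integrable_testFun (g : C_c(ℝ, ℝ)) (μ : LocFinMeasure) : Integrable g μ.toMeasure :=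
  g.continuous.integrable_of_hasCompactSupport g.hasCompactSupport

/-- A cutoff function that is one on `[-N, N]`. -/
def cutoff (N : ℝ) : C_c(ℝ, ℝ) :=
  ⟨⟨fun x => max 0 (min 1 (N + 1 - |x|)), by fun_prop⟩,
    HasCompactSupport.intro (isCompact_Icc (a := -(N + 1)) (b := N + 1)) fun x hx => by
      have h : N + 1 < |x| := not_le.1 fun h => hx (abs_le.1 h)
      exact max_eq_left ((min_le_right _ _).trans (by linarith))⟩

theorem cutoff_apply (N x : ℝ) : cutoff N x = max 0 (min 1 (N + 1 - |x|)) := rfl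

theorem cutoff_nonneg (N x : ℝ) : 0 ≤ cutoff N x := le_max_left _ _

theorem cutoff_eq_one {N x : ℝ} (hx : |x| ≤ N) : cutoff N x = 1 := by
  rw [cutoff_apply, min_eq_left (by linarith), max_eq_right zero_le_one]

theorem exists_nat_support (g : C_c(ℝ, ℝ)) : ∃ N : ℕ, ∀ x, (N : ℝ) < |x| → g x = 0 := by
  obtain ⟨R, hR⟩ := g.hasCompactSupport.isCompact.isBounded.subset_closedBall 0
  refine ⟨⌈R⌉₊, fun x hx => ?_⟩
  by_contra h
  have := hR (subset_tsupport g h)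
  rw [mem_closedBall_zero_iff, norm_eq_abs] at this
  linarith [Nat.le_ceil R]

/-- The test functions supported in `[-N, N]`. -/
def TestFun (N : ℕ) : Type := {g : C_c(ℝ, ℝ) // ∀ x, (N : ℝ) < |x| → g x = 0}

/-- Restriction to `[-N, N]` induces the sup distance on these functions from a separable space of
continuous functions. The approximants keep the same support bound. -/
theorem exists_dense_seq (N : ℕ) : ∃ u : ℕ → TestFun N, ∀ (g : TestFun N) (ε : ℝ), 0 < ε →
    ∃ j, ∀ x, |g.1 x - (u j).1 x| ≤ ε := by
  let ρ : TestFun N → C(Icc (-(N : ℝ)) N, ℝ) := fun g => ⟨fun x => g.1 x, by fun_prop⟩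
  let _ : PseudoMetricSpace (TestFun N) := PseudoMetricSpace.induced ρ inferInstance
  have : SecondCountableTopology (TestFun N) :=
    TopologicalSpace.secondCountableTopology_induced _ _ ρ
  have : Nonempty (TestFun N) := ⟨⟨0, fun _ _ => rfl⟩⟩
  refine ⟨TopologicalSpace.denseSeq _, fun g ε hε => ?_⟩
  obtain ⟨j, hj⟩ := (TopologicalSpace.denseRange_denseSeq (TestFun N)).exists_dist_lt g hε
  refine ⟨j, fun x => ?_⟩
  by_cases hx : (N : ℝ) < |x|
  · rw [g.2 x hx, (TopologicalSpace.denseSeq (TestFun N) j).2 x hx]; simpa using hε.le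
  · have h1 : dist (ρ g) (ρ (TopologicalSpace.denseSeq (TestFun N) j)) < ε := hj
    exact (ContinuousMap.dist_apply_le_dist (⟨x, abs_le.1 (not_lt.1 hx)⟩ : Icc (-(N : ℝ)) N)).trans
      h1.le

/-- A countable family of test functions that determines the vague topology. -/
def testSeq (i : ℕ × Option ℕ) : C_c(ℝ, ℝ) :=
  i.2.elim (cutoff i.1) fun j => ((exists_dense_seq i.1).choose j).1

theorem abs_testIntegral_sub_le {g q : C_c(ℝ, ℝ)} {N : ℕ} (hg : ∀ x, (N : ℝ) < |x| → g x = 0)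
    (hq : ∀ x, (N : ℝ) < |x| → q x = 0) {ε : ℝ} (hε : 0 ≤ ε) (h : ∀ x, |g x - q x| ≤ ε)
    (μ : LocFinMeasure) : |testIntegral g μ - testIntegral q μ| ≤ ε * testIntegral (cutoff N) μ := by
  rw [testIntegral, testIntegral, testIntegral, ← integral_sub (integrable_testFun g μ) (integrable_testFun q μ),
    ← integral_const_mul]
  rw [← norm_eq_abs]
  refine norm_integral_le_of_norm_le ((integrable_testFun (cutoff N) μ).const_mul ε)
    (ae_of_all _ fun x => ?_)
  by_cases hx : (N : ℝ) < |x|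
  · rw [hg x hx, hq x hx, sub_zero, norm_zero]
    exact mul_nonneg hε (cutoff_nonneg _ _)
  · rw [cutoff_eq_one (not_lt.1 hx), mul_one]; exact h x

/-- A test function is uniformly close to a member of the sequence with the same support bound, and
the error is multiplied by the integral of a cutoff. The cutoff belongs to the family as well, so
this integral is bounded near a given measure. -/
theorem isInducing_testSeq : IsInducing fun (μ : LocFinMeasure) i => testIntegral (testSeq i) μ := by
  refine ⟨le_antisymm (continuous_iff_le_induced.1
    (continuous_pi fun i => continuous_testIntegral (testSeq i))) (le_iInf fun g => ?_)⟩
  let t : TopologicalSpace LocFinMeasure :=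
    TopologicalSpace.induced (fun (μ : LocFinMeasure) i => testIntegral (testSeq i) μ) inferInstance
  have hc : ∀ i, Continuous (testIntegral (testSeq i)) := fun i =>
    continuous_iff_le_induced.2 ((induced_mono (iInf_le _ i)).trans_eq induced_compose)
  refine continuous_iff_le_induced.1 (continuous_iff_continuousAt.2 fun μ₀ =>
    Metric.tendsto_nhds.2 fun ε hε => ?_)
  obtain ⟨N, hN⟩ := exists_nat_support g
  have hB0 : 0 ≤ testIntegral (cutoff N) μ₀ := integral_nonneg fun x => cutoff_nonneg _ _
  set B := testIntegral (cutoff N) μ₀ + 1 with hB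
  obtain ⟨j, hj⟩ := (exists_dense_seq N).choose_spec ⟨g, hN⟩ (ε / (3 * B)) (by positivity)
  have h1 := Metric.tendsto_nhds.1 ((hc (N, some j)).tendsto μ₀) (ε / 3) (by positivity)
  have h2 : ∀ᶠ μ in 𝓝 μ₀, testIntegral (cutoff N) μ < B :=
    ((hc (N, none)).tendsto μ₀).eventually_lt_const (by rw [hB]; exact lt_add_one _)
  filter_upwards [h1, h2] with μ hμ1 hμ2
  have hle : ∀ μ : LocFinMeasure, testIntegral (cutoff N) μ < B →
      |testIntegral g μ - testIntegral (testSeq (N, some j)) μ| ≤ ε / 3 := fun μ hμ => by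
    refine (abs_testIntegral_sub_le hN ((exists_dense_seq N).choose j).2 (by positivity) hj μ).trans ?_
    calc _ ≤ ε / (3 * B) * B := by gcongr
      _ = ε / 3 := by
          have : B ≠ 0 := by positivity
          field_simp
  have h3 := hle μ hμ2
  have h4 := hle μ₀ (by rw [hB]; exact lt_add_one _)
  rw [Real.dist_eq] at hμ1 ⊢
  change |testIntegral g μ - testIntegral g μ₀| < ε
  rw [abs_sub_lt_iff] at hμ1 ⊢
  rw [abs_le] at h3 h4
  constructor <;> linarith [h3.1, h3.2, h4.1, h4.2, hμ1.1, hμ1.2]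

theorem measurable_testIntegral (g : C_c(ℝ, ℝ)) : Measurable (testIntegral g) :=
  (continuous_testIntegral g).measurable

theorem measurable_of_testSeq {Ω : Type*} [MeasurableSpace Ω] {X : Ω → LocFinMeasure}
    (hX : ∀ i, Measurable fun ω => testIntegral (testSeq i) (X ω)) : Measurable X := by
  have h : instMeasurableSpace = MeasurableSpace.comap
      (fun (μ : LocFinMeasure) i => testIntegral (testSeq i) μ) inferInstance := by
    have h1 : instMeasurableSpace = borel LocFinMeasure := rfl
    rw [h1, isInducing_testSeq.eq_induced, borel_comap]
    congr 1
    exact (BorelSpace.measurable_eq (α := ℕ × Option ℕ → ℝ)).symm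
  rw [h, measurable_comap_iff]
  exact measurable_pi_lambda _ hX

/-- Countably many test functions determine the Borel structure, so their exceptional sets have a
common null superset. Redefining the map there, by the zero measure, makes it measurable. -/
theorem aemeasurable_of_testIntegral {Ω : Type*} [MeasurableSpace Ω] {P : Measure Ω}
    {X : Ω → LocFinMeasure} (hX : ∀ g, AEMeasurable (fun ω => testIntegral g (X ω)) P) :
    AEMeasurable X P := by
  classical
  have h1 : ∀ᵐ ω ∂P, ∀ i, testIntegral (testSeq i) (X ω) = (hX (testSeq i)).mk _ ω :=
    ae_all_iff.2 fun i => (hX (testSeq i)).ae_eq_mk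
  obtain ⟨s, hs, hsm, hsP⟩ := exists_measurable_superset_of_null h1
  have hsc : ∀ ω, ω ∉ s → ∀ i, testIntegral (testSeq i) (X ω) = (hX (testSeq i)).mk _ ω := by
    intro ω hω
    by_contra hcon
    exact hω (hs hcon)
  refine ⟨fun ω => if ω ∈ s then pointMeasure 0 else X ω, measurable_of_testSeq fun i => ?_, ?_⟩
  · have e : (fun ω => testIntegral (testSeq i) (if ω ∈ s then pointMeasure 0 else X ω)) =
        fun ω => if ω ∈ s then testIntegral (testSeq i) (pointMeasure 0) else
          (hX (testSeq i)).mk _ ω := by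
      funext ω
      split_ifs with hω
      · rfl
      · exact hsc ω hω i
    rw [e]
    exact Measurable.ite hsm measurable_const (hX (testSeq i)).measurable_mk
  · have : ∀ᵐ ω ∂P, ω ∉ s := measure_eq_zero_iff_ae_notMem.1 hsP
    filter_upwards [this] with ω hω
    rw [if_neg hω]

theorem testIntegral_sum {ι : Type*} [Fintype ι] (t : ι → ℝ) (g : ι → C_c(ℝ, ℝ))
    (μ : LocFinMeasure) : testIntegral (∑ i, t i • g i) μ = ∑ i, t i * testIntegral (g i) μ := by
  have h : ∀ x, (∑ i, t i • g i) x = ∑ i, t i * g i x := fun x => by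
    rw [CompactlySupportedContinuousMap.sum_apply]; rfl
  simp only [testIntegral, h, ← integral_const_mul]
  exact integral_finsetSum _ fun i _ => (integrable_testFun (g i) μ).const_mul _

/-- Weak convergence follows from the convergence of the characteristic functionals. -/
theorem tendsto_of_charFunctional {Q : ProbabilityMeasure LocFinMeasure}
    {Qs : ℕ → ProbabilityMeasure LocFinMeasure}
    (h : ∀ g, Tendsto (fun n => ∫ μ, exp (testIntegral g μ * I) ∂(Qs n : Measure _))
      atTop (𝓝 (∫ μ, exp (testIntegral g μ * I) ∂(Q : Measure _)))) :
    Tendsto Qs atTop (𝓝 Q) := by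
  let J : ∀ s : Finset (ℕ × Option ℕ), LocFinMeasure → EuclideanSpace ℝ s := fun s μ =>
    WithLp.toLp 2 fun i => testIntegral (testSeq i) μ
  have hJ : ∀ s, Continuous (J s) := fun s =>
    (PiLp.continuous_toLp 2 _).comp (continuous_pi fun i => continuous_testIntegral _)
  have hfin : ∀ s, Tendsto (fun n => (Qs n).map (hJ s).aemeasurable) atTop
      (𝓝 (Q.map (hJ s).aemeasurable)) := by
    intro s
    refine ProbabilityMeasure.tendsto_iff_tendsto_charFun.2 fun t => ?_
    -- A linear combination of test functions is a test function, so the hypothesis gives the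
    -- characteristic functions of all finite-dimensional marginals, and Lévy's theorem applies to
    -- them.
    have hch : ∀ R : ProbabilityMeasure LocFinMeasure,
        charFun (R.map (hJ s).aemeasurable : Measure (EuclideanSpace ℝ s)) t =
        ∫ μ, exp (testIntegral (∑ i : s, t i • testSeq i) μ * I) ∂(R : Measure _) := by
      intro R
      rw [charFun_apply, ProbabilityMeasure.toMeasure_map,
        MeasureTheory.integral_map (hJ s).aemeasurable (by fun_prop)]
      refine integral_congr_ae (ae_of_all _ fun μ => ?_)
      simp only
      rw [testIntegral_sum, PiLp.inner_apply]
      rfl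
    simp only [hch]
    exact h _
  refine tendsto_of_forall_isOpen_le_liminf' fun U hU => ?_
  -- The largest open set of the marginal space whose preimage lies in `U`. These preimages increase
  -- with `s` to `U`, so the open-set criterion for the marginals passes to `U` by continuity from
  -- below.
  let W : ∀ s : Finset (ℕ × Option ℕ), Set (EuclideanSpace ℝ s) := fun s =>
    ⋃₀ {V | IsOpen V ∧ J s ⁻¹' V ⊆ U}
  have hWo : ∀ s, IsOpen (W s) := fun s => isOpen_sUnion fun V hV => hV.1
  have hWU : ∀ s, J s ⁻¹' W s ⊆ U := by
    rintro s μ ⟨V, hV, hμ⟩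
    exact hV.2 hμ
  have hUW : U = ⋃ s, J s ⁻¹' W s := by
    refine Set.Subset.antisymm (fun μ hμ => ?_) (Set.iUnion_subset hWU)
    obtain ⟨V, hV, rfl⟩ := isInducing_testSeq.isOpen_iff.1 hU
    obtain ⟨s, u, hu, hsV⟩ := isOpen_pi_iff.1 hV _ hμ
    refine Set.mem_iUnion.2 ⟨s, {w | ∀ i : s, w i ∈ u i}, ⟨?_, fun μ' hμ' => ?_⟩, fun i =>
      (hu i i.2).2⟩
    · simp only [Set.ofPred_forall]
      exact isOpen_iInter_of_finite fun i => (hu i i.2).1.preimage (by fun_prop)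
    · exact hsV fun i hi => hμ' ⟨i, hi⟩
  have hmono : Monotone fun s => J s ⁻¹' W s := by
    rintro s s' hss μ ⟨V, hV, hμ⟩
    have hr : Continuous fun w : EuclideanSpace ℝ s' =>
        (WithLp.toLp 2 fun i : s => w ⟨i, hss i.2⟩ : EuclideanSpace ℝ s) := by fun_prop
    exact ⟨_, ⟨hV.1.preimage hr, hV.2⟩, hμ⟩
  conv_lhs => rw [hUW]
  rw [hmono.measure_iUnion]
  refine iSup_le fun s => ?_
  calc (Q : Measure LocFinMeasure) (J s ⁻¹' W s)
      = (Q.map (hJ s).aemeasurable : Measure (EuclideanSpace ℝ s)) (W s) := by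
        rw [ProbabilityMeasure.toMeasure_map, Measure.map_apply (hJ s).measurable (hWo s).measurableSet]
    _ ≤ liminf (fun n => ((Qs n).map (hJ s).aemeasurable : Measure (EuclideanSpace ℝ s)) (W s))
          atTop := ProbabilityMeasure.le_liminf_measure_open_of_tendsto (hfin s) (hWo s)
    _ ≤ _ := by
        refine liminf_le_liminf (Eventually.of_forall fun n => ?_)
        rw [ProbabilityMeasure.toMeasure_map, Measure.map_apply (hJ s).measurable (hWo s).measurableSet]
        exact measure_mono (hWU s)

end LocFinMeasure

/-! ### Construction of the Poisson process from independent unit cells. -/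

/-- The first `c.1` points of the sequence `c.2`, moved to the interval `[m, m + 1)`. -/
def cellPoints (m : ℤ) (c : ℕ × (ℕ → ℝ)) : Measure ℝ :=
  ∑ j ∈ range c.1, Measure.dirac (m + Int.fract (c.2 j))

theorem cellPoints_apply (m : ℤ) (c : ℕ × (ℕ → ℝ)) {s : Set ℝ} (hs : MeasurableSet s) :
    cellPoints m c s = ∑ j ∈ range c.1, s.indicator 1 (m + Int.fract (c.2 j)) := by
  simp [cellPoints, Measure.finsetSum_apply, Measure.dirac_apply' _ hs]

/-- The fractional part keeps the points of cell `m` in `[m, m + 1)` for every `ω`, not only almost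
every one. So a window with integer endpoints sees finitely many complete cells, and local
finiteness is deterministic. -/
theorem restrict_sum_cellPoints (ω : ℤ → ℕ × (ℕ → ℝ)) (N : ℕ) :
    (Measure.sum fun m => cellPoints m (ω m)).restrict (Ico (-(N : ℝ)) N) =
      ∑ m ∈ Finset.Ico (-(N : ℤ)) N, cellPoints m (ω m) := by
  ext s hs
  have hs' := hs.inter (measurableSet_Ico (a := -(N : ℝ)) (b := (N : ℝ)))
  rw [Measure.restrict_apply hs, Measure.sum_apply _ hs', Measure.finsetSum_apply]
  have hmem : ∀ (m : ℤ) (t : ℝ), (m + Int.fract t ∈ Ico (-(N : ℝ)) N ↔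
      m ∈ Finset.Ico (-(N : ℤ)) N) := by
    intro m t
    have h0 := Int.fract_nonneg t
    have h1 := Int.fract_lt_one t
    rw [Finset.mem_Ico, Set.mem_Ico]
    constructor
    · rintro ⟨h2, h3⟩
      have h4 : (-(N : ℤ) : ℝ) < (m + 1 : ℤ) := by push_cast; linarith
      have h5 : (m : ℝ) < (N : ℤ) := by push_cast; linarith
      have h4' : -(N : ℤ) < m + 1 := by exact_mod_cast h4
      exact ⟨by omega, by exact_mod_cast h5⟩
    · rintro ⟨h2, h3⟩
      have h4 : ((-(N : ℤ) : ℤ) : ℝ) ≤ m := by exact_mod_cast h2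
      have h5 : ((m + 1 : ℤ) : ℝ) ≤ (N : ℤ) := by exact_mod_cast h3
      push_cast at h4 h5
      constructor <;> linarith
  rw [tsum_eq_sum (s := Finset.Ico (-(N : ℤ)) N)]
  · refine sum_congr rfl fun m hm => ?_
    rw [cellPoints_apply _ _ hs', cellPoints_apply _ _ hs]
    refine sum_congr rfl fun j _ => ?_
    have := (hmem m ((ω m).2 j)).2 hm
    by_cases h : m + Int.fract ((ω m).2 j) ∈ s <;> simp [Set.indicator, h, this]
  · intro m hm
    rw [cellPoints_apply _ _ hs']
    refine Finset.sum_eq_zero fun j _ => indicator_of_notMem (fun h => hm ?_) _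
    exact (hmem m _).1 h.2

instance (m : ℤ) (c : ℕ × (ℕ → ℝ)) : IsFiniteMeasure (cellPoints m c) := by
  unfold cellPoints; infer_instance

/-- A configuration with `(ω m).1` points in each interval `[m, m + 1)`. -/
def cellConfig (ω : ℤ → ℕ × (ℕ → ℝ)) : LocFinMeasure :=
  ⟨Measure.sum fun m => cellPoints m (ω m), ⟨fun x => by
    obtain ⟨N, hN⟩ := exists_nat_gt |x|
    obtain ⟨h1, h2⟩ := abs_lt.1 hN
    refine ⟨Ico (-(N : ℝ)) N, Ico_mem_nhds h1 h2, ?_⟩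
    rw [← Measure.restrict_apply_univ, restrict_sum_cellPoints]
    exact measure_lt_top _ _⟩⟩

theorem integral_cellConfig (ω : ℤ → ℕ × (ℕ → ℝ)) {N : ℕ} {f : ℝ → ℝ} (hf : Measurable f)
    (hfN : ∀ x ∉ Ico (-(N : ℝ)) N, f x = 0) :
    ∫ x, f x ∂(cellConfig ω).toMeasure = ∑ m ∈ Finset.Ico (-(N : ℤ)) N,
      ∑ j ∈ range (ω m).1, f (m + Int.fract ((ω m).2 j)) := by
  have hi : ∀ y : ℝ, Integrable f (Measure.dirac y) := fun y =>
    integrable_dirac' hf.stronglyMeasurable enorm_lt_top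
  rw [← setIntegral_eq_integral_of_forall_compl_eq_zero hfN]
  change ∫ x, f x ∂(Measure.sum fun m => cellPoints m (ω m)).restrict _ = _
  have hc : ∀ m, Integrable f (cellPoints m (ω m)) := fun m => by
    unfold cellPoints
    exact integrable_finsetSum_measure.2 fun j _ => hi _
  rw [restrict_sum_cellPoints, integral_finsetSum_measure fun m _ => hc m]
  refine sum_congr rfl fun m _ => ?_
  rw [cellPoints, integral_finsetSum_measure fun j _ => hi _]
  exact sum_congr rfl fun j _ => integral_dirac' _ _ hf.stronglyMeasurable

theorem measurable_cellSum (m : ℤ) {f : ℝ → ℝ} (hf : Measurable f) :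
    Measurable fun c : ℕ × (ℕ → ℝ) => ∑ j ∈ range c.1, f (m + Int.fract (c.2 j)) :=
  measurable_from_prod_countable_right fun n =>
    (measurable_fun_sum _ fun j _ =>
      hf.comp (by fun_prop : Measurable fun u : ℕ → ℝ => (m : ℝ) + Int.fract (u j)) :
      Measurable fun u : ℕ → ℝ => ∑ j ∈ range n, f (m + Int.fract (u j)))

theorem measurable_cellConfig : Measurable cellConfig := by
  refine LocFinMeasure.measurable_of_testSeq fun i => ?_
  obtain ⟨N, hN⟩ := LocFinMeasure.exists_nat_support (LocFinMeasure.testSeq i)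
  have h : (fun ω => LocFinMeasure.testIntegral (LocFinMeasure.testSeq i) (cellConfig ω)) = fun ω =>
      ∑ m ∈ Finset.Ico (-((N + 1 : ℕ) : ℤ)) (N + 1 : ℕ), ∑ j ∈ range (ω m).1,
        LocFinMeasure.testSeq i (m + Int.fract ((ω m).2 j)) := by
    funext ω
    refine integral_cellConfig ω (LocFinMeasure.testSeq i).continuous.measurable fun x hx => hN x ?_
    by_contra hcon
    obtain ⟨h1, h2⟩ := abs_le.1 (not_lt.1 hcon)
    push_cast at hx
    exact hx ⟨by linarith, by linarith⟩
  rw [h]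
  exact measurable_fun_sum _ fun m _ =>
    (measurable_cellSum m (LocFinMeasure.testSeq i).continuous.measurable).comp
      (measurable_pi_apply m)

/-- The law of the points in one cell. -/
def cellLaw (r : ℝ≥0) : Measure (ℕ × (ℕ → ℝ)) :=
  (poissonMeasure r).prod (Measure.infinitePi fun _ : ℕ => volume.restrict (Ico (0 : ℝ) 1))

instance : IsProbabilityMeasure (volume.restrict (Ico (0 : ℝ) 1)) := ⟨by simp⟩

instance (r : ℝ≥0) : IsProbabilityMeasure (cellLaw r) := by unfold cellLaw; infer_instance

theorem integral_infinitePi_prod {ι E : Type*} [MeasurableSpace E] (κ : Measure E)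
    [IsProbabilityMeasure κ] (s : Finset ι) {F : ι → E → ℂ} (hF : ∀ i, Measurable (F i)) :
    ∫ ω, ∏ i ∈ s, F i (ω i) ∂Measure.infinitePi (fun _ : ι => κ) = ∏ i ∈ s, ∫ x, F i x ∂κ := by
  have hm : Measurable fun y : s → E => ∏ i : s, F i (y i) :=
    measurable_fun_prod _ fun i _ => (hF i).comp (measurable_pi_apply i)
  have h := integral_restrict_infinitePi (μ := fun _ : ι => κ) (s := s) hm.aestronglyMeasurable
  rw [integral_fintype_prod_eq_prod (𝕜 := ℂ) (fun i : s => F i),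
    Finset.prod_coe_sort s fun i => ∫ x, F i x ∂κ] at h
  rw [← h]
  refine integral_congr_ae (ae_of_all _ fun ω => ?_)
  exact (Finset.prod_coe_sort s fun i => F i (ω i)).symm

theorem integral_pow_poissonMeasure (r : ℝ≥0) (z : ℂ) :
    ∫ n, z ^ n ∂poissonMeasure r = exp (r * (z - 1)) := by
  rw [integral_poissonMeasure]
  have h : ∀ n : ℕ, (Real.exp (-r) * r ^ n / n.factorial : ℝ) • z ^ n =
      (Real.exp (-r) : ℂ) * ((r * z) ^ n / n.factorial) := fun n => by
    rw [Complex.real_smul, mul_pow]; push_cast; ring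
  simp only [h]
  rw [tsum_mul_left, (NormedSpace.expSeries_div_hasSum_exp ((r : ℂ) * z)).tsum_eq,
    ← Complex.exp_eq_exp_ℂ, Complex.ofReal_exp, ← Complex.exp_add]
  congr 1; push_cast; ring

/-- Given `k` points in the cell, independence gives the `k`-th power of the mean of `exp(i f)` over
a unit interval. The generating function of the Poisson law then sums over `k`, and the `-1` goes
under the integral because the cell has length one. -/
theorem integral_cellLaw (r : ℝ≥0) (m : ℤ) {f : ℝ → ℝ} (hf : Measurable f) :
    ∫ c, exp ((∑ j ∈ range c.1, f (m + Int.fract (c.2 j)) : ℝ) * I)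
      ∂cellLaw r = exp (r * ∫ x in Ico (m : ℝ) (m + 1), (exp (f x * I) - 1)) := by
  have he : Measurable fun x => exp (f x * I) := by fun_prop
  have hm : Measurable fun c : ℕ × (ℕ → ℝ) =>
      exp ((∑ j ∈ range c.1, f (m + Int.fract (c.2 j)) : ℝ) * I) :=
    measurable_exp.comp ((measurable_ofReal.comp (measurable_cellSum m hf)).mul_const _)
  have hint : ∀ s : Set ℝ, volume s ≠ ∞ → IntegrableOn (fun x => exp (f x * I)) s :=
    fun s hs => Measure.integrableOn_of_bounded hs he.aestronglyMeasurable (M := 1)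
      (ae_of_all _ fun x => (norm_exp_ofReal_mul_I _).le)
  set φ := ∫ x in Ico (m : ℝ) (m + 1), exp (f x * I) with hφ
  have hφ' : ∫ x in Ico (0 : ℝ) 1, exp (f (m + Int.fract x) * I) = φ := by
    have h1 : ∫ x in Ico (0 : ℝ) 1, exp (f (m + Int.fract x) * I) =
        ∫ x in Ico (0 : ℝ) 1, exp (f (m + x) * I) :=
      setIntegral_congr_fun measurableSet_Ico fun x hx => by
        simp only [Int.fract_eq_self.2 ⟨hx.1, hx.2⟩]
    have h2 : (fun x : ℝ => (m : ℝ) + x) ⁻¹' Ico (m : ℝ) (m + 1) = Ico (0 : ℝ) 1 := by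
      simp
    have h3 := (measurePreserving_add_left volume (m : ℝ)).setIntegral_preimage_emb
      (measurableEmbedding_addLeft _) (fun x => exp (f x * I))
      (Ico (m : ℝ) (m + 1))
    rw [h2] at h3
    rw [h1, hφ]
    exact h3
  have hinner : ∀ n : ℕ, ∫ u : ℕ → ℝ, exp ((∑ j ∈ range n,
      f (m + Int.fract (u j)) : ℝ) * I) ∂(Measure.infinitePi fun _ : ℕ =>
        volume.restrict (Ico (0 : ℝ) 1)) = φ ^ n := by
    intro n
    have := integral_infinitePi_prod (volume.restrict (Ico (0 : ℝ) 1)) (range n)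
      (F := fun _ x => exp (f (m + Int.fract x) * I)) fun _ =>
        he.comp (measurable_const.add measurable_fract)
    rw [hφ', prod_const, card_range] at this
    rw [← this]
    refine integral_congr_ae (ae_of_all _ fun u => ?_)
    simp only
    rw [ofReal_sum, sum_mul, exp_sum]
  rw [cellLaw, integral_prod _ (Integrable.of_bound hm.aestronglyMeasurable 1
    (ae_of_all _ fun c => (norm_exp_ofReal_mul_I _).le))]
  simp only [hinner]
  rw [integral_pow_poissonMeasure, integral_sub (hint _ (by simp)) (integrable_const _)]
  simp [hφ]

/-- The law of the Poisson process. -/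
def poissonLaw (r : ℝ≥0) : Measure LocFinMeasure :=
  (Measure.infinitePi fun _ : ℤ => cellLaw r).map cellConfig

instance (r : ℝ≥0) : IsProbabilityMeasure (poissonLaw r) :=
  Measure.isProbabilityMeasure_map measurable_cellConfig.aemeasurable

theorem biUnion_Ico_intCast (N : ℕ) : ⋃ m ∈ Finset.Ico (-(N : ℤ)) N, Ico (m : ℝ) (m + 1) =
    Ico (-(N : ℝ)) N := by
  ext x
  simp only [Set.mem_iUnion, Finset.mem_Ico, Set.mem_Ico, exists_prop]
  constructor
  · rintro ⟨m, ⟨h1, h2⟩, h3, h4⟩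
    have h5 : ((-(N : ℤ) : ℤ) : ℝ) ≤ m := by exact_mod_cast h1
    have h6 : ((m + 1 : ℤ) : ℝ) ≤ (N : ℤ) := by exact_mod_cast h2
    push_cast at h5 h6
    constructor <;> linarith
  · rintro ⟨h1, h2⟩
    exact ⟨⌊x⌋, ⟨Int.le_floor.2 (by push_cast; linarith), Int.floor_lt.2 (by push_cast; linarith)⟩,
      Int.floor_le x, Int.lt_floor_add_one x⟩

/-- The characteristic functional of the Poisson process. -/
theorem integral_exp_cellConfig (r : ℝ≥0) {N : ℕ} {f : ℝ → ℝ} (hf : Measurable f)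
    (hfN : ∀ x ∉ Ico (-(N : ℝ)) N, f x = 0) :
    ∫ ω, exp ((∫ x, f x ∂(cellConfig ω).toMeasure : ℝ) * I)
      ∂(Measure.infinitePi fun _ : ℤ => cellLaw r) =
      exp (r * ∫ x, (exp (f x * I) - 1)) := by
  have hsplit : ∀ ω : ℤ → ℕ × (ℕ → ℝ), exp ((∑ m ∈ Finset.Ico (-(N : ℤ)) N,
      ∑ j ∈ range (ω m).1, f (m + Int.fract ((ω m).2 j)) : ℝ) * I) =
      ∏ m ∈ Finset.Ico (-(N : ℤ)) N, exp ((∑ j ∈ range (ω m).1,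
        f (m + Int.fract ((ω m).2 j)) : ℝ) * I) := fun ω => by
    rw [ofReal_sum, sum_mul, exp_sum]
  simp only [integral_cellConfig _ hf hfN, hsplit]
  rw [integral_infinitePi_prod (cellLaw r) (Finset.Ico (-(N : ℤ)) N)
    (F := fun m c => exp ((∑ j ∈ range c.1, f (m + Int.fract (c.2 j)) : ℝ) *
      I)) fun m => measurable_exp.comp
      ((measurable_ofReal.comp (measurable_cellSum m hf)).mul_const _)]
  simp only [integral_cellLaw r _ hf]
  rw [← exp_sum, ← mul_sum]
  congr 2
  rw [← integral_biUnion_finset _ (fun _ _ => measurableSet_Ico), biUnion_Ico_intCast,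
    setIntegral_eq_integral_of_forall_compl_eq_zero fun x hx => by simp [hfN x hx]]
  · intro m _ m' _ hmm
    exact Set.pairwise_disjoint_Ico_intCast ℝ hmm
  · intro m _
    refine Measure.integrableOn_of_bounded (by simp) (by fun_prop) (M := 2) (ae_of_all _ fun x => ?_)
    refine (norm_sub_le _ _).trans ?_
    rw [norm_exp_ofReal_mul_I, norm_one]; norm_num

/-! ### Measurability of point counts; the constructed law is that of a Poisson process. -/

namespace LocFinMeasure

/-- A trapezoidal function approximating the indicator function of `(a, b)`. -/
def ramp (a b : ℝ) (k : ℕ) : C_c(ℝ, ℝ) :=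
  ⟨⟨fun x => min 1 (k * max 0 (min (x - a) (b - x))), by fun_prop⟩,
    HasCompactSupport.intro (isCompact_Icc (a := a) (b := b)) fun x hx => by
      have h : min (x - a) (b - x) ≤ 0 := by
        rw [Set.mem_Icc, not_and_or, not_le, not_le] at hx
        rcases hx with h | h
        · exact (min_le_left _ _).trans (by linarith)
        · exact (min_le_right _ _).trans (by linarith)
      simp [max_eq_left h]⟩

theorem ramp_apply (a b : ℝ) (k : ℕ) (x : ℝ) :
    ramp a b k x = min 1 (k * max 0 (min (x - a) (b - x))) := rfl

theorem ramp_nonneg (a b : ℝ) (k : ℕ) (x : ℝ) : 0 ≤ ramp a b k x := by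
  rw [ramp_apply]; positivity

theorem ramp_eq_zero {a b : ℝ} (k : ℕ) {x : ℝ} (hx : x ∉ Ioo a b) : ramp a b k x = 0 := by
  have h : min (x - a) (b - x) ≤ 0 := by
    rw [Set.mem_Ioo, not_and_or, not_lt, not_lt] at hx
    rcases hx with h | h
    · exact (min_le_left _ _).trans (by linarith)
    · exact (min_le_right _ _).trans (by linarith)
  simp [ramp_apply, max_eq_left h]

theorem tendsto_ramp (a b x : ℝ) :
    Tendsto (fun k => ramp a b k x) atTop (𝓝 ((Ioo a b).indicator 1 x)) := by
  by_cases hx : x ∈ Ioo a b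
  · rw [indicator_of_mem hx]
    have h0 : 0 < max 0 (min (x - a) (b - x)) :=
      lt_max_of_lt_right (lt_min (by linarith [hx.1]) (by linarith [hx.2]))
    refine tendsto_const_nhds.congr' ?_
    filter_upwards [(tendsto_natCast_atTop_atTop.atTop_mul_const h0).eventually_ge_atTop 1] with k hk
    rw [ramp_apply, min_eq_left hk]; rfl
  · rw [indicator_of_notMem hx]
    exact tendsto_const_nhds.congr fun k => (ramp_eq_zero k hx).symm

theorem measurable_apply_Ioo (a b : ℝ) :
    Measurable fun μ : LocFinMeasure => μ.toMeasure (Ioo a b) := by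
  have h : Measurable fun μ : LocFinMeasure => μ.toMeasure.real (Ioo a b) := by
    refine measurable_of_tendsto_metrizable (fun k => measurable_testIntegral (ramp a b k))
      (tendsto_pi_nhds.2 fun μ => ?_)
    rw [← integral_indicator_one measurableSet_Ioo]
    refine tendsto_integral_of_dominated_convergence ((Ioo a b).indicator 1)
      (fun k => (ramp a b k).continuous.aestronglyMeasurable)
      ((integrable_indicator_iff measurableSet_Ioo).2
        (integrableOn_const (measure_Ioo_lt_top).ne)) (fun k => ae_of_all _ fun x => ?_)
      (ae_of_all _ fun x => tendsto_ramp a b x)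
    rw [norm_of_nonneg (ramp_nonneg _ _ _ _)]
    by_cases hx : x ∈ Ioo a b
    · rw [indicator_of_mem hx]; exact min_le_left _ _
    · rw [indicator_of_notMem hx, ramp_eq_zero k hx]
  have e : (fun μ : LocFinMeasure => μ.toMeasure (Ioo a b)) =
      fun μ => ofReal (μ.toMeasure.real (Ioo a b)) := by
    funext μ
    exact (ofReal_toReal measure_Ioo_lt_top.ne).symm
  rw [e]
  exact h.ennreal_ofReal

theorem iUnion_inter_Ioo (B : Set ℝ) : ⋃ N : ℕ, B ∩ Ioo (-(N : ℝ)) N = B := by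
  refine Set.Subset.antisymm (Set.iUnion_subset fun N => Set.inter_subset_left) fun x hx => ?_
  obtain ⟨N, hN⟩ := exists_nat_gt |x|
  exact Set.mem_iUnion.2 ⟨N, hx, abs_lt.1 hN⟩

theorem monotone_inter_Ioo (B : Set ℝ) : Monotone fun N : ℕ => B ∩ Ioo (-(N : ℝ)) N := by
  intro N M h
  have h' : (N : ℝ) ≤ M := by exact_mod_cast h
  exact Set.inter_subset_inter_right _ (Set.Ioo_subset_Ioo (by linarith) h')

theorem tendsto_measure_inter_Ioo (μ : Measure ℝ) (B : Set ℝ) :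
    Tendsto (fun N : ℕ => μ (B ∩ Ioo (-(N : ℝ)) N)) atTop (𝓝 (μ B)) := by
  have h := tendsto_measure_iUnion_atTop (μ := μ) (monotone_inter_Ioo B)
  rwa [iUnion_inter_Ioo] at h

/-- Open intervals are handled by increasing trapezoidal test functions. After restriction to a
bounded window all measures are finite, so the π-λ theorem extends this to Borel sets, and the
windows exhaust the line. -/
theorem measurable_apply {B : Set ℝ} (hB : MeasurableSet B) :
    Measurable fun μ : LocFinMeasure => μ.toMeasure B := by
  have h : ∀ N : ℕ, Measurable fun μ : LocFinMeasure =>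
      μ.toMeasure.restrict (Ioo (-(N : ℝ)) N) := by
    intro N
    have : ∀ μ : LocFinMeasure, IsFiniteMeasure (μ.toMeasure.restrict (Ioo (-(N : ℝ)) N)) :=
      fun μ => ⟨by rw [Measure.restrict_apply_univ]; exact measure_Ioo_lt_top⟩
    refine Measurable.measure_of_isPiSystem
      ((BorelSpace.measurable_eq (α := ℝ)).trans Real.borel_eq_generateFrom_Ioo_rat)
      Real.isPiSystem_Ioo_rat (fun s hs => ?_) ?_
    · simp only [Set.mem_iUnion, Set.mem_singleton_iff] at hs
      obtain ⟨a, b, -, rfl⟩ := hs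
      simp only [Measure.restrict_apply measurableSet_Ioo, Set.Ioo_inter_Ioo]
      exact measurable_apply_Ioo _ _
    · simp only [Measure.restrict_apply_univ]
      exact measurable_apply_Ioo _ _
  refine measurable_of_tendsto_metrizable (fun N => ?_)
    (tendsto_pi_nhds.2 fun μ => tendsto_measure_inter_Ioo μ.toMeasure B)
  simp only [← Measure.restrict_apply hB]
  exact (Measure.measurable_coe hB).comp (h N)

end LocFinMeasure

open LocFinMeasure

theorem integral_exp_poissonLaw (r : ℝ≥0) {N : ℕ} {f : ℝ → ℝ} (hf : Measurable f)
    (hfN : ∀ x ∉ Ico (-(N : ℝ)) N, f x = 0)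
    (hm : Measurable fun μ : LocFinMeasure => ∫ x, f x ∂μ.toMeasure) :
    ∫ μ, exp ((∫ x, f x ∂μ.toMeasure : ℝ) * I) ∂poissonLaw r =
      exp (r * ∫ x, (exp (f x * I) - 1)) := by
  rw [poissonLaw, integral_map measurable_cellConfig.aemeasurable, integral_exp_cellConfig r hf hfN]
  exact (measurable_exp.comp ((measurable_ofReal.comp hm).mul_const I)).aestronglyMeasurable

theorem integral_exp_testIntegral_poissonLaw (r : ℝ≥0) (g : C_c(ℝ, ℝ)) :
    ∫ μ, exp (testIntegral g μ * I) ∂poissonLaw r = exp (r * ∫ x, (exp (g x * I) - 1)) := by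
  obtain ⟨N, hN⟩ := exists_nat_support g
  refine integral_exp_poissonLaw (N := N + 1) r g.continuous.measurable (fun x hx => hN x ?_)
    (measurable_testIntegral g)
  by_contra hcon
  obtain ⟨h1, h2⟩ := abs_le.1 (not_lt.1 hcon)
  push_cast at hx
  exact hx ⟨by linarith, by linarith⟩

theorem integral_sum_indicator {μ : LocFinMeasure} {ι : Type*} [Fintype ι] (t : ι → ℝ)
    {B : ι → Set ℝ} (hB : ∀ i, MeasurableSet (B i)) (hfin : ∀ i, μ.toMeasure (B i) ≠ ∞) :
    ∫ x, ∑ i, (B i).indicator (fun _ => t i) x ∂μ.toMeasure =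
      ∑ i, μ.toMeasure.real (B i) * t i := by
  rw [integral_finsetSum _ fun i _ => (integrable_indicator_iff (hB i)).2
    (integrableOn_const (hfin i))]
  exact sum_congr rfl fun i _ => by rw [integral_indicator_const _ (hB i)]; rfl

theorem measure_lt_top_of_subset_Ioo (μ : LocFinMeasure) {B : Set ℝ} {N : ℕ}
    (hN : B ⊆ Ioo (-(N : ℝ)) N) : μ.toMeasure B ≠ ∞ :=
  ((measure_mono hN).trans_lt measure_Ioo_lt_top).ne

/-- The joint characteristic function of the numbers of points in disjoint bounded sets. -/
theorem integral_exp_sum_poissonLaw (r : ℝ≥0) {ι : Type*} [Fintype ι] (t : ι → ℝ) {B : ι → Set ℝ}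
    (hB : ∀ i, MeasurableSet (B i)) {N : ℕ} (hN : ∀ i, B i ⊆ Ioo (-(N : ℝ)) N)
    (hd : Pairwise (Function.onFun Disjoint B)) :
    ∫ μ : LocFinMeasure, exp ((∑ i, μ.toMeasure.real (B i) * t i : ℝ) * I) ∂poissonLaw r =
      ∏ i, exp ((r * (volume (B i)).toNNReal : ℝ≥0) * (exp (t i * I) - 1)) := by
  classical
  have hfin : ∀ i (μ : LocFinMeasure), μ.toMeasure (B i) ≠ ∞ := fun i μ =>
    measure_lt_top_of_subset_Ioo μ (hN i)
  have hvol : ∀ i, volume (B i) ≠ ∞ := fun i => ((measure_mono (hN i)).trans_lt (by simp)).ne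
  have h1 : ∀ μ : LocFinMeasure, ∑ i, μ.toMeasure.real (B i) * t i =
      ∫ x, ∑ i, (B i).indicator (fun _ => t i) x ∂μ.toMeasure := fun μ =>
    (integral_sum_indicator t hB fun i => hfin i μ).symm
  have hm : Measurable fun x => ∑ i, (B i).indicator (fun _ => t i) x :=
    measurable_fun_sum _ fun i _ => measurable_const.indicator (hB i)
  -- At most one indicator is nonzero, so the exponential minus one is additive. This is where
  -- disjointness turns into independence.
  have h2 : ∀ x, exp ((∑ i, (B i).indicator (fun _ => t i) x : ℝ) * I) - 1 =
      ∑ i, (B i).indicator (fun _ => exp (t i * I) - 1) x := by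
    intro x
    by_cases hx : ∃ i, x ∈ B i
    · obtain ⟨i, hi⟩ := hx
      have hj : ∀ j, j ≠ i → x ∉ B j := fun j hj hxj => (hd hj).le_bot ⟨hxj, hi⟩
      rw [sum_eq_single i (fun j _ h => indicator_of_notMem (hj j h) _) (by simp),
        sum_eq_single i (fun j _ h => indicator_of_notMem (hj j h) _) (by simp),
        indicator_of_mem hi, indicator_of_mem hi]
    · push Not at hx
      rw [Finset.sum_eq_zero fun i _ => indicator_of_notMem (hx i) _,
        Finset.sum_eq_zero fun i _ => indicator_of_notMem (hx i) _]
      simp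
  have hmi : Measurable fun μ : LocFinMeasure =>
      ∫ x, ∑ i, (B i).indicator (fun _ => t i) x ∂μ.toMeasure := by
    simp only [← h1]
    exact measurable_fun_sum _ fun i _ =>
      ((measurable_apply (hB i)).ennreal_toReal).mul_const _
  simp only [h1]
  rw [integral_exp_poissonLaw (N := N) r hm (fun x hx => Finset.sum_eq_zero fun i _ =>
    indicator_of_notMem (fun h => hx ⟨(hN i h).1.le, (hN i h).2⟩) _) hmi, ← exp_sum]
  simp only [h2]
  rw [integral_finsetSum _ fun i _ => (integrable_indicator_iff (hB i)).2
    (integrableOn_const (hvol i)), mul_sum]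
  congr 1
  refine sum_congr rfl fun i _ => ?_
  rw [integral_indicator_const _ (hB i), Complex.real_smul, ← mul_assoc]
  congr 1
  push_cast
  rfl

theorem hasLaw_real_poissonLaw (r : ℝ≥0) {B : Set ℝ} (hB : MeasurableSet B) {N : ℕ}
    (hN : B ⊆ Ioo (-(N : ℝ)) N) :
    (poissonLaw r).map (fun μ => μ.toMeasure.real B) =
      (poissonMeasure (r * (volume B).toNNReal)).map (fun k : ℕ => (k : ℝ)) := by
  have hm : Measurable fun μ : LocFinMeasure => μ.toMeasure.real B :=
    (measurable_apply hB).ennreal_toReal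
  have := Measure.isProbabilityMeasure_map (μ := poissonLaw r) hm.aemeasurable
  have := Measure.isProbabilityMeasure_map (μ := poissonMeasure (r * (volume B).toNNReal))
    (f := fun k : ℕ => (k : ℝ)) .of_discrete
  refine Measure.ext_of_charFun ?_
  ext t
  rw [charFun_map_cast_poissonMeasure, charFun_apply, integral_map hm.aemeasurable (by fun_prop)]
  have h := integral_exp_sum_poissonLaw r (ι := Unit) (fun _ => t) (fun _ => hB) (fun _ => hN)
    (fun i j hij => (hij rfl).elim)
  simp only [Finset.univ_unique, Finset.sum_singleton, Finset.prod_singleton] at h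
  rw [← h]
  refine integral_congr_ae (ae_of_all _ fun μ => ?_)
  simp only [Real.inner_apply]

theorem hasLaw_poissonLaw_of_subset (r : ℝ≥0) {B : Set ℝ} (hB : MeasurableSet B) {N : ℕ}
    (hN : B ⊆ Ioo (-(N : ℝ)) N) :
    (poissonLaw r).map (fun μ => μ.toMeasure B) =
      (poissonMeasure (r * (volume B).toNNReal)).map (fun k : ℕ => (k : ℝ≥0∞)) := by
  have h := congrArg (Measure.map ofReal) (hasLaw_real_poissonLaw r hB hN)
  have hm : Measurable fun μ : LocFinMeasure => μ.toMeasure.real B :=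
    (measurable_apply hB).ennreal_toReal
  rw [Measure.map_map ENNReal.measurable_ofReal hm,
    Measure.map_map ENNReal.measurable_ofReal .of_discrete] at h
  have e1 : (ofReal ∘ fun μ : LocFinMeasure => μ.toMeasure.real B) = fun μ => μ.toMeasure B := by
    funext μ
    exact ofReal_toReal (measure_lt_top_of_subset_Ioo μ hN)
  have e2 : (ofReal ∘ fun k : ℕ => (k : ℝ)) = fun k : ℕ => (k : ℝ≥0∞) := by
    funext k
    simp
  rwa [e2, e1] at h

theorem iIndepFun_poissonLaw_of_subset (r : ℝ≥0) {k : ℕ} {B : Fin k → Set ℝ}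
    (hB : ∀ i, MeasurableSet (B i)) {N : ℕ} (hN : ∀ i, B i ⊆ Ioo (-(N : ℝ)) N)
    (hd : Pairwise (Function.onFun Disjoint B)) :
    iIndepFun (fun i (μ : LocFinMeasure) => μ.toMeasure (B i)) (poissonLaw r) := by
  have hm : ∀ i, Measurable fun μ : LocFinMeasure => μ.toMeasure.real (B i) := fun i =>
    (measurable_apply (hB i)).ennreal_toReal
  have h : iIndepFun (fun i (μ : LocFinMeasure) => μ.toMeasure.real (B i)) (poissonLaw r) := by
    refine (iIndepFun_iff_charFun_pi fun i => (hm i).aemeasurable).2 fun t => ?_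
    have hmt : Measurable fun μ : LocFinMeasure =>
        WithLp.toLp 2 fun i => μ.toMeasure.real (B i) :=
      (WithLp.measurable_toLp 2 _).comp (measurable_pi_lambda _ hm)
    rw [charFun_apply, integral_map hmt.aemeasurable (by fun_prop)]
    simp only [hasLaw_real_poissonLaw r (hB _) (hN _), charFun_map_cast_poissonMeasure]
    rw [← integral_exp_sum_poissonLaw r t hB hN hd]
    refine integral_congr_ae (ae_of_all _ fun μ => ?_)
    simp only [PiLp.inner_apply, Real.inner_apply]
  have h' := h.comp (fun _ => ofReal) fun _ => ENNReal.measurable_ofReal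
  convert h' using 2 with i
  funext μ
  exact (ofReal_toReal (measure_lt_top_of_subset_Ioo μ (hN i))).symm

/-- The passage from bounded to unbounded sets: the counts increase with the window, so these events
decrease. Sublevel events are used because they also make sense when the count is infinite. -/
theorem tendsto_poissonLaw_biInter_le (r : ℝ≥0) {ι : Type*} (s : Finset ι) {B : ι → Set ℝ}
    (hB : ∀ i, MeasurableSet (B i)) (c : ι → ℝ≥0∞) :
    Tendsto (fun N : ℕ => poissonLaw r (⋂ i ∈ s, {μ | μ.toMeasure (B i ∩ Ioo (-(N : ℝ)) N) ≤ c i}))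
      atTop (𝓝 (poissonLaw r (⋂ i ∈ s, {μ | μ.toMeasure (B i) ≤ c i}))) := by
  have h := tendsto_measure_iInter_atTop (μ := poissonLaw r)
    (s := fun N : ℕ => ⋂ i ∈ s, {μ : LocFinMeasure | μ.toMeasure (B i ∩ Ioo (-(N : ℝ)) N) ≤ c i})
    (fun N => (Finset.measurableSet_biInter _ fun i _ => measurableSet_le
      (measurable_apply ((hB i).inter measurableSet_Ioo)) measurable_const).nullMeasurableSet)
    (fun N M hNM => Set.iInter₂_mono fun i _ μ hμ =>
      (measure_mono (monotone_inter_Ioo (B i) hNM)).trans hμ) ⟨0, measure_ne_top _ _⟩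
  have e : ⋂ i ∈ s, {μ : LocFinMeasure | μ.toMeasure (B i) ≤ c i} = ⋂ N : ℕ, ⋂ i ∈ s,
      {μ : LocFinMeasure | μ.toMeasure (B i ∩ Ioo (-(N : ℝ)) N) ≤ c i} := ?_
  · rwa [e]
  ext μ
  simp only [Set.mem_iInter, Set.mem_ofPred_eq]
  refine ⟨fun h N i hi => (measure_mono Set.inter_subset_left).trans (h i hi), fun h i hi => ?_⟩
  exact le_of_tendsto' (tendsto_measure_inter_Ioo μ.toMeasure (B i)) fun N => h N i hi

theorem tendsto_poissonMeasure_finset {u : ℕ → ℝ≥0} {l : ℝ≥0} (hu : Tendsto u atTop (𝓝 l))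
    (s : Finset ℕ) :
    Tendsto (fun N => poissonMeasure (u N) s) atTop (𝓝 (poissonMeasure l s)) := by
  have h : ∀ q : ℝ≥0, poissonMeasure q s =
      ∑ k ∈ s, ofReal (Real.exp (-q) * q ^ k / k.factorial) := fun q => by
    rw [← sum_measure_singleton]
    exact sum_congr rfl fun k _ => poissonMeasure_singleton q k
  simp only [h]
  refine tendsto_finsetSum _ fun k _ => ENNReal.tendsto_ofReal ?_
  have hu' : Tendsto (fun N => (u N : ℝ)) atTop (𝓝 l) := NNReal.tendsto_coe.2 hu
  exact ((((Real.continuous_exp.tendsto _).comp hu'.neg).mul (hu'.pow k)).div_const _)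

theorem hasLaw_poissonLaw (r : ℝ≥0) {B : Set ℝ} (hB : MeasurableSet B) (hvol : volume B ≠ ∞) :
    (poissonLaw r).map (fun μ => μ.toMeasure B) =
      (poissonMeasure (r * (volume B).toNNReal)).map (fun k : ℕ => (k : ℝ≥0∞)) := by
  have hm := measurable_apply hB
  have := Measure.isProbabilityMeasure_map (μ := poissonLaw r) hm.aemeasurable
  have := Measure.isProbabilityMeasure_map (μ := poissonMeasure (r * (volume B).toNNReal))
    (f := fun k : ℕ => (k : ℝ≥0∞)) .of_discrete
  refine Measure.ext_of_Iic _ _ fun c => ?_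
  rcases eq_or_ne c ∞ with rfl | hc
  · rw [show Set.Iic ∞ = (Set.univ : Set ℝ≥0∞) from Set.Iic_top, measure_univ, measure_univ]
  have hfin : (Nat.cast ⁻¹' Set.Iic c : Set ℕ).Finite := by
    refine (range (⌊c.toReal⌋₊ + 1)).finite_toSet.subset fun k hk => ?_
    rw [Finset.mem_coe, mem_range, Nat.lt_succ_iff]
    refine Nat.le_floor ?_
    have := ENNReal.toReal_mono hc hk
    simpa using this
  have h1 := tendsto_poissonLaw_biInter_le r {(0 : ℕ)} (fun _ => hB) fun _ => c
  simp only [Finset.mem_singleton, Set.iInter_iInter_eq_left] at h1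
  have h2 : ∀ N : ℕ, poissonLaw r {μ | μ.toMeasure (B ∩ Ioo (-(N : ℝ)) N) ≤ c} =
      poissonMeasure (r * (volume (B ∩ Ioo (-(N : ℝ)) N)).toNNReal) hfin.toFinset := by
    intro N
    have h3 := hasLaw_poissonLaw_of_subset r (hB.inter measurableSet_Ioo)
      (Set.inter_subset_right : B ∩ Ioo (-(N : ℝ)) N ⊆ _)
    have h4 := congrArg (fun ν => ν (Set.Iic c)) h3
    rw [Measure.map_apply (measurable_apply (hB.inter measurableSet_Ioo)) measurableSet_Iic,
      Measure.map_apply .of_discrete measurableSet_Iic] at h4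
    rw [hfin.coe_toFinset]
    exact h4
  simp only [h2] at h1
  rw [Measure.map_apply hm measurableSet_Iic, Measure.map_apply .of_discrete measurableSet_Iic,
    ← hfin.coe_toFinset]
  refine tendsto_nhds_unique h1 (tendsto_poissonMeasure_finset ?_ _)
  exact tendsto_const_nhds.mul ((ENNReal.tendsto_toNNReal hvol).comp
    (tendsto_measure_inter_Ioo volume B))

theorem isPoissonProcessLaw_poissonLaw (r : ℝ≥0) : IsPoissonProcessLaw r (poissonLaw r) := by
  refine ⟨fun B hB hvol => ⟨(measurable_apply hB).aemeasurable, hasLaw_poissonLaw r hB hvol⟩,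
    fun k B hB hd => ?_⟩
  have hm : ∀ i, Measurable fun μ : LocFinMeasure => μ.toMeasure (B i) := fun i =>
    measurable_apply (hB i)
  -- It suffices to test independence on sublevel events, which form a generating π-system. For
  -- these, both sides are limits of their versions in bounded windows.
  refine (iIndepFun_iff_iIndep _ _ _).2 (iIndepSets.iIndep (fun i => (hm i).comap_le)
    (fun i => Set.preimage (fun μ : LocFinMeasure => μ.toMeasure (B i)) '' Set.range Set.Iic)
    (fun i => isPiSystem_Iic.comap _) (fun i => ?_) ?_)
  · rw [← MeasurableSpace.comap_generateFrom, ← borel_eq_generateFrom_Iic ℝ≥0∞,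
      BorelSpace.measurable_eq (α := ℝ≥0∞)]
  refine (iIndepSets_iff _ _).2 fun s f hf => ?_
  have hc : ∀ i, ∃ c : ℝ≥0∞, i ∈ s → f i = {μ : LocFinMeasure | μ.toMeasure (B i) ≤ c} := by
    intro i
    by_cases hi : i ∈ s
    · obtain ⟨_, ⟨c, rfl⟩, h⟩ := hf i hi
      exact ⟨c, fun _ => h.symm⟩
    · exact ⟨0, fun h => (hi h).elim⟩
  choose c hc using hc
  have e1 : ⋂ i ∈ s, f i = ⋂ i ∈ s, {μ : LocFinMeasure | μ.toMeasure (B i) ≤ c i} :=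
    Set.iInter₂_congr hc
  rw [e1, prod_congr rfl fun i hi => congrArg (poissonLaw r) (hc i hi)]
  refine tendsto_nhds_unique (tendsto_poissonLaw_biInter_le r s hB c) ?_
  have h1 : ∀ i ∈ s, Tendsto (fun N : ℕ => poissonLaw r
      {μ | μ.toMeasure (B i ∩ Ioo (-(N : ℝ)) N) ≤ c i}) atTop
      (𝓝 (poissonLaw r {μ | μ.toMeasure (B i) ≤ c i})) := fun i _ => by
    have h := tendsto_poissonLaw_biInter_le r {i} hB c
    simpa only [Finset.mem_singleton, Set.iInter_iInter_eq_left] using h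
  refine (ENNReal.tendsto_finsetProd_of_ne_top s h1 fun i _ => measure_ne_top _ _).congr fun N => ?_
  have hind := iIndepFun_poissonLaw_of_subset r (fun i => (hB i).inter measurableSet_Ioo)
    (fun i => (Set.inter_subset_right : B i ∩ Ioo (-(N : ℝ)) N ⊆ _))
    fun i j hij => (hd hij).mono Set.inter_subset_left Set.inter_subset_left
  exact (hind.measure_inter_preimage_eq_mul s (sets := fun i => Set.Iic (c i))
    fun i _ => measurableSet_Iic).symm

/-! ### Convergence of the process of roots in the upper half plane. -/

section ConvergenceInDistribution

variable {Ω : ℕ → Type*} [∀ n, MeasurableSpace (Ω n)] {μ : ∀ n, Measure (Ω n)}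
  [∀ n, IsProbabilityMeasure (μ n)] {X : ∀ n, Ω n → LocFinMeasure} {Q : Measure LocFinMeasure}
  [IsProbabilityMeasure Q]

theorem tendstoInDistribution_of_charFunctional (hX : ∀ n, AEMeasurable (X n) (μ n))
    (h : ∀ g, Tendsto (fun n => ∫ ω, exp (testIntegral g (X n ω) * I) ∂μ n) atTop
      (𝓝 (∫ ν, exp (testIntegral g ν * I) ∂Q))) :
    TendstoInDistribution X atTop (id : LocFinMeasure → LocFinMeasure) μ Q := by
  refine ⟨hX, aemeasurable_id, tendsto_of_charFunctional fun g => ?_⟩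
  have hm : Measurable fun ν : LocFinMeasure => exp (testIntegral g ν * I) :=
    measurable_exp.comp ((measurable_ofReal.comp (measurable_testIntegral g)).mul_const _)
  simp only [ProbabilityMeasure.coe_mk, Measure.map_id]
  exact (h g).congr fun n => (integral_map (hX n) hm.aestronglyMeasurable).symm

theorem eventually_measure_testIntegral_le
    (h : TendstoInDistribution X atTop (id : LocFinMeasure → LocFinMeasure) μ Q) (g : C_c(ℝ, ℝ))
    {F : Set ℝ} (hF : IsClosed F) {ε : ℝ≥0∞} (hε : ε ≠ 0) :
    ∀ᶠ n in atTop, μ n {ω | testIntegral g (X n ω) ∈ F} ≤ Q {ν | testIntegral g ν ∈ F} + ε := by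
  have h1 := h.continuous_comp (continuous_testIntegral g)
  have h2 := ProbabilityMeasure.limsup_measure_closed_le_of_tendsto h1.tendsto hF
  simp only [ProbabilityMeasure.coe_mk] at h2
  have h3 : (Measure.map (testIntegral g ∘ id) Q) F = Q {ν | testIntegral g ν ∈ F} :=
    Measure.map_apply (measurable_testIntegral g) hF.measurableSet
  rw [h3] at h2
  have h4 := eventually_lt_of_limsup_lt (h2.trans_lt (ENNReal.lt_add_right (measure_ne_top Q _) hε))
  filter_upwards [h4] with n hn
  rw [Measure.map_apply_of_aemeasurable (h1.forall_aemeasurable n) hF.measurableSet] at hn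
  exact hn.le

end ConvergenceInDistribution

/-- The two characteristic functions differ by at most twice the probability of `E n`. As `E n` need
not be measurable, its measurable hull is used. -/
theorem tendsto_integral_exp_of_eq_off {Ω : ℕ → Type*} [∀ n, MeasurableSpace (Ω n)]
    {μ : ∀ n, Measure (Ω n)} [∀ n, IsProbabilityMeasure (μ n)] {U V : ∀ n, Ω n → ℝ} {L : ℂ}
    (hU : ∀ᶠ n in atTop, AEMeasurable (U n) (μ n)) (hV : ∀ᶠ n in atTop, AEMeasurable (V n) (μ n))
    {E : ∀ n, Set (Ω n)} (hE : Tendsto (fun n => μ n (E n)) atTop (𝓝 0))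
    (hUV : ∀ᶠ n in atTop, ∀ᵐ ω ∂μ n, ω ∉ E n → U n ω = V n ω)
    (hL : Tendsto (fun n => ∫ ω, exp (V n ω * I) ∂μ n) atTop (𝓝 L)) :
    Tendsto (fun n => ∫ ω, exp (U n ω * I) ∂μ n) atTop (𝓝 L) := by
  have hE' : Tendsto (fun n => 2 * (μ n).real (E n)) atTop (𝓝 0) := by
    have := ((ENNReal.tendsto_toReal ENNReal.zero_ne_top).comp hE).const_mul 2
    rwa [ENNReal.toReal_zero, mul_zero] at this
  have hint : ∀ n (W : Ω n → ℝ), AEMeasurable W (μ n) →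
      Integrable (fun ω => exp (W ω * I)) (μ n) := fun n W hW =>
    Integrable.of_bound (by fun_prop) 1 (ae_of_all _ fun ω => (norm_exp_ofReal_mul_I _).le)
  have hd : Tendsto (fun n => (∫ ω, exp (U n ω * I) ∂μ n) -
      ∫ ω, exp (V n ω * I) ∂μ n) atTop (𝓝 0) := by
    refine squeeze_zero_norm' ?_ hE'
    filter_upwards [hU, hV, hUV] with n hUn hVn hn
    rw [← integral_sub (hint n _ hUn) (hint n _ hVn)]
    have hm := measurableSet_toMeasurable (μ n) (E n)
    have e : 2 * (μ n).real (E n) = ∫ ω, (toMeasurable (μ n) (E n)).indicator (fun _ => 2) ω ∂μ n := by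
      rw [integral_indicator_const _ hm, Measure.real, Measure.real, measure_toMeasurable,
        smul_eq_mul, mul_comm]
    rw [e]
    refine norm_integral_le_of_norm_le ((integrable_indicator_iff hm).2
      (integrableOn_const (measure_ne_top _ _))) ?_
    filter_upwards [hn] with ω hω
    by_cases hωE : ω ∈ toMeasurable (μ n) (E n)
    · rw [indicator_of_mem hωE]
      refine (norm_sub_le _ _).trans ?_
      rw [norm_exp_ofReal_mul_I, norm_exp_ofReal_mul_I]; norm_num
    · rw [indicator_of_notMem hωE, hω fun h => hωE (subset_toMeasurable _ _ h), sub_self, norm_zero]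
  simpa using hd.add hL

theorem testIntegral_pointMeasure (g : C_c(ℝ, ℝ)) (s : Multiset ℝ) :
    testIntegral g (pointMeasure s) = (s.map g).sum := by
  change ∫ x, g x ∂(s.map Measure.dirac).sum = _
  induction s using Multiset.induction_on with
  | empty => simp
  | cons y s ih =>
    have := isFiniteMeasure_sum_dirac s
    have hi : ∀ ν : Measure ℝ, IsFiniteMeasure ν → Integrable g ν := fun ν _ =>
      g.continuous.integrable_of_hasCompactSupport g.hasCompactSupport
    rw [Multiset.map_cons, Multiset.sum_cons, Multiset.map_cons, Multiset.sum_cons,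
      integral_add_measure (hi _ inferInstance) (hi _ this), ih, integral_dirac]

theorem testIntegral_upperRootProcess (g : C_c(ℝ, ℝ)) (n : ℕ) (f : ℂ[X]) :
    testIntegral g (upperRootProcess n f) =
      ((f.roots.filter fun z => 0 ≤ z.im).map fun z => g (rescaledModulus n z)).sum := by
  rw [upperRootProcess, testIntegral_pointMeasure, Multiset.map_map]
  rfl

theorem testIntegral_upperRootProcess_of_nodup (g : C_c(ℝ, ℝ)) (n : ℕ) {f : ℂ[X]}
    (hf : f.roots.Nodup) : testIntegral g (upperRootProcess n f) =
      ∑ p ∈ f.roots.toFinset, if 0 ≤ p.im then g (rescaledModulus n p) else 0 := by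
  rw [testIntegral_upperRootProcess, ← Finset.sum_filter]
  change _ = (((f.roots.toFinset.filter fun z => 0 ≤ z.im).val).map _).sum
  rw [Finset.filter_val, Multiset.toFinset_val, hf.dedup]

theorem testIntegral_modulusSetProcess (g : C_c(ℝ, ℝ)) (n : ℕ) (f : ℂ[X]) :
    testIntegral g (modulusSetProcess n f) =
      ∑ t ∈ f.roots.toFinset.image (rescaledModulus n), g t := by
  rw [modulusSetProcess, testIntegral_pointMeasure]
  rfl

theorem roots_nodup_of_derivative_ne_zero {f : ℂ[X]} (h : ∀ p ∈ f.roots, f.derivative.eval p ≠ 0) :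
    f.roots.Nodup := by
  rw [Multiset.nodup_iff_count_le_one]
  intro p
  rw [Polynomial.count_roots]
  by_contra hcon
  rcases eq_or_ne f 0 with rfl | hf
  · simp at hcon
  have h1 := (Polynomial.one_lt_rootMultiplicity_iff_isRoot hf).1 (not_le.1 hcon)
  exact h p ((Polynomial.mem_roots hf).2 h1.1) h1.2

theorem roots_vecPoly_zero (a : Fin (0 + 1) → ℝ) : (vecPoly a).roots = 0 := by
  have : vecPoly a = Polynomial.C (a 0 : ℂ) := by simp [vecPoly]
  rw [this, Polynomial.roots_C]

theorem ae_roots_nodup {n : ℕ} (hn : 1 ≤ n) : ∀ᵐ a ∂γ[n],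
    (vecPoly a).natDegree = n ∧ (vecPoly a).roots.Nodup := by
  filter_upwards [ae_vecPoly_simple hn] with a ha
  exact ⟨ha.1, roots_nodup_of_derivative_ne_zero ha.2⟩

theorem exists_bound_testFun (g : C_c(ℝ, ℝ)) : ∃ C, ∀ x, |g x| ≤ C :=
  g.hasCompactSupport.exists_bound_of_continuous g.continuous

theorem aemeasurable_testIntegral_upperRootProcess {n : ℕ} (hn : 1 ≤ n) (g : C_c(ℝ, ℝ)) :
    AEMeasurable (fun a => testIntegral g (upperRootProcess n (vecPoly a))) (γ[n]) := by
  obtain ⟨C, hC⟩ := exists_bound_testFun g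
  have hφ : Measurable fun p : ℂ => if 0 ≤ p.im then g (rescaledModulus n p) else 0 :=
    Measurable.ite (measurableSet_le measurable_const measurable_im)
      (g.continuous.comp (continuous_rescaledModulus n)).measurable measurable_const
  refine (integrable_sum_roots hn hφ (C := C) fun z => ?_).aemeasurable.congr ?_
  · split_ifs
    · exact hC _
    · rw [abs_zero]; exact (abs_nonneg _).trans (hC 0)
  · filter_upwards [ae_roots_nodup hn] with a ha
    exact (testIntegral_upperRootProcess_of_nodup g n ha.2).symm

theorem aemeasurable_upperRootProcess (n : ℕ) :
    AEMeasurable (fun a => upperRootProcess n (vecPoly a)) (γ[n]) := by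
  rcases Nat.eq_zero_or_pos n with rfl | hn
  · simp only [upperRootProcess, roots_vecPoly_zero]
    exact aemeasurable_const
  · exact aemeasurable_of_testIntegral fun g => aemeasurable_testIntegral_upperRootProcess hn g

/-- `upperSum` counts the open upper half plane and the process the closed one. Once the roots are
simple, they differ only through real roots in the annulus, whose presence is negligible. The radius
`N + 1` rather than `N` keeps it positive. -/
theorem tendsto_charFunctional_upperRootProcess (g : C_c(ℝ, ℝ)) :
    Tendsto (fun n : ℕ => ∫ a, exp (testIntegral g (upperRootProcess n (vecPoly a)) *
      I) ∂γ[n]) atTop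
      (𝓝 (∫ ν, exp (testIntegral g ν * I) ∂poissonLaw (1 / 12))) := by
  obtain ⟨N, hN⟩ := exists_nat_support g
  have hN' : ∀ x, ((N + 1 : ℕ) : ℝ) < |x| → g x = 0 := fun x hx =>
    hN x (lt_trans (by push_cast; linarith) hx)
  obtain ⟨C, hC⟩ := exists_bound_testFun g
  have hlim := tendsto_integral_exp_upperSum (A := (N + 1 : ℕ)) (by positivity) g.continuous hN'
  rw [integral_exp_testIntegral_poissonLaw]
  have e : (((1 / 12 : ℝ≥0) : ℝ) : ℂ) = 1 / 12 := by push_cast; norm_num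
  rw [e]
  refine tendsto_integral_exp_of_eq_off (V := fun n a => upperSum n g a)
    (Eventually.of_forall fun n => (measurable_testIntegral g).comp_aemeasurable
      (aemeasurable_upperRootProcess n)) ?_
    (tendsto_measure_real_root (A := (N + 1 : ℕ)) (by positivity)) ?_ hlim
  · filter_upwards [eventually_ge_atTop 1] with n hn
    have hφ : Measurable fun p : ℂ => if 0 < p.im then g (rescaledModulus n p) else 0 :=
      Measurable.ite (measurableSet_lt measurable_const measurable_im)
        (g.continuous.comp (continuous_rescaledModulus n)).measurable measurable_const
    refine (integrable_sum_roots hn hφ (C := C) fun z => ?_).aemeasurable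
    split_ifs
    · exact hC _
    · rw [abs_zero]; exact (abs_nonneg _).trans (hC 0)
  · filter_upwards [eventually_ge_atTop 1] with n hn
    filter_upwards [ae_roots_nodup hn] with a ha hE
    rw [testIntegral_upperRootProcess_of_nodup g n ha.2, upperSum]
    refine sum_congr rfl fun p hp => ?_
    rcases lt_trichotomy 0 p.im with h | h | h
    · rw [if_pos h, if_pos h.le]
    · rw [if_pos h.le, if_neg (by rw [← h]; exact lt_irrefl _)]
      refine hN' _ (not_le.1 fun hle => hE ⟨p.re, ?_, ?_⟩)
      · have e : (p.re : ℂ) = p := Complex.ext rfl (by simpa using h)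
        rw [e]; exact hle
      · have e : (p.re : ℂ) = p := Complex.ext rfl (by simpa using h)
        rw [e]
        exact (Polynomial.mem_roots'.1 (Multiset.mem_toFinset.1 hp)).2
    · rw [if_neg h.le.not_gt, if_neg (not_le.2 h)]

theorem tendstoInDistribution_upperRootProcess :
    TendstoInDistribution (fun (n : ℕ) (a : Fin (n + 1) → ℝ) => upperRootProcess n (vecPoly a))
      atTop (id : LocFinMeasure → LocFinMeasure) (fun n => γ[n])
      (poissonLaw (1 / 12)) :=
  tendstoInDistribution_of_charFunctional aemeasurable_upperRootProcess
    tendsto_charFunctional_upperRootProcess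

/-! ### Coinciding moduli are negligible; convergence of the set version. -/

/-- A test function with values in `[0, 1]` that is one on `[y - ρ, y + ρ]` and zero outside
`(y - ρ - η, y + ρ + η)`. -/
def plateau (y ρ : ℝ) {η : ℝ} (hη : 0 < η) : C_c(ℝ, ℝ) :=
  ⟨⟨fun x => max 0 (min 1 ((ρ + η - |x - y|) / η)), by fun_prop⟩,
    HasCompactSupport.intro (isCompact_closedBall y (ρ + η)) fun x hx => by
      have h : ρ + η < |x - y| := not_le.1 fun h => hx h
      exact max_eq_left ((min_le_right _ _).trans (div_nonpos_of_nonpos_of_nonneg (by linarith)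
        hη.le))⟩

section plateau

variable {y ρ η : ℝ} (hη : 0 < η)

theorem plateau_apply (x : ℝ) : plateau y ρ hη x = max 0 (min 1 ((ρ + η - |x - y|) / η)) := rfl

theorem plateau_nonneg (x : ℝ) : 0 ≤ plateau y ρ hη x := le_max_left _ _

theorem plateau_le_one (x : ℝ) : plateau y ρ hη x ≤ 1 := max_le zero_le_one (min_le_left _ _)

theorem plateau_eq_one {x : ℝ} (hx : |x - y| ≤ ρ) : plateau y ρ hη x = 1 := by
  rw [plateau_apply, min_eq_left ((one_le_div hη).2 (by linarith)), max_eq_right zero_le_one]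

theorem plateau_eq_zero {x : ℝ} (hx : x ∉ Ioo (y - (ρ + η)) (y + (ρ + η))) :
    plateau y ρ hη x = 0 := by
  have h : ρ + η ≤ |x - y| := not_lt.1 fun h => hx (by
    rw [abs_lt] at h; constructor <;> linarith [h.1, h.2])
  exact max_eq_left ((min_le_right _ _).trans (div_nonpos_of_nonpos_of_nonneg (by linarith) hη.le))

theorem plateau_pos {x : ℝ} (hx : x ∈ Ioo (y - (ρ + η)) (y + (ρ + η))) : 0 < plateau y ρ hη x := by
  refine lt_max_of_lt_right (lt_min zero_lt_one (div_pos ?_ hη))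
  have : |x - y| < ρ + η := abs_lt.2 ⟨by linarith [hx.1], by linarith [hx.2]⟩
  linarith

theorem testIntegral_plateau_le (μ : LocFinMeasure) : testIntegral (plateau y ρ hη) μ ≤
    μ.toMeasure.real (Ioo (y - (ρ + η)) (y + (ρ + η))) := by
  rw [← integral_indicator_one measurableSet_Ioo]
  refine integral_mono (integrable_testFun _ μ) ((integrable_indicator_iff measurableSet_Ioo).2
    (integrableOn_const measure_Ioo_lt_top.ne)) fun x => ?_
  by_cases hx : x ∈ Ioo (y - (ρ + η)) (y + (ρ + η))
  · rw [indicator_of_mem hx]; exact plateau_le_one hη x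
  · rw [indicator_of_notMem hx, plateau_eq_zero hη hx]

theorem measure_Ioo_eq_zero_of_testIntegral_plateau {μ : LocFinMeasure}
    (h : testIntegral (plateau y ρ hη) μ ≤ 0) :
    μ.toMeasure (Ioo (y - (ρ + η)) (y + (ρ + η))) = 0 := by
  have h0 : ∫ x, plateau y ρ hη x ∂μ.toMeasure = 0 :=
    le_antisymm h (integral_nonneg fun x => plateau_nonneg hη x)
  rw [integral_eq_zero_iff_of_nonneg (fun x => plateau_nonneg hη x) (integrable_testFun _ μ)] at h0
  refine measure_mono_null (fun x hx => ?_) (ae_iff.1 h0)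
  exact (plateau_pos hη hx).ne'

end plateau

theorem volume_Ioo_toNNReal (a b : ℝ) : (volume (Ioo a b)).toNNReal = (b - a).toNNReal := by
  rw [Real.volume_Ioo, ofReal, ENNReal.toNNReal_coe]

theorem poissonLaw_Ioo_mem (r : ℝ≥0) (a b : ℝ) {S : Set ℝ≥0∞} (hS : MeasurableSet S) :
    poissonLaw r {μ | μ.toMeasure (Ioo a b) ∈ S} =
      poissonMeasure (r * (b - a).toNNReal) {k | (k : ℝ≥0∞) ∈ S} := by
  have h := ((isPoissonProcessLaw_poissonLaw r).hasLaw (Ioo a b) measurableSet_Ioo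
    (by simp)).measure_eq (p := fun x => x ∈ S) hS
  rw [volume_Ioo_toNNReal] at h
  rw [h]
  exact Measure.map_apply .of_discrete hS

theorem poissonLaw_Ioo_eq_zero (r : ℝ≥0) {a b : ℝ} (hab : a ≤ b) :
    poissonLaw r {μ | μ.toMeasure (Ioo a b) = 0} = ofReal (Real.exp (-(r * (b - a)))) := by
  have h := poissonLaw_Ioo_mem r a b (measurableSet_singleton 0)
  have e : {k : ℕ | (k : ℝ≥0∞) ∈ ({0} : Set ℝ≥0∞)} = {0} := by ext; simp
  rw [e, poissonMeasure_singleton] at h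
  simp only [Set.mem_singleton_iff] at h
  rw [h]
  simp [Real.coe_toNNReal _ (sub_nonneg.2 hab)]

/-- By `exp(-l) ≥ 1 - l`, the probability `1 - exp(-l) (1 + l)` is at most `1 - (1 - l) (1 + l)`. -/
theorem poissonMeasure_two_le (l : ℝ≥0) : poissonMeasure l {k | 2 ≤ k} ≤ ofReal (l ^ 2) := by
  have e : {k : ℕ | 2 ≤ k} = (({0, 1} : Finset ℕ) : Set ℕ)ᶜ := by
    ext k
    simp only [Set.mem_ofPred_eq, Finset.coe_insert, Finset.coe_singleton, Set.mem_compl_iff,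
      Set.mem_insert_iff, Set.mem_singleton_iff]
    omega
  rw [← ofReal_measureReal, e, probReal_compl_eq_one_sub (Finset.measurableSet _)]
  refine ofReal_le_ofReal ?_
  rw [← sum_measureReal_singleton, Finset.sum_pair zero_ne_one, poissonMeasure_real_singleton,
    poissonMeasure_real_singleton]
  have h1 : 1 - (l : ℝ) ≤ Real.exp (-l) := by linarith [Real.add_one_le_exp (-(l : ℝ))]
  have h2 : (1 - (l : ℝ)) * (1 + l) ≤ Real.exp (-l) * (1 + l) := by gcongr
  simp
  linarith

theorem poissonLaw_two_le (r : ℝ≥0) {a b : ℝ} (hab : a ≤ b) :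
    poissonLaw r {μ | 2 ≤ μ.toMeasure (Ioo a b)} ≤ ofReal ((r * (b - a)) ^ 2) := by
  have h := poissonLaw_Ioo_mem r a b (measurableSet_Ici (a := 2))
  have e : {k : ℕ | (k : ℝ≥0∞) ∈ Set.Ici (2 : ℝ≥0∞)} = {k | 2 ≤ k} := by
    ext k
    simp only [Set.mem_ofPred_eq, Set.mem_Ici]
    exact Nat.cast_le (α := ℝ≥0∞) (m := 2)
  rw [e] at h
  refine (h.le.trans (poissonMeasure_two_le _)).trans_eq ?_
  rw [NNReal.coe_mul, Real.coe_toNNReal _ (sub_nonneg.2 hab)]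

/-- The event that two different roots in the closed upper half plane have the same rescaled
modulus in `[-A, A]`. -/
def collision (n : ℕ) (A : ℝ) : Set (Fin (n + 1) → ℝ) :=
  {a | ∃ p ∈ (vecPoly a).roots, ∃ q ∈ (vecPoly a).roots, p ≠ q ∧ 0 ≤ p.im ∧ 0 ≤ q.im ∧
    rescaledModulus n p = rescaledModulus n q ∧ |rescaledModulus n p| ≤ A}

theorem two_le_testIntegral_plateau {n : ℕ} {a : Fin (n + 1) → ℝ} (ha : (vecPoly a).roots.Nodup)
    {p q : ℂ} (hp : p ∈ (vecPoly a).roots) (hq : q ∈ (vecPoly a).roots) (hpq : p ≠ q)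
    (hp0 : 0 ≤ p.im) (hq0 : 0 ≤ q.im) (h : rescaledModulus n p = rescaledModulus n q)
    {y ρ η : ℝ} (hη : 0 < η) (hy : |rescaledModulus n p - y| ≤ ρ) :
    2 ≤ testIntegral (plateau y ρ hη) (upperRootProcess n (vecPoly a)) := by
  rw [testIntegral_upperRootProcess_of_nodup _ _ ha]
  refine le_trans ?_ (Finset.sum_le_sum_of_subset_of_nonneg (s := {p, q}) (fun z hz => ?_)
    fun z _ _ => ?_)
  · rw [Finset.sum_pair hpq, if_pos hp0, if_pos hq0, ← h, plateau_eq_one hη hy]; norm_num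
  · rcases Finset.mem_insert.1 hz with rfl | hz
    · exact Multiset.mem_toFinset.2 hp
    · rw [Finset.mem_singleton.1 hz]; exact Multiset.mem_toFinset.2 hq
  · split_ifs
    · exact plateau_nonneg hη _
    · exact le_rfl

theorem exists_grid_point {A : ℝ} (hA : 0 < A) {m : ℕ} (hm : 0 < m) {x : ℝ} (hx : |x| ≤ A) :
    ∃ j ∈ range (2 * m + 1), |x - (-A + j * (A / m))| ≤ A / m := by
  have hη : 0 < A / m := by positivity
  obtain ⟨h1, h2⟩ := abs_le.1 hx
  have h0 : 0 ≤ (x + A) / (A / m) := div_nonneg (by linarith) hη.le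
  refine ⟨⌊(x + A) / (A / m)⌋₊, ?_, ?_⟩
  · rw [mem_range, Nat.lt_succ_iff]
    refine Nat.floor_le_of_le ?_
    rw [div_le_iff₀ hη]
    push_cast
    have : 2 * (m : ℝ) * (A / m) = 2 * A := by field_simp
    linarith
  · have h3 := (le_div_iff₀ hη).1 (Nat.floor_le h0)
    have h4 := (div_lt_iff₀ hη).1 (Nat.lt_floor_add_one ((x + A) / (A / m)))
    rw [abs_le]
    constructor <;> linarith

/-- Two roots with equal rescaled modulus put mass two on a grid interval of any mesh. In the limit,
an interval of length `4 A / m` has two points with probability at most `(A / (3 m))²`, and there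
are `2 m + 1` grid points, so the total is `O(1 / m)`. -/
theorem tendsto_measure_collision {A : ℝ} (hA : 0 < A) :
    Tendsto (fun n : ℕ => γ[n] (collision n A)) atTop (𝓝 0) := by
  refine ENNReal.tendsto_nhds_zero.2 fun ε hε => ?_
  obtain ⟨δ, hδ0, hδ⟩ := ENNReal.lt_iff_exists_nnreal_btwn.1 hε
  have hδ' : (0 : ℝ) < δ := by exact_mod_cast hδ0
  obtain ⟨m, hm⟩ := exists_nat_gt (A ^ 2 / δ)
  have hm0' : (0 : ℝ) < m := lt_of_le_of_lt (by positivity) hm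
  have hm0 : 0 < m := by exact_mod_cast hm0'
  have hη : 0 < A / m := by positivity
  set κ : ℝ := δ / (2 * (2 * m + 1)) with hκ
  have hκ0 : 0 < κ := by positivity
  have hj : ∀ j ∈ range (2 * m + 1), ∀ᶠ n : ℕ in atTop, γ[n]
      {a | testIntegral (plateau (-A + j * (A / m)) (A / m) hη) (upperRootProcess n (vecPoly a)) ∈
        Set.Ici 2} ≤ ofReal ((A / (3 * m)) ^ 2 + κ) := by
    intro j _
    filter_upwards [eventually_measure_testIntegral_le tendstoInDistribution_upperRootProcess
      (plateau (-A + j * (A / m)) (A / m) hη) isClosed_Ici (ENNReal.ofReal_pos.2 hκ0).ne']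
      with n hn
    refine hn.trans ?_
    rw [ofReal_add (by positivity) hκ0.le]
    gcongr
    refine (measure_mono fun ν hν => ?_).trans ((poissonLaw_two_le (1 / 12)
      (a := -A + j * (A / m) - (A / m + A / m)) (b := -A + j * (A / m) + (A / m + A / m))
      (by linarith)).trans_eq ?_)
    · have h1 := le_trans hν (testIntegral_plateau_le hη ν)
      have h2 := ofReal_le_ofReal h1
      rw [ofReal_measureReal measure_Ioo_lt_top.ne] at h2
      simpa using h2
    · congr 1
      push_cast
      field_simp
      ring
  filter_upwards [(Finset.eventually_all _).2 hj, eventually_ge_atTop 1] with n hn hn1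
  have hsub : γ[n] (collision n A) ≤ γ[n]
      (⋃ j ∈ range (2 * m + 1), {a | testIntegral (plateau (-A + j * (A / m)) (A / m) hη)
        (upperRootProcess n (vecPoly a)) ∈ Set.Ici 2}) := by
    refine measure_mono_ae ?_
    filter_upwards [ae_roots_nodup hn1] with a ha
    rintro ⟨p, hp, q, hq, hpq, hp0, hq0, h, hpA⟩
    obtain ⟨j, hj1, hj2⟩ := exists_grid_point hA hm0 hpA
    exact Set.mem_biUnion hj1 (two_le_testIntegral_plateau ha.2 hp hq hpq hp0 hq0 h hη hj2)
  refine (hsub.trans ((measure_biUnion_finset_le _ _).trans (sum_le_sum hn))).trans ?_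
  rw [sum_const, card_range, nsmul_eq_mul, ← ENNReal.ofReal_natCast, ← ofReal_mul (by positivity)]
  refine le_trans ?_ hδ.le
  rw [← ENNReal.ofReal_coe_nnreal]
  refine ofReal_le_ofReal ?_
  have h1 : ((2 * m + 1 : ℕ) : ℝ) * κ = δ / 2 := by rw [hκ]; push_cast; field_simp
  have hm1 : (1 : ℝ) ≤ m := by exact_mod_cast hm0
  have h2 : ((2 * m + 1 : ℕ) : ℝ) * (A / (3 * m)) ^ 2 ≤ A ^ 2 / (3 * m) := by
    have e : A ^ 2 / (3 * m) = (3 * m) * (A / (3 * m)) ^ 2 := by field_simp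
    rw [e]
    push_cast
    gcongr
    linarith
  have h3 : A ^ 2 / (3 * m) ≤ δ / 2 := by
    rw [div_lt_iff₀ hδ'] at hm
    rw [div_le_div_iff₀ (by positivity) two_pos]
    nlinarith
  rw [mul_add, h1]
  linarith

theorem conj_mem_roots_vecPoly {n : ℕ} {a : Fin (n + 1) → ℝ} {p : ℂ}
    (hp : p ∈ (vecPoly a).roots) : starRingEnd ℂ p ∈ (vecPoly a).roots := by
  rw [Polynomial.mem_roots'] at hp ⊢
  refine ⟨hp.1, ?_⟩
  rw [Polynomial.IsRoot.def, eval_conj_vecPoly, hp.2.eq_zero, map_zero]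

theorem image_rescaledModulus_upper {n : ℕ} (a : Fin (n + 1) → ℝ) :
    (vecPoly a).roots.toFinset.image (rescaledModulus n) =
      ((vecPoly a).roots.toFinset.filter fun z => 0 ≤ z.im).image (rescaledModulus n) := by
  refine Finset.Subset.antisymm (fun t ht => ?_) (Finset.image_subset_image (Finset.filter_subset _ _))
  obtain ⟨p, hp, rfl⟩ := mem_image.1 ht
  rw [Multiset.mem_toFinset] at hp
  rcases le_or_gt 0 p.im with h | h
  · exact mem_image.2 ⟨p, mem_filter.2 ⟨Multiset.mem_toFinset.2 hp, h⟩, rfl⟩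
  · refine mem_image.2 ⟨starRingEnd ℂ p, mem_filter.2
      ⟨Multiset.mem_toFinset.2 (conj_mem_roots_vecPoly hp), ?_⟩, ?_⟩
    · rw [Complex.conj_im]; linarith
    · rw [rescaledModulus, rescaledModulus, RCLike.norm_conj]

/-- By conjugation symmetry the upper roots already produce all moduli. Without a collision in `[-A,
A]`, distinct upper roots seen by `g` give distinct elements of the set. -/
theorem testIntegral_modulusSetProcess_eq {n : ℕ} {a : Fin (n + 1) → ℝ}
    (ha : (vecPoly a).roots.Nodup) {g : C_c(ℝ, ℝ)} {A : ℝ} (hA : ∀ x, A < |x| → g x = 0)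
    (hc : a ∉ collision n A) : testIntegral g (modulusSetProcess n (vecPoly a)) =
      testIntegral g (upperRootProcess n (vecPoly a)) := by
  rw [testIntegral_modulusSetProcess, testIntegral_upperRootProcess_of_nodup g n ha,
    ← Finset.sum_filter, image_rescaledModulus_upper]
  set F := (vecPoly a).roots.toFinset.filter fun z => 0 ≤ z.im with hF
  have h1 : ∑ p ∈ F, g (rescaledModulus n p) =
      ∑ p ∈ F.filter (fun p => |rescaledModulus n p| ≤ A), g (rescaledModulus n p) := by
    refine Eq.trans (sum_congr rfl fun p _ => ?_) (Finset.sum_filter _ _).symm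
    split_ifs with h
    · rfl
    · exact hA _ (not_le.1 h)
  rw [h1, ← Finset.sum_image (f := g) (g := rescaledModulus n)]
  · refine (Finset.sum_subset (Finset.image_subset_image (Finset.filter_subset _ _))
      fun t ht ht' => hA t (not_le.1 fun h => ht' ?_)).symm
    obtain ⟨p, hp, rfl⟩ := mem_image.1 ht
    exact mem_image.2 ⟨p, mem_filter.2 ⟨hp, h⟩, rfl⟩
  · intro p hp q hq hpq
    by_contra hne
    rw [Finset.coe_filter, hF] at hp hq
    obtain ⟨hp, hpA⟩ := hp
    obtain ⟨hq, -⟩ := hq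
    rw [mem_filter, Multiset.mem_toFinset] at hp hq
    exact hc ⟨p, hp.1, q, hq.1, hne, hp.2, hq.2, hpq, hpA⟩

/-- A sum over an image written as a sum over all indices. -/
theorem sum_image_eq_sum_div_card {ι : Type*} [Fintype ι] [DecidableEq ι] (y : ι → ℝ) (g : ℝ → ℝ) :
    ∑ t ∈ univ.image y, g t = ∑ i, g (y i) / ∑ j, if y j = y i then 1 else 0 := by
  have h := Finset.sum_comp (s := univ) (fun t => g t / ((univ.filter fun j => y j = t).card : ℝ)) y
  have h2 : ∀ i, (∑ j, if y j = y i then (1 : ℝ) else 0) =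
      ((univ.filter fun j => y j = y i).card : ℝ) := fun i => by
    rw [Finset.sum_ite, Finset.sum_const_zero, add_zero, sum_const, nsmul_eq_mul, mul_one]
  simp only [h2]
  rw [h]
  refine sum_congr rfl fun t ht => ?_
  obtain ⟨i, -, rfl⟩ := mem_image.1 ht
  have : (univ.filter fun j => y j = y i).card ≠ 0 :=
    card_ne_zero.2 ⟨i, mem_filter.2 ⟨mem_univ _, rfl⟩⟩
  rw [nsmul_eq_mul]
  field_simp

/-- A sum over a set of moduli is not a sum over roots. But if there are `n` distinct roots, every
injective `n`-tuple enumerates them all, and `S` computes the desired value from any enumeration,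
dividing by multiplicities. Averaging `S` over the injective tuples writes it as a ratio of
measurable tuple sums. -/
theorem aemeasurable_testIntegral_modulusSetProcess {n : ℕ} (hn : 1 ≤ n) (g : C_c(ℝ, ℝ)) :
    AEMeasurable (fun a => testIntegral g (modulusSetProcess n (vecPoly a))) (γ[n]) := by
  classical
  obtain ⟨C, hC⟩ := exists_bound_testFun g
  have hC0 : 0 ≤ C := (abs_nonneg _).trans (hC 0)
  let S : (Fin n → ℂ) → ℝ := fun p => ∑ i, g (rescaledModulus n (p i)) /
    ∑ j, if rescaledModulus n (p j) = rescaledModulus n (p i) then 1 else 0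
  have hx : ∀ i, Measurable fun p : Fin n → ℂ => rescaledModulus n (p i) := fun i =>
    (continuous_rescaledModulus n).measurable.comp (measurable_pi_apply i)
  have hS : Measurable S := measurable_fun_sum _ fun i _ =>
    (g.continuous.measurable.comp (hx i)).div (measurable_fun_sum _ fun j _ =>
      Measurable.ite (measurableSet_eq_fun (hx j) (hx i)) measurable_const measurable_const)
  have hinj : MeasurableSet {p : Fin n → ℂ | Function.Injective p} := by
    have e : {p : Fin n → ℂ | Function.Injective p} = ⋂ i, ⋂ j, {p | p i = p j → i = j} := by
      ext p; simp [Function.Injective]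
    rw [e]
    refine MeasurableSet.iInter fun i => MeasurableSet.iInter fun j => ?_
    by_cases hij : i = j
    · simp [hij]
    · simp only [hij, imp_false]
      exact (measurableSet_eq_fun (measurable_pi_apply i) (measurable_pi_apply j)).compl
  have hSC : ∀ p, |S p| ≤ n * C := fun p => by
    refine (Finset.abs_sum_le_sum_abs _ _).trans ?_
    refine (sum_le_card_nsmul _ _ C fun i _ => ?_).trans_eq (by simp)
    rw [abs_div]
    refine (div_le_self (abs_nonneg _) ?_).trans (hC _)
    refine le_trans ?_ (le_abs_self _)
    refine le_trans ?_ (single_le_sum (s := univ) (a := i)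
      (f := fun j => if rescaledModulus n (p j) = rescaledModulus n (p i) then (1 : ℝ) else 0)
      (fun j _ => by positivity) (mem_univ i))
    simp
  have hD := integrable_sum_rootTuples (ι := Fin n) hn (Φ := {p | Function.Injective p}.indicator 1)
    (measurable_one.indicator hinj) (C := 1) fun p => by
      by_cases hp : p ∈ {p : Fin n → ℂ | Function.Injective p}
      · rw [indicator_of_mem hp]; simp
      · rw [indicator_of_notMem hp]; simp
  have hN := integrable_sum_rootTuples (ι := Fin n) hn (Φ := {p | Function.Injective p}.indicator S)
    (hS.indicator hinj) (C := n * C) fun p => by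
      by_cases hp : p ∈ {p : Fin n → ℂ | Function.Injective p}
      · rw [indicator_of_mem hp]; exact hSC p
      · rw [indicator_of_notMem hp, abs_zero]; positivity
  refine (hN.aemeasurable.div hD.aemeasurable).congr ?_
  filter_upwards [ae_roots_nodup hn] with a ha
  set R := (vecPoly a).roots.toFinset with hR
  have hcard : R.card = n := by
    rw [hR, Multiset.toFinset_card_of_nodup ha.2,
      ← (IsAlgClosed.splits (vecPoly a)).natDegree_eq_card_roots, ha.1]
  have hval : ∀ p ∈ rootTuples (Fin n) (vecPoly a), Function.Injective p →
      S p = testIntegral g (modulusSetProcess n (vecPoly a)) := by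
    intro p hp hpi
    have himg : univ.image p = R := by
      refine Finset.eq_of_subset_of_card_le (fun z hz => ?_) ?_
      · obtain ⟨i, -, rfl⟩ := mem_image.1 hz
        exact Fintype.mem_piFinset.1 hp i
      · rw [Finset.card_image_of_injective _ hpi, hcard, card_univ, Fintype.card_fin]
    rw [testIntegral_modulusSetProcess, ← hR, ← himg, Finset.image_image]
    exact (sum_image_eq_sum_div_card (rescaledModulus n ∘ p) g).symm
  have hmul : ∀ p ∈ rootTuples (Fin n) (vecPoly a), {p | Function.Injective p}.indicator S p =
      {p : Fin n → ℂ | Function.Injective p}.indicator 1 p *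
        testIntegral g (modulusSetProcess n (vecPoly a)) := by
    intro p hp
    by_cases hpi : p ∈ {p : Fin n → ℂ | Function.Injective p}
    · rw [indicator_of_mem hpi, indicator_of_mem hpi, hval p hp hpi]; simp
    · rw [indicator_of_notMem hpi, indicator_of_notMem hpi, zero_mul]
  have hpos : 0 < ∑ p ∈ rootTuples (Fin n) (vecPoly a),
      {p : Fin n → ℂ | Function.Injective p}.indicator (1 : (Fin n → ℂ) → ℝ) p := by
    let e := (R.equivFinOfCardEq hcard).symm
    have he : Function.Injective fun i => (e i : ℂ) := Subtype.val_injective.comp e.injective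
    refine Finset.sum_pos' (fun p _ => Set.indicator_nonneg (fun _ _ => zero_le_one) _)
      ⟨fun i => (e i : ℂ), Fintype.mem_piFinset.2 fun i => (e i).2, ?_⟩
    rw [indicator_of_mem (show _ ∈ {p : Fin n → ℂ | Function.Injective p} from he)]
    exact zero_lt_one
  simp only [Pi.div_apply]
  rw [sum_congr rfl hmul, ← sum_mul, mul_div_cancel_left₀ _ hpos.ne']

theorem aemeasurable_modulusSetProcess (n : ℕ) :
    AEMeasurable (fun a => modulusSetProcess n (vecPoly a)) (γ[n]) := by
  rcases Nat.eq_zero_or_pos n with rfl | hn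
  · simp only [modulusSetProcess, roots_vecPoly_zero]
    exact aemeasurable_const
  · exact aemeasurable_of_testIntegral fun g => aemeasurable_testIntegral_modulusSetProcess hn g

theorem tendstoInDistribution_modulusSetProcess :
    TendstoInDistribution (fun (n : ℕ) (a : Fin (n + 1) → ℝ) => modulusSetProcess n (vecPoly a))
      atTop (id : LocFinMeasure → LocFinMeasure) (fun n => γ[n])
      (poissonLaw (1 / 12)) := by
  refine tendstoInDistribution_of_charFunctional aemeasurable_modulusSetProcess fun g => ?_
  obtain ⟨N, hN⟩ := exists_nat_support g
  have hN' : ∀ x, ((N + 1 : ℕ) : ℝ) < |x| → g x = 0 := fun x hx =>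
    hN x (lt_trans (by push_cast; linarith) hx)
  refine tendsto_integral_exp_of_eq_off
    (V := fun n (a : Fin (n + 1) → ℝ) => testIntegral g (upperRootProcess n (vecPoly a)))
    (Eventually.of_forall fun n => (measurable_testIntegral g).comp_aemeasurable
      (aemeasurable_modulusSetProcess n))
    (Eventually.of_forall fun n => (measurable_testIntegral g).comp_aemeasurable
      (aemeasurable_upperRootProcess n))
    (tendsto_measure_collision (A := (N + 1 : ℕ)) (by positivity)) ?_
    (tendsto_charFunctional_upperRootProcess g)
  filter_upwards [eventually_ge_atTop 1] with n hn
  filter_upwards [ae_roots_nodup hn] with a ha hE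
  exact testIntegral_modulusSetProcess_eq ha.2 hN' hE

/-! ### Transfer to the given coefficients and the distance to the circle. -/

theorem tendstoInDistribution_comp_hasLaw {Ω : Type*} [MeasurableSpace Ω] {P : Measure Ω}
    [IsProbabilityMeasure P] {Ω' : ℕ → Type*} [∀ n, MeasurableSpace (Ω' n)]
    {μ : ∀ n, Measure (Ω' n)} [∀ n, IsProbabilityMeasure (μ n)] {X : ∀ n, Ω' n → LocFinMeasure}
    {Q : Measure LocFinMeasure} [IsProbabilityMeasure Q] {Y : ∀ n, Ω → Ω' n}
    (hY : ∀ n, HasLaw (Y n) (μ n) P)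
    (h : TendstoInDistribution X atTop (id : LocFinMeasure → LocFinMeasure) μ Q) :
    TendstoInDistribution (fun n ω => X n (Y n ω)) atTop (id : LocFinMeasure → LocFinMeasure)
      (fun _ => P) Q := by
  have hX : ∀ n, AEMeasurable (X n) (P.map (Y n)) := fun n => by
    rw [(hY n).map_eq]; exact h.forall_aemeasurable n
  refine ⟨fun n => (hX n).comp_aemeasurable (hY n).aemeasurable, aemeasurable_id, ?_⟩
  refine h.tendsto.congr fun n => Subtype.ext ?_
  change (μ n).map (X n) = P.map (X n ∘ Y n)
  rw [← AEMeasurable.map_map_of_aemeasurable (hX n) (hY n).aemeasurable, (hY n).map_eq]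

theorem hasLaw_gaussVec {Ω : Type*} [MeasurableSpace Ω] {P : Measure Ω} [IsProbabilityMeasure P]
    {ξ : ℕ → Ω → ℝ} {v : ℝ≥0} (hv : v ≠ 0) (hlaw : ∀ k, HasLaw (ξ k) (gaussianReal 0 v) P)
    (hindep : iIndepFun ξ P) (n : ℕ) :
    HasLaw (fun ω (k : Fin (n + 1)) => ξ k ω / √(v : ℝ)) (γ[n]) P := by
  have h1 : ∀ k : Fin (n + 1), HasLaw (fun ω => ξ k ω / √(v : ℝ)) (gaussianReal 0 1) P := by
    intro k
    have h := gaussianReal_div_const (hlaw k) √(v : ℝ)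
    have e : v / NNReal.mk (√(v : ℝ) ^ 2) (sq_nonneg _) = 1 := by
      have : NNReal.mk (√(v : ℝ) ^ 2) (sq_nonneg _) = v := NNReal.eq (sq_sqrt v.2)
      rw [this, div_self hv]
    rwa [zero_div, e] at h
  have h2 : iIndepFun (fun (k : Fin (n + 1)) ω => ξ k ω / √(v : ℝ)) P :=
    (hindep.precomp Fin.val_injective).comp (fun _ y => y / √(v : ℝ)) fun _ =>
      measurable_id.div_const _
  refine ⟨aemeasurable_pi_lambda _ fun k => (h1 k).aemeasurable, ?_⟩
  rw [(iIndepFun_iff_map_fun_eq_pi_map fun k => (h1 k).aemeasurable).1 h2, gaussVec]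
  congr 1
  funext k
  exact (h1 k).map_eq

theorem kacPoly_eq_C_mul_vecPoly (n : ℕ) (a : ℕ → ℝ) {s : ℝ} (hs : s ≠ 0) :
    kacPoly n a = Polynomial.C (s : ℂ) * vecPoly fun k : Fin (n + 1) => a k / s := by
  rw [kacPoly, vecPoly, ← Fin.sum_univ_eq_sum_range
    (fun k => Polynomial.C (a k : ℂ) * Polynomial.X ^ k), mul_sum]
  refine sum_congr rfl fun k _ => ?_
  rw [← mul_assoc, ← Polynomial.C_mul, ← Complex.ofReal_mul, mul_div_cancel₀ _ hs]

theorem zeroSet_C_mul (f : ℂ[X]) {s : ℂ} (hs : s ≠ 0) :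
    zeroSet (Polynomial.C s * f) = zeroSet f := by
  ext z; simp [zeroSet, hs]

theorem modulusSetProcess_C_mul (n : ℕ) (f : ℂ[X]) {s : ℂ} (hs : s ≠ 0) :
    modulusSetProcess n (Polynomial.C s * f) = modulusSetProcess n f := by
  rw [modulusSetProcess, modulusSetProcess, Polynomial.roots_C_mul _ hs]

theorem upperRootProcess_C_mul (n : ℕ) (f : ℂ[X]) {s : ℂ} (hs : s ≠ 0) :
    upperRootProcess n (Polynomial.C s * f) = upperRootProcess n f := by
  rw [upperRootProcess, upperRootProcess, Polynomial.roots_C_mul _ hs]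

theorem exists_mem_sphere_dist_eq (p : ℂ) : ∃ w ∈ Metric.sphere (0 : ℂ) 1, dist w p = |1 - ‖p‖| := by
  rcases eq_or_ne p 0 with rfl | hp
  · exact ⟨1, by simp, by simp⟩
  · have hp' : ‖p‖ ≠ 0 := norm_ne_zero_iff.2 hp
    refine ⟨p / ‖p‖, by simp [hp], ?_⟩
    have e : p / ‖p‖ - p = ((1 - ‖p‖ : ℝ) : ℂ) * (p / ‖p‖) := by
      have : (‖p‖ : ℂ) ≠ 0 := by exact_mod_cast hp'
      push_cast
      field_simp
    rw [Complex.dist_eq, e, norm_mul, norm_real, norm_eq_abs, norm_div,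
      norm_real, norm_norm, div_self hp', mul_one]

theorem abs_one_sub_norm_le_dist {w : ℂ} (hw : w ∈ Metric.sphere (0 : ℂ) 1) (p : ℂ) :
    |1 - ‖p‖| ≤ dist w p := by
  rw [mem_sphere_zero_iff_norm] at hw
  rw [← hw, Complex.dist_eq]
  exact abs_norm_sub_norm_le w p

/-- The distance of a point to the circle is `|1 - ‖p‖|`, attained radially. Positive degree
guarantees a root, so the infimum is not the default value of an empty set. -/
theorem le_sq_mul_setDist_iff {n : ℕ} (hn : 1 ≤ n) {f : ℂ[X]} (hf : f.natDegree = n) (x : ℝ) :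
    x ≤ (n : ℝ) ^ 2 * setDist (Metric.sphere (0 : ℂ) 1) (zeroSet f) ↔
      ∀ p ∈ f.roots, x ≤ |rescaledModulus n p| := by
  have hf0 : f ≠ 0 := by rintro rfl; simp at hf; omega
  have hn' : (0 : ℝ) < (n : ℝ) ^ 2 := by positivity
  have habs : ∀ p, |rescaledModulus n p| = (n : ℝ) ^ 2 * |1 - ‖p‖| := fun p => by
    rw [rescaledModulus, abs_mul, abs_of_pos hn']
  rw [setDist]
  constructor
  · intro h p hp
    obtain ⟨w, hw, hwp⟩ := exists_mem_sphere_dist_eq p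
    have hmem : |1 - ‖p‖| ∈ Set.image2 dist (Metric.sphere (0 : ℂ) 1) (zeroSet f) :=
      ⟨w, hw, p, ((Polynomial.mem_roots hf0).1 hp).eq_zero, hwp⟩
    rw [habs]
    refine h.trans (mul_le_mul_of_nonneg_left (csInf_le ⟨0, ?_⟩ hmem) hn'.le)
    rintro _ ⟨w, -, p, -, rfl⟩
    exact dist_nonneg
  · intro h
    obtain ⟨z, hz⟩ := Complex.exists_root (f := f)
      (Polynomial.natDegree_pos_iff_degree_pos.1 (by omega))
    rw [← div_le_iff₀' hn']
    refine le_csInf ⟨_, ⟨1, by simp, z, hz.eq_zero, rfl⟩⟩ ?_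
    rintro _ ⟨w, hw, p, hp, rfl⟩
    have h1 := h p ((Polynomial.mem_roots hf0).2 hp)
    rw [habs, ← div_le_iff₀' hn'] at h1
    exact h1.trans (abs_one_sub_norm_le_dist hw p)

theorem testIntegral_plateau_nonpos {n : ℕ} {f : ℂ[X]} {x : ℝ} (hx : 0 < x)
    (h : ∀ p ∈ f.roots, x ≤ |rescaledModulus n p|) :
    testIntegral (plateau 0 0 hx) (upperRootProcess n f) ≤ 0 := by
  rw [testIntegral_upperRootProcess]
  refine (Multiset.sum_eq_zero fun y hy => ?_).le
  obtain ⟨p, hp, rfl⟩ := Multiset.mem_map.1 hy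
  have h1 := h p (Multiset.mem_of_mem_filter hp)
  refine plateau_eq_zero hx fun hmem => h1.not_gt (abs_lt.2 ?_)
  simpa using hmem

theorem le_abs_rescaledModulus_of_testIntegral_lt_one {n : ℕ} {a : Fin (n + 1) → ℝ} {x η : ℝ}
    (hη : 0 < η) (h : testIntegral (plateau 0 x hη) (upperRootProcess n (vecPoly a)) < 1) :
    ∀ p ∈ (vecPoly a).roots, x ≤ |rescaledModulus n p| := by
  have hup : ∀ p ∈ (vecPoly a).roots, 0 ≤ p.im → x ≤ |rescaledModulus n p| := by
    intro p hp hp0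
    by_contra! hcon
    refine h.not_ge ?_
    rw [testIntegral_upperRootProcess]
    refine le_trans (plateau_eq_one (y := 0) (ρ := x) hη (by simpa using hcon.le)).ge
      (Multiset.single_le_sum (fun y hy => ?_) _ (Multiset.mem_map.2
        ⟨p, Multiset.mem_filter.2 ⟨hp, hp0⟩, rfl⟩))
    obtain ⟨q, -, rfl⟩ := Multiset.mem_map.1 hy
    exact plateau_nonneg hη _
  intro p hp
  rcases le_or_gt 0 p.im with h0 | h0
  · exact hup p hp h0
  · have h1 := hup _ (conj_mem_roots_vecPoly hp) (by rw [Complex.conj_im]; linarith)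
    rwa [rescaledModulus, RCLike.norm_conj] at h1

/-- The event is squeezed between two conditions on test integrals. A test function positive exactly
on `(-x, x)` gives the upper bound, one equal to `1` on `[-x, x]` and supported in a slightly larger
interval gives the lower bound through the complement. Only the closed-set half of the portmanteau
theorem is needed, and both bounds are void probabilities of the Poisson process. -/
theorem tendsto_measureReal_le_setDist {Ω : Type*} [MeasurableSpace Ω] {P : Measure Ω}
    [IsProbabilityMeasure P] {Y : ∀ n, Ω → Fin (n + 1) → ℝ}
    (hY : ∀ n, HasLaw (Y n) (γ[n]) P) {x : ℝ} (hx : 0 < x) :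
    Tendsto (fun n : ℕ => P.real {ω | x ≤ (n : ℝ) ^ 2 *
      setDist (Metric.sphere (0 : ℂ) 1) (zeroSet (vecPoly (Y n ω)))}) atTop
      (𝓝 (Real.exp (-x / 6))) := by
  have hconv := tendstoInDistribution_comp_hasLaw hY tendstoInDistribution_upperRootProcess
  have hdeg : ∀ n, 1 ≤ n → ∀ᵐ ω ∂P, (vecPoly (Y n ω)).natDegree = n := by
    intro n hn
    refine ae_of_ae_map (p := fun a => (vecPoly a).natDegree = n) (hY n).aemeasurable ?_
    rw [(hY n).map_eq]
    filter_upwards [ae_roots_nodup hn] with a ha using ha.1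
  refine Metric.tendsto_nhds.2 fun ε hε => ?_
  have hε2 : ofReal (ε / 2) ≠ 0 := (ENNReal.ofReal_pos.2 (half_pos hε)).ne'
  have hr : ((1 / 12 : ℝ≥0) : ℝ) = 1 / 12 := by push_cast; rfl
  filter_upwards [eventually_ge_atTop 1,
    eventually_measure_testIntegral_le hconv (plateau 0 0 hx) isClosed_Iic hε2,
    eventually_measure_testIntegral_le hconv (plateau 0 x hε) isClosed_Ici hε2] with n hn h1 h2
  set E := {ω | x ≤ (n : ℝ) ^ 2 *
      setDist (Metric.sphere (0 : ℂ) 1) (zeroSet (vecPoly (Y n ω)))} with hE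
  have hup : P.real E ≤ Real.exp (-x / 6) + ε / 2 := by
    have h3 : P E ≤ P {ω | testIntegral (plateau 0 0 hx) (upperRootProcess n (vecPoly (Y n ω))) ∈
        Set.Iic 0} := by
      refine measure_mono_ae ?_
      filter_upwards [hdeg n hn] with ω hω hωE
      exact testIntegral_plateau_nonpos hx ((le_sq_mul_setDist_iff hn hω x).1 hωE)
    have h4 := poissonLaw_Ioo_eq_zero (1 / 12) (a := 0 - (0 + x)) (b := 0 + (0 + x)) (by linarith)
    have h5 : P E ≤ ofReal (Real.exp (-x / 6) + ε / 2) := by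
      refine h3.trans (h1.trans ?_)
      rw [ofReal_add (Real.exp_pos _).le (half_pos hε).le]
      gcongr
      refine (measure_mono fun ν hν => measure_Ioo_eq_zero_of_testIntegral_plateau hx hν).trans
        (h4.trans_le (ofReal_le_ofReal (Real.exp_le_exp.2 ?_)))
      rw [hr]
      linarith
    exact toReal_le_of_le_ofReal (by positivity) h5
  have hlow : Real.exp (-x / 6) - (ε / 6 + ε / 2) ≤ P.real E := by
    set G := {ω | testIntegral (plateau 0 x hε) (upperRootProcess n (vecPoly (Y n ω))) ∈
      Set.Ici 1} with hG
    have h3 : (1 : ℝ) ≤ P.real E + P.real G := by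
      have h4 : P Set.univ ≤ P (E ∪ G) := by
        refine measure_mono_ae ?_
        filter_upwards [hdeg n hn] with ω hω _
        by_cases hωG : ω ∈ G
        · exact Or.inr hωG
        · exact Or.inl ((le_sq_mul_setDist_iff hn hω x).2
            (le_abs_rescaledModulus_of_testIntegral_lt_one hε (not_le.1 hωG)))
      have h5 := ENNReal.toReal_mono (measure_ne_top _ _) h4
      rw [measure_univ, ENNReal.toReal_one] at h5
      exact h5.trans (measureReal_union_le E G)
    have h4 := poissonLaw_Ioo_eq_zero (1 / 12) (a := 0 - (x + ε)) (b := 0 + (x + ε)) (by linarith)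
    have hZ : MeasurableSet {ν : LocFinMeasure |
        ν.toMeasure (Ioo (0 - (x + ε)) (0 + (x + ε))) = 0} :=
      measurable_apply measurableSet_Ioo (measurableSet_singleton 0)
    have h6 : P G ≤ ofReal (1 - Real.exp (-(x + ε) / 6) + ε / 2) := by
      have h8 : 0 ≤ 1 - Real.exp (-(x + ε) / 6) :=
        sub_nonneg.2 (Real.exp_le_one_iff.2 (by linarith))
      refine h2.trans ?_
      rw [ofReal_add h8 (half_pos hε).le]
      gcongr
      refine (measure_mono fun ν hν => ?_).trans (b := poissonLaw (1 / 12) {ν : LocFinMeasure |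
        ν.toMeasure (Ioo (0 - (x + ε)) (0 + (x + ε))) = 0}ᶜ) ?_
      · intro h0
        have h7 := le_trans hν (testIntegral_plateau_le hε ν)
        rw [Measure.real, h0, ENNReal.toReal_zero] at h7
        exact absurd h7 (by norm_num)
      · rw [prob_compl_eq_one_sub hZ, h4, ENNReal.ofReal_sub _ (Real.exp_pos _).le, ofReal_one, hr]
        refine tsub_le_tsub_left (ofReal_le_ofReal (Real.exp_le_exp.2 ?_)) _
        linarith
    have h7 : P.real G ≤ 1 - Real.exp (-(x + ε) / 6) + ε / 2 := by
      refine toReal_le_of_le_ofReal ?_ h6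
      have := sub_nonneg.2 (Real.exp_le_one_iff.2 (by linarith : -(x + ε) / 6 ≤ 0))
      linarith
    have h8 : Real.exp (-x / 6) - ε / 6 ≤ Real.exp (-(x + ε) / 6) := by
      have e : -(x + ε) / 6 = -x / 6 + -ε / 6 := by ring
      rw [e, Real.exp_add]
      have h9 := Real.add_one_le_exp (-ε / 6)
      have h10 : Real.exp (-x / 6) ≤ 1 := Real.exp_le_one_iff.2 (by linarith)
      nlinarith [Real.exp_pos (-x / 6)]
    linarith
  rw [Real.dist_eq, abs_lt]
  constructor <;> linarith

end

theorem theorem1p1 {Ω : Type*} [MeasurableSpace Ω] (P : Measure Ω) [IsProbabilityMeasure P]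
    (ξ : ℕ → Ω → ℝ) (v : ℝ≥0) (hv : v ≠ 0)
    (hlaw : ∀ k, HasLaw (ξ k) (gaussianReal 0 v) P) (hindep : iIndepFun ξ P) :
    (∃ Q : ProbabilityMeasure LocFinMeasure,
      IsPoissonProcessLaw (1 / 12) (Q : Measure LocFinMeasure) ∧
      TendstoInDistribution
        (fun (n : ℕ) (ω : Ω) => modulusSetProcess n (kacPoly n (fun k => ξ k ω)))
        atTop (id : LocFinMeasure → LocFinMeasure) (fun _ => P) (Q : Measure LocFinMeasure) ∧
      TendstoInDistribution
        (fun (n : ℕ) (ω : Ω) => upperRootProcess n (kacPoly n (fun k => ξ k ω)))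
        atTop (id : LocFinMeasure → LocFinMeasure) (fun _ => P) (Q : Measure LocFinMeasure)) ∧
    (∀ x : ℝ, 0 < x →
      Tendsto
        (fun n : ℕ => P.real {ω | x ≤ (n : ℝ) ^ 2 *
          setDist (Metric.sphere (0 : ℂ) 1) (zeroSet (kacPoly n (fun k => ξ k ω)))})
        atTop (𝓝 (Real.exp (-x / 6)))) := by
  have hs : √(v : ℝ) ≠ 0 := (Real.sqrt_pos.2 (NNReal.coe_pos.2 (pos_iff_ne_zero.2 hv))).ne'
  have hs' : (√(v : ℝ) : ℂ) ≠ 0 := by exact_mod_cast hs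
  have hY := hasLaw_gaussVec hv hlaw hindep
  -- Dividing the coefficients by their standard deviation does not move the roots, so unit variance
  -- may be assumed.
  simp only [kacPoly_eq_C_mul_vecPoly _ _ hs, zeroSet_C_mul _ hs',
    modulusSetProcess_C_mul _ _ hs', upperRootProcess_C_mul _ _ hs']
  have h1 := tendstoInDistribution_comp_hasLaw
    (X := fun n (a : Fin (n + 1) → ℝ) => modulusSetProcess n (vecPoly a)) hY
    tendstoInDistribution_modulusSetProcess
  have h2 := tendstoInDistribution_comp_hasLaw
    (X := fun n (a : Fin (n + 1) → ℝ) => upperRootProcess n (vecPoly a)) hY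
    tendstoInDistribution_upperRootProcess
  exact ⟨⟨⟨poissonLaw (1 / 12), inferInstance⟩, isPoissonProcessLaw_poissonLaw _, h1, h2⟩,
    fun x hx => tendsto_measureReal_le_setDist hY hx⟩
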